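/- Let $m_\beta(k)=\sqrt{(1+\beta k^2)\tanh(k)/k}$ for $k\neq0$, $m_\beta(0)=1$, and let $\mathcal M_\beta$ be the Fourier multiplier operator on $L^2(\mathbb R)$ with symbol $m_\beta$. Consider the gravity–capillary Whitham equation $$u_t+(\mathcal M_\beta u+u^2)_x=0 \qquad (1)$$ and the equation for its travelling wave profiles, $u(x,t)=w(x-ct)$, $$(\mathcal M_\beta-c)w+w^2=0. \qquad (2)$$ A solitary wave of depression with speed $c$ is a differentiable $w:\mathbb R\to\mathbb R$ such that $w(x-ct)$ is a classical solution of (1), $w(x)\to0$ as $|x|\to\infty$, and $w$ has exactly one critical point, at which it attains a strictly negative absolute minimum. It is called subcritical if $c<m_\beta(0)=1$. Let $\beta>1/3$ and, for $\epsilon>0$ and $R:\mathbb R\to\mathbb R$, put $$c_\epsilon=1-\frac{3\beta-1}{6}\,\epsilon^2,\qquad w_{\epsilon,R}(x)=-\frac{3\beta-1}{4}\,\epsilon^2\,\mathrm{sech}^2\!\left(\frac{\epsilon x}{2}\right)+R(\epsilon x).$$ For positive constants $C=(C_r)_{r\ge0}$, say that $R$ has property $P(\epsilon,C)$ if $R$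 is $C^\infty$ and even, all its derivatives $R^{(r)}$, $r=0,1,2,\dots$, are in $L^2(\mathbb R)$ and tend to $0$ at $\pm\infty$ (so $R$ is localized), $w=w_{\epsilon,R}$ solves (2) with $c=c_\epsilon$, and $$\|R^{(r)}\|_{L^2(\mathbb R)}\le C_r\,\epsilon^4\qquad\text{for every integer } r\ge0 .$$ Then there are $\epsilon_0>0$ and positive constants $C=(C_r)_{r\ge0}$, depending only on $\beta$, such that for every $\epsilon\in(0,\epsilon_0]$ there is exactly one function $R_\epsilon$ with property $P(\epsilon,C)$, and $w_\epsilon=w_{\epsilon,R_\epsilon}$ is a subcritical solitary wave of depression with speed $c_\epsilon$. Moreover, for all other constants $C'=(C'_r)_{r\ge0}$ there is $\epsilon_1\in(0,\epsilon_0]$ such that for every $\epsilon\in(0,\epsilon_1]$ the only function that can have property $P(\epsilon,C')$ is $R_\epsilon$. -/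

import Mathlib

open scoped ContDiff

namespace GravityCapillaryWhitham

open MeasureTheory Filter Topology FourierTransform

/-- The phase speed `m_β(k) = √((1 + β k²) tanh k / k)`, with its continuous value `1` at `k = 0`. -/
noncomputable def phaseSpeed (β k : ℝ) : ℝ :=
  if k = 0 then 1 else Real.sqrt ((1 + β * k ^ 2) * (Real.tanh k / k))

/-- `g` is the image of `f` under the Fourier multiplier operator on `L²(ℝ)` with symbol `m`:
both functions are square integrable (with classes `F`, `G` in `L²`) and `ĝ(k) = m(k) f̂(k)` for almost every `k`, where the hat is
the Fourier–Plancherel transform on `L²`. Mathlib's transform has the kernel `exp (-2πi x ξ)`,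
so the wave number is `k = 2πξ`. -/
def IsMultiplierImage (m : ℝ → ℝ) (f g : ℝ → ℝ) : Prop :=
  ∃ F G : Lp ℂ 2 (volume : Measure ℝ),
    (∀ᵐ x, F x = (f x : ℂ)) ∧ (∀ᵐ x, G x = (g x : ℂ)) ∧
    ∀ᵐ ξ : ℝ, (𝓕 G : Lp ℂ 2 (volume : Measure ℝ)) ξ =
      (m (2 * Real.pi * ξ) : ℂ) * (𝓕 F : Lp ℂ 2 (volume : Measure ℝ)) ξ

/-- The travelling wave profile equation `(M_β - c) w + w² = 0`; here `g = M_β w`. -/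
def SolvesProfileEquation (β c : ℝ) (w : ℝ → ℝ) : Prop :=
  ∃ g : ℝ → ℝ, IsMultiplierImage (phaseSpeed β) w g ∧ ∀ x, g x - c * w x + w x ^ 2 = 0

/-- `u(x, t)` is a classical solution of the gravity-capillary Whitham equation
`u_t + (M_β u + u²)_x = 0`; here `v(·, t) = M_β u(·, t)`. -/
def SolvesWhitham (β : ℝ) (u : ℝ → ℝ → ℝ) : Prop :=
  ∃ v : ℝ → ℝ → ℝ,
    (∀ t, IsMultiplierImage (phaseSpeed β) (fun x => u x t) (fun x => v x t)) ∧
    ∀ x t, ∃ a b : ℝ,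
      HasDerivAt (fun s => u x s) a t ∧
      HasDerivAt (fun y => v y t + u y t ^ 2) b x ∧
      a + b = 0

/-- `w` is the profile of a solitary wave of depression with speed `c`: `w(x - ct)` solves the
Whitham equation, `w` is asymptotically zero, and `w` has a unique critical point, at which it has
a strictly negative absolute minimum. -/
def IsSolitaryWaveOfDepression (β c : ℝ) (w : ℝ → ℝ) : Prop :=
  SolvesWhitham β (fun x t => w (x - c * t)) ∧
  Differentiable ℝ w ∧
  Tendsto w (cocompact ℝ) (𝓝 0) ∧
  ∃ x₀ : ℝ, (∀ x, deriv w x = 0 ↔ x = x₀) ∧ (∀ x, w x₀ ≤ w x) ∧ w x₀ < 0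

/-- A wave is subcritical if its speed is less than the long wave speed `m_β(0)`. -/
def IsSubcritical (β c : ℝ) : Prop := c < phaseSpeed β 0

/-- The hyperbolic secant. -/
noncomputable def sech (x : ℝ) : ℝ := 1 / Real.cosh x

/-- The speed `c_ε = 1 - ((3β - 1)/6) ε²`. -/
noncomputable def speed (β ε : ℝ) : ℝ := 1 - (3 * β - 1) / 6 * ε ^ 2

/-- The profile `w_ε(x) = -((3β - 1)/4) ε² sech²(εx/2) + R(εx)`. -/
noncomputable def profile (β ε : ℝ) (R : ℝ → ℝ) (x : ℝ) : ℝ :=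
  -((3 * β - 1) / 4) * ε ^ 2 * sech (ε * x / 2) ^ 2 + R (ε * x)

/-- The properties of the correction `R`: it is smooth, even, localized (square integrable with all
its derivatives, all of which tend to `0` at infinity), the corresponding profile
solves the profile equation, and `‖R^{(r)}‖_{L²} ≤ C_r ε⁴` for every `r ≥ 0`. -/
structure IsCorrection (β ε : ℝ) (C : ℕ → ℝ) (R : ℝ → ℝ) : Prop where
  smooth : ContDiff ℝ ∞ R
  even : ∀ X, R (-X) = R X
  memLp : ∀ r : ℕ, MemLp (iteratedDeriv r R) 2 (volume : Measure ℝ)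
  tendsto_zero : ∀ r : ℕ, Tendsto (iteratedDeriv r R) (cocompact ℝ) (𝓝 0)
  solves : SolvesProfileEquation β (speed β ε) (profile β ε R)
  bound : ∀ r : ℕ,
    eLpNorm (iteratedDeriv r R) 2 (volume : Measure ℝ) ≤ ENNReal.ofReal (C r * ε ^ 4)

end GravityCapillaryWhitham

/-!
The construction is a perturbation argument in the long-wave scaling `w(x) = ε² ζ(εx)`. With
`γ = (3β - 1)/6`, the symbol `(m_β(εk) - c_ε)/ε²` of the scaled profile equation tends to `γ(1 + k²)`,
and the limiting equation `γ(ζ - ζ'') + ζ² = 0` is solved by the soliton `-(3/2) γ sech²(x/2)`. The scaled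
symbol is bounded below because `β > 1/3`, and its inverse differs from that of the limit by `O(ε²)`
uniformly in `k` (`scaledSymbol_bounds`).

*Existence and uniqueness.* All functions are represented by their Fourier transforms, in weighted `L²`
spaces. The linearisation of the limiting equation at the soliton has a kernel spanned by the odd
derivative of the soliton. Variation of parameters bounds it from below on even functions
(`sobNorm_le_linearization`), and since it is symmetric in `H¹` it is invertible there
(`exists_linearization_inverse`). The contraction principle gives an even solution within `O(ε²)` of the
soliton, unique in a ball of fixed radius (`exists_solution`). The inverse symbol decays like
`|k|^{-1/2}`, so the correction gains half a derivative at a time, always with size `O(ε²)`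
(`sobNorm_bootstrap`); it is real by uniqueness (`exists_smooth_solution`). Conversely, the bounds on a
correction and its first derivative put it into the uniqueness ball as soon as `ε` is small compared with
those two constants (`IsCorrection.exists_hat`), which gives both uniqueness claims.

*Monotonicity.* It remains to see that `v = ζ'` has no zero on the positive half-line. Near the origin it
is close to the derivative of the soliton in `C¹`. Far out both are small, and an absolute estimate of
their difference is useless; a relative one is needed. The differentiated equation is
`(ℓ_ε + A) v = (A - 2ζ) v` with the scaled symbol `ℓ_ε`, for every constant `A`. Splitting
`(ℓ_ε + A)⁻¹` into the limiting resolvent and a remainder splits `v = u + h`, where `u` solves a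
perturbed linearised soliton equation. For suitable `A` the remainder is an analytic symbol of size `O(ε²)`
in the strip `|Im k| ≤ 2` (`resolvent_strip`). By a contour shift, such a multiplier is bounded in `L²`
norms with exponentially decaying windows (`eLpNorm_window_mul_fourierInv_le`), hence `h(x)` is `O(ε²)`
relative to a windowed supremum of `u` around `x` (`exists_splitting`). The Wronskian with the derivative
of the soliton shows that this supremum is at most a constant times `|u(x)|` for `x ≥ 1`
(`wideSup_le_norm`). Thus `|h(x)| ≤ |u(x)|/2` and `u(x) ≠ 0`, and `v` does not vanish
(`exists_deriv_pos`).
-/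

namespace GravityCapillaryWhitham

open MeasureTheory Filter Topology FourierTransform
open scoped ENNReal

/-! ### Fourier integrals and the `L²` Fourier transform -/

/-- The multiplication formula `∫ g 𝓕⁻f = ∫ (𝓕⁻g) f` for integrable functions on the line. -/
theorem integral_mul_fourierInv_eq_flip {f g : ℝ → ℂ} (hf : Integrable f) (hg : Integrable g) :
    ∫ x, g x * 𝓕⁻ f x = ∫ x, 𝓕⁻ g x * f x := by
  have h := VectorFourier.integral_fourierIntegral_smul_eq_flip (L := -(innerₗ ℝ))
    (μ := (volume : Measure ℝ)) (ν := (volume : Measure ℝ))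
    Real.continuous_fourierChar (by
      have : Continuous fun p : ℝ × ℝ => inner ℝ p.1 p.2 := continuous_inner
      exact this.neg) hg hf
  simp only [smul_eq_mul] at h
  have e₁ : ∀ ξ, VectorFourier.fourierIntegral 𝐞 volume (-innerₗ ℝ) g ξ = 𝓕⁻ g ξ := fun ξ => by
    rw [Real.fourierInv_eq]
    simp [VectorFourier.fourierIntegral]
  have e₂ : ∀ ξ, VectorFourier.fourierIntegral 𝐞 volume (-innerₗ ℝ).flip f ξ = 𝓕⁻ f ξ :=
    fun ξ => by
      rw [Real.fourierInv_eq]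
      simp [VectorFourier.fourierIntegral, mul_comm]
  simp only [e₁] at h
  rw [h]
  exact integral_congr_ae (Eventually.of_forall fun x => by simp only [← e₂])

/-- The `L²` Fourier transform is symmetric against Schwartz functions. -/
theorem integral_schwartz_mul_fourier (F : Lp ℂ 2 (volume : Measure ℝ)) (g : SchwartzMap ℝ ℂ) :
    ∫ x, g x * (𝓕 F : Lp ℂ 2 (volume : Measure ℝ)) x = ∫ x, (𝓕 g) x * F x := by
  have h := congrArg (fun T => T g) (Lp.fourier_toTemperedDistribution_eq F)
  simpa using h.symm

theorem integral_schwartz_mul_fourierInv (F : Lp ℂ 2 (volume : Measure ℝ))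
    (g : SchwartzMap ℝ ℂ) :
    ∫ x, g x * (𝓕⁻ F : Lp ℂ 2 (volume : Measure ℝ)) x = ∫ x, (𝓕⁻ g) x * F x := by
  have h := congrArg (fun T => T g) (Lp.fourierInv_toTemperedDistribution_eq F)
  simpa using h.symm

/-- Two locally integrable functions agree almost everywhere if they agree against all Schwartz
functions. -/
theorem ae_eq_of_integral_schwartz_eq {f g : ℝ → ℂ} (hf : LocallyIntegrable f)
    (hg : LocallyIntegrable g)
    (h : ∀ φ : SchwartzMap ℝ ℂ, ∫ x, φ x * f x = ∫ x, φ x * g x) : f =ᵐ[volume] g := by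
  refine ae_eq_of_integral_contDiff_smul_eq hf hg fun φ hφ hc => ?_
  have h₁ : HasCompactSupport (Complex.ofRealCLM ∘ φ) := hc.comp_left rfl
  have h₂ : ContDiff ℝ ∞ (Complex.ofRealCLM ∘ φ) := by fun_prop
  simpa using h (h₁.toSchwartzMap h₂)

theorem continuous_fourierInv {f : ℝ → ℂ} (hf : Integrable f) : Continuous (𝓕⁻ f) := by
  have : (𝓕⁻ f : ℝ → ℂ) = fun x => 𝓕 f (-x) := by
    ext x; exact Real.fourierInv_eq_fourier_neg f x
  rw [this]
  exact (VectorFourier.fourierIntegral_continuous Real.continuous_fourierChar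
    (L := innerₗ ℝ) continuous_inner hf).comp continuous_neg

/-- On `L¹ ∩ L²` the inverse Fourier integral is the `L²` inverse Fourier transform. -/
theorem fourierInv_toLp {f : ℝ → ℂ} (h1 : Integrable f) (h2 : MemLp f 2) :
    (𝓕⁻ (h2.toLp f) : Lp ℂ 2 (volume : Measure ℝ)) =ᵐ[volume] 𝓕⁻ f := by
  refine ae_eq_of_integral_schwartz_eq ((Lp.memLp _).locallyIntegrable (by norm_num))
    (continuous_fourierInv h1).locallyIntegrable fun φ => ?_
  rw [integral_schwartz_mul_fourierInv, integral_mul_fourierInv_eq_flip h1 φ.integrable]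
  rw [← SchwartzMap.fourierInv_coe]
  refine integral_congr_ae ?_
  filter_upwards [h2.coeFn_toLp] with x hx
  rw [hx]

theorem memLp_fourierInv {f : ℝ → ℂ} (h1 : Integrable f) (h2 : MemLp f 2) : MemLp (𝓕⁻ f) 2 :=
  (memLp_congr_ae (fourierInv_toLp h1 h2)).1 (Lp.memLp _)

/-- Plancherel's identity for the inverse Fourier integral on `L¹ ∩ L²`. -/
theorem eLpNorm_fourierInv {f : ℝ → ℂ} (h1 : Integrable f) (h2 : MemLp f 2) :
    eLpNorm (𝓕⁻ f) 2 = eLpNorm f 2 := by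
  have h := (Lp.fourierTransformₗᵢ ℝ ℂ).symm.norm_map (h2.toLp f)
  have h' : ‖(𝓕⁻ (h2.toLp f) : Lp ℂ 2 (volume : Measure ℝ))‖ = ‖h2.toLp f‖ := h
  rw [Lp.norm_def, Lp.norm_def, eLpNorm_congr_ae (fourierInv_toLp h1 h2),
    eLpNorm_congr_ae h2.coeFn_toLp] at h'
  exact (ENNReal.toReal_eq_toReal_iff' (memLp_fourierInv h1 h2).2.ne h2.2.ne).1 h'

theorem fourier_toLp_fourierInv {f : ℝ → ℂ} (h1 : Integrable f) (h2 : MemLp f 2) :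
    𝓕 ((memLp_fourierInv h1 h2).toLp (𝓕⁻ f)) = h2.toLp f := by
  have : (memLp_fourierInv h1 h2).toLp (𝓕⁻ f) = 𝓕⁻ (h2.toLp f) := by
    apply Lp.ext
    exact (MemLp.coeFn_toLp _).trans (fourierInv_toLp h1 h2).symm
  rw [this, FourierTransform.fourier_fourierInv_eq]

theorem ae_eq_of_fourierInv_ae_eq {f g : ℝ → ℂ} (hf1 : Integrable f) (hf2 : MemLp f 2)
    (hg1 : Integrable g) (hg2 : MemLp g 2) (h : 𝓕⁻ f =ᵐ[volume] 𝓕⁻ g) : f =ᵐ[volume] g := by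
  have h3 : (memLp_fourierInv hf1 hf2).toLp (𝓕⁻ f) = (memLp_fourierInv hg1 hg2).toLp (𝓕⁻ g) :=
    (MemLp.toLp_eq_toLp_iff _ _).2 h
  have h4 : hf2.toLp f = hg2.toLp g := by
    rw [← fourier_toLp_fourierInv hf1, ← fourier_toLp_fourierInv hg1, h3]
  exact (MemLp.toLp_eq_toLp_iff _ _).1 h4

theorem fourierInv_add {f g : ℝ → ℂ} (hf : Integrable f) (hg : Integrable g) (x : ℝ) :
    𝓕⁻ (fun ξ => f ξ + g ξ) x = 𝓕⁻ f x + 𝓕⁻ g x := by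
  have e := fun h : ℝ → ℂ => Real.fourierInv_eq_fourier_neg h x
  rw [e, e, e]
  simp only [Real.fourier_real_eq]
  rw [← integral_add]
  · simp [smul_add]
  · exact (Real.fourierIntegral_convergent_iff (V := ℝ) (-x)).2 hf |>.congr (by simp [mul_comm])
  · exact (Real.fourierIntegral_convergent_iff (V := ℝ) (-x)).2 hg |>.congr (by simp [mul_comm])

theorem fourierInv_const_mul (c : ℂ) (f : ℝ → ℂ) (x : ℝ) :
    𝓕⁻ (fun ξ => c * f ξ) x = c * 𝓕⁻ f x := by
  simp only [Real.fourierInv_eq]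
  rw [← integral_const_mul]
  congr with ξ
  simp [Circle.smul_def]; ring

theorem norm_fourierInv_le (f : ℝ → ℂ) (x : ℝ) : ‖𝓕⁻ f x‖ ≤ ∫ ξ, ‖f ξ‖ := by
  rw [Real.fourierInv_eq]
  refine (norm_integral_le_integral_norm _).trans (le_of_eq ?_)
  simp

theorem tendsto_fourierInv_cocompact (f : ℝ → ℂ) : Tendsto (𝓕⁻ f) (cocompact ℝ) (𝓝 0) := by
  have : (𝓕⁻ f : ℝ → ℂ) = fun x => 𝓕 f (-x) := by
    ext x; exact Real.fourierInv_eq_fourier_neg f x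
  rw [this]
  exact (Real.zero_at_infty_fourier f).comp (Homeomorph.neg ℝ).isClosedEmbedding.tendsto_cocompact

theorem hasDerivAt_fourierInv {f : ℝ → ℂ} (hf : Integrable f)
    (hf' : Integrable fun ξ : ℝ => (ξ : ℂ) * f ξ) (x : ℝ) :
    HasDerivAt (𝓕⁻ f) (𝓕⁻ (fun ξ : ℝ => 2 * Real.pi * Complex.I * ξ * f ξ) x) x := by
  have e : (𝓕⁻ f : ℝ → ℂ) = fun x => 𝓕 f (-x) := by
    ext x; exact Real.fourierInv_eq_fourier_neg f x
  have h := (Real.hasDerivAt_fourier hf (by simpa using hf') (-x)).scomp x (hasDerivAt_neg x)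
  rw [e]
  refine h.congr_deriv ?_
  rw [Real.fourierInv_eq_fourier_neg]
  simp only [Real.fourier_real_eq, neg_smul, one_smul]
  rw [← integral_neg]
  congr with ξ
  simp [Circle.smul_def]

open scoped Convolution in
/-- The inverse Fourier integral turns convolutions into products. -/
theorem fourierInv_convolution {f g : ℝ → ℂ} (hf : Integrable f) (hg : Integrable g) (x : ℝ) :
    𝓕⁻ (fun ξ => ∫ t, f t * g (ξ - t)) x = 𝓕⁻ f x * 𝓕⁻ g x := by
  rw [Real.fourierInv_eq_fourier_neg f, Real.fourierInv_eq_fourier_neg g,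
    ← Real.fourier_mul_convolution_eq hf hg, ← Real.fourierInv_eq_fourier_neg]
  rfl

theorem fourierInv_comp_neg (f : ℝ → ℂ) (x : ℝ) : 𝓕⁻ (fun ξ => f (-ξ)) x = 𝓕⁻ f (-x) := by
  simp only [Real.fourierInv_eq]
  rw [← integral_neg_eq_self]
  simp

theorem fourierInv_conj_comp_neg (f : ℝ → ℂ) (x : ℝ) :
    𝓕⁻ (fun ξ => (starRingEnd ℂ) (f (-ξ))) x = (starRingEnd ℂ) (𝓕⁻ f x) := by
  simp only [Real.fourierInv_eq]
  rw [← integral_neg_eq_self, ← integral_conj]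
  congr with ξ
  simp [Circle.smul_def, Real.fourierChar_apply, ← Complex.exp_conj, Complex.conj_ofNat]

theorem fourierInv_comp_sub (f : ℝ → ℂ) (a x : ℝ) :
    𝓕⁻ (fun ξ : ℝ => (𝐞 (-(ξ * a)) : ℂ) * f ξ) x = 𝓕⁻ f (x - a) := by
  simp only [Real.fourierInv_eq]
  congr with ξ
  simp only [Circle.smul_def, Real.fourierChar_apply, smul_eq_mul]
  rw [← mul_assoc, ← Complex.exp_add]
  congr 2
  simp
  ring

theorem fourierInv_comp_mul (f : ℝ → ℂ) {a : ℝ} (ha : 0 < a) (x : ℝ) :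
    𝓕⁻ (fun ξ => (a : ℂ)⁻¹ * f (ξ / a)) x = 𝓕⁻ f (a * x) := by
  rw [fourierInv_const_mul]
  simp only [Real.fourierInv_eq]
  have h := Measure.integral_comp_div (fun ξ : ℝ => 𝐞 (inner ℝ ξ (a * x)) • f ξ) a
  have h2 : (fun ξ : ℝ => 𝐞 (inner ℝ ξ x) • f (ξ / a)) =
      fun ξ : ℝ => 𝐞 (inner ℝ (ξ / a) (a * x)) • f (ξ / a) := by
    ext ξ
    congr 2
    simp
    field_simp
  rw [h2, h, abs_of_pos ha]
  simp only [Complex.real_smul]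
  rw [← mul_assoc, inv_mul_cancel₀ (by exact_mod_cast ha.ne'), one_mul]

/-! ### Weighted `L²` spaces -/

/-- The Japanese bracket `⟨k⟩ = √(1 + k²)` of the wave number `k = 2πξ`. -/
noncomputable def bracket (ξ : ℝ) : ℝ := Real.sqrt (1 + (2 * Real.pi * ξ) ^ 2)

theorem bracket_sq (ξ : ℝ) : bracket ξ ^ 2 = 1 + (2 * Real.pi * ξ) ^ 2 :=
  Real.sq_sqrt (by positivity)

theorem one_le_bracket (ξ : ℝ) : 1 ≤ bracket ξ := by
  rw [bracket, Real.one_le_sqrt]; nlinarith [sq_nonneg (2 * Real.pi * ξ)]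

theorem bracket_pos (ξ : ℝ) : 0 < bracket ξ := zero_lt_one.trans_le (one_le_bracket ξ)

@[simp] theorem bracket_neg (ξ : ℝ) : bracket (-ξ) = bracket ξ := by simp [bracket]

@[fun_prop] theorem continuous_bracket : Continuous bracket := by unfold bracket; fun_prop

theorem abs_le_bracket (ξ : ℝ) : |2 * Real.pi * ξ| ≤ bracket ξ :=
  Real.abs_le_sqrt (by linarith)

/-- Peetre's inequality in additive form: `⟨k⟩ ≤ ⟨l⟩ + ⟨k - l⟩`. -/
theorem bracket_le_add (ξ t : ℝ) : bracket ξ ≤ bracket t + bracket (ξ - t) := by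
  have h1 := bracket_pos t
  have h2 := bracket_pos (ξ - t)
  refine Real.sqrt_le_left (by linarith) |>.2 ?_ |>.trans le_rfl
  have e1 := bracket_sq t
  have e2 := bracket_sq (ξ - t)
  have h3 := abs_le_bracket t
  have h4 := abs_le_bracket (ξ - t)
  have h5 : 2 * Real.pi * t * (2 * Real.pi * (ξ - t)) ≤ bracket t * bracket (ξ - t) := by
    refine (le_abs_self _).trans ?_
    rw [abs_mul]
    exact mul_le_mul h3 h4 (abs_nonneg _) h1.le
  nlinarith

@[fun_prop] theorem continuous_bracket_rpow (s : ℝ) : Continuous fun ξ => bracket ξ ^ s :=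
  continuous_bracket.rpow_const fun ξ => Or.inl (bracket_pos ξ).ne'

theorem bracket_rpow_le_add {s : ℝ} (hs : 0 ≤ s) (ξ t : ℝ) :
    bracket ξ ^ s ≤ 2 ^ s * (bracket t ^ s + bracket (ξ - t) ^ s) := by
  have h1 := bracket_pos t
  have h2 := bracket_pos (ξ - t)
  have h0 := bracket_pos ξ
  have key : bracket ξ ≤ 2 * max (bracket t) (bracket (ξ - t)) := by
    have := bracket_le_add ξ t
    have := le_max_left (bracket t) (bracket (ξ - t))
    have := le_max_right (bracket t) (bracket (ξ - t))
    linarith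
  calc bracket ξ ^ s ≤ (2 * max (bracket t) (bracket (ξ - t))) ^ s :=
        Real.rpow_le_rpow h0.le key hs
    _ = 2 ^ s * max (bracket t) (bracket (ξ - t)) ^ s :=
        Real.mul_rpow (by norm_num) (h1.le.trans (le_max_left _ _))
    _ ≤ _ := by
        gcongr
        rcases max_choice (bracket t) (bracket (ξ - t)) with h | h <;> rw [h]
        · have := Real.rpow_nonneg h2.le s; linarith
        · have := Real.rpow_nonneg h1.le s; linarith

/-- The Sobolev norm `‖u‖_{H^s}` of the function `u` with Fourier transform `f`. Functions are
represented by their Fourier transforms throughout, so that multipliers act by multiplication. -/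
noncomputable def sobNorm (s : ℝ) (f : ℝ → ℂ) : ℝ≥0∞ :=
  eLpNorm (fun ξ => ((bracket ξ ^ s : ℝ) : ℂ) * f ξ) 2

/-- `f` is the Fourier transform of a function in the Sobolev space `H^s`. -/
def MemSob (s : ℝ) (f : ℝ → ℂ) : Prop :=
  MemLp (fun ξ => ((bracket ξ ^ s : ℝ) : ℂ) * f ξ) 2

theorem enorm_bracket_mul (s : ℝ) (f : ℝ → ℂ) (ξ : ℝ) :
    ‖((bracket ξ ^ s : ℝ) : ℂ) * f ξ‖ = bracket ξ ^ s * ‖f ξ‖ := by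
  rw [norm_mul, Complex.norm_real, Real.norm_of_nonneg (Real.rpow_nonneg (bracket_pos ξ).le s)]

theorem MemSob.aestronglyMeasurable {s : ℝ} {f : ℝ → ℂ} (hf : MemSob s f) :
    AEStronglyMeasurable f := by
  have h : f = fun ξ => ((bracket ξ ^ (-s) : ℝ) : ℂ) * (((bracket ξ ^ s : ℝ) : ℂ) * f ξ) := by
    ext ξ
    rw [← mul_assoc, ← Complex.ofReal_mul, ← Real.rpow_add (bracket_pos ξ)]
    simp
  rw [h]
  exact (Complex.continuous_ofReal.comp (continuous_bracket_rpow (-s))).aestronglyMeasurable.mul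
    hf.1

theorem memSob_iff {s : ℝ} {f : ℝ → ℂ} (hf : AEStronglyMeasurable f) :
    MemSob s f ↔ sobNorm s f < ⊤ :=
  ⟨fun h => h.2, fun h => ⟨(Complex.continuous_ofReal.comp
    (continuous_bracket_rpow s)).aestronglyMeasurable.mul hf, h⟩⟩

theorem MemSob.lt_top {s : ℝ} {f : ℝ → ℂ} (hf : MemSob s f) : sobNorm s f < ⊤ := hf.2

theorem sobNorm_le_of_norm_le {s t c : ℝ} {f g : ℝ → ℂ}
    (h : ∀ᵐ ξ, bracket ξ ^ s * ‖f ξ‖ ≤ c * (bracket ξ ^ t * ‖g ξ‖)) :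
    sobNorm s f ≤ ENNReal.ofReal c * sobNorm t g := by
  refine eLpNorm_le_mul_eLpNorm_of_ae_le_mul ?_ 2
  filter_upwards [h] with ξ hξ
  rwa [enorm_bracket_mul, enorm_bracket_mul]

/-- A multiplier with symbol `O(⟨k⟩^a)` costs at most `a` derivatives. -/
theorem sobNorm_mul_le {s a c : ℝ} {f g : ℝ → ℂ} (h : ∀ ξ, ‖g ξ‖ ≤ c * bracket ξ ^ a) :
    sobNorm s (fun ξ => g ξ * f ξ) ≤ ENNReal.ofReal c * sobNorm (s + a) f := by
  refine sobNorm_le_of_norm_le (Eventually.of_forall fun ξ => ?_)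
  have h0 := Real.rpow_nonneg (bracket_pos ξ).le s
  rw [norm_mul, Real.rpow_add (bracket_pos ξ)]
  calc _ ≤ bracket ξ ^ s * ((c * bracket ξ ^ a) * ‖f ξ‖) := by gcongr; exact h ξ
    _ = _ := by ring

theorem MemSob.mul {s a c : ℝ} {f g : ℝ → ℂ} (hf : MemSob (s + a) f)
    (hg : AEStronglyMeasurable g) (h : ∀ ξ, ‖g ξ‖ ≤ c * bracket ξ ^ a) :
    MemSob s (fun ξ => g ξ * f ξ) :=
  (memSob_iff (hg.mul hf.aestronglyMeasurable)).2
    ((sobNorm_mul_le h).trans_lt (ENNReal.mul_lt_top ENNReal.ofReal_lt_top hf.lt_top))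

theorem sobNorm_mono {s t : ℝ} (hst : s ≤ t) (f : ℝ → ℂ) : sobNorm s f ≤ sobNorm t f := by
  have := sobNorm_le_of_norm_le (s := s) (t := t) (c := 1) (f := f) (g := f)
    (Eventually.of_forall fun ξ => by
      rw [one_mul]
      gcongr
      exact one_le_bracket ξ)
  simpa using this

theorem MemSob.mono {s t : ℝ} (hst : s ≤ t) {f : ℝ → ℂ} (hf : MemSob t f) : MemSob s f :=
  (memSob_iff hf.aestronglyMeasurable).2 ((sobNorm_mono hst f).trans_lt hf.lt_top)

theorem sobNorm_add_le {s : ℝ} {f g : ℝ → ℂ} (hf : AEStronglyMeasurable f)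
    (hg : AEStronglyMeasurable g) :
    sobNorm s (fun ξ => f ξ + g ξ) ≤ sobNorm s f + sobNorm s g := by
  have hb : AEStronglyMeasurable (fun ξ => ((bracket ξ ^ s : ℝ) : ℂ)) :=
    (Complex.continuous_ofReal.comp (continuous_bracket_rpow s)).aestronglyMeasurable
  have := eLpNorm_add_le (hb.mul hf) (hb.mul hg) (p := 2) (by norm_num)
  refine le_trans (le_of_eq ?_) this
  unfold sobNorm
  congr 1
  ext ξ
  simp [mul_add]

theorem MemSob.add {s : ℝ} {f g : ℝ → ℂ} (hf : MemSob s f) (hg : MemSob s g) :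
    MemSob s (fun ξ => f ξ + g ξ) :=
  (memSob_iff (hf.aestronglyMeasurable.add hg.aestronglyMeasurable)).2
    ((sobNorm_add_le hf.aestronglyMeasurable hg.aestronglyMeasurable).trans_lt
      (ENNReal.add_lt_top.2 ⟨hf.lt_top, hg.lt_top⟩))

theorem sobNorm_const_mul (s : ℝ) (c : ℂ) (f : ℝ → ℂ) :
    sobNorm s (fun ξ => c * f ξ) = ‖c‖ₑ * sobNorm s f := by
  unfold sobNorm
  rw [← eLpNorm_const_smul]
  congr 1
  ext ξ
  simp [Pi.smul_apply, mul_left_comm]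

theorem MemSob.const_mul {s : ℝ} {f : ℝ → ℂ} (c : ℂ) (hf : MemSob s f) :
    MemSob s (fun ξ => c * f ξ) := by
  have h := MemLp.const_smul hf c
  unfold MemSob
  convert h using 1
  ext ξ
  simp [Pi.smul_apply, mul_left_comm]

theorem sobNorm_congr {s : ℝ} {f g : ℝ → ℂ} (h : f =ᵐ[volume] g) : sobNorm s f = sobNorm s g :=
  eLpNorm_congr_ae (by filter_upwards [h] with ξ hξ; rw [hξ])

theorem MemSob.congr {s : ℝ} {f g : ℝ → ℂ} (hf : MemSob s f) (h : f =ᵐ[volume] g) : MemSob s g :=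
  (memLp_congr_ae (by filter_upwards [h] with ξ hξ; rw [hξ])).1 hf

theorem sobNorm_zero (f : ℝ → ℂ) : sobNorm 0 f = eLpNorm f 2 := by simp [sobNorm]

theorem memSob_zero {f : ℝ → ℂ} : MemSob 0 f ↔ MemLp f 2 := by simp [MemSob]

theorem MemSob.memLp_two {s : ℝ} (hs : 0 ≤ s) {f : ℝ → ℂ} (hf : MemSob s f) : MemLp f 2 :=
  memSob_zero.1 (hf.mono hs)

theorem memLp_bracket_inv : MemLp (fun ξ => (bracket ξ)⁻¹) 2 := by
  have hm : AEStronglyMeasurable (fun ξ => (bracket ξ)⁻¹) :=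
    (continuous_bracket.inv₀ fun ξ => (bracket_pos ξ).ne').aestronglyMeasurable
  rw [memLp_two_iff_integrable_sq hm]
  have h := (integrable_inv_one_add_sq).comp_mul_left' (R := 2 * Real.pi) (by positivity)
  refine h.congr (Eventually.of_forall fun ξ => ?_)
  simp [inv_pow, bracket_sq]

/-- The constant of the embedding `‖û‖_{L¹} ≤ C ‖u‖_{H¹}`. -/
noncomputable def embConst : ℝ≥0∞ := eLpNorm (fun ξ => (((bracket ξ)⁻¹ : ℝ) : ℂ)) 2

theorem memLp_ofReal_bracket_inv : MemLp (fun ξ => (((bracket ξ)⁻¹ : ℝ) : ℂ)) 2 :=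
  memLp_bracket_inv.ofReal

theorem embConst_lt_top : embConst < ⊤ := memLp_ofReal_bracket_inv.2

theorem bracket_inv_mul (f : ℝ → ℂ) :
    (fun ξ => (((bracket ξ)⁻¹ : ℝ) : ℂ) * (((bracket ξ ^ (1 : ℝ) : ℝ) : ℂ) * f ξ)) = f := by
  ext ξ
  rw [← mul_assoc, ← Complex.ofReal_mul, Real.rpow_one, inv_mul_cancel₀ (bracket_pos ξ).ne']
  simp

theorem MemSob.integrable {s : ℝ} (hs : 1 ≤ s) {f : ℝ → ℂ} (hf : MemSob s f) : Integrable f := by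
  have := memLp_ofReal_bracket_inv.integrable_mul (hf.mono hs)
  rwa [show (fun ξ => (((bracket ξ)⁻¹ : ℝ) : ℂ)) *
    (fun ξ => ((bracket ξ ^ (1 : ℝ) : ℝ) : ℂ) * f ξ) = f from bracket_inv_mul f] at this

theorem eLpNorm_one_le_sobNorm {f : ℝ → ℂ} (hf : AEStronglyMeasurable f) :
    eLpNorm f 1 ≤ embConst * sobNorm 1 f := by
  have hb : AEStronglyMeasurable (fun ξ => ((bracket ξ ^ (1 : ℝ) : ℝ) : ℂ) * f ξ) :=
    (Complex.continuous_ofReal.comp (continuous_bracket_rpow 1)).aestronglyMeasurable.mul hf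
  have := eLpNorm_smul_le_mul_eLpNorm (p := 2) (q := 2) (r := 1) hb memLp_ofReal_bracket_inv.1
  conv_lhs => rw [← bracket_inv_mul f]
  exact this

/-! ### Convolutions -/

/-- The convolution `f ⋆ g`, the Fourier transform of a product. -/
noncomputable def conv (f g : ℝ → ℂ) (ξ : ℝ) : ℂ := ∫ t, f t * g (ξ - t)

open scoped Convolution in
theorem conv_eq (f g : ℝ → ℂ) : conv f g = f ⋆[ContinuousLinearMap.mul ℂ ℂ] g := rfl

theorem integrable_conv {f g : ℝ → ℂ} (hf : Integrable f) (hg : Integrable g) :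
    Integrable (conv f g) := by
  rw [conv_eq]; exact hf.integrable_convolution _ hg

theorem fourierInv_conv {f g : ℝ → ℂ} (hf : Integrable f) (hg : Integrable g) (x : ℝ) :
    𝓕⁻ (conv f g) x = 𝓕⁻ f x * 𝓕⁻ g x := fourierInv_convolution hf hg x

/-- The Cauchy-Schwarz inequality for the measure with density `F`. -/
theorem lintegral_mul_sq_le {α : Type*} [MeasurableSpace α] {μ : Measure α} {F G : α → ℝ≥0∞}
    (hF : AEMeasurable F μ) (hG : AEMeasurable G μ) :
    (∫⁻ t, F t * G t ∂μ) ^ 2 ≤ (∫⁻ t, F t ∂μ) * ∫⁻ t, F t * G t ^ 2 ∂μ := by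
  have h := ENNReal.lintegral_mul_le_Lp_mul_Lq μ Real.HolderConjugate.two_two
    (hF.pow_const (1 / 2 : ℝ)) ((hF.pow_const (1 / 2 : ℝ)).mul hG)
  have e0 : ∀ t, F t ^ (1 / 2 : ℝ) * F t ^ (1 / 2 : ℝ) = F t := fun t => by
    rw [← ENNReal.rpow_add_of_nonneg _ _ (by norm_num) (by norm_num)]; norm_num
  have e1 : ∀ t, (F t ^ (1 / 2 : ℝ)) ^ (2 : ℝ) = F t := fun t => by
    rw [← ENNReal.rpow_mul]; norm_num
  have e2 : ∀ a : ℝ≥0∞, (a ^ (1 / 2 : ℝ)) ^ 2 = a := fun a => by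
    rw [← ENNReal.rpow_natCast, ← ENNReal.rpow_mul]; norm_num
  have e3 : (∫⁻ t, F t * G t ∂μ) = ∫⁻ t, ((fun t => F t ^ (1 / 2 : ℝ)) *
      ((fun t => F t ^ (1 / 2 : ℝ)) * G)) t ∂μ := by
    congr with t
    simp only [Pi.mul_apply]
    rw [← mul_assoc, e0]
  rw [e3]
  refine (pow_le_pow_left' h 2).trans (le_of_eq ?_)
  rw [mul_pow, e2, e2]
  simp only [Pi.mul_apply, e1]
  congr with t
  rw [ENNReal.mul_rpow_of_nonneg _ _ (by norm_num), e1]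
  norm_num

theorem eLpNorm_two_sq {α E : Type*} [MeasurableSpace α] {μ : Measure α} [TopologicalSpace E]
    [ContinuousENorm E] (f : α → E) : eLpNorm f 2 μ ^ 2 = ∫⁻ t, ‖f t‖ₑ ^ 2 ∂μ := by
  have := eLpNorm_nnreal_pow_eq_lintegral (f := f) (μ := μ) (p := 2) (by norm_num)
  simpa using this

/-- Young's inequality `L¹ * L² ⊆ L²`, for the integral of absolute values. -/
theorem eLpNorm_lconv_le {F G : ℝ → ℝ≥0∞} (hF : AEMeasurable F) (hG : AEMeasurable G) :
    eLpNorm (fun ξ => ∫⁻ t, F t * G (ξ - t)) 2 ≤ (∫⁻ t, F t) * eLpNorm G 2 := by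
  have hGs : ∀ ξ : ℝ, AEMeasurable (fun t => G (ξ - t)) := fun ξ =>
    hG.comp_quasiMeasurePreserving (quasiMeasurePreserving_sub_left volume ξ)
  have hG2 : AEMeasurable (fun p : ℝ × ℝ => F p.2 * G (p.1 - p.2) ^ 2)
      (volume.prod volume) :=
    (hF.comp_snd).mul ((hG.comp_quasiMeasurePreserving
      (quasiMeasurePreserving_sub volume volume)).pow_const 2)
  have key : eLpNorm (fun ξ => ∫⁻ t, F t * G (ξ - t)) 2 ^ 2 ≤
      ((∫⁻ t, F t) * eLpNorm G 2) ^ 2 := by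
    rw [eLpNorm_two_sq, mul_pow, eLpNorm_two_sq]
    simp only [enorm_eq_self]
    calc ∫⁻ ξ, (∫⁻ t, F t * G (ξ - t)) ^ 2
        ≤ ∫⁻ ξ, (∫⁻ t, F t) * ∫⁻ t, F t * G (ξ - t) ^ 2 :=
          lintegral_mono fun ξ => lintegral_mul_sq_le hF (hGs ξ)
      _ = (∫⁻ t, F t) * ∫⁻ ξ, ∫⁻ t, F t * G (ξ - t) ^ 2 :=
          lintegral_const_mul'' _ hG2.lintegral_prod_right'
      _ = (∫⁻ t, F t) * ∫⁻ t, ∫⁻ ξ, F t * G (ξ - t) ^ 2 := by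
          rw [lintegral_lintegral_swap hG2]
      _ = (∫⁻ t, F t) * ∫⁻ t, F t * ∫⁻ ξ, G ξ ^ 2 := by
          congr 2 with t
          rw [lintegral_const_mul'', lintegral_sub_right_eq_self (fun ξ => G ξ ^ 2) t]
          exact (hG.comp_quasiMeasurePreserving
            (measurePreserving_sub_right volume t).quasiMeasurePreserving).pow_const 2
      _ = _ := by
          rw [lintegral_mul_const'' _ hF]; ring
  exact (ENNReal.pow_le_pow_left_iff (by norm_num)).1 key

theorem lconv_comm (F G : ℝ → ℝ≥0∞) (ξ : ℝ) :
    ∫⁻ t, F t * G (ξ - t) = ∫⁻ t, G t * F (ξ - t) := by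
  rw [← lintegral_sub_left_eq_self (fun t => F t * G (ξ - t)) ξ]
  simp [mul_comm]

theorem enorm_conv_le (f g : ℝ → ℂ) (ξ : ℝ) :
    ‖conv f g ξ‖ₑ ≤ ∫⁻ t, ‖f t‖ₑ * ‖g (ξ - t)‖ₑ := by
  refine (enorm_integral_le_lintegral_enorm _).trans (le_of_eq ?_)
  simp only [enorm_mul]

theorem lintegral_enorm_eq (f : ℝ → ℂ) : ∫⁻ t, ‖f t‖ₑ = eLpNorm f 1 :=
  eLpNorm_one_eq_lintegral_enorm.symm

theorem eLpNorm_conv_le {f g : ℝ → ℂ} (hf : AEStronglyMeasurable f)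
    (hg : AEStronglyMeasurable g) :
    eLpNorm (conv f g) 2 ≤ eLpNorm f 1 * eLpNorm g 2 := by
  have h := eLpNorm_lconv_le hf.enorm hg.enorm
  rw [lintegral_enorm_eq, eLpNorm_enorm] at h
  refine le_trans (eLpNorm_mono_enorm fun ξ => ?_) h
  exact (enorm_conv_le f g ξ).trans (le_of_eq (by simp))

theorem aemeasurable_lconv {F G : ℝ → ℝ≥0∞} (hF : AEMeasurable F) (hG : AEMeasurable G) :
    AEMeasurable (fun ξ : ℝ => ∫⁻ t, F t * G (ξ - t)) := by
  have : AEMeasurable (fun p : ℝ × ℝ => F p.2 * G (p.1 - p.2)) (volume.prod volume) :=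
    (hF.comp_snd).mul (hG.comp_quasiMeasurePreserving
      (quasiMeasurePreserving_sub volume volume))
  exact this.lintegral_prod_right'

theorem enorm_bracket_rpow (s t : ℝ) :
    ‖((bracket t ^ s : ℝ) : ℂ)‖ₑ = ENNReal.ofReal (bracket t ^ s) := by
  rw [← ofReal_norm, Complex.norm_real,
    Real.norm_of_nonneg (Real.rpow_nonneg (bracket_pos t).le s)]

theorem aestronglyMeasurable_bracket_rpow (s : ℝ) :
    AEStronglyMeasurable (fun ξ => ((bracket ξ ^ s : ℝ) : ℂ)) :=
  (Complex.continuous_ofReal.comp (continuous_bracket_rpow s)).aestronglyMeasurable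

/-- The weight `⟨k⟩^s` of a convolution can be moved to one of the factors. -/
theorem enorm_bracket_mul_conv_le {s : ℝ} (hs : 0 ≤ s) {f g : ℝ → ℂ}
    (hf : AEStronglyMeasurable f) (hg : AEStronglyMeasurable g) (ξ : ℝ) :
    ‖((bracket ξ ^ s : ℝ) : ℂ) * conv f g ξ‖ₑ ≤ ENNReal.ofReal (2 ^ s) *
      ((∫⁻ t, ‖((bracket t ^ s : ℝ) : ℂ) * f t‖ₑ * ‖g (ξ - t)‖ₑ) +
        ∫⁻ t, ‖f t‖ₑ * ‖((bracket (ξ - t) ^ s : ℝ) : ℂ) * g (ξ - t)‖ₑ) := by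
  have m1 : AEMeasurable (fun t => ‖((bracket t ^ s : ℝ) : ℂ) * f t‖ₑ * ‖g (ξ - t)‖ₑ) :=
    ((aestronglyMeasurable_bracket_rpow s).mul hf).enorm.mul
      (hg.enorm.comp_quasiMeasurePreserving (quasiMeasurePreserving_sub_left volume ξ))
  rw [enorm_mul, enorm_bracket_rpow]
  calc _ ≤ ENNReal.ofReal (bracket ξ ^ s) * ∫⁻ t, ‖f t‖ₑ * ‖g (ξ - t)‖ₑ := by
        gcongr; exact enorm_conv_le f g ξ
    _ ≤ ∫⁻ t, ENNReal.ofReal (bracket ξ ^ s) * (‖f t‖ₑ * ‖g (ξ - t)‖ₑ) :=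
        lintegral_const_mul_le _ _
    _ ≤ ∫⁻ t, ENNReal.ofReal (2 ^ s) * (‖((bracket t ^ s : ℝ) : ℂ) * f t‖ₑ * ‖g (ξ - t)‖ₑ +
          ‖f t‖ₑ * ‖((bracket (ξ - t) ^ s : ℝ) : ℂ) * g (ξ - t)‖ₑ) := by
        refine lintegral_mono fun t => ?_
        have hle : ENNReal.ofReal (bracket ξ ^ s) ≤ ENNReal.ofReal (2 ^ s) *
            (ENNReal.ofReal (bracket t ^ s) + ENNReal.ofReal (bracket (ξ - t) ^ s)) := by
          rw [← ENNReal.ofReal_add (Real.rpow_nonneg (bracket_pos _).le s)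
            (Real.rpow_nonneg (bracket_pos _).le s), ← ENNReal.ofReal_mul (by positivity)]
          exact ENNReal.ofReal_le_ofReal (bracket_rpow_le_add hs ξ t)
        calc _ ≤ (ENNReal.ofReal (2 ^ s) * (ENNReal.ofReal (bracket t ^ s) +
              ENNReal.ofReal (bracket (ξ - t) ^ s))) * (‖f t‖ₑ * ‖g (ξ - t)‖ₑ) := by gcongr
          _ = _ := by
            simp only [enorm_mul, enorm_bracket_rpow]
            ring
    _ = _ := by
        rw [lintegral_const_mul' _ _ ENNReal.ofReal_ne_top, lintegral_add_left' m1]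

theorem sobNorm_le_ofReal_mul_eLpNorm {s c : ℝ} {f : ℝ → ℂ} {H : ℝ → ℝ≥0∞}
    (h : ∀ ξ, ‖((bracket ξ ^ s : ℝ) : ℂ) * f ξ‖ₑ ≤ ENNReal.ofReal c * H ξ) :
    sobNorm s f ≤ ENNReal.ofReal c * eLpNorm H 2 := by
  have := eLpNorm_le_nnreal_smul_eLpNorm_of_ae_le_mul'
      (f := fun ξ => ((bracket ξ ^ s : ℝ) : ℂ) * f ξ) (g := H)
      (c := Real.toNNReal c) (μ := volume) (Eventually.of_forall h) 2
  rwa [ENNReal.smul_def, smul_eq_mul] at this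

theorem eLpNorm_bracket_lconv_le (s : ℝ) {f g : ℝ → ℂ} (hf : AEStronglyMeasurable f)
    (hg : AEStronglyMeasurable g) :
    eLpNorm (fun ξ => ∫⁻ t, ‖f t‖ₑ * ‖((bracket (ξ - t) ^ s : ℝ) : ℂ) * g (ξ - t)‖ₑ) 2 ≤
      (embConst * sobNorm 1 f) * sobNorm s g := by
  have h := eLpNorm_lconv_le hf.enorm ((aestronglyMeasurable_bracket_rpow s).mul hg).enorm
  rw [lintegral_enorm_eq, eLpNorm_enorm] at h
  exact h.trans (mul_le_mul' (eLpNorm_one_le_sobNorm hf) le_rfl)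

/-- The tame product estimate `‖uv‖_s ≤ C_s (‖u‖_s ‖v‖_1 + ‖u‖_1 ‖v‖_s)`, where `H¹` only serves to
control the `L¹` norm of a Fourier transform. -/
theorem sobNorm_conv_le {s : ℝ} (hs : 0 ≤ s) {f g : ℝ → ℂ} (hf : AEStronglyMeasurable f)
    (hg : AEStronglyMeasurable g) :
    sobNorm s (conv f g) ≤ ENNReal.ofReal (2 ^ s) * embConst *
      (sobNorm s f * sobNorm 1 g + sobNorm 1 f * sobNorm s g) := by
  have hb := aestronglyMeasurable_bracket_rpow s
  have h3 := sobNorm_le_ofReal_mul_eLpNorm fun ξ => enorm_bracket_mul_conv_le hs hf hg ξ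
  have m1 := (aemeasurable_lconv (hb.mul hf).enorm hg.enorm).aestronglyMeasurable
  have m2 := (aemeasurable_lconv hf.enorm (hb.mul hg).enorm).aestronglyMeasurable
  have h4 := eLpNorm_add_le m1 m2 (p := 2) (by norm_num)
  have h1 := eLpNorm_bracket_lconv_le s hg hf
  have h2 := eLpNorm_bracket_lconv_le s hf hg
  have e : (fun ξ => ∫⁻ t, ‖g t‖ₑ * ‖((bracket (ξ - t) ^ s : ℝ) : ℂ) * f (ξ - t)‖ₑ) =
      fun ξ => ∫⁻ t, ‖((bracket t ^ s : ℝ) : ℂ) * f t‖ₑ * ‖g (ξ - t)‖ₑ := by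
    ext ξ
    exact (lconv_comm (fun t => ‖((bracket t ^ s : ℝ) : ℂ) * f t‖ₑ) (fun t => ‖g t‖ₑ) ξ).symm
  rw [e] at h1
  refine (h3.trans (mul_le_mul' le_rfl (h4.trans (add_le_add h1 h2)))).trans (le_of_eq ?_)
  ring

theorem memSob_conv {s : ℝ} (hs : 1 ≤ s) {f g : ℝ → ℂ} (hf : MemSob s f) (hg : MemSob s g) :
    MemSob s (conv f g) := by
  refine (memSob_iff (integrable_conv (hf.integrable hs)
    (hg.integrable hs)).aestronglyMeasurable).2 ?_
  refine (sobNorm_conv_le (by linarith) hf.aestronglyMeasurable hg.aestronglyMeasurable).trans_lt ?_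
  have := hf.lt_top
  have := hg.lt_top
  have := (hf.mono hs).lt_top
  have := (hg.mono hs).lt_top
  have := embConst_lt_top
  finiteness

/-! ### Derivatives of Sobolev functions -/

/-- The `L²` Fourier transform turns differentiation into multiplication by `2πiξ`. -/
theorem fourier_toLp_deriv {u u' : ℝ → ℂ} (hu : ∀ x, HasDerivAt u (u' x) x) (h : MemLp u 2)
    (h' : MemLp u' 2) :
    (𝓕 (h'.toLp u') : Lp ℂ 2 (volume : Measure ℝ)) =ᵐ[volume]
      fun ξ : ℝ => 2 * Real.pi * Complex.I * ξ * (𝓕 (h.toLp u) : Lp ℂ 2 (volume : Measure ℝ)) ξ := by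
  -- Test against a Schwartz function `φ` and integrate by parts against `𝓕 φ`.
  refine ae_eq_of_integral_schwartz_eq ((Lp.memLp _).locallyIntegrable (by norm_num)) ?_ fun φ => ?_
  · have h1 : LocallyIntegrable (𝓕 (h.toLp u) : Lp ℂ 2 (volume : Measure ℝ)) :=
      (Lp.memLp _).locallyIntegrable (by norm_num)
    have h2 : Continuous fun ξ : ℝ => 2 * Real.pi * Complex.I * (ξ : ℂ) := by fun_prop
    rw [← locallyIntegrableOn_univ] at h1 ⊢
    exact h1.continuousOn_mul h2.continuousOn isOpen_univ.isLocallyClosed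
  · set g : SchwartzMap ℝ ℂ := 𝓕 φ with hg
    set dg : SchwartzMap ℝ ℂ := SchwartzMap.derivCLM ℂ ℂ g with hdg
    have hgd : ∀ x, HasDerivAt g (dg x) x := fun x => by
      have := g.differentiable.differentiableAt (x := x)
      simpa [hdg] using this.hasDerivAt
    have hψ : ∀ x, (𝓕⁻ dg) x = -(2 * Real.pi * Complex.I * x * φ x) := fun x => by
      have e1 : (𝓕⁻ dg) x = 𝓕⁻ (deriv g) x := by
        rw [SchwartzMap.fourierInv_coe]
        congr 1
      have e2 := congrFun (Real.fourier_deriv (f := g) g.integrable g.differentiable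
        dg.integrable) (-x)
      rw [e1, Real.fourierInv_eq_fourier_neg, e2, ← Real.fourierInv_eq_fourier_neg,
        ← SchwartzMap.fourierInv_coe, hg, FourierTransform.fourierInv_fourier_eq]
      simp
    have ibp : ∫ x, g x * u' x = -∫ x, dg x * u x := by
      refine integral_mul_deriv_eq_deriv_mul_of_integrable (fun x _ => hgd x) (fun x _ => hu x)
        ?_ ?_ ?_
      · exact (g.memLp 2).integrable_mul h'
      · exact (dg.memLp 2).integrable_mul h
      · exact (g.memLp 2).integrable_mul h
    calc ∫ x, φ x * (𝓕 (h'.toLp u') : Lp ℂ 2 (volume : Measure ℝ)) x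
        = ∫ x, g x * (h'.toLp u') x := integral_schwartz_mul_fourier _ _
      _ = ∫ x, g x * u' x := integral_congr_ae (by
          filter_upwards [h'.coeFn_toLp] with x hx; rw [hx])
      _ = -∫ x, dg x * u x := ibp
      _ = -∫ x, (𝓕 (𝓕⁻ dg)) x * (h.toLp u) x := by
          rw [FourierTransform.fourier_fourierInv_eq]
          congr 1
          exact integral_congr_ae (by filter_upwards [h.coeFn_toLp] with x hx; rw [hx])
      _ = -∫ x, (𝓕⁻ dg) x * (𝓕 (h.toLp u) : Lp ℂ 2 (volume : Measure ℝ)) x := by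
          rw [integral_schwartz_mul_fourier]
      _ = _ := by
          rw [← integral_neg]
          congr with x
          rw [hψ]; ring

theorem eLpNorm_fourier_toLp {u : ℝ → ℂ} (h : MemLp u 2) :
    eLpNorm (𝓕 (h.toLp u) : Lp ℂ 2 (volume : Measure ℝ)) 2 = eLpNorm u 2 := by
  have := Lp.norm_fourier_eq (h.toLp u)
  rw [Lp.norm_def, Lp.norm_def, eLpNorm_congr_ae h.coeFn_toLp] at this
  exact (ENNReal.toReal_eq_toReal_iff' (Lp.memLp _).2.ne h.2.ne).1 this

/-- A function in `H¹` is the inverse Fourier integral of a function with finite weighted `L²`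
norm, which also represents the derivative. -/
theorem exists_fourierInv_eq {u u' : ℝ → ℂ} (hu : ∀ x, HasDerivAt u (u' x) x) (h : MemLp u 2)
    (h' : MemLp u' 2) :
    ∃ f : ℝ → ℂ, MemSob 1 f ∧ 𝓕⁻ f = u ∧ sobNorm 1 f ≤ eLpNorm u 2 + eLpNorm u' 2 ∧
      (𝓕 (h.toLp u) : Lp ℂ 2 (volume : Measure ℝ)) =ᵐ[volume] f := by
  set f : ℝ → ℂ := ⇑(𝓕 (h.toLp u) : Lp ℂ 2 (volume : Measure ℝ)) with hf
  have hfm : AEStronglyMeasurable f := (Lp.memLp _).1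
  have hd := fourier_toLp_deriv hu h h'
  have hb : sobNorm 1 f ≤ eLpNorm u 2 + eLpNorm u' 2 := by
    rw [← eLpNorm_fourier_toLp h, ← eLpNorm_fourier_toLp h', eLpNorm_congr_ae hd, ← hf]
    have hm2 : AEStronglyMeasurable (fun ξ : ℝ => 2 * Real.pi * Complex.I * ξ * f ξ) :=
      (by fun_prop : Continuous fun ξ : ℝ => 2 * Real.pi * Complex.I * (ξ : ℂ)
        ).aestronglyMeasurable.mul hfm
    rw [← eLpNorm_norm f, ← eLpNorm_norm (fun ξ : ℝ => 2 * Real.pi * Complex.I * ξ * f ξ)]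
    refine le_trans ?_ (eLpNorm_add_le hfm.norm hm2.norm (by norm_num))
    refine eLpNorm_mono_real fun ξ => ?_
    rw [enorm_bracket_mul, Real.rpow_one, Pi.add_apply, norm_mul (2 * Real.pi * Complex.I * (ξ : ℂ))]
    have e : ‖2 * Real.pi * Complex.I * (ξ : ℂ)‖ = |2 * Real.pi * ξ| := by
      simp [abs_mul]
    have hle : bracket ξ ≤ 1 + |2 * Real.pi * ξ| := by
      refine (Real.sqrt_le_left (by positivity)).2 ?_
      nlinarith [abs_nonneg (2 * Real.pi * ξ), sq_abs (2 * Real.pi * ξ)]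
    rw [e]
    nlinarith [norm_nonneg (f ξ)]
  have hfs : MemSob 1 f := (memSob_iff hfm).2 (hb.trans_lt (ENNReal.add_lt_top.2 ⟨h.2, h'.2⟩))
  have hf2 : MemLp f 2 := Lp.memLp _
  refine ⟨f, hfs, ?_, hb, ae_eq_refl _⟩
  have hcu : Continuous u := continuous_iff_continuousAt.2 fun x => (hu x).continuousAt
  refine (Continuous.ae_eq_iff_eq volume (continuous_fourierInv (hfs.integrable le_rfl)) hcu).1 ?_
  have h1 := fourierInv_toLp (hfs.integrable le_rfl) hf2
  have h2 : hf2.toLp f = 𝓕 (h.toLp u) := Lp.toLp_coeFn _ _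
  rw [h2, FourierTransform.fourierInv_fourier_eq] at h1
  exact h1.symm.trans h.coeFn_toLp

/-- Multiplication of the Fourier transform by `2πiξ`. -/
noncomputable def dMul (f : ℝ → ℂ) (ξ : ℝ) : ℂ := 2 * Real.pi * Complex.I * ξ * f ξ

theorem norm_two_pi_I_mul (ξ : ℝ) : ‖2 * Real.pi * Complex.I * (ξ : ℂ)‖ = |2 * Real.pi * ξ| := by
  simp [abs_mul]

theorem norm_two_pi_I_mul_le (ξ : ℝ) :
    ‖2 * Real.pi * Complex.I * (ξ : ℂ)‖ ≤ 1 * bracket ξ ^ (1 : ℝ) := by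
  rw [norm_two_pi_I_mul, Real.rpow_one, one_mul]
  exact abs_le_bracket ξ

theorem memSob_dMul {s : ℝ} {f : ℝ → ℂ} (hf : MemSob (s + 1) f) : MemSob s (dMul f) :=
  MemSob.mul hf (by fun_prop : Continuous fun ξ : ℝ =>
    2 * Real.pi * Complex.I * (ξ : ℂ)).aestronglyMeasurable norm_two_pi_I_mul_le

theorem sobNorm_dMul_le (s : ℝ) (f : ℝ → ℂ) : sobNorm s (dMul f) ≤ sobNorm (s + 1) f := by
  have := sobNorm_mul_le (s := s) (f := f) norm_two_pi_I_mul_le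
  rw [ENNReal.ofReal_one, one_mul] at this
  exact this

theorem MemSob.hasDerivAt {f : ℝ → ℂ} (hf : MemSob 2 f) (x : ℝ) :
    HasDerivAt (𝓕⁻ f) (𝓕⁻ (dMul f) x) x := by
  refine hasDerivAt_fourierInv (hf.integrable (by norm_num)) ?_ x
  have h : Integrable (dMul f) :=
    (memSob_dMul (s := 1) (by norm_num; exact hf)).integrable le_rfl
  have := h.const_mul (2 * Real.pi * Complex.I)⁻¹
  refine this.congr (Eventually.of_forall fun ξ => ?_)
  have : (2 * Real.pi * Complex.I : ℂ) ≠ 0 := by simp [Real.pi_ne_zero]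
  simp only [dMul]
  field_simp

theorem MemSob.continuous {f : ℝ → ℂ} (hf : MemSob 1 f) : Continuous (𝓕⁻ f) :=
  continuous_fourierInv (hf.integrable le_rfl)

theorem MemSob.fourierInv_conv {f g : ℝ → ℂ} (hf : MemSob 1 f) (hg : MemSob 1 g) (x : ℝ) :
    𝓕⁻ (conv f g) x = 𝓕⁻ f x * 𝓕⁻ g x :=
  GravityCapillaryWhitham.fourierInv_conv (hf.integrable le_rfl) (hg.integrable le_rfl) x

theorem MemSob.fourierInv_add {f g : ℝ → ℂ} (hf : MemSob 1 f) (hg : MemSob 1 g) (x : ℝ) :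
    𝓕⁻ (fun ξ => f ξ + g ξ) x = 𝓕⁻ f x + 𝓕⁻ g x :=
  GravityCapillaryWhitham.fourierInv_add (hf.integrable le_rfl) (hg.integrable le_rfl) x

theorem MemSob.ae_eq_of_fourierInv_eq {f g : ℝ → ℂ} (hf : MemSob 1 f) (hg : MemSob 1 g)
    (h : 𝓕⁻ f = 𝓕⁻ g) : f =ᵐ[volume] g :=
  ae_eq_of_fourierInv_ae_eq (hf.integrable le_rfl) (hf.memLp_two zero_le_one)
    (hg.integrable le_rfl) (hg.memLp_two zero_le_one) (by rw [h])

theorem MemSob.norm_fourierInv_le {f : ℝ → ℂ} (hf : MemSob 1 f) (x : ℝ) :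
    ‖𝓕⁻ f x‖ ≤ (embConst * sobNorm 1 f).toReal := by
  refine (GravityCapillaryWhitham.norm_fourierInv_le f x).trans ?_
  rw [integral_norm_eq_lintegral_enorm hf.aestronglyMeasurable, lintegral_enorm_eq]
  exact ENNReal.toReal_mono (ENNReal.mul_lt_top embConst_lt_top hf.lt_top).ne
    (eLpNorm_one_le_sobNorm hf.aestronglyMeasurable)

theorem MemSob.eLpNorm_fourierInv {f : ℝ → ℂ} (hf : MemSob 1 f) :
    eLpNorm (𝓕⁻ f) 2 = sobNorm 0 f := by
  rw [sobNorm_zero]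
  exact GravityCapillaryWhitham.eLpNorm_fourierInv (hf.integrable le_rfl)
    (hf.memLp_two zero_le_one)

theorem MemSob.memLp_fourierInv {f : ℝ → ℂ} (hf : MemSob 1 f) : MemLp (𝓕⁻ f) 2 :=
  GravityCapillaryWhitham.memLp_fourierInv (hf.integrable le_rfl) (hf.memLp_two zero_le_one)

theorem MemSob.fourier_toLp {f : ℝ → ℂ} (hf : MemSob 1 f) :
    (𝓕 (hf.memLp_fourierInv.toLp (𝓕⁻ f)) : Lp ℂ 2 (volume : Measure ℝ)) =ᵐ[volume] f := by
  have h := fourier_toLp_fourierInv (hf.integrable le_rfl) (hf.memLp_two zero_le_one)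
  rw [h]
  exact MemLp.coeFn_toLp _

/-! ### Smooth functions and real functions -/

/-- `f` is the Fourier transform of a function all of whose derivatives are in `L²`. -/
def MemSobAll (f : ℝ → ℂ) : Prop := ∀ s : ℝ, MemSob s f

theorem memSobAll_dMul {f : ℝ → ℂ} (hf : MemSobAll f) : MemSobAll (dMul f) :=
  fun s => memSob_dMul (hf (s + 1))

theorem MemSobAll.iterate_dMul {f : ℝ → ℂ} (hf : MemSobAll f) (r : ℕ) :
    MemSobAll (dMul^[r] f) := by
  induction r with
  | zero => exact hf
  | succ r ih => rw [Function.iterate_succ_apply']; exact memSobAll_dMul ih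

theorem sobNorm_iterate_dMul_le (s : ℝ) (r : ℕ) (f : ℝ → ℂ) :
    sobNorm s (dMul^[r] f) ≤ sobNorm (s + r) f := by
  induction r generalizing s with
  | zero => simp
  | succ r ih =>
    rw [Function.iterate_succ_apply']
    refine (sobNorm_dMul_le _ _).trans ((ih _).trans (le_of_eq ?_))
    congr 1
    push_cast; ring

/-- A real function whose complexification is the inverse Fourier integral of `f` has the
derivatives given by the powers of `2πiξ`. -/
theorem MemSobAll.iteratedDeriv_ofReal {f : ℝ → ℂ} (hf : MemSobAll f) {R : ℝ → ℝ}
    (hR : ∀ x, (R x : ℂ) = 𝓕⁻ f x) (r : ℕ) (x : ℝ) :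
    ((iteratedDeriv r R x : ℝ) : ℂ) = 𝓕⁻ (dMul^[r] f) x ∧
      HasDerivAt (iteratedDeriv r R) (iteratedDeriv (r + 1) R x) x := by
  induction r generalizing x with
  | zero =>
    refine ⟨by simpa using hR x, ?_⟩
    have hre : R = fun x => Complex.reCLM (𝓕⁻ f x) := by ext x; rw [← hR x]; simp
    have hd : DifferentiableAt ℝ R x := by
      rw [hre]
      exact (Complex.reCLM.hasFDerivAt.comp_hasDerivAt x ((hf 2).hasDerivAt x)).differentiableAt
    simpa [iteratedDeriv_one] using hd.hasDerivAt
  | succ r ih =>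
    have key : ∀ x, ((iteratedDeriv (r + 1) R x : ℝ) : ℂ) =
        𝓕⁻ (dMul^[r + 1] f) x := fun x => by
      have h1 := (ih x).2.ofReal_comp
      have h2 := ((hf.iterate_dMul r) 2).hasDerivAt x
      have h3 : (fun y => ((iteratedDeriv r R y : ℝ) : ℂ)) =
        𝓕⁻ (dMul^[r] f) := by ext y; exact (ih y).1
      rw [h3] at h1
      rw [Function.iterate_succ_apply']
      exact h1.unique h2
    refine ⟨key x, ?_⟩
    have hre : iteratedDeriv (r + 1) R = fun x => Complex.reCLM
        (𝓕⁻ (dMul^[r + 1] f) x) := by ext x; rw [← key x]; simp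
    have hd : DifferentiableAt ℝ (iteratedDeriv (r + 1) R) x := by
      rw [hre]
      exact (Complex.reCLM.hasFDerivAt.comp_hasDerivAt x
        (((hf.iterate_dMul (r + 1)) 2).hasDerivAt x)).differentiableAt
    have := hd.hasDerivAt
    rwa [← iteratedDeriv_succ] at this

theorem MemSobAll.contDiff {f : ℝ → ℂ} (hf : MemSobAll f) {R : ℝ → ℝ}
    (hR : ∀ x, (R x : ℂ) = 𝓕⁻ f x) : ContDiff ℝ ∞ R :=
  contDiff_of_differentiable_iteratedDeriv fun m _ x =>
    (hf.iteratedDeriv_ofReal hR m x).2.differentiableAt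

theorem MemSobAll.memLp_iteratedDeriv {f : ℝ → ℂ} (hf : MemSobAll f) {R : ℝ → ℝ}
    (hR : ∀ x, (R x : ℂ) = 𝓕⁻ f x) (r : ℕ) :
    MemLp (iteratedDeriv r R) 2 ∧ eLpNorm (iteratedDeriv r R) 2 ≤ sobNorm r f ∧
      Tendsto (iteratedDeriv r R) (cocompact ℝ) (𝓝 0) := by
  have h3 : (fun y => ((iteratedDeriv r R y : ℝ) : ℂ)) =
      𝓕⁻ (dMul^[r] f) := by
    ext y; exact (hf.iteratedDeriv_ofReal hR r y).1
  have hre : iteratedDeriv r R = fun x => Complex.re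
        (𝓕⁻ (dMul^[r] f) x) := by ext x; rw [← congrFun h3 x]; simp
  have hm := (hf.iterate_dMul r 1)
  refine ⟨?_, ?_, ?_⟩
  · rw [hre]; exact hm.memLp_fourierInv.re
  · have h4 : eLpNorm (iteratedDeriv r R) 2 = eLpNorm (𝓕⁻ (dMul^[r] f)) 2 := by
      rw [← h3]
      refine eLpNorm_congr_norm_ae (Eventually.of_forall fun x => ?_)
      simp
    rw [h4, hm.eLpNorm_fourierInv]
    refine (sobNorm_iterate_dMul_le 0 r f).trans ?_
    rw [zero_add]
  · have := (tendsto_fourierInv_cocompact (dMul^[r] f))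
    rw [hre]
    have h5 := (Complex.continuous_re.tendsto 0).comp this
    exact h5

/-! ### The multiplier relation -/

/-- For functions given by inverse Fourier integrals, being a multiplier image is the pointwise
relation between the Fourier transforms. -/
theorem isMultiplierImage_iff {m : ℝ → ℝ} {u v : ℝ → ℝ} {f g : ℝ → ℂ} (hf : MemSob 1 f)
    (hg : MemLp g 2) (hg1 : Integrable g)
    (hu : ∀ x, (u x : ℂ) = 𝓕⁻ f x) (hv : ∀ x, (v x : ℂ) = 𝓕⁻ g x) :
    IsMultiplierImage m u v ↔ ∀ᵐ ξ, g ξ = (m (2 * Real.pi * ξ) : ℂ) * f ξ := by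
  have hG := fourier_toLp_fourierInv hg1 hg
  constructor
  · rintro ⟨F, G, hF, hG', h⟩
    have eF : F = hf.memLp_fourierInv.toLp (𝓕⁻ f) := by
      apply Lp.ext
      filter_upwards [hF, hf.memLp_fourierInv.coeFn_toLp] with x h1 h2
      rw [h1, h2, hu]
    have eG : G = (GravityCapillaryWhitham.memLp_fourierInv hg1 hg).toLp (𝓕⁻ g) := by
      apply Lp.ext
      filter_upwards [hG', (GravityCapillaryWhitham.memLp_fourierInv hg1 hg).coeFn_toLp] with x h1 h2
      rw [h1, h2, hv]
    rw [eF, eG, hG] at h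
    filter_upwards [h, hf.fourier_toLp, hg.coeFn_toLp] with ξ h1 h2 h3
    rw [← h3, h1, h2]
  · intro h
    refine ⟨hf.memLp_fourierInv.toLp (𝓕⁻ f),
      (GravityCapillaryWhitham.memLp_fourierInv hg1 hg).toLp (𝓕⁻ g), ?_, ?_, ?_⟩
    · filter_upwards [hf.memLp_fourierInv.coeFn_toLp] with x hx
      rw [hx, hu]
    · filter_upwards [(GravityCapillaryWhitham.memLp_fourierInv hg1 hg).coeFn_toLp] with x hx
      rw [hx, hv]
    · rw [hG]
      filter_upwards [h, hf.fourier_toLp, hg.coeFn_toLp] with ξ h1 h2 h3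
      rw [h3, h1, h2]

/-! ### Real bounds for the phase speed -/

/-- The continued fraction bound `tanh k ≥ 3k/(3 + k²)`, cleared of denominators. -/
theorem three_mul_cosh_le {k : ℝ} (hk : 0 ≤ k) :
    3 * k * Real.cosh k ≤ (3 + k ^ 2) * Real.sinh k := by
  -- The difference of the two sides has derivative `x (x cosh x - sinh x)`.
  have h1 : ∀ x : ℝ, 0 ≤ x → 0 ≤ x * Real.cosh x - Real.sinh x := by
    intro x hx
    have hm : MonotoneOn (fun x : ℝ => x * Real.cosh x - Real.sinh x) (Set.Ici 0) := by
      refine monotoneOn_of_hasDerivWithinAt_nonneg (f' := fun x => x * Real.sinh x)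
        (convex_Ici 0) (by fun_prop) (fun y _ => ?_) (fun y hy => ?_)
      · have h := ((hasDerivAt_id y).mul (Real.hasDerivAt_cosh y)).sub (Real.hasDerivAt_sinh y)
        exact (h.congr_deriv (by simp)).hasDerivWithinAt
      · rw [interior_Ici] at hy
        exact mul_nonneg (le_of_lt hy) (Real.sinh_nonneg_iff.2 (le_of_lt hy))
    have := hm (Set.mem_Ici.2 le_rfl) (Set.mem_Ici.2 hx) hx
    simpa using this
  have hm : MonotoneOn (fun x : ℝ => (3 + x ^ 2) * Real.sinh x - 3 * x * Real.cosh x)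
      (Set.Ici 0) := by
    refine monotoneOn_of_hasDerivWithinAt_nonneg
      (f' := fun x => x * (x * Real.cosh x - Real.sinh x))
      (convex_Ici 0) (by fun_prop) (fun y _ => ?_) (fun y hy => ?_)
    · have h := ((((hasDerivAt_pow 2 y).const_add 3).mul (Real.hasDerivAt_sinh y)).sub
        ((((hasDerivAt_id y).const_mul 3)).mul (Real.hasDerivAt_cosh y)))
      exact (h.congr_deriv (by simp; ring)).hasDerivWithinAt
    · rw [interior_Ici] at hy
      exact mul_nonneg (le_of_lt hy) (h1 y (le_of_lt hy))
  have := hm (Set.mem_Ici.2 le_rfl) (Set.mem_Ici.2 hk) hk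
  simp at this
  linarith

theorem tanh_div_self_even (k : ℝ) : Real.tanh (-k) / -k = Real.tanh k / k := by
  rw [Real.tanh_neg, neg_div_neg_eq]

theorem phaseSpeed_neg (β k : ℝ) : phaseSpeed β (-k) = phaseSpeed β k := by
  unfold phaseSpeed
  rw [tanh_div_self_even]
  simp

theorem phaseSpeed_zero (β : ℝ) : phaseSpeed β 0 = 1 := by simp [phaseSpeed]

theorem tanh_div_self_lower {k : ℝ} (hk : k ≠ 0) : 3 / (3 + k ^ 2) ≤ Real.tanh k / k := by
  have main : ∀ k : ℝ, 0 < k → 3 / (3 + k ^ 2) ≤ Real.tanh k / k := by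
    intro k hk
    rw [Real.tanh_eq_sinh_div_cosh, div_div, div_le_div_iff₀ (by positivity)
      (mul_pos (Real.cosh_pos k) hk)]
    have := three_mul_cosh_le hk.le
    linarith
  rcases lt_or_gt_of_ne hk with h | h
  · have := main (-k) (by linarith)
    rw [tanh_div_self_even] at this
    simpa using this
  · exact main k h

theorem tanh_div_self_upper {k : ℝ} (hk : k ≠ 0) : Real.tanh k / k ≤ 1 := by
  have main : ∀ k : ℝ, 0 < k → Real.tanh k / k ≤ 1 := by
    intro k hk
    rw [Real.tanh_eq_sinh_div_cosh, div_div, div_le_one (mul_pos (Real.cosh_pos k) hk)]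
    have hm : MonotoneOn (fun x : ℝ => Real.cosh x * x - Real.sinh x) (Set.Ici 0) := by
      refine monotoneOn_of_hasDerivWithinAt_nonneg (f' := fun x => x * Real.sinh x)
        (convex_Ici 0) (by fun_prop) (fun y _ => ?_) (fun y hy => ?_)
      · have h := ((Real.hasDerivAt_cosh y).mul (hasDerivAt_id y)).sub (Real.hasDerivAt_sinh y)
        exact (h.congr_deriv (by simp; ring)).hasDerivWithinAt
      · rw [interior_Ici] at hy
        exact mul_nonneg (le_of_lt hy) (Real.sinh_nonneg_iff.2 (le_of_lt hy))
    have := hm (Set.mem_Ici.2 le_rfl) (Set.mem_Ici.2 hk.le) hk.le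
    simp at this
    linarith
  rcases lt_or_gt_of_ne hk with h | h
  · have := main (-k) (by linarith)
    rwa [tanh_div_self_even] at this
  · exact main k h

theorem tanh_div_self_nonneg (k : ℝ) : 0 ≤ Real.tanh k / k := by
  rcases eq_or_ne k 0 with rfl | h
  · simp
  · exact le_trans (by positivity) (tanh_div_self_lower h)

theorem phaseSpeed_nonneg (β k : ℝ) : 0 ≤ phaseSpeed β k := by
  unfold phaseSpeed; split_ifs
  · norm_num
  · exact Real.sqrt_nonneg _

/-- The dispersion coefficient `γ = (3β - 1)/6`: `m_β(k) = 1 + γ k² + O(k⁴)`. -/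
noncomputable def dispCoeff (β : ℝ) : ℝ := (3 * β - 1) / 6

theorem dispCoeff_pos {β : ℝ} (hβ : 1 / 3 < β) : 0 < dispCoeff β := by
  unfold dispCoeff; linarith

theorem phaseSpeed_sq {β : ℝ} (hβ : 1 / 3 < β) {k : ℝ} (hk : k ≠ 0) :
    phaseSpeed β k ^ 2 = (1 + β * k ^ 2) * (Real.tanh k / k) := by
  have : 0 ≤ β := by linarith
  rw [phaseSpeed, if_neg hk, Real.sq_sqrt]
  exact mul_nonneg (by positivity) (tanh_div_self_nonneg k)

/-- `m_β - 1` is bounded below by a multiple of `k²/(1 + k²)`. This is where `β > 1/3` matters. -/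
theorem phaseSpeed_lower {β : ℝ} (hβ : 1 / 3 < β) :
    ∃ c : ℝ, 0 < c ∧ ∀ k, 1 + c * min (k ^ 2) 1 ≤ phaseSpeed β k := by
  have hγ : 0 < β - 1 / 3 := by linarith
  have hβ0 : 0 < β := by linarith
  refine ⟨min ((β - 1 / 3) / 8) (1 / 2), by positivity, fun k => ?_⟩
  set c := min ((β - 1 / 3) / 8) (1 / 2) with hc
  have hc0 : 0 < c := by positivity
  have hc1 : c ≤ (β - 1 / 3) / 8 := min_le_left _ _
  have hc2 : c ≤ 1 / 2 := min_le_right _ _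
  rcases eq_or_ne k 0 with rfl | hk
  · simp [phaseSpeed]
  refine le_of_sq_le_sq ?_ (phaseSpeed_nonneg β k)
  rw [phaseSpeed_sq hβ hk]
  set q := min (k ^ 2) 1 with hq
  have hq1 : q ≤ 1 := min_le_right _ _
  have hq2 : q ≤ k ^ 2 := min_le_left _ _
  have hq0 : 0 ≤ q := le_min (sq_nonneg k) zero_le_one
  have h1 : (1 + β * k ^ 2) * (3 / (3 + k ^ 2)) ≤ (1 + β * k ^ 2) * (Real.tanh k / k) := by
    exact mul_le_mul_of_nonneg_left (tanh_div_self_lower hk) (by positivity)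
  have h2 : (1 + β * k ^ 2) * (3 / (3 + k ^ 2)) = 1 + (β - 1 / 3) * (3 * k ^ 2 / (3 + k ^ 2)) := by
    field_simp; ring
  have h3 : q / 2 ≤ 3 * k ^ 2 / (3 + k ^ 2) := by
    rw [le_div_iff₀ (by positivity)]
    nlinarith [mul_le_mul hq1 (le_refl (k ^ 2)) (sq_nonneg k) zero_le_one]
  have h4 : (β - 1 / 3) * (q / 2) ≤ (β - 1 / 3) * (3 * k ^ 2 / (3 + k ^ 2)) := by gcongr
  have h6 : c * q ≤ 1 := by nlinarith
  have h5 : (1 + c * q) ^ 2 ≤ 1 + 4 * c * q := by nlinarith [mul_nonneg hc0.le hq0]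
  nlinarith

theorem phaseSpeed_upper {β : ℝ} (hβ : 1 / 3 < β) (k : ℝ) :
    phaseSpeed β k ≤ 1 + (1 + β) * |k| := by
  have hβ0 : 0 < β := by linarith
  rcases eq_or_ne k 0 with rfl | hk
  · simp [phaseSpeed]
  refine le_of_sq_le_sq ?_ (by positivity)
  rw [phaseSpeed_sq hβ hk]
  have : (1 + β * k ^ 2) * (Real.tanh k / k) ≤ (1 + β * k ^ 2) * 1 := by
    exact mul_le_mul_of_nonneg_left (tanh_div_self_upper hk) (by positivity)
  have h2 := sq_abs k
  nlinarith [abs_nonneg k, mul_nonneg hβ0.le (abs_nonneg k), mul_nonneg hβ0.le (sq_nonneg k),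
    mul_nonneg (mul_nonneg hβ0.le hβ0.le) (sq_nonneg k)]

/-- `m_β` grows at least like `|k|^{1/2}`. -/
theorem phaseSpeed_growth {β : ℝ} (hβ : 1 / 3 < β) {k : ℝ} (hk : 1 ≤ |k|) :
    Real.sqrt (|k| / 4) ≤ phaseSpeed β k := by
  have main : ∀ k : ℝ, 1 ≤ k → Real.sqrt (k / 4) ≤ phaseSpeed β k := by
    intro k hk
    have hk0 : k ≠ 0 := by linarith
    refine Real.sqrt_le_left (phaseSpeed_nonneg β k) |>.2 ?_
    rw [phaseSpeed_sq hβ hk0]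
    -- `tanh 1 ≥ 3/4` by the continued fraction bound, and `β k² ≥ k²/3`.
    have h1 : 3 / 4 ≤ Real.tanh k := by
      have ht : Real.tanh 1 ≤ Real.tanh k := by
        rw [Real.tanh_eq_sinh_div_cosh, Real.tanh_eq_sinh_div_cosh,
          div_le_div_iff₀ (Real.cosh_pos 1) (Real.cosh_pos k)]
        have h0 := Real.sinh_nonneg_iff.2 (sub_nonneg.2 hk)
        rw [Real.sinh_sub] at h0
        linarith
      have := tanh_div_self_lower (k := 1) one_ne_zero
      norm_num at this
      linarith
    have h2 : k / 4 = (k ^ 2 / 3) * (3 / 4 / k) := by field_simp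
    rw [h2]
    gcongr
    nlinarith [sq_nonneg k]
  rcases abs_cases k with ⟨h, h0⟩ | ⟨h, h0⟩
  · rw [h] at hk ⊢; exact main k hk
  · rw [h] at hk ⊢; rw [← phaseSpeed_neg]; exact main (-k) hk

/-! ### The phase speed in a complex strip -/

/-- The entire function `sinh z / z`, with its removable singularity filled in. -/
noncomputable def sinhc (z : ℂ) : ℂ := dslope Complex.sinh 0 z

theorem sinhc_of_ne {z : ℂ} (hz : z ≠ 0) : sinhc z = Complex.sinh z / z := by
  rw [sinhc, dslope_of_ne _ hz, slope_def_field]; simp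

theorem sinhc_zero : sinhc 0 = 1 := by simp [sinhc]

theorem differentiable_sinhc : Differentiable ℂ sinhc := by
  have := (Complex.differentiableOn_dslope (f := Complex.sinh) (s := Set.univ) (c := 0)
    univ_mem).2 Complex.differentiable_sinh.differentiableOn
  rwa [differentiableOn_univ] at this

/-- The analytic continuation of `m_β²`. -/
noncomputable def speedSq (β : ℝ) (z : ℂ) : ℂ := (1 + β * z ^ 2) * sinhc z / Complex.cosh z

/-- The analytic continuation of `m_β` to a strip around the real axis. The principal square root is
used; it is analytic as long as `speedSq` avoids the negative half line. -/
noncomputable def speedC (β : ℝ) (z : ℂ) : ℂ := speedSq β z ^ (1 / 2 : ℂ)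

theorem speedC_sq (β : ℝ) (z : ℂ) : speedC β z ^ 2 = speedSq β z := by
  have := Complex.cpow_nat_inv_pow (speedSq β z) (n := 2) two_ne_zero
  rw [speedC]
  convert this using 3
  norm_num

theorem speedC_re_nonneg (β : ℝ) (z : ℂ) : 0 ≤ (speedC β z).re := by
  rcases eq_or_ne (speedSq β z) 0 with h | h
  · rw [speedC, h, Complex.zero_cpow (by norm_num)]; simp
  · rw [speedC, Complex.cpow_def_of_ne_zero h, Complex.exp_re]
    refine mul_nonneg (Real.exp_pos _).le (Real.cos_nonneg_of_neg_pi_div_two_le_of_le ?_ ?_)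
    · have := Complex.neg_pi_lt_arg (speedSq β z)
      simp [Complex.log_im]; linarith
    · have := Complex.arg_le_pi (speedSq β z)
      simp [Complex.log_im]; linarith

theorem speedSq_ofReal {β : ℝ} (hβ : 1 / 3 < β) (k : ℝ) :
    speedSq β k = ((phaseSpeed β k ^ 2 : ℝ) : ℂ) := by
  rcases eq_or_ne k 0 with rfl | hk
  · simp [speedSq, sinhc_zero, phaseSpeed]
  · rw [phaseSpeed_sq hβ hk, speedSq, sinhc_of_ne (by exact_mod_cast hk),
      Real.tanh_eq_sinh_div_cosh]
    push_cast
    have : (k : ℂ) ≠ 0 := by exact_mod_cast hk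
    field_simp

theorem speedC_ofReal {β : ℝ} (hβ : 1 / 3 < β) (k : ℝ) :
    speedC β k = (phaseSpeed β k : ℂ) := by
  rw [speedC, speedSq_ofReal hβ, show (1 / 2 : ℂ) = ((1 / 2 : ℝ) : ℂ) by norm_num,
    ← Complex.ofReal_cpow (sq_nonneg _), ← Real.sqrt_eq_rpow,
    Real.sqrt_sq (phaseSpeed_nonneg β k)]

theorem norm_cosh_taylor {z : ℂ} (hz : ‖z‖ ≤ 1) :
    ‖Complex.cosh z - 1 - z ^ 2 / 2‖ ≤ ‖z‖ ^ 4 := by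
  have h1 := Complex.exp_bound (x := z) hz (n := 4) (by norm_num)
  have h2 := Complex.exp_bound (x := -z) (by simpa using hz) (n := 4) (by norm_num)
  simp only [Finset.sum_range_succ, Finset.sum_range_zero, Nat.factorial, norm_neg] at h1 h2
  have e : Complex.cosh z - 1 - z ^ 2 / 2 =
      (Complex.exp z - (0 + z ^ 0 / (1 : ℕ) + z ^ 1 / ((0 + 1) * 1 : ℕ) +
        z ^ 2 / ((1 + 1) * ((0 + 1) * 1) : ℕ) + z ^ 3 / ((2 + 1) * ((1 + 1) * ((0 + 1) * 1)) : ℕ))) / 2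
      + (Complex.exp (-z) - (0 + (-z) ^ 0 / (1 : ℕ) + (-z) ^ 1 / ((0 + 1) * 1 : ℕ) +
        (-z) ^ 2 / ((1 + 1) * ((0 + 1) * 1) : ℕ) +
        (-z) ^ 3 / ((2 + 1) * ((1 + 1) * ((0 + 1) * 1)) : ℕ))) / 2 := by
    rw [Complex.cosh]; push_cast; ring
  rw [e]
  refine (norm_add_le _ _).trans ?_
  rw [norm_div, norm_div]
  norm_num at h1 h2 ⊢
  have := pow_nonneg (norm_nonneg z) 4
  linarith

theorem norm_sinhc_taylor {z : ℂ} (hz : ‖z‖ ≤ 1) :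
    ‖sinhc z - 1 - z ^ 2 / 6‖ ≤ ‖z‖ ^ 4 := by
  rcases eq_or_ne z 0 with rfl | hz0
  · simp [sinhc_zero]
  have h1 := Complex.exp_bound (x := z) hz (n := 5) (by norm_num)
  have h2 := Complex.exp_bound (x := -z) (by simpa using hz) (n := 5) (by norm_num)
  simp only [Finset.sum_range_succ, Finset.sum_range_zero, Nat.factorial, norm_neg] at h1 h2
  have e : Complex.sinh z - z - z ^ 3 / 6 =
      (Complex.exp z - (0 + z ^ 0 / (1 : ℕ) + z ^ 1 / ((0 + 1) * 1 : ℕ) +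
        z ^ 2 / ((1 + 1) * ((0 + 1) * 1) : ℕ) + z ^ 3 / ((2 + 1) * ((1 + 1) * ((0 + 1) * 1)) : ℕ)
        + z ^ 4 / ((3 + 1) * ((2 + 1) * ((1 + 1) * ((0 + 1) * 1))) : ℕ))) / 2
      - (Complex.exp (-z) - (0 + (-z) ^ 0 / (1 : ℕ) + (-z) ^ 1 / ((0 + 1) * 1 : ℕ) +
        (-z) ^ 2 / ((1 + 1) * ((0 + 1) * 1) : ℕ) +
        (-z) ^ 3 / ((2 + 1) * ((1 + 1) * ((0 + 1) * 1)) : ℕ)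
        + (-z) ^ 4 / ((3 + 1) * ((2 + 1) * ((1 + 1) * ((0 + 1) * 1))) : ℕ))) / 2 := by
    rw [Complex.sinh]; push_cast; ring
  have hs : ‖Complex.sinh z - z - z ^ 3 / 6‖ ≤ ‖z‖ ^ 5 := by
    rw [e]
    refine (norm_sub_le _ _).trans ?_
    rw [norm_div, norm_div]
    norm_num at h1 h2 ⊢
    have := pow_nonneg (norm_nonneg z) 5
    linarith
  have e2 : sinhc z - 1 - z ^ 2 / 6 = (Complex.sinh z - z - z ^ 3 / 6) / z := by
    rw [sinhc_of_ne hz0]; field_simp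
  rw [e2, norm_div, div_le_iff₀ (norm_pos_iff.2 hz0)]
  calc _ ≤ ‖z‖ ^ 5 := hs
    _ = _ := by ring

theorem norm_cosh_lower {z : ℂ} (hz : ‖z‖ ≤ 1 / 2) : 1 / 2 ≤ ‖Complex.cosh z‖ := by
  have h := norm_cosh_taylor (z := z) (by linarith)
  have h2 : ‖z‖ ^ 2 ≤ (1 / 2) ^ 2 := by gcongr
  have h4 : ‖z‖ ^ 4 ≤ (1 / 2) ^ 4 := by gcongr
  have e : (1 : ℂ) = Complex.cosh z - (Complex.cosh z - 1 - z ^ 2 / 2) - z ^ 2 / 2 := by ring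
  have := calc
    (1 : ℝ) = ‖Complex.cosh z - (Complex.cosh z - 1 - z ^ 2 / 2) - z ^ 2 / 2‖ := by
        rw [← e]; simp
    _ ≤ ‖Complex.cosh z‖ + ‖Complex.cosh z - 1 - z ^ 2 / 2‖ + ‖z ^ 2 / 2‖ :=
        (norm_sub_le _ _).trans (by gcongr; exact norm_sub_le _ _)
  have e3 : ‖z ^ 2 / 2‖ = ‖z‖ ^ 2 / 2 := by simp
  rw [e3] at this
  norm_num at h2 h4
  linarith

/-- Second order Taylor expansion of `m_β²` at the origin. -/
theorem speedSq_taylor {β : ℝ} (hβ : 1 / 3 < β) :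
    ∃ C : ℝ, 0 < C ∧ ∀ z : ℂ, ‖z‖ ≤ 1 / 2 →
      ‖speedSq β z - 1 - 2 * dispCoeff β * z ^ 2‖ ≤ C * ‖z‖ ^ 4 := by
  have hγ := dispCoeff_pos hβ
  have hβ0 : 0 < β := by linarith
  refine ⟨2 * ((β + dispCoeff β) + (1 + β) + (1 + 2 * dispCoeff β)), by positivity,
    fun z hz => ?_⟩
  have hz1 : ‖z‖ ≤ 1 := by linarith
  have hc := norm_cosh_lower hz
  have hc0 : Complex.cosh z ≠ 0 := norm_pos_iff.1 (by linarith)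
  set a := sinhc z - 1 - z ^ 2 / 6 with ha
  set b := Complex.cosh z - 1 - z ^ 2 / 2 with hb
  have hA : ‖a‖ ≤ ‖z‖ ^ 4 := norm_sinhc_taylor hz1
  have hB : ‖b‖ ≤ ‖z‖ ^ 4 := norm_cosh_taylor hz1
  have e : speedSq β z - 1 - 2 * dispCoeff β * z ^ 2 =
      ((β / 6 - dispCoeff β : ℝ) * z ^ 4 + (1 + β * z ^ 2) * a
        - (1 + 2 * dispCoeff β * z ^ 2) * b) / Complex.cosh z := by
    have e1 : sinhc z = 1 + z ^ 2 / 6 + a := by rw [ha]; ring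
    rw [speedSq, eq_div_iff hc0, sub_mul, sub_mul, div_mul_cancel₀ _ hc0, e1]
    have e2 : Complex.cosh z = 1 + z ^ 2 / 2 + b := by rw [hb]; ring
    rw [e2, dispCoeff]
    push_cast
    ring
  have hz2 : ‖z‖ ^ 2 ≤ 1 := pow_le_one₀ (norm_nonneg z) hz1
  have n1 : ‖((β / 6 - dispCoeff β : ℝ) : ℂ) * z ^ 4‖ ≤ (β + dispCoeff β) * ‖z‖ ^ 4 := by
    rw [norm_mul, norm_pow, Complex.norm_real]
    gcongr
    rw [Real.norm_eq_abs, abs_le]; constructor <;> linarith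
  have n2 : ‖(1 + β * z ^ 2) * a‖ ≤ (1 + β) * ‖z‖ ^ 4 := by
    rw [norm_mul]
    gcongr
    refine (norm_add_le _ _).trans ?_
    rw [norm_mul, norm_pow, Complex.norm_real, Real.norm_of_nonneg hβ0.le, norm_one]
    nlinarith
  have n3 : ‖(1 + 2 * dispCoeff β * z ^ 2) * b‖ ≤ (1 + 2 * dispCoeff β) * ‖z‖ ^ 4 := by
    rw [norm_mul]
    gcongr
    refine (norm_add_le _ _).trans ?_
    rw [norm_mul, norm_pow, norm_mul, Complex.norm_real, Real.norm_of_nonneg hγ.le, norm_one,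
      Complex.norm_ofNat]
    nlinarith
  rw [e, norm_div, div_le_iff₀ (by linarith)]
  have n4 := (norm_sub_le (((β / 6 - dispCoeff β : ℝ) : ℂ) * z ^ 4 + (1 + β * z ^ 2) * a)
    ((1 + 2 * dispCoeff β * z ^ 2) * b)).trans (add_le_add_left (norm_add_le _ _) _)
  have h4 := pow_nonneg (norm_nonneg z) 4
  calc _ ≤ ((β + dispCoeff β) + (1 + β) + (1 + 2 * dispCoeff β)) * ‖z‖ ^ 4 := by linarith
    _ = (2 * ((β + dispCoeff β) + (1 + β) + (1 + 2 * dispCoeff β)) * ‖z‖ ^ 4) * (1 / 2) := by ring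
    _ ≤ _ := by gcongr

theorem norm_speedC_add_one (β : ℝ) (z : ℂ) : 1 ≤ ‖speedC β z + 1‖ := by
  have h := Complex.re_le_norm (speedC β z + 1)
  have := speedC_re_nonneg β z
  simp at h
  linarith

/-- Second order Taylor expansion of `m_β` at the origin. -/
theorem speedC_taylor {β : ℝ} (hβ : 1 / 3 < β) :
    ∃ C : ℝ, 0 < C ∧ ∀ z : ℂ, ‖z‖ ≤ 1 / 2 →
      ‖speedC β z - 1 - dispCoeff β * z ^ 2‖ ≤ C * ‖z‖ ^ 4 := by
  obtain ⟨C, hC, h⟩ := speedSq_taylor hβ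
  have hγ := dispCoeff_pos hβ
  refine ⟨C + (2 * dispCoeff β + C) ^ 2, by positivity, fun z hz => ?_⟩
  have h0 := h z hz
  have hz2 : ‖z‖ ^ 4 ≤ ‖z‖ ^ 2 := pow_le_pow_of_le_one (norm_nonneg z) (by linarith) (by norm_num)
  have h1 : ‖speedC β z - 1‖ ≤ (2 * dispCoeff β + C) * ‖z‖ ^ 2 := by
    have e1 : (speedC β z - 1) * (speedC β z + 1) = speedSq β z - 1 := by
      rw [← speedC_sq]; ring
    have e2 : ‖speedC β z - 1‖ ≤ ‖speedSq β z - 1‖ := by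
      rw [← e1, norm_mul]
      exact le_mul_of_one_le_right (norm_nonneg _) (norm_speedC_add_one β z)
    have e3 : speedSq β z - 1 = (speedSq β z - 1 - 2 * dispCoeff β * z ^ 2) +
      2 * dispCoeff β * z ^ 2 := by ring
    have e4 : ‖(2 * dispCoeff β * z ^ 2 : ℂ)‖ = 2 * dispCoeff β * ‖z‖ ^ 2 := by
      rw [norm_mul, norm_pow, norm_mul, Complex.norm_real, Real.norm_of_nonneg hγ.le,
        Complex.norm_ofNat]
    rw [e3] at e2
    have := norm_add_le (speedSq β z - 1 - 2 * dispCoeff β * z ^ 2) (2 * dispCoeff β * z ^ 2)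
    rw [e4] at this
    nlinarith
  -- Expand the square root through `m - 1 = (m² - 1)/2 - (m - 1)²/2`.
  have e : speedC β z - 1 - dispCoeff β * z ^ 2 =
      (speedSq β z - 1 - 2 * dispCoeff β * z ^ 2) / 2 - (speedC β z - 1) ^ 2 / 2 := by
    rw [← speedC_sq]; ring
  rw [e]
  refine (norm_sub_le _ _).trans ?_
  rw [norm_div, norm_div, norm_pow, Complex.norm_ofNat]
  have h2 : ‖speedC β z - 1‖ ^ 2 ≤ ((2 * dispCoeff β + C) * ‖z‖ ^ 2) ^ 2 := by gcongr
  have e5 : ((2 * dispCoeff β + C) * ‖z‖ ^ 2) ^ 2 = (2 * dispCoeff β + C) ^ 2 * ‖z‖ ^ 4 := by ring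
  have := norm_nonneg (speedSq β z - 1 - 2 * dispCoeff β * z ^ 2)
  have := sq_nonneg ‖speedC β z - 1‖
  nlinarith

theorem norm_cosh_strip {z : ℂ} (hz : |z.im| ≤ 1 / 2) : Real.cosh z.re / 2 ≤ ‖Complex.cosh z‖ := by
  have hre : (Complex.cosh z).re = Real.cosh z.re * Real.cos z.im := by
    conv_lhs => rw [← Complex.re_add_im z, Complex.cosh_add, Complex.cosh_mul_I, Complex.sinh_mul_I]
    rw [← Complex.ofReal_cosh, ← Complex.ofReal_sinh, ← Complex.ofReal_cos, ← Complex.ofReal_sin]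
    simp only [Complex.add_re, Complex.mul_re, Complex.mul_im, Complex.ofReal_re, Complex.ofReal_im,
      Complex.I_re, Complex.I_im]
    ring
  have hcos : 1 / 2 ≤ Real.cos z.im := by
    have := Real.one_sub_sq_div_two_le_cos (x := z.im)
    have h2 : z.im ^ 2 ≤ (1 / 2) ^ 2 := sq_le_sq' (by linarith [abs_le.1 hz]) (by linarith [abs_le.1 hz])
    norm_num at h2
    linarith
  have := Complex.abs_re_le_norm (Complex.cosh z)
  rw [hre] at this
  have hc := Real.cosh_pos z.re
  refine le_trans ?_ ((le_abs_self _).trans this)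
  nlinarith

theorem abs_le_cosh (k : ℝ) : |k| ≤ Real.cosh k := by
  have h := Real.cosh_sq k
  have h2 : |k| ≤ |Real.sinh k| := by
    rcases le_total 0 k with hk | hk
    · rw [abs_of_nonneg hk, abs_of_nonneg (Real.sinh_nonneg_iff.2 hk)]
      exact Real.self_le_sinh_iff.2 hk
    · rw [abs_of_nonpos hk, abs_of_nonpos (Real.sinh_nonpos_iff.2 hk)]
      have := Real.sinh_le_self_iff.2 hk
      linarith
  exact h2.trans (abs_le.2 (abs_le_of_sq_le_sq' (by linarith) (Real.cosh_pos k).le))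

/-- The tanh decays to its limits exponentially, which compensates the growth of `1 + βk²` when the
wave number is shifted off the real axis. -/
theorem norm_tanh_sub_le {z : ℂ} (hz : |z.im| ≤ 1 / 2) :
    ‖Complex.tanh z - Complex.tanh z.re‖ ≤ 2 * |z.im| / Real.cosh z.re ^ 2 := by
  have h1 := norm_cosh_strip hz
  have hc := Real.cosh_pos z.re
  have hz0 : Complex.cosh z ≠ 0 := norm_pos_iff.1 (by linarith)
  have hk0 : Complex.cosh (z.re : ℂ) ≠ 0 := by
    rw [← Complex.ofReal_cosh]; exact_mod_cast hc.ne'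
  have e : Complex.tanh z - Complex.tanh z.re =
      Complex.sinh (z.im * Complex.I) / (Complex.cosh z * Complex.cosh z.re) := by
    have : (z.im * Complex.I : ℂ) = z - z.re := by
      apply Complex.ext <;> simp
    rw [this, Complex.sinh_sub, Complex.tanh_eq_sinh_div_cosh, Complex.tanh_eq_sinh_div_cosh]
    field_simp
  rw [e, Complex.sinh_mul_I, norm_div, norm_mul, norm_mul, Complex.norm_I, mul_one,
    ← Complex.ofReal_sin, ← Complex.ofReal_cosh, Complex.norm_real, Complex.norm_real,
    Real.norm_of_nonneg hc.le]
  have hs : ‖Real.sin z.im‖ ≤ |z.im| := Real.abs_sin_le_abs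
  rw [div_le_div_iff₀ (by positivity) (by positivity)]
  calc ‖Real.sin z.im‖ * Real.cosh z.re ^ 2 ≤ |z.im| * Real.cosh z.re ^ 2 := by gcongr
    _ = 2 * |z.im| * (Real.cosh z.re / 2 * Real.cosh z.re) := by ring
    _ ≤ _ := by gcongr

/-- Away from the origin, `m_β²` varies slowly in the imaginary direction. -/
theorem norm_speedSq_sub_le {β r : ℝ} (hβ : 1 / 3 < β) (hr : 0 < r) :
    ∃ C : ℝ, 0 < C ∧ ∀ z : ℂ, |z.im| ≤ 1 / 2 → r ≤ |z.re| →
      ‖speedSq β z - speedSq β z.re‖ ≤ C * |z.im| := by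
  have hβ0 : 0 < β := by linarith
  refine ⟨(1 / r ^ 2 + β) * 2 + (1 / r + β) * 2, by positivity, fun z hz hk => ?_⟩
  have hk0 : z.re ≠ 0 := by intro h; rw [h] at hk; simp at hk; linarith
  have hkc : (z.re : ℂ) ≠ 0 := by exact_mod_cast hk0
  have hz0 : z ≠ 0 := by rintro rfl; simp at hk0
  have hc := Real.cosh_pos z.re
  have hc1 := Real.one_le_cosh z.re
  have ht := norm_tanh_sub_le hz
  have form : ∀ w : ℂ, w ≠ 0 → speedSq β w = (1 / w + β * w) * Complex.tanh w := fun w hw => by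
    rw [speedSq, sinhc_of_ne hw, Complex.tanh_eq_sinh_div_cosh]; field_simp
  -- In the second term the growth of `β k` is absorbed by the factor `1/cosh² k`.
  have e : speedSq β z - speedSq β z.re =
      ((1 / z - 1 / (z.re : ℂ)) + β * (z - z.re)) * Complex.tanh z +
        (1 / (z.re : ℂ) + β * z.re) * (Complex.tanh z - Complex.tanh z.re) := by
    rw [form z hz0, form _ hkc]; ring
  have hzim : ‖z - z.re‖ = |z.im| := by
    have : z - z.re = z.im * Complex.I := by
      apply Complex.ext <;> simp
    rw [this]; simp
  have n1 : ‖1 / z - 1 / (z.re : ℂ)‖ ≤ 1 / r ^ 2 * |z.im| := by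
    have : 1 / z - 1 / (z.re : ℂ) = -((z - z.re) / (z * z.re)) := by field_simp; ring
    rw [this, norm_neg, norm_div, hzim, norm_mul, Complex.norm_real, div_eq_mul_one_div, mul_comm]
    gcongr
    rw [sq]
    exact mul_le_mul (hk.trans (Complex.abs_re_le_norm z)) hk hr.le (norm_nonneg _)
  have hsq : 1 ≤ Real.cosh z.re ^ 2 := one_le_pow₀ hc1
  have ht1 : ‖Complex.tanh z‖ ≤ 2 := by
    have h0 : ‖Complex.tanh (z.re : ℂ)‖ ≤ 1 := by
      rw [← Complex.ofReal_tanh, Complex.norm_real]; exact (Real.abs_tanh_lt_one _).le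
    have h1 : 2 * |z.im| / Real.cosh z.re ^ 2 ≤ 1 := by
      rw [div_le_one (by positivity)]; linarith
    have := norm_add_le (Complex.tanh z - Complex.tanh z.re) (Complex.tanh (z.re : ℂ))
    rw [sub_add_cancel] at this
    linarith
  have ht2 : ‖1 / (z.re : ℂ) + β * z.re‖ * ‖Complex.tanh z - Complex.tanh z.re‖ ≤
      (1 / r + β) * 2 * |z.im| := by
    have hA : ‖1 / (z.re : ℂ) + β * z.re‖ ≤ 1 / r + β * Real.cosh z.re ^ 2 := by
      refine (norm_add_le _ _).trans ?_
      rw [norm_div, norm_one, norm_mul, Complex.norm_real, Complex.norm_real,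
        Real.norm_of_nonneg hβ0.le]
      have : |z.re| ≤ Real.cosh z.re ^ 2 := (abs_le_cosh _).trans (by nlinarith)
      gcongr
      · exact hk
      · exact this
    calc _ ≤ (1 / r + β * Real.cosh z.re ^ 2) * (2 * |z.im| / Real.cosh z.re ^ 2) := by gcongr
      _ ≤ ((1 / r + β) * Real.cosh z.re ^ 2) * (2 * |z.im| / Real.cosh z.re ^ 2) := by
          gcongr
          have : 0 < 1 / r := by positivity
          nlinarith
      _ = _ := by field_simp
  rw [e]
  refine (norm_add_le _ _).trans ?_
  rw [norm_mul, norm_mul]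
  have n2 : ‖(1 / z - 1 / (z.re : ℂ)) + β * (z - z.re)‖ ≤ (1 / r ^ 2 + β) * |z.im| := by
    refine (norm_add_le _ _).trans ?_
    rw [norm_mul (β : ℂ), Complex.norm_real, Real.norm_of_nonneg hβ0.le, hzim]
    linarith
  calc _ ≤ (1 / r ^ 2 + β) * |z.im| * 2 + (1 / r + β) * 2 * |z.im| := by gcongr
    _ = _ := by ring

theorem differentiableAt_speedC {β : ℝ} {z : ℂ} (hz : |z.im| ≤ 1 / 2)
    (hs : speedSq β z ∈ Complex.slitPlane) : DifferentiableAt ℂ (speedC β) z := by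
  have hc0 : Complex.cosh z ≠ 0 := by
    have := norm_cosh_strip hz
    have hc := Real.cosh_pos z.re
    exact norm_pos_iff.1 (by linarith)
  have hd : DifferentiableAt ℂ (speedSq β) z := by
    unfold speedSq
    exact ((by fun_prop : DifferentiableAt ℂ (fun z : ℂ => 1 + β * z ^ 2) z).mul
      (differentiable_sinhc z)).div Complex.differentiable_cosh.differentiableAt hc0
  exact hd.cpow (differentiableAt_const _) hs

theorem sq_norm_eq (z : ℂ) : ‖z‖ ^ 2 = z.re ^ 2 + z.im ^ 2 := by
  rw [Complex.sq_norm, Complex.normSq_apply]; ring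

/-- Close to the origin the Taylor expansion controls `m_β`: it stays near `1`, so the square root is
analytic, and its real part grows quadratically along the real axis. -/
theorem speedC_near {β : ℝ} (hβ : 1 / 3 < β) :
    ∃ r C : ℝ, 0 < r ∧ r ≤ 1 / 2 ∧ 0 < C ∧ ∀ z : ℂ, ‖z‖ ≤ r →
      speedSq β z ∈ Complex.slitPlane ∧
      ‖speedC β z - 1 - dispCoeff β * z ^ 2‖ ≤ C * ‖z‖ ^ 4 ∧
      1 + dispCoeff β / 2 * z.re ^ 2 - 2 * dispCoeff β * z.im ^ 2 ≤ (speedC β z).re := by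
  have hγ := dispCoeff_pos hβ
  set γ := dispCoeff β with hγd
  obtain ⟨C₁, hC₁, h₁⟩ := speedC_taylor hβ
  obtain ⟨C₀, hC₀, h₀⟩ := speedSq_taylor hβ
  obtain ⟨r, hr0, hr1, hr2, hr3⟩ : ∃ r : ℝ, 0 < r ∧ r ≤ 1 / 2 ∧ C₁ * (4 * r ^ 2) ≤ γ / 2 ∧
      (2 * γ + C₀) * r ^ 2 ≤ 1 / 2 := by
    have ht : Tendsto (fun r : ℝ => C₁ * (4 * r ^ 2)) (𝓝[>] 0) (𝓝 (C₁ * (4 * 0 ^ 2))) :=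
      ((by fun_prop : Continuous fun r : ℝ => C₁ * (4 * r ^ 2)).tendsto 0).mono_left
        nhdsWithin_le_nhds
    have ht2 : Tendsto (fun r : ℝ => (2 * γ + C₀) * r ^ 2) (𝓝[>] 0) (𝓝 ((2 * γ + C₀) * 0 ^ 2)) :=
      ((by fun_prop : Continuous fun r : ℝ => (2 * γ + C₀) * r ^ 2).tendsto 0).mono_left
        nhdsWithin_le_nhds
    have e1 := ht.eventually_lt_const (show C₁ * (4 * 0 ^ 2) < γ / 2 by simp; positivity)
    have e2 := ht2.eventually_lt_const (show (2 * γ + C₀) * 0 ^ 2 < 1 / 2 by simp)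
    have e3 : ∀ᶠ r : ℝ in 𝓝[>] 0, r ∈ Set.Ioc (0 : ℝ) (1 / 2) := Ioc_mem_nhdsGT (by norm_num)
    obtain ⟨r, h1, h2, h3⟩ := (e1.and (e2.and e3)).exists
    exact ⟨r, h3.1, h3.2, h1.le, h2.le⟩
  refine ⟨r, C₁, hr0, hr1, hC₁, fun z hzr => ?_⟩
  have hn := norm_nonneg z
  have hz2re : (γ * z ^ 2 : ℂ).re = γ * (z.re ^ 2 - z.im ^ 2) := by
    simp [sq, Complex.mul_re]
  have ht := h₁ z (hzr.trans hr1)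
  have hn2 : ‖z‖ ^ 2 ≤ r ^ 2 := by gcongr
  have hn4 : ‖z‖ ^ 4 ≤ r ^ 2 * ‖z‖ ^ 2 := by
    calc ‖z‖ ^ 4 = ‖z‖ ^ 2 * ‖z‖ ^ 2 := by ring
      _ ≤ _ := by gcongr
  have hr2' : r ^ 2 ≤ 1 := by nlinarith
  refine ⟨Or.inl ?_, ht, ?_⟩
  · have h := h₀ z (hzr.trans hr1)
    have e : speedSq β z = 1 + ((speedSq β z - 1 - 2 * γ * z ^ 2) + 2 * γ * z ^ 2) := by ring
    have e4 : ‖(2 * γ * z ^ 2 : ℂ)‖ = 2 * γ * ‖z‖ ^ 2 := by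
      rw [norm_mul, norm_pow, norm_mul, Complex.norm_real, Real.norm_of_nonneg hγ.le,
        Complex.norm_ofNat]
    have h1 := norm_add_le (speedSq β z - 1 - 2 * γ * z ^ 2) (2 * γ * z ^ 2)
    have h2 := Complex.abs_re_le_norm ((speedSq β z - 1 - 2 * γ * z ^ 2) + 2 * γ * z ^ 2)
    have h3 := (abs_le.1 (h2.trans h1)).1
    rw [e4] at h3
    rw [e, Complex.add_re, Complex.one_re]
    have h5 : C₀ * ‖z‖ ^ 4 ≤ C₀ * r ^ 2 := by
      refine mul_le_mul_of_nonneg_left ?_ hC₀.le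
      nlinarith
    have h6 : 2 * γ * ‖z‖ ^ 2 ≤ 2 * γ * r ^ 2 := by gcongr
    linarith
  · have h2 := (abs_le.1 ((Complex.abs_re_le_norm _).trans ht)).1
    rw [Complex.sub_re, Complex.sub_re, Complex.one_re, hz2re] at h2
    have h3 : C₁ * ‖z‖ ^ 4 ≤ γ / 8 * (z.re ^ 2 + z.im ^ 2) := by
      rw [← sq_norm_eq]
      calc C₁ * ‖z‖ ^ 4 ≤ C₁ * (r ^ 2 * ‖z‖ ^ 2) := by gcongr
        _ = (C₁ * (4 * r ^ 2)) / 4 * ‖z‖ ^ 2 := by ring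
        _ ≤ (γ / 2) / 4 * ‖z‖ ^ 2 := by gcongr
        _ = _ := by ring
    have h4 := mul_nonneg hγ.le (sq_nonneg z.re)
    have h5 := mul_nonneg hγ.le (sq_nonneg z.im)
    linarith

/-- Away from the origin, in a sufficiently thin strip, `m_β` is a small perturbation of its values on
the real axis, which exceed `1` by a definite amount. -/
theorem speedC_far {β r : ℝ} (hβ : 1 / 3 < β) (hr0 : 0 < r) (hr1 : r ≤ 1 / 2) :
    ∃ δ C c : ℝ, 0 < δ ∧ δ ≤ 1 / 2 ∧ 0 < C ∧ 0 < c ∧ ∀ z : ℂ, |z.im| ≤ δ → r < ‖z‖ →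
      speedSq β z ∈ Complex.slitPlane ∧
      ‖speedC β z - 1 - dispCoeff β * z ^ 2‖ ≤ C * ‖z‖ ^ 2 ∧
      1 + c * min (z.re ^ 2) 1 ≤ (speedC β z).re := by
  have hγ := dispCoeff_pos hβ
  set γ := dispCoeff β with hγd
  have hβ0 : 0 < β := by linarith
  obtain ⟨c₁, hc₁, hlow⟩ := phaseSpeed_lower hβ
  obtain ⟨C₂, hC₂, h₂⟩ := norm_speedSq_sub_le hβ (r := r / 2) (by positivity)
  set q := c₁ * min ((r / 2) ^ 2) 1 with hq
  have hq0 : 0 < q := by positivity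
  -- `q` bounds `m_β - 1` from below for `|re z| ≥ r/2`; with this width `δ` of the strip, `m_β²` changes
  -- by at most `min (1/2) (q/2)` off the axis.
  set δ := min (r / 2) (min (1 / (2 * C₂)) (q / (2 * C₂))) with hδ
  have hδ0 : 0 < δ := by positivity
  have hδ1 : δ ≤ r / 2 := min_le_left _ _
  have hδ2 : C₂ * δ ≤ 1 / 2 := by
    have : δ ≤ 1 / (2 * C₂) := (min_le_right _ _).trans (min_le_left _ _)
    calc C₂ * δ ≤ C₂ * (1 / (2 * C₂)) := by gcongr
      _ = 1 / 2 := by field_simp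
  have hδ3 : C₂ * δ ≤ q / 2 := by
    have : δ ≤ q / (2 * C₂) := (min_le_right _ _).trans (min_le_right _ _)
    calc C₂ * δ ≤ C₂ * (q / (2 * C₂)) := by gcongr
      _ = q / 2 := by field_simp
  refine ⟨δ, 1 / r ^ 2 + (1 + β) / r + γ, q / 2, hδ0, by linarith, by positivity, by positivity,
    fun z hz hzr => ?_⟩
  have hn := norm_nonneg z
  have hmin2 : min (z.re ^ 2) 1 ≤ 1 := min_le_right _ _
  have hmin0 : 0 ≤ min (z.re ^ 2) 1 := le_min (sq_nonneg _) zero_le_one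
  have hkr : r / 2 ≤ |z.re| := by
    have := Complex.norm_le_abs_re_add_abs_im z
    linarith
  have hP := h₂ z (by linarith) hkr
  rw [speedSq_ofReal hβ] at hP
  set m := phaseSpeed β z.re with hm
  have hq1 : q ≤ c₁ * min (z.re ^ 2) 1 := by
    have h2 : (r / 2) ^ 2 ≤ z.re ^ 2 := by rw [← sq_abs z.re]; gcongr
    rw [hq]
    exact mul_le_mul_of_nonneg_left (min_le_min_right 1 h2) hc₁.le
  have hm1 : 1 + c₁ * min (z.re ^ 2) 1 ≤ m := hlow z.re
  have hm2 : m ≤ 1 + (1 + β) * |z.re| := phaseSpeed_upper hβ z.re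
  have hCη : C₂ * |z.im| ≤ C₂ * δ := by gcongr
  -- Both square roots have nonnegative real part and `m ≥ 1`, so their sum has norm at least `1`.
  have hmc : ‖speedC β z - m‖ ≤ C₂ * |z.im| := by
    have e1 : (speedC β z - m) * (speedC β z + m) = speedSq β z - ((m ^ 2 : ℝ) : ℂ) := by
      rw [← speedC_sq]; push_cast; ring
    rw [← e1, norm_mul] at hP
    refine le_trans (le_mul_of_one_le_right (norm_nonneg _) ?_) hP
    have h := Complex.re_le_norm (speedC β z + m)
    have := speedC_re_nonneg β z
    rw [Complex.add_re, Complex.ofReal_re] at h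
    linarith
  refine ⟨Or.inl ?_, ?_, ?_⟩
  · have h3 := (abs_le.1 ((Complex.abs_re_le_norm _).trans hP)).1
    rw [Complex.sub_re, Complex.ofReal_re] at h3
    nlinarith
  · have hone : 1 ≤ 1 / r ^ 2 * ‖z‖ ^ 2 := by
      rw [one_div_mul_eq_div, one_le_div (by positivity)]; gcongr
    have e : speedC β z - 1 - γ * z ^ 2 = (speedC β z - m) + ((m - 1 : ℝ) : ℂ) - γ * z ^ 2 := by
      push_cast; ring
    rw [e]
    refine (norm_sub_le _ _).trans ((add_le_add_left (norm_add_le _ _) _).trans ?_)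
    rw [Complex.norm_real, norm_mul, norm_pow, Complex.norm_real, Real.norm_of_nonneg hγ.le,
      Real.norm_of_nonneg (by linarith)]
    have h1 : (1 + β) * |z.re| ≤ (1 + β) / r * ‖z‖ ^ 2 := by
      rw [div_mul_eq_mul_div, le_div_iff₀ hr0]
      have := Complex.abs_re_le_norm z
      calc (1 + β) * |z.re| * r ≤ (1 + β) * ‖z‖ * ‖z‖ := by gcongr
        _ = _ := by ring
    have h2 : (1 / r ^ 2 + (1 + β) / r + γ) * ‖z‖ ^ 2 =
      1 / r ^ 2 * ‖z‖ ^ 2 + (1 + β) / r * ‖z‖ ^ 2 + γ * ‖z‖ ^ 2 := by ring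
    rw [h2]
    linarith
  · have h3 := (abs_le.1 ((Complex.abs_re_le_norm _).trans hmc)).1
    rw [Complex.sub_re, Complex.ofReal_re] at h3
    have h4 : q / 2 * min (z.re ^ 2) 1 ≤ q / 2 * 1 := by gcongr
    linarith

/-- The properties of the analytic continuation of `m_β` in a strip: it is analytic, close to
its Taylor polynomial, and has real part bounded below. -/
theorem speedC_strip {β : ℝ} (hβ : 1 / 3 < β) :
    ∃ δ C c : ℝ, 0 < δ ∧ 0 < C ∧ 0 < c ∧ ∀ z : ℂ, |z.im| ≤ δ →
      DifferentiableAt ℂ (speedC β) z ∧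
      ‖speedC β z - 1 - dispCoeff β * z ^ 2‖ ≤ C * ‖z‖ ^ 4 ∧
      ‖speedC β z - 1 - dispCoeff β * z ^ 2‖ ≤ C * ‖z‖ ^ 2 ∧
      1 + c * min (z.re ^ 2) 1 - C * z.im ^ 2 ≤ (speedC β z).re := by
  have hγ := dispCoeff_pos hβ
  obtain ⟨r, C₁, hr0, hr1, hC₁, h₁⟩ := speedC_near hβ
  obtain ⟨δ, K, c, hδ0, hδ1, hK, hc, h₂⟩ := speedC_far hβ hr0 hr1
  set γ := dispCoeff β with hγd
  have hKr : 0 < K / r ^ 2 := by positivity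
  refine ⟨δ, C₁ + K + K / r ^ 2 + 2 * γ, min (γ / 2) c, hδ0, by positivity, by positivity,
    fun z hz => ?_⟩
  have hn2 := sq_nonneg ‖z‖
  have hn4 : 0 ≤ ‖z‖ ^ 4 := by positivity
  have him := sq_nonneg z.im
  have hmin0 : 0 ≤ min (z.re ^ 2) 1 := le_min (sq_nonneg _) zero_le_one
  rcases le_or_gt ‖z‖ r with hzr | hzr
  · obtain ⟨hs, ht, hl⟩ := h₁ z hzr
    have h42 : ‖z‖ ^ 4 ≤ ‖z‖ ^ 2 :=
      pow_le_pow_of_le_one (norm_nonneg z) (by linarith) (by norm_num)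
    refine ⟨differentiableAt_speedC (hz.trans hδ1) hs, ht.trans ?_, ht.trans ?_, ?_⟩
    · exact mul_le_mul_of_nonneg_right (by linarith) hn4
    · exact mul_le_mul (by linarith) h42 hn4 (by linarith)
    · have h4 : min (γ / 2) c * min (z.re ^ 2) 1 ≤ γ / 2 * z.re ^ 2 :=
        mul_le_mul (min_le_left _ _) (min_le_left _ _) hmin0 (by linarith)
      have h5 : 2 * γ * z.im ^ 2 ≤ (C₁ + K + K / r ^ 2 + 2 * γ) * z.im ^ 2 :=
        mul_le_mul_of_nonneg_right (by linarith) him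
      linarith
  · obtain ⟨hs, ht, hl⟩ := h₂ z hz hzr
    refine ⟨differentiableAt_speedC (hz.trans hδ1) hs, ht.trans ?_, ht.trans ?_, ?_⟩
    · have h6 : K * ‖z‖ ^ 2 ≤ K / r ^ 2 * ‖z‖ ^ 4 := by
        rw [div_mul_eq_mul_div, le_div_iff₀ (by positivity)]
        have : r ^ 2 ≤ ‖z‖ ^ 2 := by gcongr
        calc K * ‖z‖ ^ 2 * r ^ 2 ≤ K * ‖z‖ ^ 2 * ‖z‖ ^ 2 := by gcongr
          _ = _ := by ring
      exact h6.trans (mul_le_mul_of_nonneg_right (by linarith) hn4)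
    · exact mul_le_mul_of_nonneg_right (by linarith) hn2
    · have h4 : min (γ / 2) c * min (z.re ^ 2) 1 ≤ c * min (z.re ^ 2) 1 :=
        mul_le_mul_of_nonneg_right (min_le_right _ _) hmin0
      have h5 : 0 ≤ (C₁ + K + K / r ^ 2 + 2 * γ) * z.im ^ 2 := by positivity
      linarith

/-! ### The symbol in the long-wave scaling -/

/-- The symbol `(m_β(εk) - c_ε)/ε²` of the profile equation in the long-wave variables, at the
wave number `k = 2πξ`. -/
noncomputable def scaledSymbol (β ε ξ : ℝ) : ℝ :=
  (phaseSpeed β (ε * (2 * Real.pi * ξ)) - speed β ε) / ε ^ 2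

/-- The analytic continuation of `scaledSymbol`, as a function of the complex wave number. -/
noncomputable def scaledSymbolC (β ε : ℝ) (k : ℂ) : ℂ :=
  (speedC β (ε * k) - 1) / ε ^ 2 + dispCoeff β

theorem scaledSymbolC_ofReal {β ε : ℝ} (hβ : 1 / 3 < β) (hε : 0 < ε) (ξ : ℝ) :
    scaledSymbolC β ε ((2 * Real.pi * ξ : ℝ) : ℂ) = (scaledSymbol β ε ξ : ℂ) := by
  rw [scaledSymbolC, scaledSymbol, ← Complex.ofReal_mul, speedC_ofReal hβ, speed, dispCoeff]
  have : (ε : ℂ) ≠ 0 := by exact_mod_cast hε.ne'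
  push_cast
  field_simp
  ring

theorem norm_inv_sub_inv_le {P Q : ℂ} {a b e : ℝ} (ha : 0 < a) (hb : 0 < b) (hP : a ≤ ‖P‖)
    (hQ : b ≤ ‖Q‖) (h : ‖P - Q‖ ≤ e) : ‖P⁻¹ - Q⁻¹‖ ≤ e / (a * b) := by
  have hP0 : P ≠ 0 := norm_pos_iff.1 (ha.trans_le hP)
  have hQ0 : Q ≠ 0 := norm_pos_iff.1 (hb.trans_le hQ)
  rw [inv_sub_inv hP0 hQ0, norm_div, norm_mul, norm_sub_rev]
  have : 0 ≤ e := (norm_nonneg _).trans h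
  gcongr

theorem norm_inv_sub_inv_le_add {P Q : ℂ} {a b : ℝ} (ha : 0 < a) (hb : 0 < b) (hP : a ≤ ‖P‖)
    (hQ : b ≤ ‖Q‖) : ‖P⁻¹ - Q⁻¹‖ ≤ 1 / a + 1 / b := by
  refine (norm_sub_le _ _).trans ?_
  rw [norm_inv, norm_inv, one_div, one_div]
  gcongr

/-- Comparison of the inverses of a symbol `P` close to `Q` for `ε|x| ≤ 1`, both large for
`ε|x| ≥ 1`. -/
theorem norm_inv_sub_inv_le_sq {P Q : ℂ} {c γ C ε x : ℝ} (hc : 0 < c) (hγ : 0 < γ) (hC : 0 ≤ C)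
    (hε : 0 < ε) (hP : γ + c * min (x ^ 2) (1 / ε ^ 2) ≤ P.re) (hQ : γ * (1 + x ^ 2) ≤ Q.re)
    (h : ‖P - Q‖ ≤ C * ε ^ 2 * (1 + x ^ 2) ^ 2) :
    ‖P⁻¹ - Q⁻¹‖ ≤ (C / (min γ c * γ) + 1 / c + 1 / γ) * ε ^ 2 := by
  have hP' := hP.trans (Complex.re_le_norm P)
  have hQ' := hQ.trans (Complex.re_le_norm Q)
  have hx := sq_nonneg x
  -- For `ε|x| ≤ 1` subtract the symbols; for `ε|x| > 1` both inverses are themselves `O(ε²)`.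
  rcases le_or_gt (x ^ 2) (1 / ε ^ 2) with h1 | h1
  · rw [min_eq_left h1] at hP'
    have h2 : min γ c * (1 + x ^ 2) ≤ ‖P‖ := by
      refine le_trans ?_ hP'
      rw [mul_add, mul_one]
      exact add_le_add (min_le_left _ _) (mul_le_mul_of_nonneg_right (min_le_right _ _) hx)
    refine (norm_inv_sub_inv_le (by positivity) (by positivity) h2 hQ' h).trans ?_
    have e : C * ε ^ 2 * (1 + x ^ 2) ^ 2 / (min γ c * (1 + x ^ 2) * (γ * (1 + x ^ 2))) =
        C / (min γ c * γ) * ε ^ 2 := by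
      have : 0 < min γ c := by positivity
      field_simp
    rw [e]
    exact mul_le_mul_of_nonneg_right (by linarith [one_div_pos.2 hc, one_div_pos.2 hγ])
      (sq_nonneg ε)
  · rw [min_eq_right h1.le] at hP'
    have h2 : c * (1 / ε ^ 2) ≤ ‖P‖ := by linarith
    have h3 : γ * (1 / ε ^ 2) ≤ ‖Q‖ := le_trans (by gcongr; linarith) hQ'
    refine (norm_inv_sub_inv_le_add (by positivity) (by positivity) h2 h3).trans ?_
    have e : 1 / (c * (1 / ε ^ 2)) + 1 / (γ * (1 / ε ^ 2)) = (1 / c + 1 / γ) * ε ^ 2 := by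
      field_simp
    rw [e]
    have : 0 ≤ C / (min γ c * γ) := by positivity
    exact mul_le_mul_of_nonneg_right (by linarith) (sq_nonneg ε)

theorem scaledSymbolC_eq {β ε : ℝ} (hε : 0 < ε) (k : ℂ) :
    scaledSymbolC β ε k - dispCoeff β * (1 + k ^ 2) =
      (speedC β (ε * k) - 1 - dispCoeff β * (ε * k) ^ 2) / ε ^ 2 := by
  have : (ε : ℂ) ≠ 0 := by exact_mod_cast hε.ne'
  rw [scaledSymbolC]
  field_simp
  ring

/-- Properties of the scaled symbol in a strip of fixed width. -/
theorem scaledSymbolC_strip {β : ℝ} (hβ : 1 / 3 < β) :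
    ∃ ε₁ C c : ℝ, 0 < ε₁ ∧ 0 < C ∧ 0 < c ∧ ∀ ε : ℝ, 0 < ε → ∀ k : ℂ,
      (|k.im| ≤ 2 ∧ ε ≤ ε₁ ∨ k.im = 0) →
      DifferentiableAt ℂ (scaledSymbolC β ε) k ∧
      ‖scaledSymbolC β ε k - dispCoeff β * (1 + k ^ 2)‖ ≤ C * ε ^ 2 * ‖k‖ ^ 4 ∧
      dispCoeff β + c * min (k.re ^ 2) (1 / ε ^ 2) - C * k.im ^ 2 ≤ (scaledSymbolC β ε k).re := by
  obtain ⟨δ, C, c, hδ, hC, hc, h⟩ := speedC_strip hβ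
  refine ⟨δ / 2, C, c, by positivity, hC, hc, fun ε hε k hk => ?_⟩
  have him : |((ε : ℂ) * k).im| ≤ δ := by
    rw [Complex.im_ofReal_mul, abs_mul, abs_of_pos hε]
    rcases hk with ⟨h1, h2⟩ | h1
    · calc ε * |k.im| ≤ δ / 2 * 2 := by gcongr
        _ = δ := by ring
    · simp [h1, hδ.le]
  obtain ⟨h1, h2, -, h3⟩ := h _ him
  refine ⟨?_, ?_, ?_⟩
  · unfold scaledSymbolC
    refine ((DifferentiableAt.sub_const ?_ _).div_const _).add_const _
    exact DifferentiableAt.comp k h1 (by fun_prop)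
  · rw [scaledSymbolC_eq hε, norm_div, norm_pow, Complex.norm_real, Real.norm_of_nonneg hε.le,
      div_le_iff₀ (by positivity)]
    refine h2.trans (le_of_eq ?_)
    rw [norm_mul, Complex.norm_real, Real.norm_of_nonneg hε.le]
    ring
  · have e : (scaledSymbolC β ε k).re = ((speedC β (ε * k)).re - 1) / ε ^ 2 + dispCoeff β := by
      rw [scaledSymbolC, ← Complex.ofReal_pow, Complex.add_re, Complex.div_ofReal_re,
        Complex.sub_re]
      simp
    rw [e, Complex.re_ofReal_mul, Complex.im_ofReal_mul] at *
    have h4 : c * min (k.re ^ 2) (1 / ε ^ 2) - C * k.im ^ 2 =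
        (c * min ((ε * k.re) ^ 2) 1 - C * (ε * k.im) ^ 2) / ε ^ 2 := by
      have : min ((ε * k.re) ^ 2) 1 = ε ^ 2 * min (k.re ^ 2) (1 / ε ^ 2) := by
        rw [mul_min_of_nonneg _ _ (sq_nonneg ε)]
        congr 1
        · ring
        · field_simp
      rw [this]
      field_simp
    have h5 : (c * min ((ε * k.re) ^ 2) 1 - C * (ε * k.im) ^ 2) / ε ^ 2 ≤
        ((speedC β (ε * k)).re - 1) / ε ^ 2 := by
      exact div_le_div_of_nonneg_right (by linarith) (sq_nonneg ε)
    linarith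

/-- The real symbol: positivity, growth of order `1/2`, and convergence of its inverse to the inverse
of the limiting symbol `γ(1 + k²)`. -/
theorem scaledSymbol_bounds {β : ℝ} (hβ : 1 / 3 < β) :
    ∃ C : ℝ, 0 < C ∧ ∀ ε : ℝ, 0 < ε → ε ≤ 1 → ∀ ξ : ℝ,
      dispCoeff β ≤ scaledSymbol β ε ξ ∧
      (scaledSymbol β ε ξ)⁻¹ ≤ C * bracket ξ ^ (-(1 / 2) : ℝ) ∧
      |(scaledSymbol β ε ξ)⁻¹ - (dispCoeff β * bracket ξ ^ 2)⁻¹| ≤ C * ε ^ 2 := by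
  obtain ⟨ε₁, C, c, -, hC, hc, h⟩ := scaledSymbolC_strip hβ
  have hγ := dispCoeff_pos hβ
  set γ := dispCoeff β with hγd
  set q := min (min γ (c / 256)) (1 / 8) with hq
  have hq0 : 0 < q := by positivity
  refine ⟨max (1 / q) (C / (min γ c * γ) + 1 / c + 1 / γ), by positivity,
    fun ε hε hε1 ξ => ?_⟩
  set K := 2 * Real.pi * ξ with hK
  obtain ⟨-, h2, h3⟩ := h ε hε (K : ℂ) (Or.inr (Complex.ofReal_im _))
  rw [scaledSymbolC_ofReal hβ hε] at h2 h3
  set ℓ := scaledSymbol β ε ξ with hℓ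
  rw [Complex.ofReal_re, Complex.ofReal_re, Complex.ofReal_im] at h3
  have h3' : γ + c * min (K ^ 2) (1 / ε ^ 2) ≤ ℓ := by linarith
  have hmin : 0 ≤ min (K ^ 2) (1 / ε ^ 2) := by positivity
  have hℓγ : γ ≤ ℓ := by nlinarith
  have hb := one_le_bracket ξ
  have hb2 : bracket ξ ^ 2 = 1 + K ^ 2 := bracket_sq ξ
  refine ⟨hℓγ, ?_, ?_⟩
  · have key : q * bracket ξ ^ (1 / 2 : ℝ) ≤ ℓ := by
      -- For `ε|K| ≤ 16` the quadratic lower bound suffices. For `ε|K| > 16` the growth of `m_β` gives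
      -- `m_β ≥ 2 ≥ 2c`, whence `m_β - c ≥ m_β/2`.
      rcases le_or_gt (ε * |K|) 16 with h16 | h16
      · have h4 : K ^ 2 / 256 ≤ min (K ^ 2) (1 / ε ^ 2) := by
          refine le_min (by nlinarith [sq_nonneg K]) ?_
          rw [div_le_div_iff₀ (by norm_num) (by positivity)]
          have : (ε * |K|) ^ 2 ≤ 16 ^ 2 := by gcongr
          rw [mul_pow, sq_abs] at this
          linarith
        have h5 : bracket ξ ^ (1 / 2 : ℝ) ≤ bracket ξ ^ 2 := by
          rw [← Real.rpow_natCast]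
          exact Real.rpow_le_rpow_of_exponent_le hb (by norm_num)
        have q1 : q ≤ γ := (min_le_left _ _).trans (min_le_left _ _)
        have q2 : q ≤ c / 256 := (min_le_left _ _).trans (min_le_right _ _)
        calc q * bracket ξ ^ (1 / 2 : ℝ) ≤ q * (1 + K ^ 2) := by rw [← hb2]; gcongr
          _ = q + q * K ^ 2 := by ring
          _ ≤ γ + c / 256 * K ^ 2 := by gcongr
          _ = γ + c * (K ^ 2 / 256) := by ring
          _ ≤ γ + c * min (K ^ 2) (1 / ε ^ 2) := by gcongr
          _ ≤ ℓ := h3'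
      · have hgr := phaseSpeed_growth hβ (k := ε * K) (by
          rw [abs_mul, abs_of_pos hε]; linarith)
        rw [abs_mul, abs_of_pos hε] at hgr
        have hK16 : 16 ≤ |K| := by nlinarith [abs_nonneg K]
        set S := Real.sqrt (ε * |K| / 4) with hS
        have hS2 : 2 ≤ S := Real.le_sqrt_of_sq_le (by linarith)
        have hℓ' : S / 2 / ε ^ 2 ≤ ℓ := by
          rw [hℓ, scaledSymbol]
          gcongr
          have : speed β ε ≤ 1 := by
            have : speed β ε = 1 - γ * ε ^ 2 := by rw [speed, hγd, dispCoeff]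
            rw [this]; nlinarith [sq_nonneg ε]
          linarith
        have hS3 : ε ^ 2 * Real.sqrt (|K| / 4) ≤ S := by
          refine Real.le_sqrt_of_sq_le ?_
          rw [mul_pow, Real.sq_sqrt (by positivity), mul_div_assoc]
          have : (ε ^ 2) ^ 2 ≤ ε := by
            rw [← pow_mul]
            exact (pow_le_of_le_one hε.le hε1 (by norm_num))
          gcongr
        have hb3 : bracket ξ ^ (1 / 2 : ℝ) ≤ 4 * Real.sqrt (|K| / 4) := by
          rw [← Real.sqrt_eq_rpow]
          refine Real.sqrt_le_left (by positivity) |>.2 ?_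
          rw [mul_pow, Real.sq_sqrt (by positivity)]
          nlinarith [sq_abs K]
        calc q * bracket ξ ^ (1 / 2 : ℝ) ≤ 1 / 8 * (4 * Real.sqrt (|K| / 4)) := by
              gcongr; exact min_le_right _ _
          _ = Real.sqrt (|K| / 4) / 2 := by ring
          _ = (ε ^ 2 * Real.sqrt (|K| / 4)) / 2 / ε ^ 2 := by field_simp
          _ ≤ S / 2 / ε ^ 2 := by gcongr
          _ ≤ ℓ := hℓ'
    have hbr : 0 < bracket ξ ^ (1 / 2 : ℝ) := Real.rpow_pos_of_pos (bracket_pos ξ) _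
    rw [Real.rpow_neg (bracket_pos ξ).le]
    calc ℓ⁻¹ ≤ (q * bracket ξ ^ (1 / 2 : ℝ))⁻¹ := by gcongr
      _ = 1 / q * (bracket ξ ^ (1 / 2 : ℝ))⁻¹ := by rw [mul_inv, one_div q]
      _ ≤ _ := by gcongr; exact le_max_left _ _
  · have e : ((γ * bracket ξ ^ 2 : ℝ) : ℂ) = (γ : ℂ) * (1 + (K : ℂ) ^ 2) := by
      rw [hb2]; push_cast; ring
    have := norm_inv_sub_inv_le_sq (P := (ℓ : ℂ)) (Q := ((γ * bracket ξ ^ 2 : ℝ) : ℂ)) (x := K)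
      hc hγ hC.le hε (by simpa using h3') (by rw [Complex.ofReal_re, hb2]) (by
        rw [e]
        refine h2.trans ?_
        rw [Complex.norm_real]
        have : ‖K‖ ^ 4 ≤ (1 + K ^ 2) ^ 2 := by
          rw [Real.norm_eq_abs, show |K| ^ 4 = (|K| ^ 2) ^ 2 by ring, sq_abs]
          nlinarith [sq_nonneg K]
        gcongr)
    rw [← Complex.ofReal_inv, ← Complex.ofReal_inv, ← Complex.ofReal_sub, Complex.norm_real,
      Real.norm_eq_abs] at this
    exact this.trans (mul_le_mul_of_nonneg_right (le_max_right _ _) (sq_nonneg ε))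

/-- The difference of the shifted resolvents is analytic and `O(ε²)` in the strip `|Im k| ≤ 2`. The
limiting symbol `γ(1 + k²)` vanishes at `±i`; the shift `A` makes the real parts of both symbols
positive in the whole strip. The bound `8γ ≤ A` keeps the zeros of `γ(1 + k²) + A` away from it. -/
theorem resolvent_strip {β : ℝ} (hβ : 1 / 3 < β) :
    ∃ ε₁ A C : ℝ, 0 < ε₁ ∧ 0 < A ∧ 0 < C ∧ 8 * dispCoeff β ≤ A ∧ ∀ ε : ℝ, 0 < ε → ε ≤ ε₁ →
      ∀ k : ℂ, |k.im| ≤ 2 →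
      DifferentiableAt ℂ (fun k => (scaledSymbolC β ε k + A)⁻¹ -
        (dispCoeff β * (1 + k ^ 2) + A)⁻¹) k ∧
      ‖(scaledSymbolC β ε k + A)⁻¹ - (dispCoeff β * (1 + k ^ 2) + A)⁻¹‖ ≤ C * ε ^ 2 := by
  obtain ⟨ε₁, C, c, hε₁, hC, hc, h⟩ := scaledSymbolC_strip hβ
  have hγ := dispCoeff_pos hβ
  set γ := dispCoeff β with hγd
  refine ⟨ε₁, 4 * C + 8 * γ, (16 * C) / (min γ c * γ) + 1 / c + 1 / γ, hε₁, by positivity,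
    by positivity, by linarith, fun ε hε hε1 k hk => ?_⟩
  obtain ⟨h1, h2, h3⟩ := h ε hε k (Or.inl ⟨hk, hε1⟩)
  have him : k.im ^ 2 ≤ 4 := by rw [← sq_abs]; nlinarith [abs_nonneg k.im]
  have hre := sq_nonneg k.re
  have hmin : 0 ≤ c * min (k.re ^ 2) (1 / ε ^ 2) := by positivity
  have hP : γ + c * min (k.re ^ 2) (1 / ε ^ 2) ≤
      (scaledSymbolC β ε k + ((4 * C + 8 * γ : ℝ) : ℂ)).re := by
    rw [Complex.add_re, Complex.ofReal_re]
    nlinarith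
  have hQe : ((γ : ℂ) * (1 + k ^ 2) + ((4 * C + 8 * γ : ℝ) : ℂ)).re =
      γ * (1 + (k.re ^ 2 - k.im ^ 2)) + (4 * C + 8 * γ) := by
    rw [Complex.add_re, Complex.ofReal_re, Complex.re_ofReal_mul, Complex.add_re, sq k,
      Complex.mul_re, Complex.one_re]
    ring
  have hQ : γ * (1 + k.re ^ 2) ≤ ((γ : ℂ) * (1 + k ^ 2) + ((4 * C + 8 * γ : ℝ) : ℂ)).re := by
    rw [hQe]; nlinarith
  have hP0 : scaledSymbolC β ε k + ((4 * C + 8 * γ : ℝ) : ℂ) ≠ 0 := fun h0 => by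
    rw [h0, Complex.zero_re] at hP; linarith
  have hQ0 : (γ : ℂ) * (1 + k ^ 2) + ((4 * C + 8 * γ : ℝ) : ℂ) ≠ 0 := fun h0 => by
    rw [h0, Complex.zero_re] at hQ; nlinarith
  refine ⟨((h1.add_const _).inv hP0).sub (DifferentiableAt.inv (by fun_prop) hQ0), ?_⟩
  refine norm_inv_sub_inv_le_sq (x := k.re) hc hγ (by positivity) hε hP hQ ?_
  rw [add_sub_add_right_eq_sub]
  refine h2.trans ?_
  have hn : ‖k‖ ^ 2 ≤ 4 * (1 + k.re ^ 2) := by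
    rw [Complex.sq_norm, Complex.normSq_apply]; nlinarith
  calc C * ε ^ 2 * ‖k‖ ^ 4 = C * ε ^ 2 * (‖k‖ ^ 2) ^ 2 := by ring
    _ ≤ C * ε ^ 2 * (4 * (1 + k.re ^ 2)) ^ 2 := by gcongr
    _ = _ := by ring

/-! ### The soliton and the linearised Korteweg-de Vries operator -/

/-- The function `sech²(x/2)`. -/
noncomputable def sechSq (x : ℝ) : ℝ := sech (x / 2) ^ 2

/-- The function `tanh(x/2)`. -/
noncomputable def tanhHalf (x : ℝ) : ℝ := Real.tanh (x / 2)

theorem sechSq_eq (x : ℝ) : sechSq x = 1 - tanhHalf x ^ 2 := by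
  have h := Real.cosh_pos (x / 2)
  have h2 := Real.cosh_sq (x / 2)
  rw [sechSq, tanhHalf, sech, Real.tanh_eq_sinh_div_cosh]
  field_simp
  linarith

theorem tanhHalf_sq (x : ℝ) : tanhHalf x ^ 2 = 1 - sechSq x := by rw [sechSq_eq]; ring

theorem sechSq_pos (x : ℝ) : 0 < sechSq x := by
  have h := Real.cosh_pos (x / 2)
  rw [sechSq, sech]; positivity

theorem sechSq_le_one (x : ℝ) : sechSq x ≤ 1 := by
  rw [sechSq_eq]; linarith [sq_nonneg (tanhHalf x)]

theorem abs_tanhHalf_le (x : ℝ) : |tanhHalf x| ≤ 1 := by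
  rw [← sq_le_one_iff_abs_le_one, tanhHalf_sq]; linarith [sechSq_pos x]

theorem sechSq_le_exp (x : ℝ) : sechSq x ≤ 4 * Real.exp (-|x|) := by
  have h := Real.cosh_pos (x / 2)
  have h1 : Real.exp (|x| / 2) ≤ 2 * Real.cosh (x / 2) := by
    rw [← Real.cosh_abs, abs_div, abs_two, Real.cosh_eq]
    linarith [Real.exp_pos (-(|x| / 2))]
  have h2 : Real.exp |x| ≤ 4 * Real.cosh (x / 2) ^ 2 := by
    calc Real.exp |x| = Real.exp (|x| / 2) ^ 2 := by rw [← Real.exp_nat_mul]; congr 1; push_cast; ring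
      _ ≤ (2 * Real.cosh (x / 2)) ^ 2 := by gcongr
      _ = _ := by ring
  rw [sechSq, sech, Real.exp_neg, div_pow, one_pow, ← div_eq_mul_inv,
    div_le_div_iff₀ (by positivity) (Real.exp_pos _)]
  linarith

@[simp] theorem sechSq_neg (x : ℝ) : sechSq (-x) = sechSq x := by
  simp [sechSq, sech, neg_div]

theorem hasDerivAt_tanhHalf (x : ℝ) : HasDerivAt tanhHalf (sechSq x / 2) x := by
  have h := Real.cosh_pos (x / 2)
  have e : tanhHalf = fun x => Real.sinh (x / 2) / Real.cosh (x / 2) := by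
    ext y; rw [tanhHalf, Real.tanh_eq_sinh_div_cosh]
  have hd : HasDerivAt (fun x : ℝ => x / 2) (1 / 2) x := (hasDerivAt_id x).div_const 2
  rw [e]
  refine HasDerivAt.congr_deriv (hd.sinh.div hd.cosh h.ne') ?_
  rw [sechSq, sech]
  have := Real.cosh_sq (x / 2)
  field_simp
  linarith

theorem hasDerivAt_sechSq (x : ℝ) : HasDerivAt sechSq (-(tanhHalf x * sechSq x)) x := by
  have e : sechSq = fun x => 1 - tanhHalf x ^ 2 := by ext y; exact sechSq_eq y
  have h : HasDerivAt (fun x => 1 - tanhHalf x ^ 2) (-(tanhHalf x * sechSq x)) x :=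
    HasDerivAt.congr_deriv (((hasDerivAt_tanhHalf x).pow 2).const_sub 1) (by simp; ring)
  rwa [← e] at h

@[fun_prop] theorem continuous_tanhHalf : Continuous tanhHalf :=
  continuous_iff_continuousAt.2 fun x => (hasDerivAt_tanhHalf x).continuousAt

@[fun_prop] theorem continuous_sechSq : Continuous sechSq :=
  continuous_iff_continuousAt.2 fun x => (hasDerivAt_sechSq x).continuousAt

/-- The odd solution `-s'` of `y'' = (1 - 3s) y`, where `s = sech²(x/2)`. -/
noncomputable def oddSol (x : ℝ) : ℝ := sechSq x * tanhHalf x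

/-- The derivative of `oddSol`. -/
noncomputable def oddSol' (x : ℝ) : ℝ := sechSq x * (3 / 2 * sechSq x - 1)

theorem hasDerivAt_oddSol (x : ℝ) : HasDerivAt oddSol (oddSol' x) x := by
  refine HasDerivAt.congr_deriv ((hasDerivAt_sechSq x).mul (hasDerivAt_tanhHalf x)) ?_
  have := tanhHalf_sq x
  rw [oddSol']
  linear_combination (-sechSq x) * this

theorem hasDerivAt_oddSol' (x : ℝ) :
    HasDerivAt oddSol' ((1 - 3 * sechSq x) * oddSol x) x := by
  refine HasDerivAt.congr_deriv ((hasDerivAt_sechSq x).mul (((hasDerivAt_sechSq x).const_mul (3 / 2)).sub_const 1)) ?_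
  rw [oddSol]
  ring

@[fun_prop] theorem continuous_oddSol : Continuous oddSol := by unfold oddSol; fun_prop

@[fun_prop] theorem continuous_oddSol' : Continuous oddSol' := by unfold oddSol'; fun_prop

theorem abs_oddSol_le (x : ℝ) : |oddSol x| ≤ 4 * Real.exp (-|x|) := by
  rw [oddSol, abs_mul, abs_of_pos (sechSq_pos x)]
  exact (mul_le_of_le_one_right (sechSq_pos x).le (abs_tanhHalf_le x)).trans (sechSq_le_exp x)

theorem abs_oddSol'_le (x : ℝ) : |oddSol' x| ≤ 4 * Real.exp (-|x|) := by
  rw [oddSol', abs_mul, abs_of_pos (sechSq_pos x)]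
  refine (mul_le_of_le_one_right (sechSq_pos x).le ?_).trans (sechSq_le_exp x)
  rw [abs_le]
  constructor <;> linarith [sechSq_pos x, sechSq_le_one x]

/-- The even solution of `y'' = (1 - 3s) y`, which grows like `e^{|x|}`; it is found from `oddSol` by
reduction of order. -/
noncomputable def evenSol (x : ℝ) : ℝ :=
  -sechSq x + 15 / 16 * (x * oddSol x) + 7 / 8 * tanhHalf x ^ 2 + 1 / 4 * Real.sinh (x / 2) ^ 2

/-- The derivative of `evenSol`. -/
noncomputable def evenSol' (x : ℝ) : ℝ :=
  45 / 16 * oddSol x + 15 / 16 * (x * oddSol' x) +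
    1 / 4 * (Real.sinh (x / 2) * Real.cosh (x / 2))

theorem hasDerivAt_evenSol (x : ℝ) : HasDerivAt evenSol (evenSol' x) x := by
  have hd : HasDerivAt (fun x : ℝ => x / 2) (1 / 2) x := (hasDerivAt_id x).div_const 2
  refine HasDerivAt.congr_deriv ((((hasDerivAt_sechSq x).neg.add
    (((hasDerivAt_id x).mul (hasDerivAt_oddSol x)).const_mul (15 / 16))).add
    (((hasDerivAt_tanhHalf x).pow 2).const_mul (7 / 8))).add ((hd.sinh.pow 2).const_mul (1 / 4))) ?_
  simp only [evenSol', id, oddSol]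
  ring

theorem sechSq_mul_sinh_sq (x : ℝ) : sechSq x * Real.sinh (x / 2) ^ 2 = 1 - sechSq x := by
  have h := Real.cosh_pos (x / 2)
  rw [← tanhHalf_sq, tanhHalf, Real.tanh_eq_sinh_div_cosh, sechSq, sech]
  field_simp

theorem oddSol_mul_sinh_cosh (x : ℝ) :
    oddSol x * (Real.sinh (x / 2) * Real.cosh (x / 2)) = 1 - sechSq x := by
  have h := Real.cosh_pos (x / 2)
  rw [← tanhHalf_sq, oddSol, tanhHalf, Real.tanh_eq_sinh_div_cosh, sechSq, sech]
  field_simp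

theorem hasDerivAt_evenSol' (x : ℝ) :
    HasDerivAt evenSol' ((1 - 3 * sechSq x) * evenSol x) x := by
  have hd : HasDerivAt (fun x : ℝ => x / 2) (1 / 2) x := (hasDerivAt_id x).div_const 2
  refine HasDerivAt.congr_deriv ((((hasDerivAt_oddSol x).const_mul (45 / 16)).add
    (((hasDerivAt_id x).mul (hasDerivAt_oddSol' x)).const_mul (15 / 16))).add
    ((hd.sinh.mul hd.cosh).const_mul (1 / 4))) ?_
  have h1 := sechSq_mul_sinh_sq x
  have h2 := tanhHalf_sq x
  have h3 := Real.cosh_sq (x / 2)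
  simp only [evenSol, id, oddSol']
  linear_combination (3 / 4) * h1 - (7 / 8 * (1 - 3 * sechSq x)) * h2 + 1 / 8 * h3

/-- The Wronskian of the two solutions is constant, so they span all solutions of `y'' = (1 - 3s) y`. -/
theorem wronskian_oddSol_evenSol (x : ℝ) :
    oddSol x * evenSol' x - oddSol' x * evenSol x = 1 / 2 := by
  have h1 := sechSq_mul_sinh_sq x
  have h2 := tanhHalf_sq x
  have h4 := oddSol_mul_sinh_cosh x
  have h5 : oddSol x ^ 2 = sechSq x ^ 2 * (1 - sechSq x) := by rw [oddSol, mul_pow, h2]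
  simp only [evenSol, evenSol', oddSol']
  linear_combination 1 / 4 * h4 + 45 / 16 * h5 - (7 / 8 * (sechSq x * (3 / 2 * sechSq x - 1))) * h2
    - (1 / 4 * (3 / 2 * sechSq x - 1)) * h1

theorem abs_evenSol_le (x : ℝ) : |evenSol x| ≤ 4 * Real.exp |x| := by
  have h0 := abs_nonneg x
  have h1 := Real.add_one_le_exp |x|
  have hs := sechSq_le_one x
  have hs0 := sechSq_pos x
  have a1 : |x * oddSol x| ≤ Real.exp |x| := by
    rw [abs_mul, oddSol, abs_mul, abs_of_pos hs0]
    calc |x| * (sechSq x * |tanhHalf x|) ≤ |x| * (1 * 1) := by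
          gcongr; exact abs_tanhHalf_le x
      _ ≤ _ := by linarith
  have a2 : Real.sinh (x / 2) ^ 2 ≤ Real.exp |x| := by
    have : |Real.sinh (x / 2)| ≤ Real.exp (|x| / 2) := by
      rw [Real.abs_sinh, abs_div, abs_two, Real.sinh_eq]
      linarith [Real.exp_pos (-(|x| / 2)), Real.exp_pos (|x| / 2)]
    calc Real.sinh (x / 2) ^ 2 = |Real.sinh (x / 2)| ^ 2 := (sq_abs _).symm
      _ ≤ Real.exp (|x| / 2) ^ 2 := by gcongr
      _ = _ := by rw [← Real.exp_nat_mul]; congr 1; push_cast; ring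
  have a3 := tanhHalf_sq x
  have a4 := abs_le.1 a1
  have a5 := sq_nonneg (tanhHalf x)
  have a6 := sq_nonneg (Real.sinh (x / 2))
  rw [evenSol, abs_le]
  constructor <;> linarith

theorem evenSol'_zero : evenSol' 0 = 0 := by simp [evenSol', oddSol, tanhHalf]

@[fun_prop] theorem continuous_evenSol : Continuous evenSol :=
  continuous_iff_continuousAt.2 fun x => (hasDerivAt_evenSol x).continuousAt

theorem integrable_exp_neg_abs : Integrable fun t : ℝ => Real.exp (-|t|) :=
  (integrable_inv_one_add_sq.const_mul 2).mono' (by fun_prop) (Eventually.of_forall fun t => by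
    have h := Real.quadratic_le_exp_of_nonneg (abs_nonneg t)
    rw [sq_abs] at h
    rw [Real.norm_of_nonneg (Real.exp_pos _).le, Real.exp_neg, ← div_eq_mul_inv,
      inv_le_comm₀ (Real.exp_pos _) (by positivity), inv_div]
    linarith [abs_nonneg t])

theorem lintegral_exp_neg_abs : ∫⁻ t : ℝ, ENNReal.ofReal (Real.exp (-|t|)) = 2 := by
  rw [← ofReal_integral_eq_lintegral_ofReal integrable_exp_neg_abs
    (Eventually.of_forall fun t => (Real.exp_pos _).le),
    integral_comp_abs (f := fun t => Real.exp (-t)), integral_exp_neg_Ioi_zero]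
  norm_num

/-- Variation of parameters: the pointwise bound for even bounded solutions of the linearised
equation `z - z'' - 3 s z = g`. The product of `oddSol` at the larger and `evenSol` at the smaller
argument is `O(e^{-|x - y|})`. -/
theorem enorm_le_of_linearized {z z' g : ℝ → ℝ} {B : ℝ}
    (hz : ∀ x, HasDerivAt z (z' x) x)
    (hz' : ∀ x, HasDerivAt z' ((1 - 3 * sechSq x) * z x - g x) x) (hg : Continuous g)
    (bz : ∀ x, |z x| ≤ B) (bz' : ∀ x, |z' x| ≤ B) (bg : ∀ x, |g x| ≤ B)
    (ez : ∀ x, z (-x) = z x) (x : ℝ) (hx : 0 ≤ x) :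
    ‖z x‖ₑ ≤ 32 * ∫⁻ y, ENNReal.ofReal (Real.exp (-|x - y|)) * ‖g y‖ₑ := by
  have hB : 0 ≤ B := (abs_nonneg _).trans (bz 0)
  have cz : Continuous z := continuous_iff_continuousAt.2 fun x => (hz x).continuousAt
  have d1 : ∀ y, HasDerivAt (fun y => z' y * oddSol y - z y * oddSol' y) (-(g y * oddSol y)) y :=
    fun y => by
      refine HasDerivAt.congr_deriv (((hz' y).mul (hasDerivAt_oddSol y)).sub ((hz y).mul (hasDerivAt_oddSol' y))) ?_
      ring
  have d2 : ∀ y, HasDerivAt (fun y => z' y * evenSol y - z y * evenSol' y) (-(g y * evenSol y)) y :=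
    fun y => by
      refine HasDerivAt.congr_deriv (((hz' y).mul (hasDerivAt_evenSol y)).sub ((hz y).mul (hasDerivAt_evenSol' y))) ?_
      ring
  have lim : Tendsto (fun y => z' y * oddSol y - z y * oddSol' y) atTop (𝓝 0) := by
    refine squeeze_zero_norm' (a := fun y => 8 * B * Real.exp (-y)) ?_ ?_
    · filter_upwards [eventually_ge_atTop 0] with y hy
      have h1 := abs_oddSol_le y
      have h2 := abs_oddSol'_le y
      rw [abs_of_nonneg hy] at h1 h2
      refine (norm_sub_le _ _).trans ?_
      rw [norm_mul, norm_mul]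
      calc ‖z' y‖ * ‖oddSol y‖ + ‖z y‖ * ‖oddSol' y‖
          ≤ B * (4 * Real.exp (-y)) + B * (4 * Real.exp (-y)) := by
            gcongr
            · exact bz' y
            · exact h1
            · exact bz y
            · exact h2
        _ = _ := by ring
    · simpa using Real.tendsto_exp_neg_atTop_nhds_zero.const_mul (8 * B)
  have hint : IntegrableOn (fun y => -(g y * oddSol y)) (Set.Ioi x) := by
    refine Integrable.integrableOn (Integrable.mono' (integrable_exp_neg_abs.const_mul (4 * B))
      (by fun_prop) (Eventually.of_forall fun y => ?_))
    rw [norm_neg, norm_mul]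
    calc ‖g y‖ * ‖oddSol y‖ ≤ B * (4 * Real.exp (-|y|)) := by
          gcongr
          · exact bg y
          · exact abs_oddSol_le y
      _ = _ := by ring
  -- The Wronskian with `oddSol` vanishes at infinity, the one with `evenSol` at the origin (since `z` is
  -- even). Integrating both and eliminating the derivative of `z` gives the solution formula `key`.
  have w1 : z' x * oddSol x - z x * oddSol' x = ∫ y in Set.Ioi x, g y * oddSol y := by
    have := integral_Ioi_of_hasDerivAt_of_tendsto' (fun y _ => d1 y) hint lim
    rw [integral_neg] at this
    linarith
  have z0 : z' 0 = 0 := by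
    have h1 : HasDerivAt (fun y => z (-y)) (-(z' 0)) 0 := by
      have := HasDerivAt.scomp (0 : ℝ) (h := fun y : ℝ => -y) (h' := -1)
        (by simpa using hz (-0)) (hasDerivAt_neg 0)
      simpa [Function.comp_def] using this
    simp only [ez] at h1
    have := h1.unique (hz 0)
    linarith
  have w2 : z' x * evenSol x - z x * evenSol' x = -∫ y in Set.Ioc 0 x, g y * evenSol y := by
    have h1 := intervalIntegral.integral_eq_sub_of_hasDerivAt (a := 0) (b := x)
      (fun y _ => d2 y) (Continuous.intervalIntegrable (by fun_prop) _ _)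
    rw [z0, evenSol'_zero, intervalIntegral.integral_of_le hx, integral_neg] at h1
    linarith
  have key : z x = 2 * ((∫ y in Set.Ioi x, g y * oddSol y) * evenSol x) +
      2 * ((∫ y in Set.Ioc 0 x, g y * evenSol y) * oddSol x) := by
    rw [← w1, ← neg_eq_iff_eq_neg.2 w2]
    linear_combination (-2 * z x) * wronskian_oddSol_evenSol x
  have en : ∀ r c : ℝ, |r| ≤ c → ‖r‖ₑ ≤ ENNReal.ofReal c := fun r c h => by
    rw [← ofReal_norm]; exact ENNReal.ofReal_le_ofReal h
  have b1 : ‖(∫ y in Set.Ioi x, g y * oddSol y) * evenSol x‖ₑ ≤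
      ∫⁻ y in Set.Ioi x, 16 * (ENNReal.ofReal (Real.exp (-|x - y|)) * ‖g y‖ₑ) := by
    rw [← integral_mul_const]
    refine (enorm_integral_le_lintegral_enorm _).trans
      (setLIntegral_mono (by fun_prop) fun y hy => ?_)
    have hy' : x < y := hy
    rw [mul_assoc, enorm_mul, mul_comm, ← mul_assoc]
    gcongr
    refine (en _ (16 * Real.exp (-|x - y|)) ?_).trans (le_of_eq ?_)
    · rw [abs_mul]
      refine (mul_le_mul (abs_oddSol_le y) (abs_evenSol_le x) (abs_nonneg _)
        (by positivity)).trans (le_of_eq ?_)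
      rw [show 4 * Real.exp (-|y|) * (4 * Real.exp |x|) =
        16 * (Real.exp (-|y|) * Real.exp |x|) by ring, ← Real.exp_add,
        abs_of_nonneg hx, abs_of_nonneg (hx.trans hy'.le), abs_of_nonpos (by linarith)]
      congr 2; ring
    · rw [ENNReal.ofReal_mul (by norm_num)]; norm_num
  have b2 : ‖(∫ y in Set.Ioc 0 x, g y * evenSol y) * oddSol x‖ₑ ≤
      ∫⁻ y in Set.Ioc 0 x, 16 * (ENNReal.ofReal (Real.exp (-|x - y|)) * ‖g y‖ₑ) := by
    rw [← integral_mul_const]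
    refine (enorm_integral_le_lintegral_enorm _).trans
      (setLIntegral_mono (by fun_prop) fun y hy => ?_)
    rw [mul_assoc, enorm_mul, mul_comm, ← mul_assoc]
    gcongr
    refine (en _ (16 * Real.exp (-|x - y|)) ?_).trans (le_of_eq ?_)
    · rw [abs_mul]
      refine (mul_le_mul (abs_evenSol_le y) (abs_oddSol_le x) (abs_nonneg _)
        (by positivity)).trans (le_of_eq ?_)
      rw [show 4 * Real.exp |y| * (4 * Real.exp (-|x|)) =
        16 * (Real.exp |y| * Real.exp (-|x|)) by ring, ← Real.exp_add,
        abs_of_nonneg hx, abs_of_nonneg hy.1.le, abs_of_nonneg (by linarith [hy.2])]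
      congr 2; ring
    · rw [ENNReal.ofReal_mul (by norm_num)]; norm_num
  have e2 : ‖(2 : ℝ)‖ₑ = 2 := by rw [← ofReal_norm]; norm_num
  calc ‖z x‖ₑ ≤ 2 * ‖(∫ y in Set.Ioi x, g y * oddSol y) * evenSol x‖ₑ +
      2 * ‖(∫ y in Set.Ioc 0 x, g y * evenSol y) * oddSol x‖ₑ := by
        rw [key]
        refine (enorm_add_le _ _).trans ?_
        rw [enorm_mul 2, enorm_mul 2, e2]
    _ ≤ 2 * (∫⁻ y in Set.Ioi x, 16 * (ENNReal.ofReal (Real.exp (-|x - y|)) * ‖g y‖ₑ)) +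
      2 * ∫⁻ y in Set.Ioc 0 x, 16 * (ENNReal.ofReal (Real.exp (-|x - y|)) * ‖g y‖ₑ) := by gcongr
    _ = 2 * ∫⁻ y in Set.Ioi x ∪ Set.Ioc 0 x,
        16 * (ENNReal.ofReal (Real.exp (-|x - y|)) * ‖g y‖ₑ) := by
        rw [← mul_add, lintegral_union measurableSet_Ioc]
        rw [Set.disjoint_left]
        exact fun a h1 h2 => absurd h2.2 (not_le.2 h1)
    _ ≤ 2 * ∫⁻ y, 16 * (ENNReal.ofReal (Real.exp (-|x - y|)) * ‖g y‖ₑ) := by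
        exact mul_le_mul' le_rfl (setLIntegral_le_lintegral _ _)
    _ = _ := by
        rw [lintegral_const_mul _ (by fun_prop), ← mul_assoc]; norm_num

/-- The linearised operator is bounded below in `L²` on even functions. The kernel element `oddSol`, due
to translation invariance, is excluded by parity. -/
theorem eLpNorm_le_of_linearized {z z' g : ℝ → ℝ} {B : ℝ}
    (hz : ∀ x, HasDerivAt z (z' x) x)
    (hz' : ∀ x, HasDerivAt z' ((1 - 3 * sechSq x) * z x - g x) x) (hg : Continuous g)
    (bz : ∀ x, |z x| ≤ B) (bz' : ∀ x, |z' x| ≤ B) (bg : ∀ x, |g x| ≤ B)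
    (ez : ∀ x, z (-x) = z x) (eg : ∀ x, g (-x) = g x) :
    eLpNorm z 2 ≤ 64 * eLpNorm g 2 := by
  have h1 : ∀ x, ‖z x‖ₑ ≤
      32 * ∫⁻ t, ENNReal.ofReal (Real.exp (-|t|)) * ‖g (x - t)‖ₑ := by
    intro x
    rw [lconv_comm (fun t => ENNReal.ofReal (Real.exp (-|t|))) (fun t => ‖g t‖ₑ)]
    rcases le_total 0 x with hx | hx
    · refine (enorm_le_of_linearized hz hz' hg bz bz' bg ez x hx).trans (le_of_eq ?_)
      simp only [mul_comm]
    · rw [← ez]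
      refine (enorm_le_of_linearized hz hz' hg bz bz' bg ez (-x) (by linarith)).trans
        (le_of_eq ?_)
      rw [← lintegral_neg_eq_self]
      congr 1
      refine lintegral_congr fun y => ?_
      rw [eg, mul_comm, ← abs_neg, show -(-x - -y) = x - y by ring]
  have h2 := eLpNorm_lconv_le (F := fun t => ENNReal.ofReal (Real.exp (-|t|)))
    (G := fun t => ‖g t‖ₑ) (by fun_prop) (by fun_prop)
  rw [lintegral_exp_neg_abs, eLpNorm_enorm] at h2
  have h3 := eLpNorm_le_nnreal_smul_eLpNorm_of_ae_le_mul' (f := z)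
    (g := fun x => ∫⁻ t, ENNReal.ofReal (Real.exp (-|t|)) * ‖g (x - t)‖ₑ)
    (c := 32) (μ := volume) (Eventually.of_forall fun x => by simpa using h1 x) 2
  rw [ENNReal.smul_def, smul_eq_mul] at h3
  refine h3.trans ((mul_le_mul' le_rfl h2).trans (le_of_eq ?_))
  rw [← mul_assoc]
  norm_num

/-! ### The soliton on the Fourier side -/

theorem fourierInv_congr_ae {f g : ℝ → ℂ} (h : f =ᵐ[volume] g) : 𝓕⁻ f = 𝓕⁻ g := by
  ext x
  simp only [Real.fourierInv_eq]
  exact integral_congr_ae (by filter_upwards [h] with ξ hξ; rw [hξ])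

/-- `f` is even, up to a null set. -/
def EvenAE (f : ℝ → ℂ) : Prop := ∀ᵐ ξ, f (-ξ) = f ξ

theorem EvenAE.congr {f g : ℝ → ℂ} (hf : EvenAE f) (h : f =ᵐ[volume] g) : EvenAE g := by
  have h' : ∀ᵐ ξ : ℝ, f (-ξ) = g (-ξ) := (Measure.measurePreserving_neg volume).quasiMeasurePreserving.ae h
  filter_upwards [hf, h, h'] with ξ h1 h2 h3
  rw [← h2, ← h3, h1]

theorem EvenAE.add {f g : ℝ → ℂ} (hf : EvenAE f) (hg : EvenAE g) :
    EvenAE fun ξ => f ξ + g ξ := by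
  filter_upwards [hf, hg] with ξ h1 h2
  rw [h1, h2]

theorem EvenAE.mul {f g : ℝ → ℂ} (hf : EvenAE f) (hg : EvenAE g) :
    EvenAE fun ξ => f ξ * g ξ := by
  filter_upwards [hf, hg] with ξ h1 h2
  rw [h1, h2]

theorem EvenAE.of_forall {f : ℝ → ℂ} (hf : ∀ ξ, f (-ξ) = f ξ) : EvenAE f :=
  Eventually.of_forall hf

theorem conv_neg {f g : ℝ → ℂ} (hf : EvenAE f) (hg : EvenAE g) (ξ : ℝ) :
    conv f g (-ξ) = conv f g ξ := by
  unfold conv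
  rw [← integral_neg_eq_self]
  have h2 : ∀ᵐ t : ℝ, g (-(ξ - t)) = g (ξ - t) :=
    (quasiMeasurePreserving_sub_left volume ξ).ae hg
  refine integral_congr_ae ?_
  filter_upwards [hf, h2] with t h1 h2
  rw [h1, ← h2]
  congr 2
  ring

theorem EvenAE.fourierInv {f : ℝ → ℂ} (hf : EvenAE f) (x : ℝ) : 𝓕⁻ f (-x) = 𝓕⁻ f x := by
  rw [← fourierInv_comp_neg]
  exact congrFun (fourierInv_congr_ae hf) x

theorem evenAE_of_fourierInv {f : ℝ → ℂ} (hf : MemSob 1 f) (h : ∀ x, 𝓕⁻ f (-x) = 𝓕⁻ f x) :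
    EvenAE f := by
  have hm : MemSob 1 fun ξ => f (-ξ) := by
    have := hf.comp_measurePreserving (Measure.measurePreserving_neg volume)
    simpa [MemSob, Function.comp_def] using this
  refine hm.ae_eq_of_fourierInv_eq hf ?_
  ext x
  rw [fourierInv_comp_neg, h]

/-- The transform of the derivative, for functions in `H¹` whose derivative is in `H¹`. -/
theorem ae_eq_dMul {f g : ℝ → ℂ} (hf : MemSob 1 f) (hg : MemSob 1 g)
    (h : ∀ x, HasDerivAt (𝓕⁻ f) (𝓕⁻ g x) x) : g =ᵐ[volume] dMul f := by
  have h1 := fourier_toLp_deriv h hf.memLp_fourierInv hg.memLp_fourierInv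
  filter_upwards [h1, hf.fourier_toLp, hg.fourier_toLp] with ξ h1 h2 h3
  rw [← h3, h1, h2, dMul]

theorem memLp_of_le_exp {u : ℝ → ℝ} {c : ℝ} (hu : Continuous u)
    (h : ∀ x, |u x| ≤ c * Real.exp (-|x|)) : MemLp u 2 := by
  have h1 : MemLp (fun x : ℝ => Real.exp (-|x|)) 2 := by
    rw [memLp_two_iff_integrable_sq (by fun_prop)]
    refine integrable_exp_neg_abs.mono' (by fun_prop) (Eventually.of_forall fun x => ?_)
    rw [Real.norm_of_nonneg (by positivity)]
    refine pow_le_of_le_one (Real.exp_pos _).le ?_ (by norm_num)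
    rw [Real.exp_le_one_iff]
    linarith [abs_nonneg x]
  refine (h1.const_mul c).mono hu.aestronglyMeasurable (Eventually.of_forall fun x => ?_)
  rw [Real.norm_eq_abs]
  exact (h x).trans (le_abs_self _)

/-- The profile `-(3/2) γ sech²(x/2)` of the limiting solitary wave. -/
noncomputable def soliton (β x : ℝ) : ℝ := -(3 / 2) * dispCoeff β * sechSq x

/-- `S` is the Fourier transform of the soliton: it lies in every Sobolev space, is even, and satisfies
the transformed equation `γ (1 + k²) S = - S ⋆ S`. -/
structure IsSolitonHat (β : ℝ) (S : ℝ → ℂ) : Prop where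
  memSobAll : MemSobAll S
  fourierInv : ∀ x, 𝓕⁻ S x = (soliton β x : ℂ)
  even : EvenAE S
  eq : ∀ᵐ ξ, ((dispCoeff β * bracket ξ ^ 2 : ℝ) : ℂ) * S ξ = -conv S S ξ

theorem inv_limit_symbol_le {γ : ℝ} (hγ : 0 < γ) (ξ : ℝ) :
    ‖(((γ * bracket ξ ^ 2)⁻¹ : ℝ) : ℂ)‖ ≤ γ⁻¹ * bracket ξ ^ (-2 : ℝ) := by
  have := bracket_pos ξ
  rw [Complex.norm_real, Real.norm_of_nonneg (by positivity), mul_inv, Real.rpow_neg this.le]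
  norm_cast

theorem continuous_inv_limit_symbol {γ : ℝ} (hγ : 0 < γ) :
    Continuous fun ξ => (((γ * bracket ξ ^ 2)⁻¹ : ℝ) : ℂ) := by
  refine Complex.continuous_ofReal.comp (Continuous.inv₀ (by fun_prop) fun ξ => ?_)
  have := bracket_pos ξ
  positivity

/-- The Fourier transform of the soliton. Two derivatives are computed by hand, which suffices for the
transformed equation; the equation then improves the decay of `S` by two powers at a time. -/
theorem exists_isSolitonHat {β : ℝ} (hβ : 1 / 3 < β) : ∃ S, IsSolitonHat β S := by
  have hγ := dispCoeff_pos hβ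
  set γ := dispCoeff β with hγd
  have hs : ∀ x, |soliton β x| ≤ (3 / 2 * γ * 4) * Real.exp (-|x|) := fun x => by
    rw [soliton, abs_mul, abs_of_pos (sechSq_pos x), abs_mul, abs_of_pos hγ, abs_neg,
      abs_of_pos (by norm_num)]
    have := sechSq_le_exp x
    calc 3 / 2 * γ * sechSq x ≤ 3 / 2 * γ * (4 * Real.exp (-|x|)) := by gcongr
      _ = _ := by ring
  have hc : ∀ {u : ℝ → ℝ}, (∀ x, |u x| ≤ 4 * Real.exp (-|x|)) →
      ∀ x, |3 / 2 * γ * u x| ≤ (3 / 2 * γ * 4) * Real.exp (-|x|) := fun {u} hu x => by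
    rw [abs_mul, abs_of_pos (by positivity)]
    calc 3 / 2 * γ * |u x| ≤ 3 / 2 * γ * (4 * Real.exp (-|x|)) := by gcongr; exact hu x
      _ = _ := by ring
  have h3 : ∀ x, |(1 - 3 * sechSq x) * oddSol x| ≤ (2 * 4) * Real.exp (-|x|) := fun x => by
    rw [abs_mul]
    calc |1 - 3 * sechSq x| * |oddSol x| ≤ 2 * (4 * Real.exp (-|x|)) := by
          gcongr
          · rw [abs_le]; constructor <;> linarith [sechSq_pos x, sechSq_le_one x]
          · exact abs_oddSol_le x
      _ = _ := by ring
  have m0 : MemLp (soliton β) 2 := memLp_of_le_exp (by unfold soliton; fun_prop) hs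
  have m1 : MemLp (fun x => 3 / 2 * γ * oddSol x) 2 :=
    memLp_of_le_exp (by fun_prop) (hc abs_oddSol_le)
  have m2 : MemLp (fun x => 3 / 2 * γ * oddSol' x) 2 :=
    memLp_of_le_exp (by fun_prop) (hc abs_oddSol'_le)
  have m3 : MemLp (fun x => 3 / 2 * γ * ((1 - 3 * sechSq x) * oddSol x)) 2 :=
    (memLp_of_le_exp (by fun_prop) h3).const_mul _
  have d0 : ∀ x, HasDerivAt (fun x => (soliton β x : ℂ)) ((3 / 2 * γ * oddSol x : ℝ) : ℂ) x :=
    fun x => HasDerivAt.ofReal_comp (HasDerivAt.congr_deriv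
      ((hasDerivAt_sechSq x).const_mul (-(3 / 2) * γ)) (by rw [oddSol]; ring))
  have d1 : ∀ x, HasDerivAt (fun x => ((3 / 2 * γ * oddSol x : ℝ) : ℂ))
      ((3 / 2 * γ * oddSol' x : ℝ) : ℂ) x :=
    fun x => ((hasDerivAt_oddSol x).const_mul _).ofReal_comp
  have d2 : ∀ x, HasDerivAt (fun x => ((3 / 2 * γ * oddSol' x : ℝ) : ℂ))
      ((3 / 2 * γ * ((1 - 3 * sechSq x) * oddSol x) : ℝ) : ℂ) x :=
    fun x => ((hasDerivAt_oddSol' x).const_mul _).ofReal_comp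
  obtain ⟨S, hS, iS, -, -⟩ := exists_fourierInv_eq d0 m0.ofReal m1.ofReal
  obtain ⟨T, hT, iT, -, -⟩ := exists_fourierInv_eq d1 m1.ofReal m2.ofReal
  obtain ⟨U, hU, iU, -, -⟩ := exists_fourierInv_eq d2 m2.ofReal m3.ofReal
  have hTS : T =ᵐ[volume] dMul S := ae_eq_dMul hS hT (by rw [iS, iT]; exact d0)
  have hUT : U =ᵐ[volume] dMul T := ae_eq_dMul hT hU (by rw [iT, iU]; exact d1)
  have hcv := memSob_conv le_rfl hS hS
  have heq : ∀ᵐ ξ, ((γ * bracket ξ ^ 2 : ℝ) : ℂ) * S ξ = -conv S S ξ := by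
    have hl : MemSob 1 fun ξ => (γ : ℂ) * (S ξ + (-1) * U ξ) :=
      (hS.add (hU.const_mul (-1))).const_mul _
    have hr : MemSob 1 fun ξ => (-1) * conv S S ξ := hcv.const_mul (-1)
    have := hl.ae_eq_of_fourierInv_eq hr (by
      ext x
      rw [fourierInv_const_mul, hS.fourierInv_add (hU.const_mul (-1)), fourierInv_const_mul,
        fourierInv_const_mul, hS.fourierInv_conv hS, iS, iU]
      simp only [soliton, oddSol']
      rw [← hγd]
      push_cast
      ring)
    filter_upwards [this, hTS, hUT] with ξ h1 h2 h3
    simp only [neg_one_mul] at h1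
    rw [← h1, h3, dMul, h2, dMul, bracket_sq]
    push_cast
    linear_combination (γ * 4 * (Real.pi : ℂ) ^ 2 * ξ ^ 2 * S ξ) * Complex.I_sq
  have hboot : ∀ n : ℕ, MemSob (1 + 2 * n) S := by
    intro n
    induction n with
    | zero => simpa using hS
    | succ n ih =>
      have h1 := memSob_conv (by linarith [n.cast_nonneg (α := ℝ)]) ih ih
      have h2 : MemSob (1 + 2 * (n + 1 : ℕ)) fun ξ => (((γ * bracket ξ ^ 2)⁻¹ : ℝ) : ℂ) *
          conv S S ξ :=
        MemSob.mul (a := -2) (by convert h1 using 1; push_cast; ring)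
          (continuous_inv_limit_symbol hγ).aestronglyMeasurable (inv_limit_symbol_le hγ)
      refine (h2.const_mul (-1)).congr ?_
      filter_upwards [heq] with ξ h
      have hb := bracket_pos ξ
      have hne : ((γ * bracket ξ ^ 2 : ℝ) : ℂ) ≠ 0 := by
        exact_mod_cast (by positivity : γ * bracket ξ ^ 2 ≠ 0)
      rw [mul_left_comm, neg_one_mul, ← h, Complex.ofReal_inv, inv_mul_cancel_left₀ hne]
  refine ⟨S, fun s => ?_, fun x => congrFun iS x, ?_, heq⟩
  · obtain ⟨n, hn⟩ := exists_nat_ge s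
    exact (hboot n).mono (by linarith [n.cast_nonneg (α := ℝ)])
  · refine evenAE_of_fourierInv hS fun x => ?_
    rw [iS]
    simp [soliton]

theorem eLpNorm_re_le (b : ℝ → ℂ) : eLpNorm (fun x => (b x).re) 2 ≤ eLpNorm b 2 :=
  eLpNorm_mono fun _ => Complex.abs_re_le_norm _

theorem eLpNorm_im_le (b : ℝ → ℂ) : eLpNorm (fun x => (b x).im) 2 ≤ eLpNorm b 2 :=
  eLpNorm_mono fun _ => Complex.abs_im_le_norm _

/-- The linearisation `f ↦ f + 2 (γ⟨k⟩²)⁻¹ (S ⋆ f)` of the limiting equation at the soliton is bounded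
below on even functions. With `b` the image of `f`, the difference `z = f - b` solves
`z'' = (1 - 3s) z - 3s b` in physical space, so that variation of parameters applies to `z`. -/
theorem sobNorm_le_linearization {β : ℝ} (hβ : 1 / 3 < β) {S : ℝ → ℂ} (hS : IsSolitonHat β S) :
    ∃ C : ℝ≥0∞, C < ⊤ ∧ ∀ f : ℝ → ℂ, MemSob 1 f → EvenAE f →
      sobNorm 1 f ≤ C * sobNorm 1 (fun ξ => f ξ +
        2 * ((((dispCoeff β * bracket ξ ^ 2)⁻¹ : ℝ) : ℂ) * conv S f ξ)) := by
  have hγ := dispCoeff_pos hβ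
  set γ := dispCoeff β with hγd
  have hS1 := hS.memSobAll 1
  refine ⟨1 + ENNReal.ofReal γ⁻¹ * 2 * eLpNorm S 1 * 385, ?_, fun f hf ef => ?_⟩
  · have : eLpNorm S 1 < ⊤ := (memLp_one_iff_integrable.2 (hS1.integrable le_rfl)).2
    finiteness
  have hcv := memSob_conv le_rfl hS1 hf
  set k : ℝ → ℂ := fun ξ => (((γ * bracket ξ ^ 2)⁻¹ : ℝ) : ℂ) * conv S f ξ with hk
  have hk3 : MemSob 3 k := MemSob.mul (a := -2) (by convert hcv using 1; norm_num)
    (continuous_inv_limit_symbol hγ).aestronglyMeasurable (inv_limit_symbol_le hγ)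
  set Z : ℝ → ℂ := fun ξ => (-2) * k ξ with hZ
  have hZ3 : MemSob 3 Z := hk3.const_mul (-2)
  have hZ1 : MemSob 1 Z := hZ3.mono (by norm_num)
  have hZ2 : MemSob 2 (dMul Z) := memSob_dMul (by norm_num; exact hZ3)
  have hZ21 : MemSob 1 (dMul Z) := hZ2.mono (by norm_num)
  have hZZ : MemSob 1 (dMul (dMul Z)) := memSob_dMul (by norm_num; exact hZ2)
  set b : ℝ → ℂ := fun ξ => f ξ + 2 * k ξ with hb
  have hb1 : MemSob 1 b := hf.add ((hk3.mono (by norm_num)).const_mul 2)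
  have hfe : f = fun ξ => Z ξ + b ξ := by ext ξ; simp only [hZ, hb]; ring
  have ek : EvenAE k := (EvenAE.of_forall fun ξ => by simp).mul
    (EvenAE.of_forall (conv_neg hS.even ef))
  have eZ : EvenAE Z := (EvenAE.of_forall fun _ => rfl).mul ek
  have eb : EvenAE b := ef.add ((EvenAE.of_forall fun _ => rfl).mul ek)
  have dz : ∀ x, HasDerivAt (𝓕⁻ Z) (𝓕⁻ (dMul Z) x) x := (hZ3.mono (by norm_num)).hasDerivAt
  have dz' : ∀ x, HasDerivAt (𝓕⁻ (dMul Z)) (𝓕⁻ (dMul (dMul Z)) x) x := hZ2.hasDerivAt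
  -- The differential equation for `Z = f - b`. Its coefficients are real, so the real and the imaginary
  -- part are estimated separately.
  have heq : ∀ x, 𝓕⁻ (dMul (dMul Z)) x =
      ((1 - 3 * sechSq x : ℝ) : ℂ) * 𝓕⁻ Z x - ((3 * sechSq x : ℝ) : ℂ) * 𝓕⁻ b x := by
    intro x
    have h1 : (fun ξ => dMul (dMul Z) ξ) = fun ξ => Z ξ + ((2 / γ : ℝ) : ℂ) * conv S f ξ := by
      ext ξ
      have hb := bracket_pos ξ
      have hb2 := bracket_sq ξ
      have hne : ((γ * bracket ξ ^ 2 : ℝ) : ℂ) ≠ 0 := by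
        exact_mod_cast (by positivity : γ * bracket ξ ^ 2 ≠ 0)
      have e : conv S f ξ = ((γ * bracket ξ ^ 2 : ℝ) : ℂ) * k ξ := by
        simp only [hk]; rw [Complex.ofReal_inv, mul_inv_cancel_left₀ hne]
      have hγ0 : (γ : ℂ) ≠ 0 := by exact_mod_cast hγ.ne'
      rw [e, hb2]
      simp only [dMul, hZ]
      push_cast
      field_simp
      linear_combination (-4 * (Real.pi : ℂ) ^ 2 * ξ ^ 2 * k ξ) * (Complex.I_sq)
    have h2 := hZ1.fourierInv_add (hcv.const_mul ((2 / γ : ℝ) : ℂ)) x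
    rw [← h1, fourierInv_const_mul ((2 / γ : ℝ) : ℂ), hS1.fourierInv_conv hf, hS.fourierInv] at h2
    have h3 : 𝓕⁻ f x = 𝓕⁻ Z x + 𝓕⁻ b x := by
      conv_lhs => rw [hfe]
      exact hZ1.fourierInv_add hb1 x
    have hγ0 : (γ : ℂ) ≠ 0 := by exact_mod_cast hγ.ne'
    rw [h3, soliton, ← hγd] at h2
    refine h2.trans ?_
    push_cast
    field_simp
    ring
  have cb := hb1.continuous
  set B := max (max (embConst * sobNorm 1 Z).toReal (embConst * sobNorm 1 (dMul Z)).toReal)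
    (3 * (embConst * sobNorm 1 b).toReal) with hB
  have b1 : ∀ x, ‖𝓕⁻ Z x‖ ≤ B := fun x =>
    (hZ1.norm_fourierInv_le x).trans ((le_max_left _ _).trans (le_max_left _ _))
  have b2 : ∀ x, ‖𝓕⁻ (dMul Z) x‖ ≤ B := fun x =>
    (hZ21.norm_fourierInv_le x).trans ((le_max_right _ _).trans (le_max_left _ _))
  have b3 : ∀ x, ‖((3 * sechSq x : ℝ) : ℂ) * 𝓕⁻ b x‖ ≤ B := fun x => by
    refine le_trans ?_ (le_max_right _ _)
    rw [norm_mul, Complex.norm_real, Real.norm_of_nonneg (by linarith [sechSq_pos x])]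
    have := sechSq_le_one x
    gcongr
    · linarith
    · exact hb1.norm_fourierInv_le x
  have hre := eLpNorm_le_of_linearized (z := fun x => (𝓕⁻ Z x).re)
    (z' := fun x => (𝓕⁻ (dMul Z) x).re) (g := fun x => (((3 * sechSq x : ℝ) : ℂ) * 𝓕⁻ b x).re)
    (B := B) (fun x => Complex.reCLM.hasFDerivAt.comp_hasDerivAt x (dz x))
    (fun x => by
      have := Complex.reCLM.hasFDerivAt.comp_hasDerivAt x (dz' x)
      refine this.congr_deriv ?_
      rw [heq]
      simp only [Complex.reCLM_apply, Complex.sub_re, Complex.re_ofReal_mul])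
    (by fun_prop) (fun x => (Complex.abs_re_le_norm _).trans (b1 x))
    (fun x => (Complex.abs_re_le_norm _).trans (b2 x))
    (fun x => (Complex.abs_re_le_norm _).trans (b3 x))
    (fun x => by rw [eZ.fourierInv]) (fun x => by rw [eb.fourierInv, sechSq_neg])
  have him := eLpNorm_le_of_linearized (z := fun x => (𝓕⁻ Z x).im)
    (z' := fun x => (𝓕⁻ (dMul Z) x).im) (g := fun x => (((3 * sechSq x : ℝ) : ℂ) * 𝓕⁻ b x).im)
    (B := B) (fun x => Complex.imCLM.hasFDerivAt.comp_hasDerivAt x (dz x))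
    (fun x => by
      have := Complex.imCLM.hasFDerivAt.comp_hasDerivAt x (dz' x)
      refine this.congr_deriv ?_
      rw [heq]
      simp only [Complex.imCLM_apply, Complex.sub_im, Complex.im_ofReal_mul])
    (by fun_prop) (fun x => (Complex.abs_im_le_norm _).trans (b1 x))
    (fun x => (Complex.abs_im_le_norm _).trans (b2 x))
    (fun x => (Complex.abs_im_le_norm _).trans (b3 x))
    (fun x => by rw [eZ.fourierInv]) (fun x => by rw [eb.fourierInv, sechSq_neg])
  have hg : eLpNorm (fun x => ((3 * sechSq x : ℝ) : ℂ) * 𝓕⁻ b x) 2 ≤ 3 * eLpNorm (𝓕⁻ b) 2 := by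
    have := eLpNorm_le_mul_eLpNorm_of_ae_le_mul (f := fun x => ((3 * sechSq x : ℝ) : ℂ) * 𝓕⁻ b x)
      (g := 𝓕⁻ b) (c := 3) (μ := volume) (Eventually.of_forall fun x => by
        rw [norm_mul, Complex.norm_real, Real.norm_of_nonneg (by linarith [sechSq_pos x])]
        gcongr
        linarith [sechSq_le_one x]) 2
    simpa using this
  have hz : eLpNorm (𝓕⁻ Z) 2 ≤ 384 * eLpNorm (𝓕⁻ b) 2 := by
    have cz := hZ1.continuous
    have h1 : eLpNorm (𝓕⁻ Z) 2 ≤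
        eLpNorm (fun x => (𝓕⁻ Z x).re) 2 + eLpNorm (fun x => (𝓕⁻ Z x).im) 2 := by
      have h2 := eLpNorm_add_le (f := fun x => ((𝓕⁻ Z x).re : ℂ))
        (g := fun x => ((𝓕⁻ Z x).im : ℂ) * Complex.I) (p := 2) (μ := volume)
        (by fun_prop) (by fun_prop) (by norm_num)
      refine le_trans (le_of_eq ?_) (h2.trans (le_of_eq ?_))
      · congr 1; ext x; simp [Complex.re_add_im]
      · congr 1 <;> refine eLpNorm_congr_norm_ae (Eventually.of_forall fun x => ?_) <;> simp
    calc _ ≤ _ := h1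
      _ ≤ 64 * (3 * eLpNorm (𝓕⁻ b) 2) + 64 * (3 * eLpNorm (𝓕⁻ b) 2) := by
          gcongr
          · exact hre.trans (mul_le_mul' le_rfl ((eLpNorm_re_le _).trans hg))
          · exact him.trans (mul_le_mul' le_rfl ((eLpNorm_im_le _).trans hg))
      _ = _ := by rw [← mul_assoc, ← add_mul]; norm_num
  have hu : eLpNorm f 2 ≤ 385 * sobNorm 1 b := by
    have h1 : sobNorm 0 f ≤ sobNorm 0 Z + sobNorm 0 b := by
      conv_lhs => rw [hfe]
      exact sobNorm_add_le hZ1.aestronglyMeasurable hb1.aestronglyMeasurable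
    rw [sobNorm_zero f] at h1
    rw [hZ1.eLpNorm_fourierInv, hb1.eLpNorm_fourierInv] at hz
    calc _ ≤ _ := h1
      _ ≤ 384 * sobNorm 0 b + 1 * sobNorm 0 b := by gcongr; simp
      _ = 385 * sobNorm 0 b := by rw [← add_mul]; norm_num
      _ ≤ _ := by gcongr; exact sobNorm_mono zero_le_one _
  -- `k` gains two derivatives, so its `H¹` norm is controlled by the `L²` norm of `f`.
  have hk1 : sobNorm 1 k ≤ ENNReal.ofReal γ⁻¹ * (eLpNorm S 1 * eLpNorm f 2) := by
    have h1 := sobNorm_mul_le (s := 1) (a := -2) (f := conv S f) (inv_limit_symbol_le hγ)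
    refine h1.trans ?_
    gcongr
    refine (sobNorm_mono (t := 0) (by norm_num) _).trans ?_
    rw [sobNorm_zero]
    exact eLpNorm_conv_le hS1.aestronglyMeasurable hf.aestronglyMeasurable
  have hZn : sobNorm 1 Z = 2 * sobNorm 1 k := by
    rw [hZ, sobNorm_const_mul, enorm_neg]
    congr 1
    rw [← ofReal_norm]; norm_num
  calc sobNorm 1 f ≤ sobNorm 1 Z + sobNorm 1 b := by
        conv_lhs => rw [hfe]
        exact sobNorm_add_le hZ1.aestronglyMeasurable hb1.aestronglyMeasurable
    _ ≤ 2 * (ENNReal.ofReal γ⁻¹ * (eLpNorm S 1 * (385 * sobNorm 1 b))) + sobNorm 1 b := by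
        rw [hZn]
        gcongr
        exact hk1.trans (by gcongr)
    _ = _ := by ring

/-! ### Operators on the weighted space -/

theorem conv_congr_ae {f f' g g' : ℝ → ℂ} (hf : f =ᵐ[volume] f') (hg : g =ᵐ[volume] g') :
    conv f g = conv f' g' := by
  ext ξ
  have h2 : ∀ᵐ t : ℝ, g (ξ - t) = g' (ξ - t) :=
    (quasiMeasurePreserving_sub_left volume ξ).ae hg
  exact integral_congr_ae (by filter_upwards [hf, h2] with t h1 h2; rw [h1, h2])

theorem integrable_mul_comp_sub {f g : ℝ → ℂ} (hf : MemLp f 2) (hg : MemLp g 2) (ξ : ℝ) :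
    Integrable fun t => f t * g (ξ - t) :=
  hf.integrable_mul (hg.comp_measurePreserving (volume.measurePreserving_sub_left ξ))

theorem conv_add_left {f f' g : ℝ → ℂ} (hf : MemLp f 2) (hf' : MemLp f' 2) (hg : MemLp g 2)
    (ξ : ℝ) : conv (fun t => f t + f' t) g ξ = conv f g ξ + conv f' g ξ := by
  unfold conv
  simp only [add_mul]
  exact integral_add (integrable_mul_comp_sub hf hg ξ) (integrable_mul_comp_sub hf' hg ξ)

theorem conv_comm (f g : ℝ → ℂ) : conv f g = conv g f := by
  ext ξ
  unfold conv
  rw [← integral_sub_left_eq_self (fun t => f t * g (ξ - t)) volume ξ]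
  simp [mul_comm]

theorem conv_add_right {f g g' : ℝ → ℂ} (hf : MemLp f 2) (hg : MemLp g 2) (hg' : MemLp g' 2)
    (ξ : ℝ) : conv f (fun t => g t + g' t) ξ = conv f g ξ + conv f g' ξ := by
  rw [conv_comm, conv_add_left hg hg' hf, conv_comm g, conv_comm g']

theorem conv_const_mul_left (c : ℂ) (f g : ℝ → ℂ) (ξ : ℝ) :
    conv (fun t => c * f t) g ξ = c * conv f g ξ := by
  unfold conv
  rw [← integral_const_mul]
  simp only [mul_assoc]

/-- The Hilbert space of square integrable functions of the frequency `ξ`. -/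
noncomputable abbrev FourierL2 := Lp ℂ 2 (volume : Measure ℝ)

/-- The isometry from `L²` onto the Fourier transforms of `H¹`: division by `⟨k⟩`. -/
noncomputable def lower (a : ℝ → ℂ) (ξ : ℝ) : ℂ := (((bracket ξ)⁻¹ : ℝ) : ℂ) * a ξ

theorem bracket_mul_lower (a : ℝ → ℂ) :
    (fun ξ => ((bracket ξ ^ (1 : ℝ) : ℝ) : ℂ) * lower a ξ) = a := by
  ext ξ
  rw [lower, ← mul_assoc, ← Complex.ofReal_mul, Real.rpow_one, mul_inv_cancel₀ (bracket_pos ξ).ne']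
  simp

theorem memSob_lower {a : ℝ → ℂ} (ha : MemLp a 2) : MemSob 1 (lower a) := by
  rw [MemSob, bracket_mul_lower]; exact ha

theorem memSob_lower_coe (a : FourierL2) : MemSob 1 (lower a) := memSob_lower (Lp.memLp a)

theorem sobNorm_lower (a : FourierL2) : sobNorm 1 (lower a) = ‖a‖ₑ := by
  rw [sobNorm, bracket_mul_lower, Lp.enorm_def]

/-- The inverse of `lower`. -/
noncomputable def MemSob.lift {f : ℝ → ℂ} (hf : MemSob 1 f) : FourierL2 := MemLp.toLp _ hf

theorem MemSob.coeFn_lift {f : ℝ → ℂ} (hf : MemSob 1 f) :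
    hf.lift =ᵐ[volume] fun ξ => ((bracket ξ ^ (1 : ℝ) : ℝ) : ℂ) * f ξ := MemLp.coeFn_toLp _

theorem MemSob.lower_lift {f : ℝ → ℂ} (hf : MemSob 1 f) : lower hf.lift =ᵐ[volume] f := by
  filter_upwards [hf.coeFn_lift] with ξ h
  rw [lower, h]
  exact congrFun (bracket_inv_mul f) ξ

theorem MemSob.enorm_lift {f : ℝ → ℂ} (hf : MemSob 1 f) : ‖hf.lift‖ₑ = sobNorm 1 f := by
  rw [← sobNorm_lower, sobNorm_congr hf.lower_lift]

theorem lower_add (a b : FourierL2) :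
    lower ⇑(a + b) =ᵐ[volume] fun ξ => lower a ξ + lower b ξ := by
  filter_upwards [Lp.coeFn_add a b] with ξ h
  rw [lower, h, Pi.add_apply, mul_add]; rfl

theorem lower_smul (c : ℂ) (a : FourierL2) :
    lower ⇑(c • a) =ᵐ[volume] fun ξ => c * lower a ξ := by
  filter_upwards [Lp.coeFn_smul c a] with ξ h
  rw [lower, h, Pi.smul_apply, smul_eq_mul, mul_left_comm]; rfl

theorem memLp_mul_coe {g : ℝ → ℂ} (hg : AEStronglyMeasurable g) {C : ℝ} (h : ∀ ξ, ‖g ξ‖ ≤ C)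
    (a : FourierL2) : MemLp (fun ξ => g ξ * a ξ) 2 :=
  (Lp.memLp a).of_le_mul (hg.mul (Lp.memLp a).1) (c := C) (Eventually.of_forall fun ξ => by
    rw [norm_mul]; gcongr; exact h ξ)

/-- Multiplication by a bounded function, as an operator on `L²`. -/
noncomputable def mulOp (g : ℝ → ℂ) (hg : AEStronglyMeasurable g) (C : ℝ) (h : ∀ ξ, ‖g ξ‖ ≤ C) :
    FourierL2 →L[ℂ] FourierL2 :=
  have hm := memLp_mul_coe hg h
  LinearMap.mkContinuous
    { toFun := fun a => (hm a).toLp _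
      map_add' := fun a b => by
        apply Lp.ext
        filter_upwards [(hm (a + b)).coeFn_toLp, (hm a).coeFn_toLp, (hm b).coeFn_toLp,
          Lp.coeFn_add a b, Lp.coeFn_add ((hm a).toLp _) ((hm b).toLp _)] with ξ h1 h2 h3 h4 h5
        rw [h1, h5, h4, Pi.add_apply, Pi.add_apply, h2, h3, mul_add]
      map_smul' := fun c a => by
        apply Lp.ext
        filter_upwards [(hm (c • a)).coeFn_toLp, (hm a).coeFn_toLp,
          Lp.coeFn_smul c a, Lp.coeFn_smul c ((hm a).toLp _)] with ξ h1 h2 h3 h4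
        rw [RingHom.id_apply, h1, h4, h3, Pi.smul_apply, Pi.smul_apply, h2, smul_eq_mul,
          smul_eq_mul, mul_left_comm] } C
    fun a => Lp.norm_le_mul_norm_of_ae_le_mul (by
      filter_upwards [(hm a).coeFn_toLp] with ξ h1
      refine (congrArg norm h1).trans_le ?_
      rw [norm_mul]; gcongr; exact h ξ)

theorem coeFn_mulOp {g : ℝ → ℂ} (hg : AEStronglyMeasurable g) {C : ℝ} (h : ∀ ξ, ‖g ξ‖ ≤ C)
    (a : FourierL2) : mulOp g hg C h a =ᵐ[volume] fun ξ => g ξ * a ξ :=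
  (memLp_mul_coe hg h a).coeFn_toLp

theorem norm_mulOp_le {g : ℝ → ℂ} (hg : AEStronglyMeasurable g) {C : ℝ} (h : ∀ ξ, ‖g ξ‖ ≤ C)
    (a : FourierL2) : ‖mulOp g hg C h a‖ ≤ C * ‖a‖ :=
  Lp.norm_le_mul_norm_of_ae_le_mul (by
      filter_upwards [coeFn_mulOp hg h a] with ξ h1
      rw [h1, norm_mul]; gcongr; exact h ξ)

theorem lower_mulOp {g : ℝ → ℂ} (hg : AEStronglyMeasurable g) {C : ℝ} (h : ∀ ξ, ‖g ξ‖ ≤ C)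
    (a : FourierL2) : lower (mulOp g hg C h a) =ᵐ[volume] fun ξ => g ξ * lower a ξ := by
  filter_upwards [coeFn_mulOp hg h a] with ξ h1
  rw [lower, h1, mul_left_comm]; rfl

/-- Convolution of Fourier transforms of `H¹` functions, in the coordinates of `lower`. -/
noncomputable def convOp : FourierL2 →L[ℂ] FourierL2 →L[ℂ] FourierL2 :=
  have hm := fun a b : FourierL2 => memSob_conv le_rfl (memSob_lower_coe a) (memSob_lower_coe b)
  have h2 := fun a : FourierL2 => (memSob_lower_coe a).memLp_two zero_le_one
  have ext : ∀ {a b : FourierL2}, lower a =ᵐ[volume] lower b → a = b := fun {a b} h => by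
    apply Lp.ext
    filter_upwards [h] with ξ h
    rw [← bracket_mul_lower a, ← bracket_mul_lower b]
    simp only [h]
  have addl : ∀ a a' b : FourierL2, (hm (a + a') b).lift = (hm a b).lift + (hm a' b).lift :=
    fun a a' b => ext (by
      filter_upwards [(hm (a + a') b).lower_lift, (hm a b).lower_lift, (hm a' b).lower_lift,
        lower_add (hm a b).lift (hm a' b).lift] with ξ h1 h2' h3 h4
      rw [h1, h4, h2', h3, conv_congr_ae (lower_add a a') (ae_eq_refl _),
        conv_add_left (h2 a) (h2 a') (h2 b)])
  have smull : ∀ (c : ℂ) (a b : FourierL2), (hm (c • a) b).lift = c • (hm a b).lift :=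
    fun c a b => ext (by
      filter_upwards [(hm (c • a) b).lower_lift, (hm a b).lower_lift,
        lower_smul c (hm a b).lift] with ξ h1 h2' h4
      rw [h1, h4, h2', conv_congr_ae (lower_smul c a) (ae_eq_refl _), conv_const_mul_left])
  have comm : ∀ a b : FourierL2, (hm a b).lift = (hm b a).lift := fun a b => ext (by
      filter_upwards [(hm a b).lower_lift, (hm b a).lower_lift] with ξ h1 h2'
      rw [h1, h2', conv_comm])
  LinearMap.mkContinuous₂ (LinearMap.mk₂ ℂ (fun a b => (hm a b).lift) addl smull
    (fun a b b' => by rw [comm, addl, comm b, comm b'])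
    (fun c a b => by rw [comm, smull, comm]))
    (4 * embConst.toReal) fun a b => by
      have h := sobNorm_conv_le zero_le_one (memSob_lower_coe a).aestronglyMeasurable
        (memSob_lower_coe b).aestronglyMeasurable
      rw [← (hm a b).enorm_lift, sobNorm_lower, sobNorm_lower] at h
      have h3 := ENNReal.toReal_mono (by have := embConst_lt_top; finiteness) h
      rw [toReal_enorm] at h3
      refine h3.trans (le_of_eq ?_)
      rw [← two_mul]
      simp only [ENNReal.toReal_mul, toReal_enorm, Real.rpow_one]
      norm_num
      ring

theorem lower_convOp (a b : FourierL2) :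
    lower (convOp a b) =ᵐ[volume] conv (lower a) (lower b) :=
  (memSob_conv le_rfl (memSob_lower_coe a) (memSob_lower_coe b)).lower_lift

theorem ext_of_lower {a b : FourierL2} (h : lower a =ᵐ[volume] lower b) : a = b := by
  apply Lp.ext
  filter_upwards [h] with ξ h
  rw [← bracket_mul_lower a, ← bracket_mul_lower b]
  simp only [h]

/-- Reflection `a(ξ) ↦ a(-ξ)`. -/
noncomputable def reflect : FourierL2 →ₗᵢ[ℂ] FourierL2 :=
  Lp.compMeasurePreservingₗᵢ ℂ (fun ξ : ℝ => -ξ) (Measure.measurePreserving_neg volume)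

theorem coeFn_reflect (a : FourierL2) : reflect a =ᵐ[volume] fun ξ => a (-ξ) :=
  Lp.coeFn_compMeasurePreserving a (Measure.measurePreserving_neg volume)

theorem reflect_eq_iff (a : FourierL2) : reflect a = a ↔ EvenAE (lower a) := by
  constructor
  · intro h
    have h1 := coeFn_reflect a
    rw [h] at h1
    filter_upwards [h1] with ξ h2
    rw [lower, lower, bracket_neg, ← h2]
  · intro h
    apply Lp.ext
    filter_upwards [coeFn_reflect a, h] with ξ h1 h2
    rw [h1]
    have hb : (((bracket ξ)⁻¹ : ℝ) : ℂ) ≠ 0 := by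
      exact_mod_cast (inv_pos.2 (bracket_pos ξ)).ne'
    rw [lower, lower, bracket_neg] at h2
    exact mul_left_cancel₀ hb h2

theorem reflect_reflect (a : FourierL2) : reflect (reflect a) = a := by
  apply Lp.ext
  have h : ∀ᵐ ξ : ℝ, reflect a (-ξ) = a (- -ξ) :=
    (Measure.measurePreserving_neg volume).quasiMeasurePreserving.ae (coeFn_reflect a)
  filter_upwards [coeFn_reflect (reflect a), h] with ξ h1 h2
  rw [h1, h2, neg_neg]

theorem inner_reflect (a b : FourierL2) : inner ℂ (reflect a) b = inner ℂ a (reflect b) := by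
  conv_lhs => rw [← reflect_reflect b]
  exact reflect.inner_map_map _ _

/-- Plancherel's identity for inner products. -/
theorem integral_inner_fourierInv {f g : ℝ → ℂ} (hf : MemSob 1 f) (hg : MemSob 1 g) :
    ∫ ξ, inner ℂ (f ξ) (g ξ) = ∫ x, inner ℂ (𝓕⁻ f x) (𝓕⁻ g x) := by
  have h := Lp.inner_fourier_eq (hf.memLp_fourierInv.toLp (𝓕⁻ f))
    (hg.memLp_fourierInv.toLp (𝓕⁻ g))
  rw [L2.inner_def, L2.inner_def] at h
  rw [integral_congr_ae (g := fun ξ => inner ℂ (f ξ) (g ξ)) (by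
    filter_upwards [hf.fourier_toLp, hg.fourier_toLp] with ξ h1 h2; rw [h1, h2])] at h
  rw [h]
  exact integral_congr_ae (by
    filter_upwards [hf.memLp_fourierInv.coeFn_toLp, hg.memLp_fourierInv.coeFn_toLp]
      with ξ h1 h2; rw [h1, h2])

/-- A symmetric operator that is bounded below is invertible: its range is closed, and the orthogonal
complement of the range is the kernel. -/
theorem exists_inverse_of_isSymmetric {H : Type*} [NormedAddCommGroup H]
    [InnerProductSpace ℂ H] [CompleteSpace H] (B : H →L[ℂ] H)
    (hs : ∀ a b, inner ℂ (B a) b = inner ℂ a (B b)) {c : ℝ} (hc : 0 ≤ c)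
    (h : ∀ a, ‖a‖ ≤ c * ‖B a‖) :
    ∃ T : H →L[ℂ] H, (∀ a, B (T a) = a) ∧ ∀ a, T (B a) = a := by
  have ha : AntilipschitzWith ⟨c, hc⟩ B := B.antilipschitz_of_bound h
  have hadj : ContinuousLinearMap.adjoint B = B :=
    (ContinuousLinearMap.isSelfAdjoint_iff').1 (ContinuousLinearMap.isSelfAdjoint_iff_isSymmetric.2 hs)
  have hker : (B : H →ₗ[ℂ] H).ker = ⊥ := LinearMap.ker_eq_bot.2 ha.injective
  have hr : (B : H →ₗ[ℂ] H).range = ⊤ := by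
    have h1 : IsClosed ((B : H →ₗ[ℂ] H).range : Set H) := ha.isClosed_range B.uniformContinuous
    rw [← h1.submodule_topologicalClosure_eq, Submodule.topologicalClosure_eq_top_iff,
      ContinuousLinearMap.orthogonal_range, hadj, hker]
  let e := ContinuousLinearEquiv.ofBijective B hker hr
  exact ⟨e.symm, fun a => ContinuousLinearEquiv.ofBijective_apply_symm_apply B hker hr a,
    fun a => ContinuousLinearEquiv.ofBijective_symm_apply_apply B hker hr a⟩

/-- Fixed points of a map `F` with `F 0 = O(η)` and Lipschitz constant `O(η + ‖a‖ + ‖b‖)` on a closed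
invariant set: for small `η` there is one of size `O(η)`, and it is unique in a ball whose radius `δ` does
not depend on `η`. -/
theorem exists_small_fixedPoint {C : ℝ} (hC : 0 < C) :
    ∃ δ η₀ : ℝ, 0 < δ ∧ 0 < η₀ ∧ ∀ {H : Type} [NormedAddCommGroup H] [CompleteSpace H]
      (s : Set H) (F : H → H) (η : ℝ), IsClosed s → 0 ∈ s → Set.MapsTo F s s → 0 ≤ η → η ≤ η₀ →
      ‖F 0‖ ≤ C * η → (∀ a ∈ s, ∀ b ∈ s, ‖F a - F b‖ ≤ C * (η + ‖a‖ + ‖b‖) * ‖a - b‖) →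
      (∃ a ∈ s, F a = a ∧ ‖a‖ ≤ 2 * C * η) ∧
      ∀ a ∈ s, ∀ b ∈ s, ‖a‖ ≤ δ → ‖b‖ ≤ δ → F a = a → F b = b → a = b := by
  refine ⟨1 / (8 * C), min (1 / (4 * C)) (1 / (16 * C ^ 2)), by positivity, by positivity,
    fun {H} _ _ s F η hs h0 hF hη0 hη hF0 hL => ?_⟩
  set δ := 1 / (8 * C) with hδ
  have hδ0 : 0 < δ := by positivity
  have hCδ : C * δ = 1 / 8 := by rw [hδ]; field_simp
  have hη1 : C * η ≤ 1 / 4 := by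
    calc C * η ≤ C * (1 / (4 * C)) := by gcongr; exact hη.trans (min_le_left _ _)
      _ = 1 / 4 := by field_simp
  have hη2 : C * η ≤ δ / 2 := by
    calc C * η ≤ C * (1 / (16 * C ^ 2)) := by gcongr; exact hη.trans (min_le_right _ _)
      _ = δ / 2 := by rw [hδ]; field_simp; norm_num
  have lip : ∀ a ∈ s, ∀ b ∈ s, ‖a‖ ≤ δ → ‖b‖ ≤ δ → ‖F a - F b‖ ≤ 1 / 2 * ‖a - b‖ := by
    intro a ha b hb ha' hb'
    refine (hL a ha b hb).trans ?_
    gcongr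
    calc C * (η + ‖a‖ + ‖b‖) ≤ C * (η + δ + δ) := by gcongr
      _ = C * η + C * δ + C * δ := by ring
      _ ≤ 1 / 2 := by rw [hCδ]; linarith
  have gr : ∀ a ∈ s, ‖a‖ ≤ δ → ‖F a‖ ≤ C * η + 1 / 2 * ‖a‖ := by
    intro a ha ha'
    have h1 := lip a ha 0 h0 ha' (by simpa using hδ0.le)
    rw [sub_zero] at h1
    have h2 := norm_add_le (F a - F 0) (F 0)
    rw [sub_add_cancel] at h2
    linarith
  refine ⟨?_, fun a ha b hb ha' hb' ea eb => ?_⟩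
  · set t := s ∩ Metric.closedBall 0 δ with ht
    have hmaps : Set.MapsTo F t t := fun a ha => by
      have ha' : ‖a‖ ≤ δ := by simpa using ha.2
      refine ⟨hF ha.1, ?_⟩
      rw [mem_closedBall_zero_iff]
      have := gr a ha.1 ha'
      linarith
    have hcon : ContractingWith (1 / 2) (hmaps.restrict F t t) := by
      refine ⟨by norm_num, LipschitzWith.of_dist_le_mul fun a b => ?_⟩
      have := lip a a.2.1 b b.2.1 (by simpa using a.2.2) (by simpa using b.2.2)
      rw [← dist_eq_norm, ← dist_eq_norm] at this
      simpa [Subtype.dist_eq] using this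
    obtain ⟨a, ha, hfa, -, -⟩ := ContractingWith.exists_fixedPoint'
      (hs.inter Metric.isClosed_closedBall).isComplete hmaps hcon
      (x := 0) ⟨h0, by simpa using hδ0.le⟩ (edist_ne_top _ _)
    have ha' : ‖a‖ ≤ δ := by simpa using ha.2
    refine ⟨a, ha.1, hfa, ?_⟩
    have := gr a ha.1 ha'
    rw [hfa] at this
    linarith
  · have := lip a ha b hb ha' hb'
    rw [ea, eb] at this
    have h3 := norm_nonneg (a - b)
    exact sub_eq_zero.1 (norm_eq_zero.1 (by linarith))

/-! ### Existence and local uniqueness -/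

/-- The profile equation in the long-wave scaling `w(x) = ε² ζ(εx)`, for the Fourier transform `f` of `ζ`. -/
def SolvesHat (β ε : ℝ) (f : ℝ → ℂ) : Prop :=
  ∀ᵐ ξ, (scaledSymbol β ε ξ : ℂ) * f ξ = -conv f f ξ

theorem measurable_phaseSpeed (β : ℝ) : Measurable (phaseSpeed β) := by
  unfold phaseSpeed
  refine Measurable.ite (measurableSet_singleton 0) (by fun_prop) ?_
  have : Measurable Real.tanh := by
    rw [show Real.tanh = fun x => Real.sinh x / Real.cosh x from
      funext Real.tanh_eq_sinh_div_cosh]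
    fun_prop
  fun_prop

theorem measurable_scaledSymbol (β ε : ℝ) : Measurable (scaledSymbol β ε) := by
  unfold scaledSymbol
  exact (((measurable_phaseSpeed β).comp (by fun_prop)).sub_const _).div_const _

theorem scaledSymbol_neg (β ε ξ : ℝ) : scaledSymbol β ε (-ξ) = scaledSymbol β ε ξ := by
  rw [scaledSymbol, scaledSymbol, ← phaseSpeed_neg β (ε * (2 * Real.pi * ξ))]
  congr 3; ring

theorem conv_add_self {f g : ℝ → ℂ} (hf : MemLp f 2) (hg : MemLp g 2) (ξ : ℝ) :
    conv (fun t => f t + g t) (fun t => f t + g t) ξ =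
      conv f f ξ + 2 * conv f g ξ + conv g g ξ := by
  rw [conv_add_left (g := fun t => f t + g t) hf hg (hf.add hg), conv_add_right hf hf hg,
    conv_add_right hg hf hg,
    conv_comm g f]
  ring

theorem evenAE_lower_convOp {a b : FourierL2} (ha : EvenAE (lower a)) (hb : EvenAE (lower b)) :
    EvenAE (lower (convOp a b)) :=
  (EvenAE.of_forall (conv_neg ha hb)).congr (lower_convOp a b).symm

theorem evenAE_lower_mulOp {g : ℝ → ℂ} (hg : AEStronglyMeasurable g) {C : ℝ}
    (h : ∀ ξ, ‖g ξ‖ ≤ C) (eg : ∀ ξ, g (-ξ) = g ξ) {a : FourierL2} (ha : EvenAE (lower a)) :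
    EvenAE (lower (mulOp g hg C h a)) :=
  ((EvenAE.of_forall eg).mul ha).congr (lower_mulOp hg h a).symm

theorem evenAE_lower_add {a b : FourierL2} (ha : EvenAE (lower a)) (hb : EvenAE (lower b)) :
    EvenAE (lower ⇑(a + b)) := (ha.add hb).congr (lower_add a b).symm

theorem evenAE_lower_smul (c : ℂ) {a : FourierL2} (ha : EvenAE (lower a)) :
    EvenAE (lower ⇑(c • a)) :=
  ((EvenAE.of_forall fun _ => rfl).mul ha).congr (lower_smul c a).symm

/-- The inverse of the limiting symbol. -/
noncomputable def limitInv (β ξ : ℝ) : ℂ := (((dispCoeff β * bracket ξ ^ 2)⁻¹ : ℝ) : ℂ)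

theorem aestronglyMeasurable_limitInv {β : ℝ} (hβ : 1 / 3 < β) :
    AEStronglyMeasurable (limitInv β) :=
  (continuous_inv_limit_symbol (dispCoeff_pos hβ)).aestronglyMeasurable

theorem limitInv_neg (β ξ : ℝ) : limitInv β (-ξ) = limitInv β ξ := by
  rw [limitInv, limitInv, bracket_neg]

theorem norm_limitInv_le {β : ℝ} (hβ : 1 / 3 < β) (ξ : ℝ) :
    ‖limitInv β ξ‖ ≤ (dispCoeff β)⁻¹ := by
  refine (inv_limit_symbol_le (dispCoeff_pos hβ) ξ).trans ?_
  refine mul_le_of_le_one_right (inv_nonneg.2 (dispCoeff_pos hβ).le) ?_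
  exact Real.rpow_le_one_of_one_le_of_nonpos (one_le_bracket ξ) (by norm_num)

/-- The operator `a ↦ 2 (γ⟨k⟩²)⁻¹ (S ⋆ a)` in the coordinates of `lower`; `1 + linOp` is the linearisation of
the limiting equation at the soliton. -/
noncomputable def linOp {β : ℝ} (hβ : 1 / 3 < β) (s : FourierL2) : FourierL2 →L[ℂ] FourierL2 :=
  (2 : ℂ) • (mulOp _ (aestronglyMeasurable_limitInv hβ) _ (norm_limitInv_le hβ)).comp (convOp s)

theorem lower_linOp {β : ℝ} (hβ : 1 / 3 < β) (s a : FourierL2) :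
    lower (linOp hβ s a) =ᵐ[volume]
      fun ξ => 2 * (limitInv β ξ * conv (lower s) (lower a) ξ) := by
  have h := lower_smul 2 (mulOp _ (aestronglyMeasurable_limitInv hβ) _ (norm_limitInv_le hβ)
    (convOp s a))
  filter_upwards [h, lower_mulOp (aestronglyMeasurable_limitInv hβ) (norm_limitInv_le hβ)
    (convOp s a), lower_convOp s a] with ξ h1 h2 h3
  rw [linOp, _root_.smul_apply, ContinuousLinearMap.comp_apply, h1, h2, h3]

theorem evenAE_lower_linOp {β : ℝ} (hβ : 1 / 3 < β) {s a : FourierL2} (hs : EvenAE (lower s))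
    (ha : EvenAE (lower a)) : EvenAE (lower (linOp hβ s a)) :=
  evenAE_lower_smul 2 (evenAE_lower_mulOp (aestronglyMeasurable_limitInv hβ) (norm_limitInv_le hβ)
    (limitInv_neg β) (evenAE_lower_convOp hs ha))

theorem IsSolitonHat.lift_fourierInv {β : ℝ} {S : ℝ → ℂ} (hS : IsSolitonHat β S) (x : ℝ) :
    𝓕⁻ (lower (hS.memSobAll 1).lift) x = (soliton β x : ℂ) := by
  rw [fourierInv_congr_ae (hS.memSobAll 1).lower_lift, hS.fourierInv]

/-- `linOp` is symmetric in `H¹`, because the soliton is real and the weight `⟨k⟩²` of the inner product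
cancels the multiplier. -/
theorem inner_linOp {β : ℝ} (hβ : 1 / 3 < β) {S : ℝ → ℂ} (hS : IsSolitonHat β S)
    (a b : FourierL2) : inner ℂ (linOp hβ (hS.memSobAll 1).lift a) b =
      inner ℂ a (linOp hβ (hS.memSobAll 1).lift b) := by
  set s := (hS.memSobAll 1).lift with hs
  have hγ := dispCoeff_pos hβ
  have ms := memSob_lower_coe s
  have ma := memSob_lower_coe a
  have mb := memSob_lower_coe b
  have repr : ∀ a : FourierL2, linOp hβ s a =ᵐ[volume] fun ξ =>
      ((2 * (dispCoeff β)⁻¹ * (bracket ξ)⁻¹ : ℝ) : ℂ) * conv (lower s) (lower a) ξ := by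
    intro a
    filter_upwards [lower_linOp hβ s a] with ξ h
    rw [← bracket_mul_lower (linOp hβ s a)]
    simp only [h]
    have hb := bracket_pos ξ
    have hb' : (bracket ξ : ℂ) ≠ 0 := by exact_mod_cast hb.ne'
    rw [limitInv, Real.rpow_one]
    push_cast
    field_simp
  have ea : inner ℂ (linOp hβ s a) b = ((2 * (dispCoeff β)⁻¹ : ℝ) : ℂ) *
      ∫ ξ, inner ℂ (conv (lower s) (lower a) ξ) (lower b ξ) := by
    rw [L2.inner_def, ← integral_const_mul]
    refine integral_congr_ae ?_
    filter_upwards [repr a] with ξ h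
    rw [h, lower]
    simp only [RCLike.inner_apply, map_mul, Complex.conj_ofReal]
    push_cast
    ring
  have eb : inner ℂ a (linOp hβ s b) = ((2 * (dispCoeff β)⁻¹ : ℝ) : ℂ) *
      ∫ ξ, inner ℂ (lower a ξ) (conv (lower s) (lower b) ξ) := by
    rw [L2.inner_def, ← integral_const_mul]
    refine integral_congr_ae ?_
    filter_upwards [repr b] with ξ h
    rw [h]
    simp only [RCLike.inner_apply, map_mul, lower, Complex.conj_ofReal]
    push_cast
    ring
  rw [ea, eb, integral_inner_fourierInv (memSob_conv le_rfl ms ma) mb,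
    integral_inner_fourierInv ma (memSob_conv le_rfl ms mb)]
  congr 2
  ext x
  rw [ms.fourierInv_conv ma, ms.fourierInv_conv mb, hS.lift_fourierInv]
  simp only [RCLike.inner_apply, map_mul, Complex.conj_ofReal]
  ring

/-- The linearisation is invertible on even functions: the inverse is the restriction of a bounded
operator that preserves evenness. -/
theorem exists_linearization_inverse {β : ℝ} (hβ : 1 / 3 < β) {S : ℝ → ℂ}
    (hS : IsSolitonHat β S) :
    ∃ T : FourierL2 →L[ℂ] FourierL2, (∀ a : FourierL2, EvenAE (lower a) → EvenAE (lower (T a)) ∧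
      T a + linOp hβ (hS.memSobAll 1).lift (T a) = a) ∧
      ∀ a : FourierL2, EvenAE (lower a) → T (a + linOp hβ (hS.memSobAll 1).lift a) = a := by
  set s := (hS.memSobAll 1).lift with hs
  set K := linOp hβ s with hK
  have es : EvenAE (lower s) := hS.even.congr (hS.memSobAll 1).lower_lift.symm
  obtain ⟨C, hC, hlow⟩ := sobNorm_le_linearization hβ hS
  -- the projection onto even functions
  set E : FourierL2 →L[ℂ] FourierL2 :=
    (2⁻¹ : ℂ) • (ContinuousLinearMap.id ℂ _ + reflect.toContinuousLinearMap) with hE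
  have Eap : ∀ a, E a = (2⁻¹ : ℂ) • (a + reflect a) := fun a => rfl
  have Eeven : ∀ a, reflect (E a) = E a := fun a => by
    rw [Eap, map_smul, map_add, reflect_reflect, add_comm]
  have Efix : ∀ a, reflect a = a → E a = a := fun a h => by
    rw [Eap, h, ← two_smul ℂ a, smul_smul]; norm_num
  have Esym : ∀ a b, inner ℂ (E a) b = inner ℂ a (E b) := fun a b => by
    rw [Eap, Eap, inner_smul_left, inner_smul_right, inner_add_left, inner_add_right,
      inner_reflect]
    simp [Complex.conj_ofNat]
  have Enorm : ∀ a, ‖E a‖ ≤ ‖a‖ := fun a => by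
    rw [Eap, norm_smul]
    have := norm_add_le a (reflect a)
    rw [reflect.norm_map] at this
    norm_num
    linarith
  have Keven : ∀ a, reflect a = a → reflect (K a) = K a := fun a h =>
    (reflect_eq_iff _).2 (evenAE_lower_linOp hβ es ((reflect_eq_iff a).1 h))
  -- `B = 1 + EKE` agrees with `1 + K` on even functions and with the identity on odd ones, so it is
  -- symmetric and bounded below on the whole space.
  set B : FourierL2 →L[ℂ] FourierL2 := ContinuousLinearMap.id ℂ _ + E.comp (K.comp E) with hB
  have Bap : ∀ a, B a = a + E (K (E a)) := fun a => rfl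
  have Bfix : ∀ a, reflect a = a → B a = a + K a := fun a h => by
    rw [Bap, Efix a h, Efix _ (Keven a h)]
  have Brefl : ∀ a, B (reflect a) = reflect (B a) := fun a => by
    have : E (reflect a) = E a := by rw [Eap, Eap, reflect_reflect, add_comm]
    rw [Bap, Bap, this, map_add, Eeven]
  have elow : ∀ a, reflect a = a → ‖a‖ ≤ C.toReal * ‖a + K a‖ := by
    intro a ha
    have h1 := hlow (lower a) (memSob_lower_coe a) ((reflect_eq_iff a).1 ha)
    rw [sobNorm_lower] at h1
    have h2 : sobNorm 1 (fun ξ => lower a ξ + 2 *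
        ((((dispCoeff β * bracket ξ ^ 2)⁻¹ : ℝ) : ℂ) * conv S (lower a) ξ)) = ‖a + K a‖ₑ := by
      rw [← sobNorm_lower]
      refine sobNorm_congr ?_
      filter_upwards [lower_add a (K a), lower_linOp hβ s a] with ξ h3 h4
      rw [h3, h4, conv_congr_ae (hS.memSobAll 1).lower_lift (ae_eq_refl _), limitInv]
    rw [h2] at h1
    have h3 := ENNReal.toReal_mono (by finiteness) h1
    rwa [ENNReal.toReal_mul, toReal_enorm, toReal_enorm] at h3
  have Blow : ∀ a, ‖a‖ ≤ (C.toReal + 2) * ‖B a‖ := by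
    intro a
    have h1 : E (B a) = E a + K (E a) := by
      rw [Bap, map_add, Efix _ (Eeven _), Efix _ (Keven _ (Eeven a))]
    have h2 := elow (E a) (Eeven a)
    rw [← h1] at h2
    have h3 : a - E a = B a - E (B a) := by
      rw [h1, Bap, Efix _ (Keven _ (Eeven a))]; abel
    have h4 := norm_sub_le (B a) (E (B a))
    rw [← h3] at h4
    have h5 := norm_add_le (a - E a) (E a)
    rw [sub_add_cancel] at h5
    have h6 := Enorm (B a)
    have h7 : C.toReal * ‖E (B a)‖ ≤ C.toReal * ‖B a‖ := by gcongr
    linarith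
  have Bsym : ∀ a b, inner ℂ (B a) b = inner ℂ a (B b) := fun a b => by
    rw [Bap, Bap, inner_add_left, inner_add_right, Esym, inner_linOp hβ hS, Esym]
  obtain ⟨T, hT1, hT2⟩ := exists_inverse_of_isSymmetric B Bsym (by positivity) Blow
  have hTe : ∀ a, reflect a = a → reflect (T a) = T a := fun a h => by
    rw [← hT2 (reflect (T a)), Brefl, hT1, h]
  refine ⟨T, fun a ha => ?_, fun a ha => ?_⟩
  · have h := hTe a ((reflect_eq_iff a).2 ha)
    exact ⟨(reflect_eq_iff _).1 h, by rw [← Bfix _ h, hT1]⟩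
  · rw [← Bfix _ ((reflect_eq_iff a).2 ha), hT2]

set_option maxHeartbeats 1000000 in
/-- Existence and local uniqueness of even solutions near the soliton. With `G = 1/ℓ` the inverse of the
scaled symbol and `G₀` its limit, the equation for `S + r` reads
`r + 2 G₀ (S ⋆ r) = -(G - G₀)(S ⋆ S + 2 S ⋆ r) - G (r ⋆ r)`. Applying the inverse of the linearisation turns
it into a fixed point problem, in which `G - G₀ = O(ε²)` is the small parameter. -/
theorem exists_solution {β : ℝ} (hβ : 1 / 3 < β) {S : ℝ → ℂ} (hS : IsSolitonHat β S) :
    ∃ ε₀ δ K : ℝ, 0 < ε₀ ∧ ε₀ ≤ 1 ∧ 0 < δ ∧ 0 < K ∧ ∀ ε : ℝ, 0 < ε → ε ≤ ε₀ →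
      (∃ r, MemSob 1 r ∧ EvenAE r ∧ sobNorm 1 r ≤ ENNReal.ofReal (K * ε ^ 2) ∧
        SolvesHat β ε fun ξ => S ξ + r ξ) ∧
      ∀ r₁ r₂, MemSob 1 r₁ → EvenAE r₁ → sobNorm 1 r₁ ≤ ENNReal.ofReal δ →
        SolvesHat β ε (fun ξ => S ξ + r₁ ξ) → MemSob 1 r₂ → EvenAE r₂ →
        sobNorm 1 r₂ ≤ ENNReal.ofReal δ → SolvesHat β ε (fun ξ => S ξ + r₂ ξ) →
        r₁ =ᵐ[volume] r₂ := by
  obtain ⟨C, hC, hsym⟩ := scaledSymbol_bounds hβ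
  have hγ := dispCoeff_pos hβ
  set γ := dispCoeff β with hγd
  have hS1 := hS.memSobAll 1
  set s := hS1.lift with hs
  have es : EvenAE (lower s) := hS.even.congr hS1.lower_lift.symm
  obtain ⟨T, hT1, hT2⟩ := exists_linearization_inverse hβ hS
  rw [← hs] at hT1 hT2
  set N := ‖convOp‖ with hN
  have hconv : ∀ a b, ‖convOp a b‖ ≤ N * ‖a‖ * ‖b‖ := fun a b => convOp.le_opNorm₂ a b
  set C₁ := ‖T‖ * N * (C * ‖s‖ ^ 2 + 2 * C * ‖s‖ + γ⁻¹) + 1 with hC₁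
  have hN0 : 0 ≤ N := hN ▸ norm_nonneg (convOp)
  have hC₁0 : 0 < C₁ := by positivity
  obtain ⟨δ, η₀, hδ, hη₀, hfix⟩ := exists_small_fixedPoint hC₁0
  refine ⟨min 1 η₀, δ, 2 * C₁, by positivity, min_le_left _ _, hδ, by positivity,
    fun ε hε hε0 => ?_⟩
  have hε1 : ε ≤ 1 := hε0.trans (min_le_left _ _)
  have hη : ε ^ 2 ≤ η₀ :=
    (pow_le_of_le_one hε.le hε1 (by norm_num)).trans (hε0.trans (min_le_right _ _))
  have hsymε := hsym ε hε hε1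
  -- the multipliers `G = 1/ℓ` and `G - G₀`
  set G : ℝ → ℂ := fun ξ => (((scaledSymbol β ε ξ)⁻¹ : ℝ) : ℂ) with hG
  have hGm : AEStronglyMeasurable G :=
    (Complex.measurable_ofReal.comp (measurable_scaledSymbol β ε).inv).aestronglyMeasurable
  have hGb : ∀ ξ, ‖G ξ‖ ≤ γ⁻¹ := fun ξ => by
    have h1 := (hsymε ξ).1
    rw [hG, Complex.norm_real, Real.norm_of_nonneg (inv_nonneg.2 (hγ.le.trans h1))]
    gcongr
  have hGe : ∀ ξ, G (-ξ) = G ξ := fun ξ => by simp only [hG, scaledSymbol_neg]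
  set D : ℝ → ℂ := fun ξ => G ξ - limitInv β ξ with hD
  have hDm : AEStronglyMeasurable D := hGm.sub (aestronglyMeasurable_limitInv hβ)
  have hDb : ∀ ξ, ‖D ξ‖ ≤ C * ε ^ 2 := fun ξ => by
    have h1 := (hsymε ξ).2.2
    simp only [hD, hG, limitInv]
    rw [← Complex.ofReal_sub, Complex.norm_real, Real.norm_eq_abs]
    exact h1
  have hDe : ∀ ξ, D (-ξ) = D ξ := fun ξ => by simp only [hD, hGe, limitInv_neg]
  set MG := mulOp G hGm _ hGb with hMG
  set MD := mulOp D hDm _ hDb with hMD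
  set rhs : FourierL2 → FourierL2 := fun a =>
    (-1 : ℂ) • MD (convOp s s + (2 : ℂ) • convOp s a) + (-1 : ℂ) • MG (convOp a a) with hrhs
  have rhs_even : ∀ a : FourierL2, EvenAE (lower a) → EvenAE (lower (rhs a)) := fun a ha =>
    evenAE_lower_add
      (evenAE_lower_smul _ (evenAE_lower_mulOp hDm hDb hDe (evenAE_lower_add
        (evenAE_lower_convOp es es) (evenAE_lower_smul _ (evenAE_lower_convOp es ha)))))
      (evenAE_lower_smul _ (evenAE_lower_mulOp hGm hGb hGe (evenAE_lower_convOp ha ha)))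
  have lower_rhs : ∀ a : FourierL2, lower (rhs a) =ᵐ[volume] fun ξ =>
      -(D ξ * (conv S S ξ + 2 * conv S (lower a) ξ)) - G ξ * conv (lower a) (lower a) ξ := by
    intro a
    have hss := lower_convOp s s
    have hsa := lower_convOp s a
    rw [conv_congr_ae hS1.lower_lift hS1.lower_lift] at hss
    rw [conv_congr_ae hS1.lower_lift (ae_eq_refl _)] at hsa
    filter_upwards [lower_add ((-1 : ℂ) • MD (convOp s s + (2 : ℂ) • convOp s a))
        ((-1 : ℂ) • MG (convOp a a)),
      lower_smul (-1) (MD (convOp s s + (2 : ℂ) • convOp s a)),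
      lower_smul (-1) (MG (convOp a a)), lower_mulOp hGm hGb (convOp a a),
      lower_mulOp hDm hDb (convOp s s + (2 : ℂ) • convOp s a),
      lower_add (convOp s s) ((2 : ℂ) • convOp s a), lower_smul 2 (convOp s a), hss, hsa,
      lower_convOp a a] with ξ h1 h2 h3 h4 h5 h6 h7 h8 h9 h10
    rw [hrhs, h1, h2, h3, h4, h5, h6, h7, h8, h9, h10]
    ring
  have equiv : ∀ a : FourierL2, EvenAE (lower a) →
      (T (rhs a) = a ↔ SolvesHat β ε fun ξ => S ξ + lower a ξ) := by
    intro a ha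
    have h1 : T (rhs a) = a ↔ a + linOp hβ s a = rhs a := by
      constructor
      · intro h
        have := (hT1 (rhs a) (rhs_even a ha)).2
        rwa [h] at this
      · intro h
        rw [← h, hT2 a ha]
    have h2 : a + linOp hβ s a = rhs a ↔
        lower ⇑(a + linOp hβ s a) =ᵐ[volume] lower (rhs a) :=
      ⟨fun h => by rw [h], ext_of_lower⟩
    rw [h1, h2]
    have hlin := lower_linOp hβ s a
    rw [conv_congr_ae hS1.lower_lift (ae_eq_refl _)] at hlin
    have key : ∀ᵐ ξ, (lower ⇑(a + linOp hβ s a) ξ = lower (rhs a) ξ ↔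
        (scaledSymbol β ε ξ : ℂ) * (S ξ + lower a ξ) =
          -conv (fun ξ => S ξ + lower a ξ) (fun ξ => S ξ + lower a ξ) ξ) := by
      filter_upwards [lower_add a (linOp hβ s a), hlin, lower_rhs a, hS.eq] with ξ e1 e2 e3 e4
      rw [e1, e2, e3, conv_add_self (hS1.memLp_two zero_le_one)
        ((memSob_lower_coe a).memLp_two zero_le_one)]
      have hℓ : (scaledSymbol β ε ξ : ℂ) ≠ 0 := by
        exact_mod_cast (hγ.trans_le (hsymε ξ).1).ne'
      have hb := bracket_pos ξ
      have hq : ((γ * bracket ξ ^ 2 : ℝ) : ℂ) ≠ 0 := by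
        exact_mod_cast (by positivity : γ * bracket ξ ^ 2 ≠ 0)
      simp only [hD, hG, limitInv, Complex.ofReal_inv]
      rw [← hγd] at *
      have e5 : S ξ = -((((γ * bracket ξ ^ 2 : ℝ) : ℂ))⁻¹ * conv S S ξ) := by
        rw [← mul_neg, ← e4, inv_mul_cancel_left₀ hq]
      generalize ((γ * bracket ξ ^ 2 : ℝ) : ℂ) = q at *
      generalize (scaledSymbol β ε ξ : ℂ) = ℓ at *
      generalize lower a ξ = r at *
      generalize S ξ = σ at *
      generalize conv S S ξ = c₁ at *
      generalize conv S (lower a) ξ = c₂ at *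
      generalize conv (lower a) (lower a) ξ = c₃ at *
      subst e5
      constructor
      · intro h
        have : r = -((ℓ⁻¹ - q⁻¹) * (c₁ + 2 * c₂)) - ℓ⁻¹ * c₃ - 2 * (q⁻¹ * c₂) := by
          rw [← h]; ring
        rw [this]
        field_simp
        ring
      · intro h
        have h' : -(q⁻¹ * c₁) + r = ℓ⁻¹ * -(c₁ + 2 * c₂ + c₃) := by
          rw [← h, inv_mul_cancel_left₀ hℓ]
        linear_combination h'
    constructor
    · intro h
      filter_upwards [h, key] with ξ h k using k.1 h
    · intro h
      filter_upwards [h, key] with ξ h k using k.2 h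
  have hset : IsClosed {a : FourierL2 | EvenAE (lower a)} := by
    have : {a : FourierL2 | EvenAE (lower a)} = {a | reflect a = a} := by
      ext a; exact (reflect_eq_iff a).symm
    rw [this]
    exact isClosed_eq reflect.continuous continuous_id
  have lower_zero : lower ⇑(0 : FourierL2) =ᵐ[volume] fun _ => 0 := by
    filter_upwards [Lp.coeFn_zero ℂ 2 (volume : Measure ℝ)] with ξ h
    rw [lower, h, Pi.zero_apply, mul_zero]
  have F0 : ‖T (rhs 0)‖ ≤ C₁ * ε ^ 2 := by
    have e : rhs 0 = (-1 : ℂ) • MD (convOp s s) := by simp [hrhs]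
    calc ‖T (rhs 0)‖ ≤ ‖T‖ * ‖rhs 0‖ := T.le_opNorm _
      _ ≤ ‖T‖ * (C * ε ^ 2 * (N * ‖s‖ * ‖s‖)) := by
          rw [e, neg_one_smul, norm_neg]
          gcongr
          exact (norm_mulOp_le hDm hDb _).trans (by gcongr; exact hconv s s)
      _ = (‖T‖ * N * (C * ‖s‖ ^ 2)) * ε ^ 2 := by ring
      _ ≤ C₁ * ε ^ 2 := by
          gcongr
          rw [hC₁]
          have : ‖T‖ * N * (C * ‖s‖ ^ 2) ≤ ‖T‖ * N * (C * ‖s‖ ^ 2 + 2 * C * ‖s‖ + γ⁻¹) := by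
            gcongr
            have : 0 ≤ 2 * C * ‖s‖ + γ⁻¹ := by positivity
            linarith
          linarith
  have FL : ∀ a b, ‖T (rhs a) - T (rhs b)‖ ≤ C₁ * (ε ^ 2 + ‖a‖ + ‖b‖) * ‖a - b‖ := by
    intro a b
    have e : rhs a - rhs b = -((2 : ℂ) • MD (convOp s (a - b))) -
        (MG (convOp (a - b) a) + MG (convOp b (a - b))) := by
      simp only [hrhs, map_add, map_smul, map_sub, sub_apply, smul_sub,
        smul_add, neg_one_smul]
      abel
    have h1 : ‖(2 : ℂ) • MD (convOp s (a - b))‖ ≤ 2 * (C * ε ^ 2 * (N * ‖s‖ * ‖a - b‖)) := by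
      rw [norm_smul, Complex.norm_two]
      gcongr
      exact (norm_mulOp_le hDm hDb _).trans (by gcongr; exact hconv _ _)
    have h2 : ‖MG (convOp (a - b) a)‖ ≤ γ⁻¹ * (N * ‖a - b‖ * ‖a‖) :=
      (norm_mulOp_le hGm hGb _).trans (by gcongr; exact hconv _ _)
    have h3 : ‖MG (convOp b (a - b))‖ ≤ γ⁻¹ * (N * ‖b‖ * ‖a - b‖) :=
      (norm_mulOp_le hGm hGb _).trans (by gcongr; exact hconv _ _)
    have h4 : ‖rhs a - rhs b‖ ≤ 2 * (C * ε ^ 2 * (N * ‖s‖ * ‖a - b‖)) +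
        (γ⁻¹ * (N * ‖a - b‖ * ‖a‖) + γ⁻¹ * (N * ‖b‖ * ‖a - b‖)) := by
      rw [e]
      refine (norm_sub_le _ _).trans ?_
      rw [norm_neg]
      exact add_le_add h1 ((norm_add_le _ _).trans (add_le_add h2 h3))
    rw [← map_sub]
    have hna := norm_nonneg a
    have hnb := norm_nonneg b
    have hnT := norm_nonneg T
    calc ‖T (rhs a - rhs b)‖ ≤ ‖T‖ * ‖rhs a - rhs b‖ := T.le_opNorm _
      _ ≤ ‖T‖ * (2 * (C * ε ^ 2 * (N * ‖s‖ * ‖a - b‖)) +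
        (γ⁻¹ * (N * ‖a - b‖ * ‖a‖) + γ⁻¹ * (N * ‖b‖ * ‖a - b‖))) := by gcongr
      _ = (‖T‖ * N * (2 * C * ‖s‖)) * ε ^ 2 * ‖a - b‖ +
          (‖T‖ * N * γ⁻¹) * (‖a‖ + ‖b‖) * ‖a - b‖ := by ring
      _ ≤ C₁ * ε ^ 2 * ‖a - b‖ + C₁ * (‖a‖ + ‖b‖) * ‖a - b‖ := by
          have hTN : 0 ≤ ‖T‖ * N := by positivity
          have g1 : ‖T‖ * N * (2 * C * ‖s‖) ≤ C₁ := by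
            rw [hC₁]
            have : ‖T‖ * N * (2 * C * ‖s‖) ≤ ‖T‖ * N * (C * ‖s‖ ^ 2 + 2 * C * ‖s‖ + γ⁻¹) := by
              gcongr
              have : 0 ≤ C * ‖s‖ ^ 2 + γ⁻¹ := by positivity
              linarith
            linarith
          have g2 : ‖T‖ * N * γ⁻¹ ≤ C₁ := by
            rw [hC₁]
            have : ‖T‖ * N * γ⁻¹ ≤ ‖T‖ * N * (C * ‖s‖ ^ 2 + 2 * C * ‖s‖ + γ⁻¹) := by
              gcongr
              have : 0 ≤ C * ‖s‖ ^ 2 + 2 * C * ‖s‖ := by positivity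
              linarith
            linarith
          gcongr
      _ = _ := by ring
  obtain ⟨hex, huniq⟩ := hfix {a : FourierL2 | EvenAE (lower a)} (fun a => T (rhs a)) (ε ^ 2)
    hset ((EvenAE.of_forall fun _ => rfl).congr lower_zero.symm)
    (fun a ha => (hT1 _ (rhs_even a ha)).1) (sq_nonneg ε) hη F0 (fun a _ b _ => FL a b)
  have hnorm : ∀ {r : ℝ → ℂ} (hr : MemSob 1 r) {d : ℝ}, 0 ≤ d →
      sobNorm 1 r ≤ ENNReal.ofReal d → ‖hr.lift‖ ≤ d := fun {r} hr {d} hd h => by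
    rw [← hr.enorm_lift, ← ofReal_norm] at h
    exact (ENNReal.ofReal_le_ofReal_iff hd).1 h
  have hsol : ∀ {r : ℝ → ℂ} (hr : MemSob 1 r), EvenAE r →
      SolvesHat β ε (fun ξ => S ξ + r ξ) → T (rhs hr.lift) = hr.lift := fun {r} hr er h => by
    refine (equiv _ (er.congr hr.lower_lift.symm)).2 ?_
    have hae : (fun ξ => S ξ + lower hr.lift ξ) =ᵐ[volume] fun ξ => S ξ + r ξ := by
      filter_upwards [hr.lower_lift] with ξ h; rw [h]
    unfold SolvesHat
    rw [conv_congr_ae hae hae]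
    filter_upwards [h, hae] with ξ h1 h2
    rw [h2, h1]
  refine ⟨?_, fun r₁ r₂ m₁ e₁ n₁ s₁ m₂ e₂ n₂ s₂ => ?_⟩
  · obtain ⟨a, ha, hfa, hna⟩ := hex
    refine ⟨lower a, memSob_lower_coe a, ha, ?_, (equiv a ha).1 hfa⟩
    rw [sobNorm_lower, ← ofReal_norm]
    exact ENNReal.ofReal_le_ofReal hna
  · have := huniq m₁.lift (e₁.congr m₁.lower_lift.symm) m₂.lift (e₂.congr m₂.lower_lift.symm)
      (hnorm m₁ hδ.le n₁) (hnorm m₂ hδ.le n₂) (hsol m₁ e₁ s₁) (hsol m₂ e₂ s₂)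
    have h1 := m₁.lower_lift
    rw [this] at h1
    exact h1.symm.trans m₂.lower_lift

/-! ### Regularity and reality of the solutions -/

theorem conv_conj (f g : ℝ → ℂ) (ξ : ℝ) :
    conv (fun t => (starRingEnd ℂ) (f t)) (fun t => (starRingEnd ℂ) (g t)) ξ =
      (starRingEnd ℂ) (conv f g ξ) := by
  unfold conv
  rw [← integral_conj]
  simp only [map_mul]

theorem sobNorm_conj (s : ℝ) (f : ℝ → ℂ) :
    sobNorm s (fun ξ => (starRingEnd ℂ) (f ξ)) = sobNorm s f :=
  eLpNorm_congr_norm_ae (Eventually.of_forall fun ξ => by simp)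

theorem MemSob.conj {s : ℝ} {f : ℝ → ℂ} (hf : MemSob s f) :
    MemSob s fun ξ => (starRingEnd ℂ) (f ξ) :=
  (memSob_iff (Complex.continuous_conj.comp_aestronglyMeasurable hf.aestronglyMeasurable)).2
    ((sobNorm_conj s f).trans_lt hf.lt_top)

theorem EvenAE.conj {f : ℝ → ℂ} (hf : EvenAE f) : EvenAE fun ξ => (starRingEnd ℂ) (f ξ) := by
  filter_upwards [hf] with ξ h
  rw [h]

theorem IsSolitonHat.conj {β : ℝ} {S : ℝ → ℂ} (hS : IsSolitonHat β S) :
    (fun ξ => (starRingEnd ℂ) (S ξ)) =ᵐ[volume] S := by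
  have hS1 := hS.memSobAll 1
  refine hS1.conj.ae_eq_of_fourierInv_eq hS1 ?_
  have h1 : (fun ξ => (starRingEnd ℂ) (S ξ)) =ᵐ[volume] fun ξ => (starRingEnd ℂ) (S (-ξ)) := by
    filter_upwards [hS.even] with ξ h
    rw [h]
  rw [fourierInv_congr_ae h1]
  ext x
  rw [fourierInv_conj_comp_neg, hS.fourierInv, Complex.conj_ofReal]

theorem SolvesHat.congr {β ε : ℝ} {f g : ℝ → ℂ} (hf : SolvesHat β ε f) (h : f =ᵐ[volume] g) :
    SolvesHat β ε g := by
  unfold SolvesHat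
  rw [← conv_congr_ae h h]
  filter_upwards [hf, h] with ξ h1 h2
  rw [← h2, h1]

theorem SolvesHat.conj {β ε : ℝ} {f : ℝ → ℂ} (hf : SolvesHat β ε f) :
    SolvesHat β ε fun ξ => (starRingEnd ℂ) (f ξ) := by
  filter_upwards [hf] with ξ h
  rw [conv_conj, ← map_neg, ← h, map_mul, Complex.conj_ofReal]

/-- Since the inverse of the symbol decays like `⟨k⟩^{-1/2}`, small solutions gain half a derivative
at a time: `r = -(G - G₀)(S ⋆ S) - G (2 S ⋆ r + r ⋆ r)`, where the first term is smooth and of size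
`O(ε²)`. -/
theorem sobNorm_bootstrap {β : ℝ} (hβ : 1 / 3 < β) {S : ℝ → ℂ} (hS : IsSolitonHat β S) {K : ℝ}
    (hK : 0 < K) (n : ℕ) : ∃ K' : ℝ, 0 < K' ∧ ∀ ε : ℝ, 0 < ε → ε ≤ 1 → ∀ r, MemSob 1 r →
      sobNorm 1 r ≤ ENNReal.ofReal (K * ε ^ 2) → SolvesHat β ε (fun ξ => S ξ + r ξ) →
      MemSob (1 + n / 2) r ∧ sobNorm (1 + n / 2) r ≤ ENNReal.ofReal (K' * ε ^ 2) := by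
  obtain ⟨C, hC, hsym⟩ := scaledSymbol_bounds hβ
  have hγ := dispCoeff_pos hβ
  induction n with
  | zero =>
    refine ⟨K, hK, fun ε hε hε1 r hr hn _ => ?_⟩
    simpa using ⟨hr, hn⟩
  | succ n ih =>
    obtain ⟨K₁, hK₁, ih⟩ := ih
    set s : ℝ := 1 + n / 2 with hs
    have hs1 : 1 ≤ s := by rw [hs]; have := n.cast_nonneg (α := ℝ); linarith
    have hs' : (1 + (n + 1 : ℕ) / 2 : ℝ) = s + 1 / 2 := by rw [hs]; push_cast; ring
    rw [hs']
    have hSS : MemSob (s + 1 / 2) (conv S S) :=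
      memSob_conv (by linarith) (hS.memSobAll _) (hS.memSobAll _)
    set a := (sobNorm (s + 1 / 2) (conv S S)).toReal with ha
    set b := (ENNReal.ofReal (2 ^ s) * embConst).toReal with hb
    set σ := (sobNorm s S).toReal with hσ
    set σ₁ := (sobNorm 1 S).toReal with hσ₁
    have hSs := (hS.memSobAll s).lt_top
    have hSs1 := (hS.memSobAll 1).lt_top
    have hemb := embConst_lt_top
    refine ⟨C * a + C * (2 * (b * (σ * K + σ₁ * K₁)) + b * (K₁ * K + K * K₁)) + 1,
      by positivity, fun ε hε hε1 r hr hn hsol => ?_⟩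
    obtain ⟨hrs, hns⟩ := ih ε hε hε1 r hr hn hsol
    have hsymε := hsym ε hε hε1
    set G : ℝ → ℂ := fun ξ => (((scaledSymbol β ε ξ)⁻¹ : ℝ) : ℂ) with hG
    have hGm : AEStronglyMeasurable G :=
      (Complex.measurable_ofReal.comp (measurable_scaledSymbol β ε).inv).aestronglyMeasurable
    have hGb : ∀ ξ, ‖G ξ‖ ≤ C * bracket ξ ^ (-(1 / 2) : ℝ) := fun ξ => by
      have h1 := (hsymε ξ).1
      rw [hG, Complex.norm_real, Real.norm_of_nonneg (inv_nonneg.2 (hγ.le.trans h1))]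
      exact (hsymε ξ).2.1
    set D : ℝ → ℂ := fun ξ => G ξ - limitInv β ξ with hD
    have hDm : AEStronglyMeasurable D := hGm.sub (aestronglyMeasurable_limitInv hβ)
    have hDb : ∀ ξ, ‖D ξ‖ ≤ C * ε ^ 2 * bracket ξ ^ (0 : ℝ) := fun ξ => by
      have h1 := (hsymε ξ).2.2
      simp only [hD, hG, limitInv]
      rw [← Complex.ofReal_sub, Complex.norm_real, Real.norm_eq_abs, Real.rpow_zero, mul_one]
      exact h1
    have hS2 := (hS.memSobAll 1).memLp_two zero_le_one
    have hr2 := hr.memLp_two zero_le_one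
    have hSr : MemSob s (conv S r) := memSob_conv hs1 (hS.memSobAll s) hrs
    have hrr : MemSob s (conv r r) := memSob_conv hs1 hrs hrs
    set q : ℝ → ℂ := fun ξ => 2 * conv S r ξ + conv r r ξ with hq
    have hqs : MemSob s q := (hSr.const_mul 2).add hrr
    have hA : MemSob (s + 1 / 2) fun ξ => D ξ * conv S S ξ :=
      MemSob.mul (a := 0) (by simpa using hSS) hDm hDb
    have hB : MemSob (s + 1 / 2) fun ξ => G ξ * q ξ :=
      MemSob.mul (a := -(1 / 2)) (by simpa using hqs) hGm hGb
    have hrep : r =ᵐ[volume] fun ξ => (-1) * (D ξ * conv S S ξ + G ξ * q ξ) := by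
      filter_upwards [hsol, hS.eq] with ξ h1 h2
      rw [conv_add_self hS2 hr2] at h1
      have hℓ : (scaledSymbol β ε ξ : ℂ) ≠ 0 := by
        exact_mod_cast (hγ.trans_le (hsymε ξ).1).ne'
      have hbr := bracket_pos ξ
      have hq0 : ((dispCoeff β * bracket ξ ^ 2 : ℝ) : ℂ) ≠ 0 := by
        exact_mod_cast (by positivity : dispCoeff β * bracket ξ ^ 2 ≠ 0)
      have e1 : S ξ = -(limitInv β ξ * conv S S ξ) := by
        rw [limitInv, ← mul_neg, ← h2, Complex.ofReal_inv, inv_mul_cancel_left₀ hq0]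
      have e2 : S ξ + r ξ = -(G ξ * (conv S S ξ + 2 * conv S r ξ + conv r r ξ)) := by
        rw [← mul_neg, ← h1]
        simp only [hG]
        rw [Complex.ofReal_inv, inv_mul_cancel_left₀ hℓ]
      simp only [hD, hq]
      linear_combination e2 - e1
    have hnA : sobNorm (s + 1 / 2) (fun ξ => D ξ * conv S S ξ) ≤
        ENNReal.ofReal (C * a * ε ^ 2) := by
      refine (sobNorm_mul_le hDb).trans (le_of_eq ?_)
      rw [add_zero, ← ENNReal.ofReal_toReal hSS.lt_top.ne, ← ha,
        ← ENNReal.ofReal_mul (by positivity)]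
      congr 1; ring
    have hcv : ∀ {f g : ℝ → ℂ} {x₁ x₂ y₁ y₂ : ℝ}, AEStronglyMeasurable f →
        AEStronglyMeasurable g → 0 ≤ x₁ → 0 ≤ x₂ → 0 ≤ y₁ → 0 ≤ y₂ →
        sobNorm s f ≤ ENNReal.ofReal x₁ → sobNorm 1 f ≤ ENNReal.ofReal x₂ →
        sobNorm s g ≤ ENNReal.ofReal y₁ → sobNorm 1 g ≤ ENNReal.ofReal y₂ →
        sobNorm s (conv f g) ≤ ENNReal.ofReal (b * (x₁ * y₂ + x₂ * y₁)) := by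
      intro f g x₁ x₂ y₁ y₂ mf mg p1 p2 p3 p4 h1 h2 h3 h4
      refine (sobNorm_conv_le (by linarith) mf mg).trans ?_
      rw [ENNReal.ofReal_mul (by positivity), ENNReal.ofReal_add (by positivity) (by positivity),
        ENNReal.ofReal_mul p1, ENNReal.ofReal_mul p2, hb,
        ENNReal.ofReal_toReal (by finiteness)]
      gcongr
    have tS := ENNReal.ofReal_toReal hSs.ne
    have tS1 := ENNReal.ofReal_toReal hSs1.ne
    have n1 : sobNorm s (conv S r) ≤
        ENNReal.ofReal (b * (σ * (K * ε ^ 2) + σ₁ * (K₁ * ε ^ 2))) :=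
      hcv (hS.memSobAll 1).aestronglyMeasurable hr.aestronglyMeasurable (by positivity)
        (by positivity) (by positivity) (by positivity) tS.ge tS1.ge hns hn
    have n2 : sobNorm s (conv r r) ≤
        ENNReal.ofReal (b * (K₁ * ε ^ 2 * (K * ε ^ 2) + K * ε ^ 2 * (K₁ * ε ^ 2))) :=
      hcv hr.aestronglyMeasurable hr.aestronglyMeasurable (by positivity)
        (by positivity) (by positivity) (by positivity) hns hn hns hn
    have nq : sobNorm s q ≤ ENNReal.ofReal
        ((2 * (b * (σ * K + σ₁ * K₁)) + b * (K₁ * K + K * K₁)) * ε ^ 2) := by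
      have hε2 : ε ^ 2 ≤ 1 := pow_le_one₀ hε.le hε1
      have e : (2 * (b * (σ * K + σ₁ * K₁)) + b * (K₁ * K + K * K₁)) * ε ^ 2 =
        2 * (b * (σ * (K * ε ^ 2) + σ₁ * (K₁ * ε ^ 2))) +
          b * (K₁ * ε ^ 2 * K + K * (K₁ * ε ^ 2)) := by ring
      rw [e, ENNReal.ofReal_add (by positivity) (by positivity), ENNReal.ofReal_mul (by norm_num)]
      refine (sobNorm_add_le (hSr.const_mul 2).aestronglyMeasurable
        hrr.aestronglyMeasurable).trans (add_le_add ?_ (n2.trans (ENNReal.ofReal_le_ofReal ?_)))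
      · rw [sobNorm_const_mul]
        refine mul_le_mul' (le_of_eq ?_) n1
        rw [← ofReal_norm]; norm_num
      · have h1 : K * ε ^ 2 ≤ K * 1 := by gcongr
        rw [mul_one] at h1
        gcongr
    have hnB : sobNorm (s + 1 / 2) (fun ξ => G ξ * q ξ) ≤ ENNReal.ofReal
        (C * ((2 * (b * (σ * K + σ₁ * K₁)) + b * (K₁ * K + K * K₁)) * ε ^ 2)) := by
      refine (sobNorm_mul_le hGb).trans ?_
      rw [ENNReal.ofReal_mul hC.le, show s + 1 / 2 + -(1 / 2) = s by ring]
      gcongr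
    refine ⟨((hA.add hB).const_mul (-1)).congr hrep.symm, ?_⟩
    rw [sobNorm_congr hrep, sobNorm_const_mul, enorm_neg, enorm_one, one_mul]
    refine (sobNorm_add_le hA.aestronglyMeasurable hB.aestronglyMeasurable).trans
      ((add_le_add hnA hnB).trans ?_)
    rw [← ENNReal.ofReal_add (by positivity) (by positivity)]
    refine ENNReal.ofReal_le_ofReal ?_
    have : 0 ≤ ε ^ 2 := sq_nonneg ε
    linarith

/-- Smooth real solutions near the soliton. The complex conjugate of a solution is a solution in the
same ball, so reality follows from uniqueness. -/
theorem exists_smooth_solution {β : ℝ} (hβ : 1 / 3 < β) {S : ℝ → ℂ} (hS : IsSolitonHat β S) :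
    ∃ ε₀ δ : ℝ, ∃ K : ℕ → ℝ, 0 < ε₀ ∧ ε₀ ≤ 1 ∧ 0 < δ ∧ (∀ n, 0 < K n) ∧
      ∀ ε : ℝ, 0 < ε → ε ≤ ε₀ → ∃ r, MemSobAll r ∧ EvenAE r ∧
        (∀ x, ((𝓕⁻ r x).re : ℂ) = 𝓕⁻ r x) ∧ SolvesHat β ε (fun ξ => S ξ + r ξ) ∧
        (∀ n : ℕ, sobNorm n r ≤ ENNReal.ofReal (K n * ε ^ 2)) ∧
        ∀ r₂, MemSob 1 r₂ → EvenAE r₂ → sobNorm 1 r₂ ≤ ENNReal.ofReal δ →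
          SolvesHat β ε (fun ξ => S ξ + r₂ ξ) → r₂ =ᵐ[volume] r := by
  obtain ⟨ε₀, δ, K, hε₀, hε₀1, hδ, hK, h⟩ := exists_solution hβ hS
  choose K' hK' hboot using fun n => sobNorm_bootstrap hβ hS hK n
  refine ⟨min ε₀ (δ / K), δ, fun n => K' (2 * n), by positivity,
    (min_le_left _ _).trans hε₀1, hδ, fun n => hK' _, fun ε hε hε0 => ?_⟩
  have hε1 : ε ≤ 1 := hε0.trans ((min_le_left _ _).trans hε₀1)
  obtain ⟨⟨r, hr, er, nr, sr⟩, huniq⟩ := h ε hε (hε0.trans (min_le_left _ _))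
  have hsmall : K * ε ^ 2 ≤ δ := by
    calc K * ε ^ 2 ≤ K * (δ / K) := by
          gcongr
          exact (pow_le_of_le_one hε.le hε1 (by norm_num)).trans (hε0.trans (min_le_right _ _))
      _ = δ := by field_simp
  have nr' : sobNorm 1 r ≤ ENNReal.ofReal δ := nr.trans (ENNReal.ofReal_le_ofReal hsmall)
  have hreg := fun n => hboot n ε hε hε1 r hr nr sr
  refine ⟨r, fun s => ?_, er, ?_, sr, fun n => ?_, fun r₂ m₂ e₂ n₂ s₂ =>
    huniq r₂ r m₂ e₂ n₂ s₂ hr er nr' sr⟩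
  · obtain ⟨n, hn⟩ := exists_nat_ge (2 * s)
    exact (hreg n).1.mono (by linarith)
  · have hc : (fun ξ => (starRingEnd ℂ) (r ξ)) =ᵐ[volume] r := by
      refine huniq _ r hr.conj er.conj ((sobNorm_conj 1 r).trans_le nr') ?_ hr er nr' sr
      refine sr.conj.congr ?_
      filter_upwards [hS.conj] with ξ h
      rw [map_add, h]
    intro x
    have h1 : (fun ξ => (starRingEnd ℂ) (r (-ξ))) =ᵐ[volume] r := by
      filter_upwards [hc, er] with ξ h1 h2
      rw [h2, h1]
    rw [← Complex.conj_eq_iff_re, ← fourierInv_conj_comp_neg, fourierInv_congr_ae h1]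
  · have := (hreg (2 * n)).2
    refine (sobNorm_mono ?_ r).trans this
    push_cast; linarith

/-! ### The profile equation in physical variables -/

theorem quasiMeasurePreserving_mul_left {a : ℝ} (ha : a ≠ 0) :
    Measure.QuasiMeasurePreserving (fun ξ : ℝ => a * ξ) volume volume :=
  ⟨by fun_prop, by
    rw [Real.map_volume_mul_left ha]; exact Measure.smul_absolutelyContinuous⟩

theorem ae_comp_div_iff {ε : ℝ} (hε : 0 < ε) {P : ℝ → Prop} :
    (∀ᵐ ξ, P (ξ / ε)) ↔ ∀ᵐ ξ, P ξ := by
  constructor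
  · intro h
    filter_upwards [(quasiMeasurePreserving_mul_left hε.ne').ae h] with ξ h1
    rwa [mul_div_cancel_left₀ _ hε.ne'] at h1
  · intro h
    filter_upwards [(quasiMeasurePreserving_mul_left (inv_ne_zero hε.ne')).ae h] with ξ h1
    rwa [div_eq_inv_mul]

/-- The transform of `x ↦ ε² z(εx)`, where `f` is the transform of `z`: one of the two powers of `ε` is
absorbed by the change of variables. -/
noncomputable def dilateHat (ε : ℝ) (f : ℝ → ℂ) (ξ : ℝ) : ℂ := (ε : ℂ) * f (ξ / ε)

theorem fourierInv_dilateHat {ε : ℝ} (hε : 0 < ε) (f : ℝ → ℂ) (x : ℝ) :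
    𝓕⁻ (dilateHat ε f) x = (ε : ℂ) ^ 2 * 𝓕⁻ f (ε * x) := by
  have hε0 : (ε : ℂ) ≠ 0 := by exact_mod_cast hε.ne'
  rw [← fourierInv_comp_mul f hε x, ← fourierInv_const_mul]
  have : dilateHat ε f = fun ξ => (ε : ℂ) ^ 2 * ((ε : ℂ)⁻¹ * f (ξ / ε)) := by
    ext ξ
    rw [dilateHat]
    field_simp
  rw [this]

theorem memSob_dilateHat {ε : ℝ} (hε : 0 < ε) {f : ℝ → ℂ} (hf : MemSob 1 f) :
    MemSob 1 (dilateHat ε f) := by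
  have hm : AEStronglyMeasurable fun ξ => f (ξ / ε) :=
    ((hf.integrable le_rfl).comp_div hε.ne').1
  have h2 : Integrable fun ξ => ‖((bracket (ξ / ε) ^ (1 : ℝ) : ℝ) : ℂ) * f (ξ / ε)‖ ^ 2 :=
    ((memLp_two_iff_integrable_sq_norm hf.1).1 hf).comp_div hε.ne'
  have h3 : MemLp (fun ξ => ((bracket (ξ / ε) ^ (1 : ℝ) : ℝ) : ℂ) * f (ξ / ε)) 2 := by
    refine (memLp_two_iff_integrable_sq_norm (AEStronglyMeasurable.mul ?_ hm)).2 h2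
    exact ((Complex.continuous_ofReal.comp (continuous_bracket_rpow 1)).comp
      (by fun_prop : Continuous fun ξ : ℝ => ξ / ε)).aestronglyMeasurable
  refine h3.of_le_mul (c := (1 + ε) * ε) ((aestronglyMeasurable_bracket_rpow 1).mul
    (aestronglyMeasurable_const.mul hm)) (Eventually.of_forall fun ξ => ?_)
  rw [enorm_bracket_mul, norm_mul ((bracket (ξ / ε) ^ (1 : ℝ) : ℝ) : ℂ), Complex.norm_real,
    Real.rpow_one, Real.rpow_one, Real.norm_of_nonneg (bracket_pos _).le, dilateHat, norm_mul,
    Complex.norm_real, Real.norm_of_nonneg hε.le]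
  have hb : bracket ξ ≤ (1 + ε) * bracket (ξ / ε) := by
    have h0 := bracket_pos (ξ / ε)
    refine Real.sqrt_le_left (by positivity) |>.2 ?_
    rw [mul_pow (1 + ε), bracket_sq]
    have e : (2 * Real.pi * ξ) ^ 2 = ε ^ 2 * (2 * Real.pi * (ξ / ε)) ^ 2 := by field_simp
    rw [e]
    nlinarith [sq_nonneg (2 * Real.pi * (ξ / ε)), mul_nonneg hε.le (sq_nonneg (2 * Real.pi * (ξ / ε)))]
  calc bracket ξ * (ε * ‖f (ξ / ε)‖) ≤ ((1 + ε) * bracket (ξ / ε)) * (ε * ‖f (ξ / ε)‖) := by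
        gcongr
    _ = _ := by ring

theorem conv_dilateHat {ε : ℝ} (hε : 0 < ε) (f : ℝ → ℂ) (ξ : ℝ) :
    conv (dilateHat ε f) (dilateHat ε f) ξ = (ε : ℂ) ^ 3 * conv f f (ξ / ε) := by
  unfold conv dilateHat
  have h := Measure.integral_comp_div (fun t : ℝ => (ε : ℂ) ^ 2 * (f t * f (ξ / ε - t))) ε
  rw [abs_of_pos hε, integral_const_mul _ (fun t => f t * f (ξ / ε - t)), Complex.real_smul] at h
  rw [show (ε : ℂ) ^ 3 * ∫ t, f t * f (ξ / ε - t) =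
    (ε : ℂ) * ((ε : ℂ) ^ 2 * ∫ t, f t * f (ξ / ε - t)) by ring, ← h]
  refine integral_congr_ae (Eventually.of_forall fun t => ?_)
  simp only [sub_div]
  ring

/-- The profile equation for `w(x) = ε² z(εx)` in terms of the transform of `z`. -/
theorem solvesProfileEquation_iff {β ε : ℝ} (hε : 0 < ε) {f : ℝ → ℂ} (hf : MemSob 1 f)
    {z w : ℝ → ℝ} (hz : ∀ x, (z x : ℂ) = 𝓕⁻ f x) (hw : ∀ x, w x = ε ^ 2 * z (ε * x)) :
    SolvesProfileEquation β (speed β ε) w ↔ SolvesHat β ε f := by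
  set W := dilateHat ε f with hW
  have mW : MemSob 1 W := memSob_dilateHat hε hf
  have hwW : ∀ x, (w x : ℂ) = 𝓕⁻ W x := fun x => by
    rw [hW, fourierInv_dilateHat hε, ← hz, hw]; push_cast; ring
  have mWW := memSob_conv le_rfl mW mW
  set V : ℝ → ℂ := fun ξ => (speed β ε : ℂ) * W ξ + (-1) * conv W W ξ with hV
  have mV : MemSob 1 V := (mW.const_mul _).add (mWW.const_mul (-1))
  have hv : ∀ x, ((speed β ε * w x - w x ^ 2 : ℝ) : ℂ) = 𝓕⁻ V x := fun x => by
    rw [hV, (mW.const_mul _).fourierInv_add (mWW.const_mul (-1)), fourierInv_const_mul,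
      fourierInv_const_mul, mW.fourierInv_conv mW, ← hwW]
    push_cast; ring
  have h1 : SolvesProfileEquation β (speed β ε) w ↔
      IsMultiplierImage (phaseSpeed β) w fun x => speed β ε * w x - w x ^ 2 := by
    constructor
    · rintro ⟨g, hg, h⟩
      have : g = fun x => speed β ε * w x - w x ^ 2 := by ext x; linarith [h x]
      rwa [this] at hg
    · exact fun h => ⟨_, h, fun x => by ring⟩
  rw [h1, isMultiplierImage_iff mW (mV.memLp_two zero_le_one) (mV.integrable le_rfl) hwW hv,
    SolvesHat, ← ae_comp_div_iff hε
      (P := fun ξ => (scaledSymbol β ε ξ : ℂ) * f ξ = -conv f f ξ)]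
  refine eventually_congr (Eventually.of_forall fun ξ => ?_)
  have hε0 : (ε : ℂ) ≠ 0 := by exact_mod_cast hε.ne'
  have e1 : (phaseSpeed β (2 * Real.pi * ξ) : ℂ) =
      (ε : ℂ) ^ 2 * (scaledSymbol β ε (ξ / ε) : ℂ) + (speed β ε : ℂ) := by
    have : ε * (2 * Real.pi * (ξ / ε)) = 2 * Real.pi * ξ := by field_simp
    rw [scaledSymbol, this]
    push_cast
    field_simp
    ring
  simp only [hV]
  rw [e1, hW, conv_dilateHat hε, dilateHat]
  generalize f (ξ / ε) = F
  generalize conv f f (ξ / ε) = Q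
  generalize (scaledSymbol β ε (ξ / ε) : ℂ) = ℓ
  generalize (speed β ε : ℂ) = c
  have hε3 : (ε : ℂ) ^ 3 ≠ 0 := pow_ne_zero _ hε0
  constructor
  · intro h
    have : (ε : ℂ) ^ 3 * (ℓ * F + Q) = 0 := by linear_combination -h
    rcases mul_eq_zero.1 this with h' | h'
    · exact absurd h' hε3
    · linear_combination h'
  · intro h
    linear_combination (-(ε : ℂ) ^ 3) * h

theorem profile_eq (β ε : ℝ) {R ρ : ℝ → ℝ} (hR : ∀ x, R x = ε ^ 2 * ρ x) (x : ℝ) :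
    profile β ε R x = ε ^ 2 * (soliton β (ε * x) + ρ (ε * x)) := by
  rw [profile, hR, soliton, sechSq, dispCoeff]
  ring

theorem IsSolitonHat.fourierInv_add {β : ℝ} {S r : ℝ → ℂ} (hS : IsSolitonHat β S)
    (hr : MemSob 1 r) {ρ : ℝ → ℝ} (hρ : ∀ x, (ρ x : ℂ) = 𝓕⁻ r x) (x : ℝ) :
    ((soliton β x + ρ x : ℝ) : ℂ) = 𝓕⁻ (fun ξ => S ξ + r ξ) x := by
  rw [(hS.memSobAll 1).fourierInv_add hr, hS.fourierInv, ← hρ, Complex.ofReal_add]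

/-- A smooth solution of the transformed equation gives a correction. -/
theorem isCorrection_of_solvesHat {β ε : ℝ} (hε : 0 < ε) {S r : ℝ → ℂ} (hS : IsSolitonHat β S)
    (hr : MemSobAll r) (er : EvenAE r) (hre : ∀ x, ((𝓕⁻ r x).re : ℂ) = 𝓕⁻ r x)
    (sr : SolvesHat β ε fun ξ => S ξ + r ξ) {K : ℕ → ℝ}
    (hn : ∀ n : ℕ, sobNorm n r ≤ ENNReal.ofReal (K n * ε ^ 2)) :
    IsCorrection β ε K fun x => ε ^ 2 * (𝓕⁻ r x).re := by
  have hm : MemSobAll fun ξ => ((ε ^ 2 : ℝ) : ℂ) * r ξ := fun s => (hr s).const_mul _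
  have hR : ∀ x, ((ε ^ 2 * (𝓕⁻ r x).re : ℝ) : ℂ) = 𝓕⁻ (fun ξ => ((ε ^ 2 : ℝ) : ℂ) * r ξ) x :=
    fun x => by rw [fourierInv_const_mul, ← hre x, Complex.ofReal_mul]; simp
  refine ⟨hm.contDiff hR, fun x => ?_, fun n => (hm.memLp_iteratedDeriv hR n).1,
    fun n => (hm.memLp_iteratedDeriv hR n).2.2, ?_, fun n => ?_⟩
  · simp only [er.fourierInv]
  · exact (solvesProfileEquation_iff hε ((hS.memSobAll 1).add (hr 1))
      (hS.fourierInv_add (hr 1) hre) (profile_eq β ε fun _ => rfl)).2 sr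
  · refine (hm.memLp_iteratedDeriv hR n).2.1.trans ?_
    rw [sobNorm_const_mul, ← ofReal_norm, Complex.norm_real, Real.norm_of_nonneg (sq_nonneg ε)]
    calc _ ≤ ENNReal.ofReal (ε ^ 2) * ENNReal.ofReal (K n * ε ^ 2) := by gcongr; exact hn n
      _ = _ := by rw [← ENNReal.ofReal_mul (sq_nonneg ε)]; congr 1; ring

/-- A correction comes from an even solution `r` of the transformed equation. The first two bounds alone
control `r` in `H¹`, and `O(ε⁴)` becomes `O(ε²)` after rescaling. The constants may be negative here,
hence the absolute values. -/
theorem IsCorrection.exists_hat {β ε : ℝ} (hε : 0 < ε) {S : ℝ → ℂ} (hS : IsSolitonHat β S)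
    {C : ℕ → ℝ} {R : ℝ → ℝ} (hR : IsCorrection β ε C R) {δ : ℝ}
    (hδ : (|C 0| + |C 1|) * ε ^ 2 ≤ δ) :
    ∃ r, MemSob 1 r ∧ EvenAE r ∧ sobNorm 1 r ≤ ENNReal.ofReal δ ∧
      SolvesHat β ε (fun ξ => S ξ + r ξ) ∧ ∀ x, R x = ε ^ 2 * (𝓕⁻ r x).re := by
  have hε2 : 0 < ε ^ 2 := by positivity
  have hd : ∀ x, HasDerivAt R (iteratedDeriv 1 R x) x := fun x => by
    rw [iteratedDeriv_one]
    exact ((hR.smooth.differentiable (by simp)) x).hasDerivAt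
  set u : ℝ → ℂ := fun x => ((ε ^ 2)⁻¹ * R x : ℝ) with hu
  set u' : ℝ → ℂ := fun x => ((ε ^ 2)⁻¹ * iteratedDeriv 1 R x : ℝ) with hu'
  have m0 : MemLp u 2 := by
    have := hR.memLp 0
    rw [iteratedDeriv_zero] at this
    exact (this.const_mul _).ofReal
  have m1 : MemLp u' 2 := ((hR.memLp 1).const_mul _).ofReal
  have hdu : ∀ x, HasDerivAt u (u' x) x := fun x => ((hd x).const_mul _).ofReal_comp
  obtain ⟨r, hr, ir, nr, -⟩ := exists_fourierInv_eq hdu m0 m1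
  have hnorm : ∀ (v : ℝ → ℝ) (c : ℝ), eLpNorm v 2 ≤ ENNReal.ofReal (c * ε ^ 4) →
      eLpNorm (fun x => (((ε ^ 2)⁻¹ * v x : ℝ) : ℂ)) 2 ≤ ENNReal.ofReal (|c| * ε ^ 2) := by
    intro v c h
    have h1 : eLpNorm (fun x => (((ε ^ 2)⁻¹ * v x : ℝ) : ℂ)) 2 =
        eLpNorm ((ε ^ 2)⁻¹ • v) 2 :=
      eLpNorm_congr_norm_ae (Eventually.of_forall fun x => by simp)
    rw [h1, eLpNorm_const_smul, ← ofReal_norm, Real.norm_of_nonneg (by positivity)]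
    calc _ ≤ ENNReal.ofReal (ε ^ 2)⁻¹ * ENNReal.ofReal (|c| * ε ^ 4) := by
          gcongr
          refine h.trans (ENNReal.ofReal_le_ofReal ?_)
          gcongr
          exact le_abs_self c
      _ = _ := by
          rw [← ENNReal.ofReal_mul (by positivity)]
          congr 1
          field_simp
  have hρ : ∀ x, (((ε ^ 2)⁻¹ * R x : ℝ) : ℂ) = 𝓕⁻ r x := fun x => (congrFun ir x).symm
  have hRr : ∀ x, R x = ε ^ 2 * ((ε ^ 2)⁻¹ * R x) := fun x => by field_simp
  refine ⟨r, hr, evenAE_of_fourierInv hr fun x => ?_, ?_, ?_, fun x => ?_⟩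
  · rw [← hρ, ← hρ, hR.even]
  · refine nr.trans ((add_le_add (hnorm R (C 0) ?_) (hnorm _ _ (hR.bound 1))).trans ?_)
    · have := hR.bound 0
      rwa [iteratedDeriv_zero] at this
    · rw [← ENNReal.ofReal_add (by positivity) (by positivity), ← add_mul]
      exact ENNReal.ofReal_le_ofReal hδ
  · exact (solvesProfileEquation_iff hε ((hS.memSobAll 1).add hr)
      (hS.fourierInv_add hr hρ) (profile_eq β ε hRr)).1 hR.solves
  · rw [← hρ, Complex.ofReal_re, ← hRr]

/-! ### Fourier multipliers with analytic symbols and exponential weights -/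

/-- The Fourier integral `∫ p(y) e^{-iky} dy` at a complex wave number `k`. -/
noncomputable def waveTransform (p : ℝ → ℂ) (k : ℂ) : ℂ :=
  ∫ y : ℝ, p y * Complex.exp (-(Complex.I * k * y))

theorem norm_cexp_wave (k : ℂ) (y : ℝ) :
    ‖Complex.exp (-(Complex.I * k * y))‖ = Real.exp (k.im * y) := by
  rw [Complex.norm_exp]; simp

theorem norm_cexp_wave_le {k : ℂ} {b : ℝ} (hk : |k.im| ≤ b) (y : ℝ) :
    ‖Complex.exp (-(Complex.I * k * y))‖ ≤ Real.exp (b * |y|) := by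
  rw [norm_cexp_wave, Real.exp_le_exp]
  calc k.im * y ≤ |k.im * y| := le_abs_self _
    _ = |k.im| * |y| := abs_mul _ _
    _ ≤ b * |y| := by gcongr

theorem integrable_mul_of_hasCompactSupport {p g : ℝ → ℂ} (hp : Continuous p)
    (hc : HasCompactSupport p) (hg : Continuous g) : Integrable (fun y => p y * g y) :=
  (hp.mul hg).integrable_of_hasCompactSupport hc.mul_right

theorem differentiable_waveTransform {p : ℝ → ℂ} (hp : Continuous p) (hc : HasCompactSupport p) :
    Differentiable ℂ (waveTransform p) := by
  intro k
  have hb : ∀ z ∈ Metric.ball k 1, |z.im| ≤ |k.im| + 1 := fun z hz => by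
    have h1 : |(z - k).im| ≤ 1 := (Complex.abs_im_le_norm _).trans (mem_ball_iff_norm.1 hz).le
    rw [Complex.sub_im] at h1
    have := abs_sub_abs_le_abs_sub z.im k.im
    linarith
  have := hasDerivAt_integral_of_dominated_loc_of_deriv_le (μ := (volume : Measure ℝ))
    (F := fun (k : ℂ) (y : ℝ) => p y * Complex.exp (-(Complex.I * k * y)))
    (F' := fun (k : ℂ) (y : ℝ) => p y * (Complex.exp (-(Complex.I * k * y)) * -(Complex.I * y)))
    (bound := fun y => ‖p y * ((Real.exp ((|k.im| + 1) * |y|) * |y| : ℝ) : ℂ)‖)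
    (Metric.ball_mem_nhds k one_pos)
    (Eventually.of_forall fun z => (by fun_prop : Continuous fun y : ℝ =>
      p y * Complex.exp (-(Complex.I * z * y))).aestronglyMeasurable)
    (integrable_mul_of_hasCompactSupport hp hc (by fun_prop))
    (by fun_prop : Continuous fun y : ℝ =>
      p y * (Complex.exp (-(Complex.I * k * y)) * -(Complex.I * y))).aestronglyMeasurable
    (Eventually.of_forall fun y z hz => by
      rw [norm_mul, norm_mul, norm_mul]
      refine mul_le_mul_of_nonneg_left ?_ (norm_nonneg _)
      rw [norm_neg, norm_mul, Complex.norm_I, one_mul, Complex.norm_real, Complex.norm_real,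
        Real.norm_eq_abs, Real.norm_eq_abs, abs_mul, abs_abs, Real.abs_exp]
      gcongr
      exact norm_cexp_wave_le (hb z hz) y)
    (integrable_mul_of_hasCompactSupport hp hc (by fun_prop)).norm
    (Eventually.of_forall fun y z _ => by
      refine HasDerivAt.const_mul _ (HasDerivAt.cexp ?_)
      have := ((hasDerivAt_id z).const_mul Complex.I).mul_const (y : ℂ)
      simpa using this.fun_neg)
  exact this.2.differentiableAt

theorem waveTransform_deriv {p p' : ℝ → ℂ} (hp : ∀ y, HasDerivAt p (p' y) y)
    (hp' : Continuous p') (hc : HasCompactSupport p) (hc' : HasCompactSupport p') (k : ℂ) :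
    waveTransform p' k = Complex.I * k * waveTransform p k := by
  have hpc : Continuous p := continuous_iff_continuousAt.2 fun y => (hp y).continuousAt
  have hd : ∀ y : ℝ, HasDerivAt (fun y : ℝ => Complex.exp (-(Complex.I * k * y)))
      (Complex.exp (-(Complex.I * k * y)) * -(Complex.I * k)) y := fun y => by
    refine HasDerivAt.cexp ?_
    have := (hasDerivAt_id y).ofReal_comp.const_mul (Complex.I * k)
    simpa using this.fun_neg
  have h := integral_mul_deriv_eq_deriv_mul_of_integrable (fun y _ => hp y) (fun y _ => hd y)
    (integrable_mul_of_hasCompactSupport hpc hc (by fun_prop))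
    (integrable_mul_of_hasCompactSupport hp' hc' (by fun_prop))
    (integrable_mul_of_hasCompactSupport hpc hc (by fun_prop))
  simp only [waveTransform]
  rw [← integral_const_mul, ← neg_eq_iff_eq_neg.2 h, ← integral_neg]
  congr with y
  ring

theorem norm_waveTransform_le {p : ℝ → ℂ} (hp : Continuous p) (hc : HasCompactSupport p) {b : ℝ}
    {k : ℂ} (hk : |k.im| ≤ b) :
    ‖waveTransform p k‖ ≤ ∫ y, ‖p y‖ * Real.exp (b * |y|) := by
  refine norm_integral_le_of_norm_le ?_ (Eventually.of_forall fun y => ?_)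
  · have := (integrable_mul_of_hasCompactSupport hp hc
      (g := fun y => ((Real.exp (b * |y|) : ℝ) : ℂ)) (by fun_prop)).norm
    refine this.congr (Eventually.of_forall fun y => ?_)
    simp only [norm_mul, Complex.norm_real, Real.norm_eq_abs, Real.abs_exp]
  · rw [norm_mul]
    gcongr
    exact norm_cexp_wave_le hk y

/-- The Fourier integral of a test function decays quadratically in horizontal strips. -/
theorem exists_waveTransform_decay {p : ℝ → ℂ} (hp : ContDiff ℝ ∞ p) (hc : HasCompactSupport p)
    (b : ℝ) : ∃ C, ∀ k : ℂ, |k.im| ≤ b → ‖waveTransform p k‖ ≤ C * (1 + k.re ^ 2)⁻¹ := by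
  have h1 : ContDiff ℝ ∞ (deriv p) := (contDiff_infty_iff_deriv.1 hp).2
  have h2 : ContDiff ℝ ∞ (deriv (deriv p)) := (contDiff_infty_iff_deriv.1 h1).2
  refine ⟨(∫ y, ‖p y‖ * Real.exp (b * |y|)) + ∫ y, ‖deriv (deriv p) y‖ * Real.exp (b * |y|),
    fun k hk => ?_⟩
  have e1 := norm_waveTransform_le hp.continuous hc hk
  have e2 := norm_waveTransform_le h2.continuous hc.deriv.deriv hk
  rw [waveTransform_deriv (fun y => (h1.differentiable (by simp) y).hasDerivAt) h2.continuous
    hc.deriv hc.deriv.deriv, waveTransform_deriv (fun y => (hp.differentiable (by simp)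
    y).hasDerivAt) h1.continuous hc hc.deriv, norm_mul, norm_mul, norm_mul, norm_mul, Complex.norm_I, one_mul] at e2
  rw [← div_eq_mul_inv, le_div_iff₀ (by positivity)]
  have h3 : k.re ^ 2 ≤ ‖k‖ ^ 2 := by
    rw [← sq_abs]; gcongr; exact Complex.abs_re_le_norm k
  nlinarith [norm_nonneg (waveTransform p k)]

/-- Shifting the contour of integration in a horizontal strip, by Cauchy's theorem for the rectangles
between `±n` and `±n + iη`, whose vertical sides contribute nothing in the limit. -/
theorem integral_eq_integral_add_mul_I {F : ℂ → ℂ} {η C : ℝ}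
    (hF : ∀ k : ℂ, |k.im| ≤ |η| → DifferentiableAt ℂ F k)
    (hC : ∀ k : ℂ, |k.im| ≤ |η| → ‖F k‖ ≤ C * (1 + k.re ^ 2)⁻¹) :
    ∫ x : ℝ, F x = ∫ x : ℝ, F (x + η * Complex.I) := by
  have hcont : ∀ a : ℝ, |a| ≤ |η| → Continuous fun x : ℝ => F (x + a * Complex.I) := fun a ha =>
    continuous_iff_continuousAt.2 fun x => by
      refine ContinuousAt.comp (f := fun x : ℝ => (x : ℂ) + a * Complex.I) (g := F) ?_
        (by fun_prop)
      exact (hF _ (by simpa using ha)).continuousAt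
  have hint : ∀ a : ℝ, |a| ≤ |η| → Integrable fun x : ℝ => F (x + a * Complex.I) := fun a ha => by
    refine (integrable_inv_one_add_sq.const_mul C).mono' (hcont a ha).aestronglyMeasurable
      (Eventually.of_forall fun x => ?_)
    simpa using hC (x + a * Complex.I) (by simpa using ha)
  have hint0 : Integrable fun x : ℝ => F x := by simpa using hint 0 (by simp)
  have hT : Tendsto (fun n : ℕ => (n : ℝ)) atTop atTop := tendsto_natCast_atTop_atTop
  have hlim := (intervalIntegral_tendsto_integral hint0 (tendsto_neg_atTop_atBot.comp hT) hT).sub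
    (intervalIntegral_tendsto_integral (hint η le_rfl) (tendsto_neg_atTop_atBot.comp hT) hT)
  have hside : ∀ s : ℝ, |s| = 1 → Tendsto (fun n : ℕ => Complex.I • ∫ y : ℝ in (0 : ℝ)..η,
      F (((s * n : ℝ) : ℂ) + y * Complex.I)) atTop (𝓝 0) := fun s hs => by
    have hb : Tendsto (fun n : ℕ => |C| * (1 + (n : ℝ) ^ 2)⁻¹ * |η - 0|) atTop (𝓝 0) := by
      have h0 : Tendsto (fun n : ℕ => 1 + (n : ℝ) ^ 2) atTop atTop :=
        tendsto_atTop_add_const_left _ _ ((tendsto_pow_atTop two_ne_zero).comp hT)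
      have := (tendsto_inv_atTop_zero.comp h0).const_mul |C| |>.mul_const |η - 0|
      simpa using this
    refine squeeze_zero_norm (fun n => ?_) hb
    rw [norm_smul, Complex.norm_I, one_mul]
    refine intervalIntegral.norm_integral_le_of_norm_le_const fun y hy => ?_
    have hy' : |y| ≤ |η| := by
      rcases Set.mem_uIoc.1 hy with h | h
      · rw [abs_of_pos h.1, abs_of_pos (h.1.trans_le h.2)]; exact h.2
      · rw [abs_of_nonpos h.2, abs_of_neg (h.1.trans_le h.2)]; linarith [h.1]
    refine (hC _ (by simpa using hy')).trans ?_
    have : (s * (n : ℝ)) ^ 2 = n ^ 2 := by rw [mul_pow, ← sq_abs s, hs]; ring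
    simp only [Complex.add_re, Complex.ofReal_re, Complex.mul_re, Complex.ofReal_im, Complex.I_re,
      Complex.I_im, mul_zero, zero_mul, sub_zero, add_zero, this]
    gcongr
    exact le_abs_self C
  have hrect : ∀ n : ℕ, (∫ x : ℝ in -(n : ℝ)..n, F x) - (∫ x : ℝ in -(n : ℝ)..n,
      F (x + η * Complex.I)) = (Complex.I • ∫ y : ℝ in (0 : ℝ)..η,
      F ((((-1) * n : ℝ) : ℂ) + y * Complex.I)) - Complex.I • ∫ y : ℝ in (0 : ℝ)..η,
      F (((1 * n : ℝ) : ℂ) + y * Complex.I) := fun n => by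
    have h := Complex.integral_boundary_rect_eq_zero_of_differentiableOn F ((-(n : ℝ) : ℝ) : ℂ)
      ((n : ℝ) + η * Complex.I) (fun k hk => by
        refine (hF k ?_).differentiableWithinAt
        have := hk.2
        simp only [Complex.ofReal_im, Complex.add_im, Complex.mul_im, Complex.ofReal_re,
          Complex.I_im, Complex.I_re, mul_one, mul_zero, add_zero, zero_add,
          Set.mem_preimage] at this
        rcases Set.mem_uIcc.1 this with h | h
        · rw [abs_of_nonneg h.1, abs_of_nonneg (h.1.trans h.2)]; exact h.2
        · rw [abs_of_nonpos h.2, abs_of_nonpos (h.1.trans h.2)]; linarith [h.1])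
    simp only [Complex.ofReal_im, Complex.add_im, Complex.mul_im, Complex.ofReal_re, Complex.add_re,
      Complex.mul_re, Complex.I_im, Complex.I_re, mul_one, mul_zero, add_zero, zero_add,
      sub_zero, zero_mul, Complex.ofReal_zero] at h
    rw [one_mul, neg_one_mul]
    linear_combination h
  have h0 := (hside (-1) (by simp)).sub (hside 1 (by simp))
  rw [sub_zero] at h0
  exact sub_eq_zero.1 (tendsto_nhds_unique hlim (h0.congr fun n => (hrect n).symm))

/-- The symbol `D`, a function of the wave number, is analytic and bounded by `B` in the strip
`|Im k| ≤ 2`. -/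
structure StripBound (D : ℂ → ℂ) (B : ℝ) : Prop where
  differentiableAt : ∀ k : ℂ, |k.im| ≤ 2 → DifferentiableAt ℂ D k
  norm_le : ∀ k : ℂ, |k.im| ≤ 2 → ‖D k‖ ≤ B

theorem StripBound.nonneg {D : ℂ → ℂ} {B : ℝ} (hD : StripBound D B) : 0 ≤ B :=
  (norm_nonneg _).trans (hD.norm_le 0 (by simp))

theorem StripBound.continuous {D : ℂ → ℂ} {B : ℝ} (hD : StripBound D B) {η : ℝ} (hη : |η| ≤ 2) :
    Continuous fun ξ : ℝ => D (2 * Real.pi * ξ + η * Complex.I) :=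
  continuous_iff_continuousAt.2 fun ξ => by
    refine ContinuousAt.comp (f := fun ξ : ℝ => 2 * Real.pi * (ξ : ℂ) + η * Complex.I) (g := D)
      ?_ (by fun_prop)
    exact (hD.differentiableAt _ (by simpa using hη)).continuousAt

/-- Multiplication by `e^{ηy}` shifts the wave number by `iη`. -/
theorem fourier_exp_mul (p : ℝ → ℂ) (η ξ : ℝ) :
    𝓕 (fun y : ℝ => (Real.exp (η * y) : ℂ) * p y) ξ =
      waveTransform p (2 * Real.pi * ξ + η * Complex.I) := by
  rw [Real.fourier_real_eq, waveTransform]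
  congr with y
  rw [Circle.smul_def, Real.fourierChar_apply, smul_eq_mul, Complex.ofReal_exp, ← mul_assoc,
    ← Complex.exp_add, mul_comm]
  congr 2
  push_cast
  linear_combination ((η : ℂ) * y) * Complex.I_mul_I

/-- Integrability on a shifted line of the integrands that occur in the contour shift. -/
theorem integrable_mul_fourier_test {p : ℝ → ℂ} (hp : ContDiff ℝ ∞ p) (hc : HasCompactSupport p)
    {D : ℂ → ℂ} {B : ℝ} (hD : StripBound D B) {η : ℝ} (hη : |η| ≤ 2) :
    Integrable (fun ξ : ℝ => D (2 * Real.pi * ξ + η * Complex.I) *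
      𝓕 (fun y : ℝ => (Real.exp (η * y) : ℂ) * p y) ξ) ∧
    MemLp (𝓕 (fun y : ℝ => (Real.exp (η * y) : ℂ) * p y)) 2 ∧
    Integrable (𝓕 (fun y : ℝ => (Real.exp (η * y) : ℂ) * p y)) := by
  have hq : ContDiff ℝ ∞ (fun y : ℝ => (Real.exp (η * y) : ℂ) * p y) := by
    have : ContDiff ℝ ∞ fun y : ℝ => (Real.exp (η * y) : ℂ) :=
      Complex.ofRealCLM.contDiff.comp (Real.contDiff_exp.comp (contDiff_const.mul contDiff_id))
    exact this.mul hp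
  have hqc : HasCompactSupport (fun y : ℝ => (Real.exp (η * y) : ℂ) * p y) := hc.mul_left
  have hS : ∀ ξ, 𝓕 (fun y : ℝ => (Real.exp (η * y) : ℂ) * p y) ξ =
      (𝓕 (hqc.toSchwartzMap hq) : SchwartzMap ℝ ℂ) ξ := fun ξ => by
    rw [SchwartzMap.fourier_coe]; rfl
  have h2 : MemLp (𝓕 (fun y : ℝ => (Real.exp (η * y) : ℂ) * p y)) 2 :=
    (memLp_congr_ae (Eventually.of_forall hS)).2
      ((𝓕 (hqc.toSchwartzMap hq) : SchwartzMap ℝ ℂ).memLp 2 volume)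
  have h1 : Integrable (𝓕 (fun y : ℝ => (Real.exp (η * y) : ℂ) * p y)) :=
    ((𝓕 (hqc.toSchwartzMap hq) : SchwartzMap ℝ ℂ).integrable).congr
      (Eventually.of_forall fun ξ => (hS ξ).symm)
  refine ⟨?_, h2, h1⟩
  exact h1.bdd_mul (hD.continuous hη).aestronglyMeasurable
    (Eventually.of_forall fun ξ => hD.norm_le _ (by simpa using hη))

/-- Conjugating a Fourier multiplier by the weight `e^{ηx}` shifts its symbol. -/
theorem exp_mul_fourierInv {p : ℝ → ℂ} (hp : ContDiff ℝ ∞ p) (hc : HasCompactSupport p)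
    {D : ℂ → ℂ} {B : ℝ} (hD : StripBound D B) {η : ℝ} (hη : |η| ≤ 2) (x : ℝ) :
    (Real.exp (η * x) : ℂ) * 𝓕⁻ (fun ξ : ℝ => D (2 * Real.pi * ξ) * 𝓕 p ξ) x =
      𝓕⁻ (fun ξ : ℝ => D (2 * Real.pi * ξ + η * Complex.I) *
        𝓕 (fun y : ℝ => (Real.exp (η * y) : ℂ) * p y) ξ) x := by
  obtain ⟨C, hC⟩ := exists_waveTransform_decay hp hc 2
  set G : ℂ → ℂ := fun k => D k * waveTransform p k * Complex.exp (Complex.I * k * x) with hG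
  have hGd : ∀ k : ℂ, |k.im| ≤ |η| → DifferentiableAt ℂ G k := fun k hk =>
    ((hD.differentiableAt k (hk.trans hη)).mul
      (differentiable_waveTransform hp.continuous hc k)).mul (by fun_prop)
  have hGb : ∀ k : ℂ, |k.im| ≤ |η| →
      ‖G k‖ ≤ B * C * Real.exp (2 * |x|) * (1 + k.re ^ 2)⁻¹ := fun k hk => by
    have h1 := hD.norm_le k (hk.trans hη)
    have h2 := hC k (hk.trans hη)
    have h3 : ‖Complex.exp (Complex.I * k * x)‖ ≤ Real.exp (2 * |x|) := by
      have := norm_cexp_wave_le (k := k) (hk.trans hη) (-x)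
      simpa using this
    have := hD.nonneg
    calc ‖G k‖ = ‖D k‖ * ‖waveTransform p k‖ * ‖Complex.exp (Complex.I * k * x)‖ := by
          rw [hG, norm_mul, norm_mul]
      _ ≤ B * (C * (1 + k.re ^ 2)⁻¹) * Real.exp (2 * |x|) := by
          have := (norm_nonneg _).trans h2
          gcongr
      _ = _ := by ring
  -- Shift the contour, then pass from the wave number `k` to the frequency `ξ` by `k = 2πξ`.
  have h := integral_eq_integral_add_mul_I hGd hGb
  have e1 := Measure.integral_comp_mul_left (fun k : ℝ => G k) (2 * Real.pi)
  have e2 := Measure.integral_comp_mul_left (fun k : ℝ => G (k + η * Complex.I)) (2 * Real.pi)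
  rw [h, ← e2] at e1
  simp only [Real.fourierInv_eq]
  have h1 : ∀ ξ : ℝ, 𝐞 (inner ℝ ξ x) • (D (2 * Real.pi * ξ) * 𝓕 p ξ) =
      G ((2 * Real.pi * ξ : ℝ) : ℂ) := fun ξ => by
    have := fourier_exp_mul p 0 ξ
    simp only [zero_mul, Real.exp_zero, Complex.ofReal_one, one_mul, Complex.ofReal_zero,
      add_zero] at this
    rw [this, hG, Circle.smul_def, Real.fourierChar_apply, smul_eq_mul, mul_comm]
    push_cast
    congr 2
    simp
    ring
  have h2 : ∀ ξ : ℝ, 𝐞 (inner ℝ ξ x) • (D (2 * Real.pi * ξ + η * Complex.I) *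
      𝓕 (fun y : ℝ => (Real.exp (η * y) : ℂ) * p y) ξ) =
      (Real.exp (η * x) : ℂ) * G ((2 * Real.pi * ξ : ℝ) + η * Complex.I) := fun ξ => by
    rw [fourier_exp_mul, hG, Circle.smul_def, Real.fourierChar_apply, smul_eq_mul, mul_comm,
      Complex.ofReal_exp, mul_left_comm, ← Complex.exp_add]
    push_cast
    congr 2
    simp
    linear_combination (-(η : ℂ) * x) * Complex.I_mul_I
  simp only [h1, h2]
  rw [integral_const_mul, e1]

/-- A Fourier multiplier whose symbol is analytic and bounded in a strip is bounded in the `L²`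
space with weight `e^{ηx}`. -/
theorem eLpNorm_exp_mul_fourierInv_le {p : ℝ → ℂ} (hp : ContDiff ℝ ∞ p) (hc : HasCompactSupport p)
    {D : ℂ → ℂ} {B : ℝ} (hD : StripBound D B) {η : ℝ} (hη : |η| ≤ 2) :
    eLpNorm (fun x : ℝ => (Real.exp (η * x) : ℂ) *
      𝓕⁻ (fun ξ : ℝ => D (2 * Real.pi * ξ) * 𝓕 p ξ) x) 2 ≤
      ENNReal.ofReal B * eLpNorm (fun x : ℝ => (Real.exp (η * x) : ℂ) * p x) 2 := by
  obtain ⟨h1, h2, h3⟩ := integrable_mul_fourier_test hp hc hD hη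
  have hb : ∀ ξ : ℝ, ‖D (2 * Real.pi * ξ + η * Complex.I) *
      𝓕 (fun y : ℝ => (Real.exp (η * y) : ℂ) * p y) ξ‖ ≤
      B * ‖𝓕 (fun y : ℝ => (Real.exp (η * y) : ℂ) * p y) ξ‖ := fun ξ => by
    rw [norm_mul]
    gcongr
    exact hD.norm_le _ (by simpa using hη)
  simp only [exp_mul_fourierInv hp hc hD hη]
  rw [show (fun x => 𝓕⁻ (fun ξ : ℝ => D (2 * Real.pi * ξ + η * Complex.I) *
        𝓕 (fun y : ℝ => (Real.exp (η * y) : ℂ) * p y) ξ) x) = 𝓕⁻ (fun ξ : ℝ =>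
        D (2 * Real.pi * ξ + η * Complex.I) *
        𝓕 (fun y : ℝ => (Real.exp (η * y) : ℂ) * p y) ξ) from rfl,
    eLpNorm_fourierInv h1 (h2.of_le_mul h1.1 (Eventually.of_forall hb))]
  refine (eLpNorm_le_mul_eLpNorm_of_ae_le_mul (Eventually.of_forall hb) 2).trans ?_
  have hq : Continuous fun y : ℝ => (Real.exp (η * y) : ℂ) * p y := by
    have := hp.continuous; fun_prop
  rw [← eLpNorm_fourierInv h3 h2, hq.fourierInv_fourier_eq
    (hq.integrable_of_hasCompactSupport hc.mul_left) h3]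

/-- A smooth window around `x`, growing like `e^{2(y-x)}` to the left of `x` and decaying like
`e^{-(y-x)/2}` to the right of it. The rates do not exceed the half-width `2` of the strip in which the
symbols are analytic. The rate on the left exceeds the growth rate `1` of `oddSol` towards the left. -/
noncomputable def window (x y : ℝ) : ℝ := (Real.exp (2 * (x - y)) + Real.exp ((y - x) / 2))⁻¹

theorem window_pos (x y : ℝ) : 0 < window x y := by unfold window; positivity

theorem continuous_window (x : ℝ) : Continuous (window x) := by
  unfold window
  exact Continuous.inv₀ (by fun_prop) fun y => by positivity

theorem contDiff_window (x : ℝ) : ContDiff ℝ ∞ (window x) := by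
  unfold window
  refine ContDiff.inv (by fun_prop) fun y => by positivity

theorem window_mul_exp_left (x y : ℝ) : window x y ≤ Real.exp (2 * (y - x)) := by
  rw [window, show 2 * (y - x) = -(2 * (x - y)) by ring, Real.exp_neg]
  gcongr
  have := Real.exp_pos ((y - x) / 2)
  linarith

theorem window_mul_exp_right (x y : ℝ) : window x y ≤ Real.exp (-(1 / 2) * (y - x)) := by
  rw [window, show -(1 / 2) * (y - x) = -((y - x) / 2) by ring, Real.exp_neg]
  gcongr
  have := Real.exp_pos (2 * (x - y))
  linarith

theorem window_le_one (x y : ℝ) : window x y ≤ 1 := by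
  rcases le_total y x with h | h
  · refine (window_mul_exp_left x y).trans (Real.exp_le_one_iff.2 (by linarith))
  · refine (window_mul_exp_right x y).trans (Real.exp_le_one_iff.2 (by linarith))

theorem exp_mul_window_add (x y : ℝ) :
    Real.exp (2 * (x - y)) * window x y + Real.exp ((y - x) / 2) * window x y = 1 := by
  rw [← add_mul, window, mul_inv_cancel₀ (by positivity)]

/-- The windowed estimate for a multiplier applied to `e^{-η(y-x)} window x y • q`: the window is bounded
by the exponential weight on the left-hand side and cancels against it on the right. -/
theorem eLpNorm_window_exp_le {q : ℝ → ℂ} (hq : ContDiff ℝ ∞ q) (hc : HasCompactSupport q)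
    {D : ℂ → ℂ} {B : ℝ} (hD : StripBound D B) (x : ℝ) {η : ℝ} (hη : |η| ≤ 2)
    (h : ∀ y, window x y ≤ Real.exp (η * (y - x))) :
    eLpNorm (fun y => (window x y : ℂ) * 𝓕⁻ (fun ξ : ℝ => D (2 * Real.pi * ξ) *
      𝓕 (fun y => (Real.exp (-(η * (y - x))) * window x y : ℝ) * q y) ξ) y) 2 ≤
      ENNReal.ofReal B * eLpNorm (fun y => (window x y : ℂ) * q y) 2 := by
  have hp : ContDiff ℝ ∞ fun y => ((Real.exp (-(η * (y - x))) * window x y : ℝ) : ℂ) * q y := by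
    refine ContDiff.mul (Complex.ofRealCLM.contDiff.comp (ContDiff.mul ?_ (contDiff_window x))) hq
    fun_prop
  have h1 := eLpNorm_exp_mul_fourierInv_le hp hc.mul_left hD hη
  set T := 𝓕⁻ (fun ξ : ℝ => D (2 * Real.pi * ξ) *
      𝓕 (fun y => ((Real.exp (-(η * (y - x))) * window x y : ℝ) : ℂ) * q y) ξ)
  have hx : ∀ y, Real.exp (η * (y - x)) = Real.exp (-(η * x)) * Real.exp (η * y) := fun y => by
    rw [← Real.exp_add]; ring_nf
  calc _ ≤ ENNReal.ofReal (Real.exp (-(η * x))) *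
        eLpNorm (fun y : ℝ => (Real.exp (η * y) : ℂ) * T y) 2 := by
        refine eLpNorm_le_mul_eLpNorm_of_ae_le_mul (Eventually.of_forall fun y => ?_) 2
        rw [norm_mul, norm_mul, Complex.norm_real, Complex.norm_real, Real.norm_eq_abs,
          Real.norm_eq_abs, Real.abs_exp, abs_of_pos (window_pos x y), ← mul_assoc, ← hx]
        gcongr
        exact h y
    _ ≤ ENNReal.ofReal (Real.exp (-(η * x))) * (ENNReal.ofReal B * eLpNorm (fun y : ℝ =>
        (Real.exp (η * y) : ℂ) * (((Real.exp (-(η * (y - x))) * window x y : ℝ) : ℂ) * q y)) 2) := by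
        gcongr
    _ = ENNReal.ofReal B * (ENNReal.ofReal (Real.exp (-(η * x))) * eLpNorm (fun y : ℝ =>
        (Real.exp (η * y) : ℂ) * (((Real.exp (-(η * (y - x))) * window x y : ℝ) : ℂ) * q y)) 2) := by
        ring
    _ ≤ _ := by
        gcongr
        rw [← Real.enorm_of_nonneg (Real.exp_pos _).le, ← eLpNorm_const_smul]
        refine (eLpNorm_congr_ae (Eventually.of_forall fun y => ?_)).le
        have h1 : Real.exp (-(η * x)) * (Real.exp (η * y) * Real.exp (-(η * (y - x)))) = 1 := by
          rw [← Real.exp_add, ← Real.exp_add, Real.exp_eq_one_iff]; ring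
        have h2 : (Real.exp (-(η * x)) : ℂ) * ((Real.exp (η * y) : ℂ) *
            (Real.exp (-(η * (y - x))) : ℂ)) = 1 := by exact_mod_cast h1
        simp only [Pi.smul_apply, Complex.real_smul, Complex.ofReal_mul]
        linear_combination (window x y * q y) * h2

/-- A Fourier multiplier whose symbol is analytic and bounded in a strip is bounded in windowed
`L²` norms, uniformly in the position of the window. -/
theorem eLpNorm_window_mul_fourierInv_le {P : ℝ → ℂ} (hP1 : Integrable P) (hP2 : MemLp P 2)
    {D : ℂ → ℂ} {B : ℝ} (hD : StripBound D B) (x : ℝ) :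
    eLpNorm (fun y => (window x y : ℂ) * 𝓕⁻ (fun ξ : ℝ => D (2 * Real.pi * ξ) * P ξ) y) 2 ≤
      ENNReal.ofReal (2 * B) * eLpNorm (fun y => (window x y : ℂ) * 𝓕⁻ P y) 2 := by
  have hB := hD.nonneg
  have hD0 : Continuous fun ξ : ℝ => D (2 * Real.pi * ξ) := by
    simpa using hD.continuous (η := 0) (by simp)
  have hDb : ∀ ξ : ℝ, ‖D (2 * Real.pi * ξ)‖ ≤ B := fun ξ => hD.norm_le _ (by simp)
  have hmi : ∀ {Q : ℝ → ℂ}, Integrable Q → Integrable fun ξ : ℝ => D (2 * Real.pi * ξ) * Q ξ :=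
    fun hQ => hQ.bdd_mul hD0.aestronglyMeasurable (Eventually.of_forall hDb)
  have hmb : ∀ (Q : ℝ → ℂ) (ξ : ℝ), ‖D (2 * Real.pi * ξ) * Q ξ‖ ≤ B * ‖Q ξ‖ := fun Q ξ => by
    rw [norm_mul]
    gcongr
    exact hDb ξ
  have hm2 : ∀ {Q : ℝ → ℂ}, Integrable Q → MemLp Q 2 →
      MemLp (fun ξ : ℝ => D (2 * Real.pi * ξ) * Q ξ) 2 :=
    fun hQ1 hQ => hQ.of_le_mul (hmi hQ1).1 (Eventually.of_forall (hmb _))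
  have hwle : ∀ g : ℝ → ℂ, eLpNorm (fun y => (window x y : ℂ) * g y) 2 ≤ eLpNorm g 2 := fun g => by
    refine eLpNorm_mono fun y => ?_
    rw [norm_mul, Complex.norm_real, Real.norm_eq_abs, abs_of_pos (window_pos x y)]
    exact mul_le_of_le_one_left (norm_nonneg _) (window_le_one x y)
  have hwc : Continuous fun y => (window x y : ℂ) :=
    Complex.continuous_ofReal.comp (continuous_window x)
  -- the estimate for test functions
  have htest : ∀ g : ℝ → ℂ, ContDiff ℝ ∞ g → HasCompactSupport g →
      Integrable (𝓕 g) ∧ MemLp (𝓕 g) 2 ∧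
      eLpNorm (fun y => (window x y : ℂ) * 𝓕⁻ (fun ξ : ℝ => D (2 * Real.pi * ξ) * 𝓕 g ξ) y) 2 ≤
      ENNReal.ofReal (2 * B) * eLpNorm (fun y => (window x y : ℂ) * g y) 2 := by
    intro g hg hc
    have h0 : ∀ q : ℝ → ℂ, ContDiff ℝ ∞ q → HasCompactSupport q →
        Integrable (𝓕 q) ∧ MemLp (𝓕 q) 2 := fun q hq hqc => by
      have := integrable_mul_fourier_test hq hqc hD (η := 0) (by simp)
      simp only [zero_mul, Real.exp_zero, Complex.ofReal_one, one_mul] at this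
      exact ⟨this.2.2, this.2.1⟩
    refine ⟨(h0 g hg hc).1, (h0 g hg hc).2, ?_⟩
    -- The weights `a` and `b` add up to `1`; each term is estimated with its own exponential weight.
    set a : ℝ → ℝ := fun y => Real.exp (-(2 * (y - x))) * window x y
    set b : ℝ → ℝ := fun y => Real.exp (-(-(1 / 2) * (y - x))) * window x y
    have ha : ContDiff ℝ ∞ fun y => (a y : ℂ) * g y := by
      refine ContDiff.mul (Complex.ofRealCLM.contDiff.comp (ContDiff.mul ?_ (contDiff_window x))) hg
      fun_prop
    have hb : ContDiff ℝ ∞ fun y => (b y : ℂ) * g y := by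
      refine ContDiff.mul (Complex.ofRealCLM.contDiff.comp (ContDiff.mul ?_ (contDiff_window x))) hg
      fun_prop
    have hab : ∀ y, g y = a y * g y + b y * g y := fun y => by
      have := exp_mul_window_add x y
      have h1 : a y + b y = 1 := by
        rw [← this]; simp only [a, b]; ring_nf
      have h2 : (a y : ℂ) + b y = 1 := by exact_mod_cast h1
      linear_combination -g y * h2
    have hF : 𝓕 g = fun ξ => 𝓕 (fun y => (a y : ℂ) * g y) ξ + 𝓕 (fun y => (b y : ℂ) * g y) ξ := by
      ext ξ
      have e1 : Integrable fun y => (a y : ℂ) * g y :=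
        ha.continuous.integrable_of_hasCompactSupport hc.mul_left
      have e2 : Integrable fun y => (b y : ℂ) * g y :=
        hb.continuous.integrable_of_hasCompactSupport hc.mul_left
      have := fourierInv_add e1 e2 (-ξ)
      simp only [Real.fourierInv_eq_fourier_neg, neg_neg] at this
      rw [← this, ← funext hab]
    have hA := eLpNorm_window_exp_le hg hc hD x (η := 2) (by norm_num)
      fun y => window_mul_exp_left x y
    have hB' := eLpNorm_window_exp_le hg hc hD x (η := -(1 / 2))
      (by rw [abs_neg, abs_of_pos] <;> norm_num) fun y => window_mul_exp_right x y
    have hs : ∀ y, 𝓕⁻ (fun ξ : ℝ => D (2 * Real.pi * ξ) * 𝓕 g ξ) y =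
        𝓕⁻ (fun ξ : ℝ => D (2 * Real.pi * ξ) * 𝓕 (fun y => (a y : ℂ) * g y) ξ) y +
        𝓕⁻ (fun ξ : ℝ => D (2 * Real.pi * ξ) * 𝓕 (fun y => (b y : ℂ) * g y) ξ) y := fun y => by
      rw [← fourierInv_add (hmi (h0 _ ha hc.mul_left).1) (hmi (h0 _ hb hc.mul_left).1), hF]
      simp only [mul_add]
    simp only [hs, mul_add]
    have hca := continuous_fourierInv (hmi (h0 _ ha hc.mul_left).1)
    have hcb := continuous_fourierInv (hmi (h0 _ hb hc.mul_left).1)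
    refine (eLpNorm_add_le (hwc.mul hca).aestronglyMeasurable (hwc.mul hcb).aestronglyMeasurable
      (by norm_num)).trans ((add_le_add hA hB').trans (le_of_eq ?_))
    rw [two_mul, ENNReal.ofReal_add hB hB, add_mul]
  -- approximation by test functions
  have hpm : MemLp (𝓕⁻ P) 2 := memLp_fourierInv hP1 hP2
  refine ENNReal.le_of_forall_pos_le_add fun e he _ => ?_
  obtain ⟨δ, hδ, hδe⟩ : ∃ δ : ℝ, 0 < δ ∧ 3 * B * δ ≤ e := by
    refine ⟨e / (3 * B + 1), by positivity, ?_⟩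
    rw [mul_div_assoc', div_le_iff₀ (by positivity)]
    have : (0 : ℝ) < e := he
    nlinarith
  obtain ⟨g, hc, hg, hgle⟩ := hpm.exist_eLpNorm_sub_le (by norm_num) (by norm_num) hδ
  obtain ⟨hg1, hg2, hgt⟩ := htest g hg hc
  have hgi : 𝓕⁻ (𝓕 g) = g := hg.continuous.fourierInv_fourier_eq
    (hg.continuous.integrable_of_hasCompactSupport hc) hg1
  have hd1 : Integrable fun ξ => P ξ - 𝓕 g ξ := hP1.sub hg1
  have hdm : MemLp (fun ξ => P ξ - 𝓕 g ξ) 2 := hP2.sub hg2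
  have hdiff : eLpNorm (fun ξ => P ξ - 𝓕 g ξ) 2 ≤ ENNReal.ofReal δ := by
    rw [← eLpNorm_fourierInv hd1 hdm]
    refine le_trans (le_of_eq ?_) hgle
    congr 1
    ext y
    have h1 := fourierInv_add hP1 (hg1.const_mul (-1)) y
    rw [fourierInv_const_mul, hgi] at h1
    rw [Pi.sub_apply, sub_eq_add_neg, ← neg_one_mul, ← h1]
    refine congrArg (fun F : ℝ → ℂ => 𝓕⁻ F y) (funext fun ξ => ?_)
    ring
  have hd2 : eLpNorm (fun y => 𝓕⁻ (fun ξ : ℝ => D (2 * Real.pi * ξ) * (P ξ - 𝓕 g ξ)) y) 2 ≤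
      ENNReal.ofReal (B * δ) := by
    rw [show (fun y => 𝓕⁻ (fun ξ : ℝ => D (2 * Real.pi * ξ) * (P ξ - 𝓕 g ξ)) y) =
      𝓕⁻ (fun ξ : ℝ => D (2 * Real.pi * ξ) * (P ξ - 𝓕 g ξ)) from rfl,
      eLpNorm_fourierInv (hmi hd1) (hm2 hd1 hdm),
      ENNReal.ofReal_mul hB]
    refine (eLpNorm_le_mul_eLpNorm_of_ae_le_mul (Eventually.of_forall (hmb _)) 2).trans ?_
    gcongr
  have hsplit : ∀ y, (window x y : ℂ) * 𝓕⁻ (fun ξ : ℝ => D (2 * Real.pi * ξ) * P ξ) y =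
      window x y * 𝓕⁻ (fun ξ : ℝ => D (2 * Real.pi * ξ) * 𝓕 g ξ) y +
      window x y * 𝓕⁻ (fun ξ : ℝ => D (2 * Real.pi * ξ) * (P ξ - 𝓕 g ξ)) y := fun y => by
    rw [← mul_add, ← fourierInv_add (hmi hg1) (hmi hd1)]
    refine congrArg (fun F : ℝ → ℂ => (window x y : ℂ) * 𝓕⁻ F y) (funext fun ξ => ?_)
    ring
  have hgw : eLpNorm (fun y => (window x y : ℂ) * g y) 2 ≤
      eLpNorm (fun y => (window x y : ℂ) * 𝓕⁻ P y) 2 + ENNReal.ofReal δ := by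
    have : (fun y => (window x y : ℂ) * g y) = fun y => (window x y : ℂ) * 𝓕⁻ P y +
        window x y * -(𝓕⁻ P - g) y := by
      ext y; simp only [Pi.sub_apply]; ring
    rw [this]
    refine (eLpNorm_add_le (f := fun y => (window x y : ℂ) * 𝓕⁻ P y)
      (g := fun y => (window x y : ℂ) * -(𝓕⁻ P - g) y)
      (hwc.mul (continuous_fourierInv hP1)).aestronglyMeasurable
      (hwc.mul ((continuous_fourierInv hP1).sub hg.continuous).neg).aestronglyMeasurable
      (by norm_num)).trans ?_
    gcongr
    exact (hwle (-(𝓕⁻ P - g))).trans ((eLpNorm_neg _ _ _).trans_le hgle)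
  simp only [hsplit]
  refine (eLpNorm_add_le (hwc.mul (continuous_fourierInv (hmi hg1))).aestronglyMeasurable
    (hwc.mul (continuous_fourierInv (hmi hd1))).aestronglyMeasurable
    (by norm_num)).trans ?_
  calc _ ≤ ENNReal.ofReal (2 * B) * (eLpNorm (fun y => (window x y : ℂ) * 𝓕⁻ P y) 2 +
        ENNReal.ofReal δ) + ENNReal.ofReal (B * δ) :=
        add_le_add (hgt.trans (by gcongr)) ((hwle _).trans hd2)
    _ = ENNReal.ofReal (2 * B) * eLpNorm (fun y => (window x y : ℂ) * 𝓕⁻ P y) 2 +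
        ENNReal.ofReal (3 * B * δ) := by
        rw [mul_add, add_assoc, ← ENNReal.ofReal_mul (by positivity), ← ENNReal.ofReal_add
          (by positivity) (by positivity)]
        congr 2
        ring
    _ ≤ _ := by
        gcongr
        rw [← ENNReal.ofReal_coe_nnreal]
        exact ENNReal.ofReal_le_ofReal hδe

/-! ### Windowed suprema and perturbations of the linearised soliton equation -/

/-- A window around `x` that decays more slowly than `window x` on both sides, so that the quotient of the
two is square integrable. To the left its rate `3/2` still exceeds the growth rate `1` of `oddSol`; to
the right its decay only has to be slower than that of `oddSol`. -/
noncomputable def wide (x y : ℝ) : ℝ :=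
  min (Real.exp (3 / 2 * (y - x))) (Real.exp (-((y - x) / 4)))

theorem wide_pos (x y : ℝ) : 0 < wide x y := lt_min (Real.exp_pos _) (Real.exp_pos _)

theorem wide_self (x : ℝ) : wide x x = 1 := by simp [wide]

theorem wide_le_one (x y : ℝ) : wide x y ≤ 1 := by
  rcases le_total y x with h | h
  · exact (min_le_left _ _).trans (Real.exp_le_one_iff.2 (by linarith))
  · exact (min_le_right _ _).trans (Real.exp_le_one_iff.2 (by linarith))

theorem wide_mul_exp_abs_le (x y : ℝ) : window x y ≤ wide x y * Real.exp (-|(y - x) / 4|) := by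
  rcases le_total y x with h | h
  · refine (window_mul_exp_left x y).trans ?_
    rw [wide, min_eq_left (Real.exp_le_exp.2 (by linarith)), ← Real.exp_add,
      abs_of_nonpos (by linarith), Real.exp_le_exp]
    linarith
  · refine (window_mul_exp_right x y).trans ?_
    rw [wide, min_eq_right (Real.exp_le_exp.2 (by linarith)), ← Real.exp_add,
      abs_of_nonneg (by linarith), Real.exp_le_exp]
    linarith

theorem wide_le_left {x z : ℝ} (h : z ≤ x) (y : ℝ) :
    wide z y ≤ Real.exp (3 / 2 * (x - z)) * wide x y := by
  rw [wide, wide, mul_min_of_nonneg _ _ (Real.exp_pos _).le, ← Real.exp_add, ← Real.exp_add]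
  refine min_le_min (Real.exp_le_exp.2 ?_) (Real.exp_le_exp.2 ?_) <;> linarith

theorem wide_le_right {x z : ℝ} (h : x ≤ z) (y : ℝ) :
    wide z y ≤ Real.exp ((z - x) / 4) * wide x y := by
  rw [wide, wide, mul_min_of_nonneg _ _ (Real.exp_pos _).le, ← Real.exp_add, ← Real.exp_add]
  refine min_le_min (Real.exp_le_exp.2 ?_) (Real.exp_le_exp.2 ?_) <;> linarith

/-- The supremum of `u` seen through the window `wide x`. -/
noncomputable def wideSup (u : ℝ → ℂ) (x : ℝ) : ℝ := ⨆ y, wide x y * ‖u y‖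

theorem le_wideSup {u : ℝ → ℂ} {M : ℝ} (hM : ∀ y, ‖u y‖ ≤ M) (x y : ℝ) :
    wide x y * ‖u y‖ ≤ wideSup u x :=
  le_ciSup (f := fun y => wide x y * ‖u y‖) ⟨M, by
    rintro _ ⟨y, rfl⟩
    exact (mul_le_of_le_one_left (norm_nonneg _) (wide_le_one x y)).trans (hM y)⟩ y

theorem norm_le_wideSup {u : ℝ → ℂ} {M : ℝ} (hM : ∀ y, ‖u y‖ ≤ M) (x : ℝ) :
    ‖u x‖ ≤ wideSup u x := by
  simpa [wide_self] using le_wideSup hM x x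

theorem wideSup_nonneg (u : ℝ → ℂ) (x : ℝ) : 0 ≤ wideSup u x :=
  Real.iSup_nonneg fun y => mul_nonneg (wide_pos x y).le (norm_nonneg _)

theorem wideSup_le {u : ℝ → ℂ} {M : ℝ} (hM : ∀ y, ‖u y‖ ≤ M) (x : ℝ) : wideSup u x ≤ M :=
  ciSup_le fun y => (mul_le_of_le_one_left (norm_nonneg _) (wide_le_one x y)).trans (hM y)

theorem wideSup_le_left {u : ℝ → ℂ} {M : ℝ} (hM : ∀ y, ‖u y‖ ≤ M) {x z : ℝ} (h : z ≤ x) :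
    wideSup u z ≤ Real.exp (3 / 2 * (x - z)) * wideSup u x :=
  ciSup_le fun y => (mul_le_mul_of_nonneg_right (wide_le_left h y) (norm_nonneg _)).trans (by
    rw [mul_assoc]
    gcongr
    exact le_wideSup hM x y)

theorem wideSup_le_right {u : ℝ → ℂ} {M : ℝ} (hM : ∀ y, ‖u y‖ ≤ M) {x z : ℝ} (h : x ≤ z) :
    wideSup u z ≤ Real.exp ((z - x) / 4) * wideSup u x :=
  ciSup_le fun y => (mul_le_mul_of_nonneg_right (wide_le_right h y) (norm_nonneg _)).trans (by
    rw [mul_assoc]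
    gcongr
    exact le_wideSup hM x y)

theorem exp_neg_le_sechSq {x : ℝ} (hx : 0 ≤ x) : Real.exp (-x) ≤ sechSq x := by
  have h := Real.cosh_pos (x / 2)
  have h1 : Real.cosh (x / 2) ≤ Real.exp (x / 2) := by
    rw [Real.cosh_eq]
    have : Real.exp (-(x / 2)) ≤ Real.exp (x / 2) := Real.exp_le_exp.2 (by linarith)
    linarith
  rw [sechSq, sech, div_pow, one_pow, Real.exp_neg, ← one_div]
  gcongr
  calc Real.cosh (x / 2) ^ 2 ≤ Real.exp (x / 2) ^ 2 := by gcongr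
    _ = Real.exp x := by rw [← Real.exp_nat_mul]; congr 1; push_cast; ring

theorem le_tanhHalf {x : ℝ} (hx : 0 ≤ x) : (1 - Real.exp (-x)) / 2 ≤ tanhHalf x := by
  have h := Real.cosh_pos (x / 2)
  have e : Real.exp (-x) = Real.exp (-(x / 2)) * Real.exp (-(x / 2)) := by
    rw [← Real.exp_add]; ring_nf
  have e1 : Real.exp (x / 2) * Real.exp (-(x / 2)) = 1 := by rw [← Real.exp_add]; simp
  have e2 : Real.exp (-x) ≤ 1 := Real.exp_le_one_iff.2 (by linarith)
  have e3 : Real.exp (-(x / 2)) ≤ 1 := Real.exp_le_one_iff.2 (by linarith)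
  have e4 := Real.exp_pos (-(x / 2))
  have e5 : 1 ≤ Real.exp (x / 2) := Real.one_le_exp (by linarith)
  rw [tanhHalf, Real.tanh_eq_sinh_div_cosh, le_div_iff₀ h, Real.sinh_eq, Real.cosh_eq, e]
  set a := Real.exp (-(x / 2))
  set b := Real.exp (x / 2)
  have : a * a * b = a := by linear_combination a * e1
  have h7 : a ≤ 1 := e3
  nlinarith [mul_pos e4 e4]

theorem exp_neg_div_le_oddSol {x : ℝ} (hx : 1 ≤ x) : Real.exp (-x) / 4 ≤ oddSol x := by
  have h1 := exp_neg_le_sechSq (zero_le_one.trans hx)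
  have h2 := le_tanhHalf (zero_le_one.trans hx)
  have h3 : Real.exp (-x) ≤ 1 / 2 := by
    rw [Real.exp_neg, one_div]
    gcongr
    have := Real.add_one_le_exp x
    linarith
  rw [oddSol]
  calc Real.exp (-x) / 4 = Real.exp (-x) * (1 / 4) := by ring
    _ ≤ sechSq x * tanhHalf x := by
      have := sechSq_pos x
      gcongr
      linarith

theorem div_le_oddSol {x : ℝ} (hx : 0 ≤ x) (hx1 : x ≤ 1) : x / 12 ≤ oddSol x := by
  have h1 := exp_neg_le_sechSq hx
  have h2 := le_tanhHalf hx
  have h3 : Real.exp (-x) ≤ 1 - x / 2 := by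
    rw [Real.exp_neg]
    have := Real.quadratic_le_exp_of_nonneg hx
    rw [inv_le_comm₀ (Real.exp_pos x) (by linarith)]
    refine le_trans ?_ this
    rw [inv_le_iff_one_le_mul₀ (by linarith)]
    nlinarith [mul_nonneg hx hx]
  have h4 : 1 / 3 ≤ Real.exp (-x) := by
    rw [Real.exp_neg, one_div]
    gcongr
    exact (Real.exp_le_exp.2 hx1).trans Real.exp_one_lt_three.le
  rw [oddSol]
  calc x / 12 = 1 / 3 * (x / 4) := by ring
    _ ≤ sechSq x * tanhHalf x := by
      have := sechSq_pos x
      gcongr <;> linarith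

section Perturbation

variable {u u' g : ℝ → ℂ} {M G : ℝ}

/-- The Wronskian of `oddSol` and a function `u` with derivative `u'`. -/
noncomputable def wronskian (u u' : ℝ → ℂ) (x : ℝ) : ℂ := u' x * oddSol x - u x * oddSol' x

theorem hasDerivAt_wronskian (hu : ∀ x, HasDerivAt u (u' x) x)
    (hu' : ∀ x, HasDerivAt u' ((1 - 3 * sechSq x : ℝ) * u x + g x) x) (x : ℝ) :
    HasDerivAt (wronskian u u') (g x * oddSol x) x := by
  refine HasDerivAt.congr_deriv (((hu' x).mul (hasDerivAt_oddSol x).ofReal_comp).sub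
    ((hu x).mul (hasDerivAt_oddSol' x).ofReal_comp)) ?_
  push_cast
  ring

theorem tendsto_wronskian (bu : ∀ x, ‖u x‖ ≤ M) (bu' : ∀ x, ‖u' x‖ ≤ M) :
    Tendsto (wronskian u u') atTop (𝓝 0) := by
  have hM : 0 ≤ M := (norm_nonneg _).trans (bu 0)
  have h0 : Tendsto (fun x : ℝ => 8 * M * Real.exp (-x)) atTop (𝓝 0) := by
    simpa using (Real.tendsto_exp_neg_atTop_nhds_zero).const_mul (8 * M)
  refine squeeze_zero_norm' ?_ h0
  filter_upwards [eventually_ge_atTop 0] with x hx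
  have h1 := abs_oddSol_le x
  have h2 := abs_oddSol'_le x
  rw [abs_of_nonneg hx] at h1 h2
  calc ‖wronskian u u' x‖ ≤ ‖u' x‖ * |oddSol x| + ‖u x‖ * |oddSol' x| := by
        refine (norm_sub_le _ _).trans (le_of_eq ?_)
        simp
    _ ≤ M * (4 * Real.exp (-x)) + M * (4 * Real.exp (-x)) := by
        gcongr
        · exact bu' x
        · exact bu x
    _ = _ := by ring

/-- The Wronskian of a bounded solution vanishes at infinity, so it is the integral of its derivative
`g • oddSol` from there. The decay of `oddSol` outweighs the growth `e^{(z-x)/4}` of `wideSup u z`. -/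
theorem norm_wronskian_le (hu : ∀ x, HasDerivAt u (u' x) x)
    (hu' : ∀ x, HasDerivAt u' ((1 - 3 * sechSq x : ℝ) * u x + g x) x)
    (bu : ∀ x, ‖u x‖ ≤ M) (bu' : ∀ x, ‖u' x‖ ≤ M) (hG : 0 ≤ G)
    (hg : ∀ x, ‖g x‖ ≤ G * wideSup u x) {x : ℝ} (hx : 0 ≤ x) :
    ‖wronskian u u' x‖ ≤ 16 / 3 * G * wideSup u x * Real.exp (-x) := by
  have hV := wideSup_nonneg u x
  set V := wideSup u x with hVd
  set B : ℝ → ℝ := fun z => 16 / 3 * G * V * (Real.exp (-x) - Real.exp (-(3 / 4) * z - x / 4))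
  have key : ∀ b, x ≤ b → ‖wronskian u u' b - wronskian u u' x‖ ≤
      16 / 3 * G * V * Real.exp (-x) := fun b hb => by
    have := image_norm_le_of_norm_deriv_right_le_deriv_boundary (a := x) (b := b)
      (f := fun z => wronskian u u' z - wronskian u u' x) (f' := fun z => g z * oddSol z)
      (B := B) (B' := fun z => 4 * G * V * Real.exp (-(3 / 4) * z - x / 4))
      (fun z _ => ((hasDerivAt_wronskian hu hu' z).sub_const _).continuousAt.continuousWithinAt)
      (fun z _ => ((hasDerivAt_wronskian hu hu' z).sub_const _).hasDerivWithinAt)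
      (by
        simp only [B, sub_self, norm_zero]
        rw [show -(3 / 4) * x - x / 4 = -x by ring]; simp)
      (fun z => by
        have h1 : HasDerivAt (fun z : ℝ => -(3 / 4) * z - x / 4) (-(3 / 4)) z := by
          simpa using ((hasDerivAt_id z).const_mul (-(3 / 4) : ℝ)).sub_const (x / 4)
        refine ((h1.exp.const_sub (Real.exp (-x))).const_mul (16 / 3 * G * V)).congr_deriv ?_
        ring)
      (fun z hz => by
        have h1 := abs_oddSol_le z
        rw [abs_of_nonneg (hx.trans hz.1)] at h1
        rw [norm_mul, Complex.norm_real, Real.norm_eq_abs]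
        calc ‖g z‖ * |oddSol z| ≤ (G * (Real.exp ((z - x) / 4) * V)) * (4 * Real.exp (-z)) := by
              gcongr
              exact (hg z).trans (by gcongr; exact wideSup_le_right bu hz.1)
          _ = 4 * G * V * (Real.exp ((z - x) / 4) * Real.exp (-z)) := by ring
          _ = _ := by rw [← Real.exp_add]; ring_nf)
      (Set.right_mem_Icc.2 hb)
    refine this.trans ?_
    simp only [B]
    gcongr
    linarith [Real.exp_pos (-(3 / 4) * b - x / 4)]
  have hlim : Tendsto (fun b => ‖wronskian u u' b - wronskian u u' x‖) atTop
      (𝓝 ‖0 - wronskian u u' x‖) := ((tendsto_wronskian bu bu').sub_const _).norm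
  rw [zero_sub, norm_neg] at hlim
  refine le_of_tendsto hlim ?_
  filter_upwards [eventually_ge_atTop x] with b hb
  exact key b hb

theorem hasDerivAt_div_oddSol (hu : ∀ x, HasDerivAt u (u' x) x) {x : ℝ} (hx : 1 ≤ x) :
    HasDerivAt (fun x => u x / oddSol x) (wronskian u u' x / (oddSol x : ℂ) ^ 2) x := by
  have h0 : (oddSol x : ℂ) ≠ 0 := by
    have := exp_neg_div_le_oddSol hx
    have := Real.exp_pos (-x)
    exact_mod_cast (by linarith : 0 < oddSol x).ne'
  refine ((hu x).div (hasDerivAt_oddSol x).ofReal_comp h0).congr_deriv ?_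
  rw [wronskian]

theorem norm_deriv_div_oddSol_le (hu : ∀ x, HasDerivAt u (u' x) x)
    (hu' : ∀ x, HasDerivAt u' ((1 - 3 * sechSq x : ℝ) * u x + g x) x)
    (bu : ∀ x, ‖u x‖ ≤ M) (bu' : ∀ x, ‖u' x‖ ≤ M) (hG : 0 ≤ G)
    (hg : ∀ x, ‖g x‖ ≤ G * wideSup u x) {x : ℝ} (hx : 1 ≤ x) :
    ‖wronskian u u' x / (oddSol x : ℂ) ^ 2‖ ≤ 86 * G * wideSup u x * Real.exp x := by
  have h1 := norm_wronskian_le hu hu' bu bu' hG hg (zero_le_one.trans hx)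
  have h2 := exp_neg_div_le_oddSol hx
  have hV := wideSup_nonneg u x
  have h3 := Real.exp_pos (-x)
  have h4 : Real.exp x * Real.exp (-x) = 1 := by rw [← Real.exp_add]; simp
  rw [norm_div, norm_pow, Complex.norm_real, Real.norm_of_nonneg (by linarith),
    div_le_iff₀ (pow_pos (by linarith) 2)]
  calc _ ≤ 16 / 3 * G * wideSup u x * Real.exp (-x) := h1
    _ ≤ 86 / 16 * G * wideSup u x * Real.exp (-x) := by
      have : 0 ≤ G * wideSup u x * Real.exp (-x) := by positivity
      linarith
    _ = 86 * G * wideSup u x * Real.exp x * (Real.exp (-x) / 4) ^ 2 := by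
      linear_combination (-(86 / 16) * G * wideSup u x * Real.exp (-x)) * h4
    _ ≤ _ := by gcongr

/-- Comparison of `u x` and `u y` through the quotient by `oddSol`. -/
theorem norm_le_mul_div {x y d : ℝ} (h1 : 1 ≤ x) (h2 : 1 ≤ y)
    (h : ‖u y / oddSol y - u x / oddSol x‖ ≤ d) :
    ‖u y‖ ≤ 4 * Real.exp (-y) * (4 * Real.exp x * ‖u x‖ + d) := by
  have ox := exp_neg_div_le_oddSol h1
  have oy := exp_neg_div_le_oddSol h2
  have ex := Real.exp_pos (-x)
  have ey := Real.exp_pos (-y)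
  have o := abs_oddSol_le y
  rw [abs_of_nonneg (zero_le_one.trans h2)] at o
  have e1 : u y = oddSol y * (u x / oddSol x + (u y / oddSol y - u x / oddSol x)) := by
    have : (oddSol y : ℂ) ≠ 0 := by exact_mod_cast (by linarith : 0 < oddSol y).ne'
    field_simp
    ring
  have e2 : ‖u x / oddSol x‖ ≤ 4 * Real.exp x * ‖u x‖ := by
    have h4 : Real.exp x * Real.exp (-x) = 1 := by rw [← Real.exp_add]; simp
    rw [norm_div, Complex.norm_real, Real.norm_of_nonneg (by linarith), div_le_iff₀ (by linarith)]
    calc ‖u x‖ = 4 * Real.exp x * ‖u x‖ * (Real.exp (-x) / 4) := by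
          linear_combination -‖u x‖ * h4
      _ ≤ _ := by gcongr
  rw [e1, norm_mul, Complex.norm_real, Real.norm_eq_abs]
  gcongr
  exact (norm_add_le _ _).trans (add_le_add e2 h)

/-- A bounded solution is nearly proportional to `oddSol` on `[1, ∞)`: the derivative of `u / oddSol` is
the Wronskian over `oddSol²`. Integrating it from `x` in both directions bounds `u y`, seen through
`wide x`, by `u x` up to an error governed by `g`. -/
theorem wide_mul_norm_le (hu : ∀ x, HasDerivAt u (u' x) x)
    (hu' : ∀ x, HasDerivAt u' ((1 - 3 * sechSq x : ℝ) * u x + g x) x)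
    (bu : ∀ x, ‖u x‖ ≤ M) (bu' : ∀ x, ‖u' x‖ ≤ M) (hG : 0 ≤ G)
    (hg : ∀ x, ‖g x‖ ≤ G * wideSup u x) {x y : ℝ} (hx : 1 ≤ x) (hy : 1 ≤ y) :
    wide x y * ‖u y‖ ≤ 16 * ‖u x‖ + 688 * G * wideSup u x := by
  have hV := wideSup_nonneg u x
  have hd : ∀ z, 1 ≤ z → HasDerivAt (fun x => u x / oddSol x) _ z :=
    fun z hz => hasDerivAt_div_oddSol hu hz
  set V := wideSup u x with hVd
  rcases le_total x y with hxy | hxy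
  · have := image_norm_le_of_norm_deriv_right_le_deriv_boundary (a := x) (b := y)
      (f := fun z => u z / oddSol z - u x / oddSol x)
      (f' := fun z => wronskian u u' z / (oddSol z : ℂ) ^ 2)
      (B := fun z => 344 / 5 * G * V * (Real.exp (5 / 4 * z - x / 4) - Real.exp x))
      (B' := fun z => 86 * G * V * Real.exp (5 / 4 * z - x / 4))
      (fun z hz => ((hd z (hx.trans hz.1)).sub_const _).continuousAt.continuousWithinAt)
      (fun z hz => ((hd z (hx.trans hz.1)).sub_const _).hasDerivWithinAt)
      (by
        simp only [sub_self, norm_zero]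
        rw [show 5 / 4 * x - x / 4 = x by ring]; simp)
      (fun z => by
        have h1 : HasDerivAt (fun z : ℝ => 5 / 4 * z - x / 4) (5 / 4) z := by
          simpa using ((hasDerivAt_id z).const_mul (5 / 4 : ℝ)).sub_const (x / 4)
        refine ((h1.exp.sub_const (Real.exp x)).const_mul (344 / 5 * G * V)).congr_deriv ?_
        ring)
      (fun z hz => by
        refine (norm_deriv_div_oddSol_le hu hu' bu bu' hG hg (hx.trans hz.1)).trans ?_
        calc 86 * G * wideSup u z * Real.exp z
            ≤ 86 * G * (Real.exp ((z - x) / 4) * V) * Real.exp z := by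
              gcongr; exact wideSup_le_right bu hz.1
          _ = 86 * G * V * (Real.exp ((z - x) / 4) * Real.exp z) := by ring
          _ = _ := by rw [← Real.exp_add]; ring_nf)
      (Set.right_mem_Icc.2 hxy)
    have h2 := norm_le_mul_div hx hy this
    rw [wide, min_eq_right (Real.exp_le_exp.2 (by linarith))]
    have e1 : Real.exp (-((y - x) / 4)) * (Real.exp (-y) * Real.exp x) ≤ 1 := by
      rw [← Real.exp_add, ← Real.exp_add, Real.exp_le_one_iff]; linarith
    have e2 : Real.exp (-((y - x) / 4)) * (Real.exp (-y) * Real.exp (5 / 4 * y - x / 4)) = 1 := by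
      rw [← Real.exp_add, ← Real.exp_add, Real.exp_eq_one_iff]; ring
    have e3 := Real.exp_pos x
    calc _ ≤ Real.exp (-((y - x) / 4)) * (4 * Real.exp (-y) * (4 * Real.exp x * ‖u x‖ +
          344 / 5 * G * V * (Real.exp (5 / 4 * y - x / 4) - 0))) := by
          refine mul_le_mul_of_nonneg_left (h2.trans ?_) (Real.exp_pos _).le
          gcongr
      _ = 16 * ‖u x‖ * (Real.exp (-((y - x) / 4)) * (Real.exp (-y) * Real.exp x)) +
          1376 / 5 * G * V * (Real.exp (-((y - x) / 4)) * (Real.exp (-y) *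
          Real.exp (5 / 4 * y - x / 4))) := by ring
      _ ≤ 16 * ‖u x‖ * 1 + 688 * G * V * 1 := by
          rw [e2]
          gcongr
          norm_num
      _ = _ := by ring
  · have := image_norm_le_of_norm_deriv_right_le_deriv_boundary (a := y) (b := x)
      (f := fun z => u z / oddSol z - u y / oddSol y)
      (f' := fun z => wronskian u u' z / (oddSol z : ℂ) ^ 2)
      (B := fun z => 172 * G * V * (Real.exp (3 / 2 * x - y / 2) - Real.exp (3 / 2 * x - z / 2)))
      (B' := fun z => 86 * G * V * Real.exp (3 / 2 * x - z / 2))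
      (fun z hz => ((hd z (hy.trans hz.1)).sub_const _).continuousAt.continuousWithinAt)
      (fun z hz => ((hd z (hy.trans hz.1)).sub_const _).hasDerivWithinAt)
      (by simp)
      (fun z => by
        have h1 : HasDerivAt (fun z : ℝ => 3 / 2 * x - z / 2) (-(1 / 2)) z :=
          ((hasDerivAt_id z).div_const 2).const_sub (3 / 2 * x)
        refine ((h1.exp.const_sub (Real.exp (3 / 2 * x - y / 2))).const_mul
          (172 * G * V)).congr_deriv ?_
        ring)
      (fun z hz => by
        refine (norm_deriv_div_oddSol_le hu hu' bu bu' hG hg (hy.trans hz.1)).trans ?_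
        calc 86 * G * wideSup u z * Real.exp z
            ≤ 86 * G * (Real.exp (3 / 2 * (x - z)) * V) * Real.exp z := by
              gcongr; exact wideSup_le_left bu hz.2.le
          _ = 86 * G * V * (Real.exp (3 / 2 * (x - z)) * Real.exp z) := by ring
          _ = _ := by rw [← Real.exp_add]; ring_nf)
      (Set.right_mem_Icc.2 hxy)
    rw [norm_sub_rev] at this
    have h2 := norm_le_mul_div hx hy this
    rw [wide, min_eq_left (Real.exp_le_exp.2 (by linarith))]
    have e1 : Real.exp (3 / 2 * (y - x)) * (Real.exp (-y) * Real.exp x) ≤ 1 := by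
      rw [← Real.exp_add, ← Real.exp_add, Real.exp_le_one_iff]; linarith
    have e2 : Real.exp (3 / 2 * (y - x)) * (Real.exp (-y) * Real.exp (3 / 2 * x - y / 2)) = 1 := by
      rw [← Real.exp_add, ← Real.exp_add, Real.exp_eq_one_iff]; ring
    have e3 := Real.exp_pos (3 / 2 * x - x / 2)
    calc _ ≤ Real.exp (3 / 2 * (y - x)) * (4 * Real.exp (-y) * (4 * Real.exp x * ‖u x‖ +
          172 * G * V * (Real.exp (3 / 2 * x - y / 2) - 0))) := by
          refine mul_le_mul_of_nonneg_left (h2.trans ?_) (Real.exp_pos _).le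
          gcongr
      _ = 16 * ‖u x‖ * (Real.exp (3 / 2 * (y - x)) * (Real.exp (-y) * Real.exp x)) +
          688 * G * V * (Real.exp (3 / 2 * (y - x)) * (Real.exp (-y) *
          Real.exp (3 / 2 * x - y / 2))) := by ring
      _ ≤ 16 * ‖u x‖ * 1 + 688 * G * V * 1 := by
          rw [e2]
          gcongr
      _ = _ := by ring

/-- An odd bounded solution of `u'' = (1 - 3s)u + g` with a relatively small right-hand side is
bounded below by its own windowed supremum, so that it cannot vanish to the right of `1`. -/
theorem wideSup_le_norm (hu : ∀ x, HasDerivAt u (u' x) x)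
    (hu' : ∀ x, HasDerivAt u' ((1 - 3 * sechSq x : ℝ) * u x + g x) x)
    (bu : ∀ x, ‖u x‖ ≤ M) (bu' : ∀ x, ‖u' x‖ ≤ M) (hG : 0 ≤ G)
    (hg : ∀ x, ‖g x‖ ≤ G * wideSup u x) (ou : ∀ x, ‖u (-x)‖ = ‖u x‖) {L : ℝ} (hL : 1 ≤ L)
    (h01 : ∀ y, 0 ≤ y → y ≤ 1 → ‖u y‖ ≤ L * ‖u 1‖) {x : ℝ} (hx : 1 ≤ x) :
    wideSup u x ≤ L * (16 * ‖u x‖ + 688 * G * wideSup u x) := by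
  have hV := wideSup_nonneg u x
  have key : ∀ y, 1 ≤ y → wide x y * ‖u y‖ ≤ 16 * ‖u x‖ + 688 * G * wideSup u x :=
    fun y hy => wide_mul_norm_le hu hu' bu bu' hG hg hx hy
  have key0 : ∀ y, 0 ≤ y → wide x y * ‖u y‖ ≤ L * (16 * ‖u x‖ + 688 * G * wideSup u x) := by
    intro y hy
    rcases le_total 1 y with h | h
    · exact (key y h).trans (le_mul_of_one_le_left (by positivity) hL)
    · have h1 : wide x y ≤ wide x 1 := by
        rw [wide, wide, min_eq_left (b := Real.exp (-((1 - x) / 4)))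
          (Real.exp_le_exp.2 (by linarith))]
        exact (min_le_left _ _).trans (Real.exp_le_exp.2 (by linarith))
      calc wide x y * ‖u y‖ ≤ wide x 1 * (L * ‖u 1‖) := by
            have := wide_pos x 1
            gcongr
            exact h01 y hy h
        _ = L * (wide x 1 * ‖u 1‖) := by ring
        _ ≤ _ := by gcongr; exact key 1 le_rfl
  refine ciSup_le fun y => ?_
  rcases le_total 0 y with h | h
  · exact key0 y h
  · rw [← ou]
    refine le_trans ?_ (key0 (-y) (by linarith))
    gcongr
    refine le_min ((min_le_left _ _).trans (Real.exp_le_exp.2 (by linarith)))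
      ((min_le_left _ _).trans (Real.exp_le_exp.2 (by linarith)))

end Perturbation

/-! ### Local comparison of the full problem with the limiting one -/

theorem MemSobAll.add {f g : ℝ → ℂ} (hf : MemSobAll f) (hg : MemSobAll g) :
    MemSobAll fun ξ => f ξ + g ξ := fun s => (hf s).add (hg s)

theorem MemSobAll.const_mul {f : ℝ → ℂ} (c : ℂ) (hf : MemSobAll f) :
    MemSobAll fun ξ => c * f ξ := fun s => (hf s).const_mul c

theorem MemSobAll.conv {f g : ℝ → ℂ} (hf : MemSobAll f) (hg : MemSobAll g) :
    MemSobAll (GravityCapillaryWhitham.conv f g) := fun s =>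
  (memSob_conv (le_max_right s 1) (hf _) (hg _)).mono (le_max_left s 1)

theorem MemSobAll.strip_mul {P : ℝ → ℂ} (hP : MemSobAll P) {D : ℂ → ℂ} {B : ℝ}
    (hD : StripBound D B) : MemSobAll fun ξ : ℝ => D (2 * Real.pi * ξ) * P ξ := fun s => by
  have hD0 : Continuous fun ξ : ℝ => D (2 * Real.pi * ξ) := by
    simpa using hD.continuous (η := 0) (by simp)
  exact MemSob.mul (a := 0) (c := B) (hP _) hD0.aestronglyMeasurable fun ξ => by
    rw [Real.rpow_zero, mul_one]; exact hD.norm_le _ (by simp)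

/-- The `L²` norm of `q` seen through the window centred at `x`. -/
noncomputable def windowNorm (x : ℝ) (q : ℝ → ℂ) : ℝ :=
  (eLpNorm (fun y => (window x y : ℂ) * q y) 2).toReal

theorem windowNorm_nonneg (x : ℝ) (q : ℝ → ℂ) : 0 ≤ windowNorm x q := ENNReal.toReal_nonneg

theorem memLp_window_mul (x : ℝ) {q : ℝ → ℂ} (hq : MemLp q 2) :
    MemLp (fun y => (window x y : ℂ) * q y) 2 := by
  refine hq.of_le ((Complex.continuous_ofReal.comp
    (continuous_window x)).aestronglyMeasurable.mul hq.1) (Eventually.of_forall fun y => ?_)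
  rw [norm_mul, Complex.norm_real, Real.norm_eq_abs, abs_of_pos (window_pos x y)]
  exact mul_le_of_le_one_left (norm_nonneg _) (window_le_one x y)

theorem windowNorm_add_le (x : ℝ) {p q : ℝ → ℂ} (hp : MemLp p 2) (hq : MemLp q 2) :
    windowNorm x (fun y => p y + q y) ≤ windowNorm x p + windowNorm x q := by
  have h1 := memLp_window_mul x hp
  have h2 := memLp_window_mul x hq
  rw [windowNorm, windowNorm, windowNorm, ← ENNReal.toReal_add h1.2.ne h2.2.ne]
  simp only [mul_add]
  exact ENNReal.toReal_mono (ENNReal.add_lt_top.2 ⟨h1.2, h2.2⟩).ne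
    (eLpNorm_add_le h1.1 h2.1 (by norm_num))

theorem windowNorm_le_mul (x : ℝ) {p q : ℝ → ℂ} {c : ℝ} (hc : 0 ≤ c) (hp : MemLp p 2)
    (h : ∀ y, ‖q y‖ ≤ c * ‖p y‖) : windowNorm x q ≤ c * windowNorm x p := by
  have h1 := memLp_window_mul x hp
  have h2 := eLpNorm_le_mul_eLpNorm_of_ae_le_mul (μ := volume)
    (f := fun y => (window x y : ℂ) * q y) (g := fun y => (window x y : ℂ) * p y) (c := c)
    (Eventually.of_forall fun y => by
      rw [norm_mul, norm_mul, mul_left_comm]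
      gcongr
      exact h y) 2
  have := ENNReal.toReal_mono (ENNReal.mul_lt_top ENNReal.ofReal_lt_top h1.2).ne h2
  rwa [ENNReal.toReal_mul, ENNReal.toReal_ofReal hc] at this

/-- The windowed estimate for multipliers with analytic symbols, in terms of `windowNorm`. -/
theorem windowNorm_strip_mul_le (x : ℝ) {P : ℝ → ℂ} (hP : MemSob 1 P) {D : ℂ → ℂ} {B : ℝ}
    (hD : StripBound D B) :
    windowNorm x (𝓕⁻ fun ξ : ℝ => D (2 * Real.pi * ξ) * P ξ) ≤ 2 * B * windowNorm x (𝓕⁻ P) := by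
  have h := eLpNorm_window_mul_fourierInv_le (hP.integrable le_rfl) (hP.memLp_two zero_le_one) hD x
  have := ENNReal.toReal_mono (ENNReal.mul_lt_top ENNReal.ofReal_lt_top
    (memLp_window_mul x hP.memLp_fourierInv).2).ne h
  have hB := hD.nonneg
  rwa [ENNReal.toReal_mul, ENNReal.toReal_ofReal (by positivity)] at this

/-- A windowed supremum controls the windowed `L²` norm, since `window x / wide x` has `L²` norm at
most `2`. -/
theorem windowNorm_le_of_wide {x V : ℝ} {q : ℝ → ℂ} (hV : ∀ y, wide x y * ‖q y‖ ≤ V) :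
    windowNorm x q ≤ 2 * V := by
  have hV0 : 0 ≤ V := (mul_nonneg (wide_pos x x).le (norm_nonneg _)).trans (hV x)
  have h1 : eLpNorm (fun y => (window x y : ℂ) * q y) 2 ≤
      ENNReal.ofReal V * eLpNorm (fun y : ℝ => Real.exp (-|(y - x) / 4|)) 2 := by
    refine eLpNorm_le_mul_eLpNorm_of_ae_le_mul (Eventually.of_forall fun y => ?_) 2
    rw [norm_mul, Complex.norm_real, Real.norm_eq_abs, abs_of_pos (window_pos x y),
      Real.norm_of_nonneg (Real.exp_pos _).le]
    calc window x y * ‖q y‖ ≤ (wide x y * Real.exp (-|(y - x) / 4|)) * ‖q y‖ := by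
          gcongr; exact wide_mul_exp_abs_le x y
      _ = wide x y * ‖q y‖ * Real.exp (-|(y - x) / 4|) := by ring
      _ ≤ _ := by gcongr; exact hV y
  have h2 : eLpNorm (fun y : ℝ => Real.exp (-|(y - x) / 4|)) 2 = ENNReal.ofReal 2 := by
    have h3 : eLpNorm (fun y : ℝ => Real.exp (-|(y - x) / 4|)) 2 ^ 2 = ENNReal.ofReal 2 ^ 2 := by
      rw [eLpNorm_two_sq]
      have e : ∀ y : ℝ, ‖Real.exp (-|(y - x) / 4|)‖ₑ ^ 2 =
          ENNReal.ofReal (Real.exp (-|(y - x) / 2|)) := fun y => by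
        rw [Real.enorm_of_nonneg (Real.exp_pos _).le, ← ENNReal.ofReal_pow (Real.exp_pos _).le,
          ← Real.exp_nat_mul]
        congr 2
        rw [abs_div, abs_div, abs_two, abs_of_pos (by norm_num : (0 : ℝ) < 4)]
        push_cast; ring
      simp only [e]
      rw [lintegral_sub_right_eq_self (fun y : ℝ => ENNReal.ofReal (Real.exp (-|y / 2|))) x]
      have hI : Integrable fun y : ℝ => Real.exp (-|y / 2|) :=
        integrable_exp_neg_abs.comp_div two_ne_zero
      rw [← ofReal_integral_eq_lintegral_ofReal hI
        (Eventually.of_forall fun t => (Real.exp_pos _).le),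
        Measure.integral_comp_div (fun t => Real.exp (-|t|)) 2,
        integral_comp_abs (f := fun t => Real.exp (-t)), integral_exp_neg_Ioi_zero,
        ← ENNReal.ofReal_pow (by norm_num)]
      norm_num
    exact (ENNReal.pow_right_strictMono two_ne_zero).injective h3
  rw [h2, ← ENNReal.ofReal_mul hV0] at h1
  have := ENNReal.toReal_mono ENNReal.ofReal_ne_top h1
  rwa [ENNReal.toReal_ofReal (by positivity), mul_comm] at this

theorem exists_hasDerivAt_window (x y : ℝ) :
    ∃ w, HasDerivAt (window x) w y ∧ |w| ≤ 2 * window x y := by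
  have h1 : HasDerivAt (fun y => Real.exp (2 * (x - y)) + Real.exp ((y - x) / 2))
      (Real.exp (2 * (x - y)) * -2 + Real.exp ((y - x) / 2) * (1 / 2)) y := by
    refine HasDerivAt.add (HasDerivAt.exp ?_) (HasDerivAt.exp ?_)
    · simpa using ((hasDerivAt_id y).const_sub x).const_mul 2
    · exact ((hasDerivAt_id y).sub_const x).div_const 2
  have a := Real.exp_pos (2 * (x - y))
  have b := Real.exp_pos ((y - x) / 2)
  refine ⟨_, h1.inv (by positivity), ?_⟩
  rw [window, abs_div, abs_of_pos (a := (_ : ℝ) ^ 2) (by positivity), div_le_iff₀ (by positivity),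
    mul_assoc, sq, inv_mul_cancel_left₀ (by positivity), abs_neg, abs_le]
  constructor <;> linarith

/-- A localised Sobolev embedding: the embedding of `H¹` applied to `window x • h`. -/
theorem norm_le_windowNorm {h h' : ℝ → ℂ} (hd : ∀ y, HasDerivAt h (h' y) y) (hm : MemLp h 2)
    (hm' : MemLp h' 2) (x : ℝ) :
    ‖h x‖ ≤ 2 * embConst.toReal * (3 * windowNorm x h + windowNorm x h') := by
  choose w hw hwb using exists_hasDerivAt_window x
  have hwm : Measurable w := by
    have : w = deriv (window x) := funext fun y => (hw y).deriv.symm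
    rw [this]; exact measurable_deriv _
  have hq : ∀ y, HasDerivAt (fun y => (window x y : ℂ) * h y)
      (w y * h y + window x y * h' y) y := fun y => (hw y).ofReal_comp.mul (hd y)
  have m1 := memLp_window_mul x hm
  have m2 := memLp_window_mul x hm'
  have b3 : ∀ y, ‖(w y : ℂ) * h y‖ ≤ 2 * ‖(window x y : ℂ) * h y‖ := fun y => by
    rw [norm_mul, norm_mul, Complex.norm_real, Complex.norm_real, Real.norm_eq_abs,
      Real.norm_eq_abs, abs_of_pos (window_pos x y), ← mul_assoc]
    gcongr
    exact hwb y
  have m3 : MemLp (fun y => (w y : ℂ) * h y) 2 :=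
    m1.of_le_mul ((Complex.measurable_ofReal.comp hwm).aestronglyMeasurable.mul hm.1)
      (Eventually.of_forall b3)
  obtain ⟨f, mf, ef, bf, -⟩ := exists_fourierInv_eq hq m1 (m3.add m2)
  have h1 := mf.norm_fourierInv_le x
  rw [ef] at h1
  have hx : window x x = 1 / 2 := by simp [window]; norm_num
  simp only [hx, norm_mul] at h1
  have h2 : eLpNorm (fun y => (w y : ℂ) * h y + window x y * h' y) 2 ≤
      ENNReal.ofReal 2 * eLpNorm (fun y => (window x y : ℂ) * h y) 2 +
        eLpNorm (fun y => (window x y : ℂ) * h' y) 2 :=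
    (eLpNorm_add_le m3.1 m2.1 (by norm_num)).trans (add_le_add
      (eLpNorm_le_mul_eLpNorm_of_ae_le_mul (Eventually.of_forall b3) 2) le_rfl)
  have h3 := bf.trans (add_le_add le_rfl h2)
  have t1 := m1.2
  have t2 := m2.2
  have h4 := ENNReal.toReal_mono (by finiteness) h3
  rw [ENNReal.toReal_add (by finiteness) (by finiteness), ENNReal.toReal_add (by finiteness)
    (by finiteness), ENNReal.toReal_mul, ENNReal.toReal_ofReal (by norm_num)] at h4
  change _ ≤ windowNorm x h + (2 * windowNorm x h + windowNorm x h') at h4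
  rw [ENNReal.toReal_mul] at h1
  have h5 : ‖((1 / 2 : ℝ) : ℂ)‖ = 1 / 2 := by
    rw [Complex.norm_real, Real.norm_of_nonneg (by norm_num)]
  rw [h5] at h1
  have h6 := mul_le_mul_of_nonneg_left h4 (ENNReal.toReal_nonneg (a := embConst))
  nlinarith

theorem le_re_limitSymbol {γ A : ℝ} (hγ : 0 < γ) (hA : 8 * γ ≤ A) {k : ℂ} (hk : |k.im| ≤ 2) :
    γ * (5 + k.re ^ 2) ≤ ‖(γ : ℂ) * (1 + k ^ 2) + A‖ := by
  refine le_trans ?_ (Complex.re_le_norm _)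
  have h : k.im ^ 2 ≤ 4 := by rw [← sq_abs]; nlinarith [abs_nonneg k.im]
  have : ((γ : ℂ) * (1 + k ^ 2) + A).re = γ * (1 + k.re ^ 2 - k.im ^ 2) + A := by
    simp [sq]; left; ring
  rw [this]
  nlinarith

/-- The symbol `1/(γ(1 + k²) + A)`, as a function of the wave number, of the resolvent of the limiting
dispersion operator `γ(1 - ∂²)`. -/
noncomputable def limitResolvent (γ A : ℝ) (k : ℂ) : ℂ := ((γ : ℂ) * (1 + k ^ 2) + A)⁻¹

theorem stripBound_limitResolvent {γ A : ℝ} (hγ : 0 < γ) (hA : 8 * γ ≤ A) :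
    StripBound (limitResolvent γ A) (1 / γ) ∧
    StripBound (fun k => Complex.I * k * limitResolvent γ A k) (1 / γ) := by
  have hne : ∀ k : ℂ, |k.im| ≤ 2 → (γ : ℂ) * (1 + k ^ 2) + A ≠ 0 := fun k hk h => by
    have := le_re_limitSymbol hγ hA hk
    rw [h, norm_zero] at this
    nlinarith [sq_nonneg k.re]
  have hd : ∀ k : ℂ, |k.im| ≤ 2 →
      DifferentiableAt ℂ (limitResolvent γ A) k := fun k hk =>
    DifferentiableAt.inv (by fun_prop) (hne k hk)
  refine ⟨⟨hd, fun k hk => ?_⟩, ⟨fun k hk => DifferentiableAt.mul (by fun_prop) (hd k hk),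
    fun k hk => ?_⟩⟩
  · have := le_re_limitSymbol hγ hA hk
    rw [limitResolvent, norm_inv, ← one_div]
    refine one_div_le_one_div_of_le hγ (le_trans ?_ this)
    nlinarith [sq_nonneg k.re]
  · have h1 := le_re_limitSymbol hγ hA hk
    have h2 : 0 < ‖(γ : ℂ) * (1 + k ^ 2) + A‖ := norm_pos_iff.2 (hne k hk)
    rw [norm_mul, limitResolvent, norm_inv, norm_mul, Complex.norm_I, one_mul, ← div_eq_mul_inv,
      div_le_div_iff₀ h2 hγ, one_mul]
    have h3 : ‖k‖ ≤ |k.re| + 2 := (Complex.norm_le_abs_re_add_abs_im k).trans (by linarith)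
    have h4 : |k.re| ≤ 1 + k.re ^ 2 := by
      rw [← sq_abs k.re]; nlinarith [sq_nonneg (|k.re| - 1), abs_nonneg k.re]
    nlinarith

/-- Differentiating the profile equation. -/
theorem SolvesHat.deriv {β ε : ℝ} {f : ℝ → ℂ} (hf : MemSobAll f) (hs : SolvesHat β ε f) :
    ∀ᵐ ξ, (scaledSymbol β ε ξ : ℂ) * dMul f ξ = -(2 * conv f (dMul f) ξ) := by
  have hV := memSobAll_dMul hf
  have hd : ∀ x, HasDerivAt (𝓕⁻ (conv f f)) (𝓕⁻ (fun ξ => 2 * conv f (dMul f) ξ) x) x := by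
    intro x
    have h1 : (𝓕⁻ (conv f f)) = fun x => 𝓕⁻ f x * 𝓕⁻ f x :=
      funext fun x => (hf 1).fourierInv_conv (hf 1) x
    rw [h1, fourierInv_const_mul, (hf 1).fourierInv_conv (hV 1)]
    exact (((hf 2).hasDerivAt x).mul ((hf 2).hasDerivAt x)).congr_deriv (by ring)
  have h2 := ae_eq_dMul (memSob_conv le_rfl (hf 1) (hf 1)) ((hf.conv hV).const_mul 2 1) hd
  filter_upwards [hs, h2] with ξ h3 h4
  rw [h4, dMul, dMul]
  linear_combination (2 * Real.pi * Complex.I * ξ) * h3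

theorem windowNorm_le_mul_add (x : ℝ) {p₁ p₂ q : ℝ → ℂ} {c : ℝ} (hc : 0 ≤ c) (h₁ : MemLp p₁ 2)
    (h₂ : MemLp p₂ 2) (h : ∀ y, ‖q y‖ ≤ c * (‖p₁ y‖ + ‖p₂ y‖)) :
    windowNorm x q ≤ c * (windowNorm x p₁ + windowNorm x p₂) := by
  have e : ∀ p : ℝ → ℂ, MemLp p 2 → MemLp (fun y => (‖p y‖ : ℂ)) 2 ∧
      windowNorm x (fun y => (‖p y‖ : ℂ)) ≤ windowNorm x p := fun p hp => by
    have hn : MemLp (fun y => (‖p y‖ : ℂ)) 2 := hp.norm.ofReal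
    have := windowNorm_le_mul x zero_le_one hp (q := fun y => (‖p y‖ : ℂ)) (by simp)
    exact ⟨hn, by simpa using this⟩
  refine (windowNorm_le_mul x hc ((e p₁ h₁).1.add (e p₂ h₂).1) (q := q) fun y => ?_).trans ?_
  · simp only [Pi.add_apply]
    rw [← Complex.ofReal_add, Complex.norm_real, Real.norm_of_nonneg (by positivity)]
    exact h y
  · gcongr
    exact (windowNorm_add_le x (e p₁ h₁).1 (e p₂ h₂).1).trans
      (add_le_add (e p₁ h₁).2 (e p₂ h₂).2)

/-- The arithmetic of `norm_strip_mul_le_of_wide`. The letters stand for windowed norms of `h`, `p`, `v`,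
`u` (index `0`) and of their derivatives (index `1`); for small `δ` the terms with `v` on the right
are absorbed, which leaves a bound by `u` alone. -/
theorem windowed_bound_closing {γ δ N H₀ P₀ V₀ U₀ H₁ P₁ V₁ U₁ : ℝ} (hγ : 0 < γ) (hδ : 0 ≤ δ)
    (hN : 0 < N) (hs : 4 * δ * N ≤ 1) (v0 : 0 ≤ V₀) (v1 : 0 ≤ V₁)
    (w1 : H₀ ≤ 2 * δ * P₀) (w2 : P₀ ≤ N * V₀)
    (w3 : V₀ ≤ U₀ + H₀) (w4 : U₁ ≤ 2 * (1 / γ) * P₀) (w5 : H₁ ≤ 2 * δ * P₁) (w6 : V₁ ≤ U₁ + H₁)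
    (w7 : P₁ ≤ N * (V₁ + V₀)) :
    3 * H₀ + H₁ ≤ δ * (N * (20 + 16 * (N / γ))) * U₀ := by
  have hNγ : 0 ≤ N / γ := by positivity
  have h1 : H₀ ≤ 2 * δ * N * V₀ := w1.trans (by nlinarith)
  have h2 : V₀ ≤ 2 * U₀ := by nlinarith
  have h3 : H₁ ≤ 2 * δ * N * (V₁ + V₀) := w5.trans (by nlinarith)
  have h4 : U₁ ≤ 2 * (N / γ) * V₀ := w4.trans (by
    calc 2 * (1 / γ) * P₀ ≤ 2 * (1 / γ) * (N * V₀) := by gcongr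
      _ = _ := by ring)
  have h5 : V₁ ≤ (4 * (N / γ) + 1) * V₀ := by nlinarith
  have hδN : 0 ≤ δ * N := by positivity
  calc 3 * H₀ + H₁ ≤ 3 * (2 * δ * N * V₀) + 2 * δ * N * ((4 * (N / γ) + 1) * V₀ + V₀) := by
        have : 2 * δ * N * (V₁ + V₀) ≤ 2 * δ * N * ((4 * (N / γ) + 1) * V₀ + V₀) := by
          gcongr
        linarith
    _ = δ * N * (10 + 8 * (N / γ)) * V₀ := by ring
    _ ≤ δ * N * (10 + 8 * (N / γ)) * (2 * U₀) := by gcongr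
    _ = _ := by ring

/-- A small analytic multiplier `D` applied to `p = O(v)`, where `v = u + h` with `h = Dp`, is
pointwise small relative to the windowed supremum of `u`. -/
theorem norm_strip_mul_le_of_wide {γ A δ N : ℝ} (hγ : 0 < γ) (hA : 8 * γ ≤ A) (hN : 0 < N)
    (hs : 4 * δ * N ≤ 1) {D : ℂ → ℂ} (hD : StripBound D δ) {P V U H : ℝ → ℂ} (hP : MemSobAll P)
    (hV : MemSobAll V)
    (hU : U = fun ξ : ℝ => limitResolvent γ A (2 * Real.pi * ξ) * P ξ)
    (hH : H = fun ξ : ℝ => D (2 * Real.pi * ξ) * P ξ) (hVUH : V =ᵐ[volume] fun ξ => U ξ + H ξ)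
    (bp : ∀ y, ‖𝓕⁻ P y‖ ≤ N * ‖𝓕⁻ V y‖)
    (bdp : ∀ y, ‖𝓕⁻ (dMul P) y‖ ≤ N * (‖𝓕⁻ (dMul V) y‖ + ‖𝓕⁻ V y‖)) {x W : ℝ}
    (hW : ∀ y, wide x y * ‖𝓕⁻ U y‖ ≤ W) :
    ‖𝓕⁻ H x‖ ≤ δ * (4 * embConst.toReal * (N * (20 + 16 * (N / γ)))) * W := by
  obtain ⟨hJ, hJ1⟩ := stripBound_limitResolvent hγ hA
  have mU : MemSobAll U := by rw [hU]; exact hP.strip_mul hJ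
  have mH : MemSobAll H := by rw [hH]; exact hP.strip_mul hD
  have dV := memSobAll_dMul hV
  have dU := memSobAll_dMul mU
  have dH := memSobAll_dMul mH
  have dP := memSobAll_dMul hP
  have mF : ∀ {Q : ℝ → ℂ}, MemSobAll Q → MemLp (𝓕⁻ Q) 2 := fun hQ => (hQ 1).memLp_fourierInv
  have w1 : windowNorm x (𝓕⁻ H) ≤ 2 * δ * windowNorm x (𝓕⁻ P) := by
    rw [hH]; exact windowNorm_strip_mul_le x (hP 1) hD
  have w2 : windowNorm x (𝓕⁻ P) ≤ N * windowNorm x (𝓕⁻ V) :=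
    windowNorm_le_mul x hN.le (mF hV) bp
  have w3 : windowNorm x (𝓕⁻ V) ≤ windowNorm x (𝓕⁻ U) + windowNorm x (𝓕⁻ H) := by
    rw [show 𝓕⁻ V = fun x => 𝓕⁻ U x + 𝓕⁻ H x from funext fun x => by
      rw [fourierInv_congr_ae hVUH, (mU 1).fourierInv_add (mH 1)]]
    exact windowNorm_add_le x (mF mU) (mF mH)
  have w4 : windowNorm x (𝓕⁻ (dMul U)) ≤ 2 * (1 / γ) * windowNorm x (𝓕⁻ P) := by
    have h := windowNorm_strip_mul_le x (hP 1) hJ1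
    have e : dMul U = fun ξ : ℝ => Complex.I * (2 * Real.pi * ξ) *
        limitResolvent γ A (2 * Real.pi * ξ) * P ξ := funext fun ξ => by
      rw [dMul, hU]; ring
    rw [e]
    exact h
  have w5 : windowNorm x (𝓕⁻ (dMul H)) ≤ 2 * δ * windowNorm x (𝓕⁻ (dMul P)) := by
    rw [show dMul H = fun ξ : ℝ => D (2 * Real.pi * ξ) * dMul P ξ from funext fun ξ => by
        rw [dMul, hH, dMul]; ring]
    exact windowNorm_strip_mul_le x (dP 1) hD
  have w6 : windowNorm x (𝓕⁻ (dMul V)) ≤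
      windowNorm x (𝓕⁻ (dMul U)) + windowNorm x (𝓕⁻ (dMul H)) := by
    have : dMul V =ᵐ[volume] fun ξ => dMul U ξ + dMul H ξ := by
      filter_upwards [hVUH] with ξ h1
      rw [dMul, h1, dMul, dMul]
      ring
    rw [show 𝓕⁻ (dMul V) = fun x => 𝓕⁻ (dMul U) x + 𝓕⁻ (dMul H) x from funext fun x => by
      rw [fourierInv_congr_ae this, (dU 1).fourierInv_add (dH 1)]]
    exact windowNorm_add_le x (mF dU) (mF dH)
  have w7 := windowNorm_le_mul_add x hN.le (mF dV) (mF hV) bdp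
  have w8 : windowNorm x (𝓕⁻ U) ≤ 2 * W := windowNorm_le_of_wide hW
  have w9 := norm_le_windowNorm (mH 2).hasDerivAt (mF mH) (mF dH) x
  have w10 := windowed_bound_closing hγ hD.nonneg hN hs (windowNorm_nonneg _ _)
    (windowNorm_nonneg _ _) w1 w2 w3 w4 w5 w6 w7
  have hδ := hD.nonneg
  have hE : 0 ≤ embConst.toReal := ENNReal.toReal_nonneg
  calc ‖𝓕⁻ H x‖ ≤ 2 * embConst.toReal *
        (3 * windowNorm x (𝓕⁻ H) + windowNorm x (𝓕⁻ (dMul H))) := w9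
    _ ≤ 2 * embConst.toReal * (δ * (N * (20 + 16 * (N / γ))) * (2 * W)) := by
        gcongr
        exact w10.trans (by gcongr)
    _ = _ := by ring

/-- The derivative `v = ζ'` of a solution `ζ` splits as `u + h`, where `u` satisfies the differentiated
limiting equation with the forcing `-(A - 2ζ)h` and `h` is small relative to the windowed supremum of
`u`. The differentiated equation says that the operator with symbol `ℓ_ε + A` maps `v` to
`p = (A - 2ζ)v`; `u` and `h` arise by applying to `p` the limiting resolvent and the difference of the
two resolvents. -/
theorem exists_splitting {β : ℝ} (hβ : 1 / 3 < β) : ∃ A : ℝ, 0 < A ∧ ∀ M : ℝ, 0 ≤ M →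
    ∃ ε₁ C : ℝ, 0 < ε₁ ∧ 0 < C ∧ ∀ ε : ℝ, 0 < ε → ε ≤ ε₁ → ∀ f : ℝ → ℂ, MemSobAll f →
      SolvesHat β ε f → (∀ x, 𝓕⁻ f (-x) = 𝓕⁻ f x) → (∀ x, ‖𝓕⁻ f x‖ ≤ M) →
      (∀ x, ‖𝓕⁻ (dMul f) x‖ ≤ M) →
      ∃ U H : ℝ → ℂ, MemSobAll U ∧
        (∀ x, 𝓕⁻ (dMul f) x = 𝓕⁻ U x + 𝓕⁻ H x) ∧
        (∀ x, dispCoeff β * 𝓕⁻ (dMul (dMul U)) x =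
          (dispCoeff β + 2 * 𝓕⁻ f x) * 𝓕⁻ U x - (A - 2 * 𝓕⁻ f x) * 𝓕⁻ H x) ∧
        (∀ x, ‖𝓕⁻ U (-x)‖ = ‖𝓕⁻ U x‖) ∧
        ∀ x V, (∀ y, wide x y * ‖𝓕⁻ U y‖ ≤ V) → ‖𝓕⁻ H x‖ ≤ C * ε ^ 2 * V := by
  obtain ⟨ε₁, A, c, hε₁, hA, hc, hA8, hres⟩ := resolvent_strip hβ
  obtain ⟨_, _, hsym⟩ := scaledSymbol_bounds hβ
  have hγ := dispCoeff_pos hβ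
  set γ := dispCoeff β with hγd
  obtain ⟨hJ, hJ1⟩ := stripBound_limitResolvent hγ hA8
  refine ⟨A, hA, fun M hM => ?_⟩
  set N := A + 2 * M with hN
  have hN0 : 0 < N := by positivity
  refine ⟨min ε₁ (1 / (4 * c * N + 1)), c * (4 * embConst.toReal * (N * (20 + 16 * (N / γ)))) + 1,
    lt_min hε₁ (by positivity), by positivity, fun ε hε hε' f hf hs ef bf bf' => ?_⟩
  have hεε₁ : ε ≤ ε₁ := hε'.trans (min_le_left _ _)
  have hε1 : ε ≤ 1 := (hε'.trans (min_le_right _ _)).trans (by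
    rw [div_le_one (by positivity)]
    have : 0 < c * N := by positivity
    linarith)
  have hsmall : 4 * c * N * ε ^ 2 ≤ 1 := by
    have h1 : ε * (4 * c * N + 1) ≤ 1 := by
      rw [← le_div_iff₀ (by positivity)]; exact hε'.trans (min_le_right _ _)
    have h2 : 0 < c * N := by positivity
    nlinarith
  obtain ⟨D, hD⟩ : ∃ D : ℂ → ℂ, D = fun k => (scaledSymbolC β ε k + A)⁻¹ -
      limitResolvent γ A k := ⟨_, rfl⟩
  have hDs : StripBound D (c * ε ^ 2) :=
    ⟨fun k hk => by rw [hD]; exact (hres ε hε hεε₁ k hk).1,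
      fun k hk => by rw [hD]; exact (hres ε hε hεε₁ k hk).2⟩
  -- the transforms of `v = ζ'`, of `p = (A - 2ζ)v` and of the two parts of `v`
  set V := dMul f with hVd
  have hV : MemSobAll V := memSobAll_dMul hf
  set P : ℝ → ℂ := fun ξ => A * V ξ + (-2) * conv f V ξ with hPd
  have hP : MemSobAll P := (hV.const_mul A).add ((hf.conv hV).const_mul (-2))
  set U : ℝ → ℂ := fun ξ : ℝ => limitResolvent γ A (2 * Real.pi * ξ) * P ξ with hUd
  have hU : MemSobAll U := hP.strip_mul hJ
  set H : ℝ → ℂ := fun ξ : ℝ => D (2 * Real.pi * ξ) * P ξ with hHd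
  have hH : MemSobAll H := hP.strip_mul hDs
  have hne : ∀ ξ : ℝ, (γ : ℂ) * (1 + (2 * Real.pi * ξ : ℂ) ^ 2) + A ≠ 0 := fun ξ => by
    have : 0 < γ * (1 + (2 * Real.pi * ξ) ^ 2) + A := by positivity
    exact_mod_cast this.ne'
  have hVUH : V =ᵐ[volume] fun ξ => U ξ + H ξ := by
    filter_upwards [hs.deriv hf] with ξ h1
    have h2 : (scaledSymbol β ε ξ : ℂ) + A ≠ 0 := by
      have : 0 < scaledSymbol β ε ξ + A := by linarith [(hsym ε hε hε1 ξ).1]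
      exact_mod_cast this.ne'
    have h3 : scaledSymbolC β ε (2 * Real.pi * ξ) = scaledSymbol β ε ξ := by
      have := scaledSymbolC_ofReal hβ hε ξ
      push_cast at this
      exact this
    have h4 : P ξ = (scaledSymbol β ε ξ + A) * V ξ := by
      simp only [hPd]
      linear_combination -h1
    simp only [hUd, hHd, hD]
    rw [h3, ← add_mul, add_sub_cancel, h4, inv_mul_cancel_left₀ h2]
  have ev : ∀ x, 𝓕⁻ V x = 𝓕⁻ U x + 𝓕⁻ H x := fun x => by
    rw [fourierInv_congr_ae hVUH, (hU 1).fourierInv_add (hH 1)]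
  have ep : ∀ x, 𝓕⁻ P x = (A - 2 * 𝓕⁻ f x) * 𝓕⁻ V x := fun x => by
    rw [hPd, (hV.const_mul A 1).fourierInv_add ((hf.conv hV).const_mul (-2) 1),
      fourierInv_const_mul, fourierInv_const_mul, (hf 1).fourierInv_conv (hV 1)]
    ring
  have hp_eq : ∀ ξ, P ξ = ((γ + A : ℝ) : ℂ) * U ξ + (-γ : ℂ) * dMul (dMul U) ξ := fun ξ => by
    have h1 : P ξ = ((γ : ℂ) * (1 + (2 * Real.pi * ξ : ℂ) ^ 2) + A) * U ξ := by
      simp only [hUd, limitResolvent]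
      rw [mul_inv_cancel_left₀ (hne ξ)]
    rw [h1, dMul, dMul]
    push_cast
    linear_combination (γ * (2 * Real.pi * ξ) ^ 2 * U ξ) * Complex.I_mul_I
  have hdv : ∀ x, HasDerivAt (𝓕⁻ V) (𝓕⁻ (dMul V) x) x := (hV 2).hasDerivAt
  -- the pointwise bounds for `p` and its derivative
  have bA : ∀ y, ‖(A : ℂ) - 2 * 𝓕⁻ f y‖ ≤ N := fun y => by
    refine (norm_sub_le _ _).trans ?_
    rw [norm_mul, Complex.norm_real, Real.norm_of_nonneg hA.le, hN]
    have := bf y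
    norm_num
    linarith
  have bp : ∀ y, ‖𝓕⁻ P y‖ ≤ N * ‖𝓕⁻ V y‖ := fun y => by
    rw [ep, norm_mul]
    gcongr
    exact bA y
  have edp : ∀ x, 𝓕⁻ (dMul P) x =
      (A - 2 * 𝓕⁻ f x) * 𝓕⁻ (dMul V) x + -2 * 𝓕⁻ V x * 𝓕⁻ V x := fun x => by
    have h1 : HasDerivAt (𝓕⁻ P) (𝓕⁻ (dMul P) x) x := (hP 2).hasDerivAt x
    rw [show 𝓕⁻ P = fun x => (A - 2 * 𝓕⁻ f x) * 𝓕⁻ V x from funext ep] at h1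
    have h2 := ((((hf 2).hasDerivAt x).const_mul 2).const_sub (A : ℂ)).mul (hdv x)
    rw [h1.unique h2]
    ring
  have bdp : ∀ y, ‖𝓕⁻ (dMul P) y‖ ≤ N * (‖𝓕⁻ (dMul V) y‖ + ‖𝓕⁻ V y‖) := fun y => by
    rw [edp, mul_add]
    refine (norm_add_le _ _).trans (add_le_add ?_ ?_)
    · rw [norm_mul]
      gcongr
      exact bA y
    · rw [norm_mul, norm_mul]
      gcongr
      have := bf' y
      norm_num
      linarith
  refine ⟨U, H, hU, ev, fun x => ?_, fun x => ?_, fun x W hW => ?_⟩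
  · have h1 : 𝓕⁻ P x = 𝓕⁻ (fun ξ => ((γ + A : ℝ) : ℂ) * U ξ + (-γ : ℂ) * dMul (dMul U) ξ) x :=
      congrArg (fun F : ℝ → ℂ => 𝓕⁻ F x) (funext hp_eq)
    rw [(hU.const_mul _ 1).fourierInv_add ((memSobAll_dMul (memSobAll_dMul hU)).const_mul _ 1),
      fourierInv_const_mul, fourierInv_const_mul, ep, ev] at h1
    push_cast at h1
    linear_combination h1
  · have hvneg : ∀ x, 𝓕⁻ V (-x) = -𝓕⁻ V x := fun x => by
      have h1 := ((hf 2).hasDerivAt (-x)).scomp x (hasDerivAt_neg x)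
      rw [show 𝓕⁻ f ∘ Neg.neg = 𝓕⁻ f from funext ef] at h1
      have := h1.unique ((hf 2).hasDerivAt x)
      rw [← this]; simp [hVd]
    have hPneg : (fun ξ => P (-ξ)) =ᵐ[volume] fun ξ => (-1) * P ξ := by
      have hm : MemSob 1 fun ξ => P (-ξ) := by
        have := (hP 1).comp_measurePreserving (Measure.measurePreserving_neg volume)
        simpa [MemSob, Function.comp_def] using this
      refine hm.ae_eq_of_fourierInv_eq ((hP 1).const_mul _) (funext fun x => ?_)
      rw [fourierInv_comp_neg, fourierInv_const_mul, ep, ep, ef, hvneg]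
      ring
    rw [← fourierInv_comp_neg]
    have : (fun ξ => U (-ξ)) =ᵐ[volume] fun ξ => (-1) * U ξ := by
      filter_upwards [hPneg] with ξ h1
      simp only [hUd, limitResolvent] at h1 ⊢
      rw [h1]
      push_cast
      ring
    rw [fourierInv_congr_ae this, fourierInv_const_mul, norm_mul]
    simp
  · have hW0 : 0 ≤ W := (mul_nonneg (wide_pos x x).le (norm_nonneg _)).trans (hW x)
    refine (norm_strip_mul_le_of_wide hγ hA8 hN0 (by linarith) hDs hP hV hUd hHd hVUH bp bdp
      hW).trans ?_
    have h0 : 0 ≤ ε ^ 2 * W := by positivity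
    nlinarith

/-! ### Monotonicity of the profiles -/

theorem IsSolitonHat.fourierInv_dMul {β : ℝ} {S : ℝ → ℂ} (hS : IsSolitonHat β S) (x : ℝ) :
    𝓕⁻ (dMul S) x = ((3 / 2 * dispCoeff β * oddSol x : ℝ) : ℂ) := by
  have h1 := (hS.memSobAll 2).hasDerivAt x
  rw [show 𝓕⁻ S = fun x => (soliton β x : ℂ) from funext hS.fourierInv] at h1
  have h2 : HasDerivAt (soliton β) (3 / 2 * dispCoeff β * oddSol x) x := by
    refine ((hasDerivAt_sechSq x).const_mul (-(3 / 2) * dispCoeff β)).congr_deriv ?_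
    rw [oddSol]; ring
  exact h1.unique h2.ofReal_comp

theorem abs_oddSol_le_one (x : ℝ) : |oddSol x| ≤ 1 := by
  rw [oddSol, abs_mul, abs_of_pos (sechSq_pos x)]
  exact mul_le_one₀ (sechSq_le_one x) (abs_nonneg _) (abs_tanhHalf_le x)

/-- If `v = u + h` with `h` relatively small, then a bound for `v` gives an explicit bound for `u`. -/
theorem norm_le_two_mul_of_splitting {u v h : ℝ → ℂ} {M₀ M c : ℝ} (bu : ∀ x, ‖u x‖ ≤ M₀)
    (bv : ∀ x, ‖v x‖ ≤ M) (hv : ∀ x, v x = u x + h x) (hh : ∀ x, ‖h x‖ ≤ c * wideSup u x)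
    (hc0 : 0 ≤ c) (hc : c ≤ 1 / 2) (x : ℝ) : ‖u x‖ ≤ 2 * M := by
  have hb : BddAbove (Set.range fun x => ‖u x‖) := ⟨M₀, by rintro _ ⟨x, rfl⟩; exact bu x⟩
  set T := ⨆ x, ‖u x‖ with hT
  have hle : ∀ x, ‖u x‖ ≤ T := fun x => le_ciSup hb x
  have hT0 : 0 ≤ T := (norm_nonneg _).trans (hle 0)
  have : T ≤ M + 1 / 2 * T := ciSup_le fun x => by
    have h1 : u x = v x - h x := by rw [hv]; ring
    rw [h1]
    refine (norm_sub_le _ _).trans (add_le_add (bv x) ((hh x).trans ?_))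
    have := wideSup_le hle x
    calc c * wideSup u x ≤ c * T := by gcongr
      _ ≤ _ := by gcongr
  have := hle x
  linarith

/-- For small `ε`, the derivative of an even solution close to the soliton is nonzero to the right of
`1`. In the splitting `v = u + h` of the derivative, `h` is small relative to the windowed supremum of
`u`, which in turn is controlled by `|u(x)|`; hence `|h(x)| ≤ |u(x)|/2`. This is a relative estimate and
holds no matter how small `v(x)` is. -/
theorem exists_fourierInv_dMul_ne_zero {β : ℝ} (hβ : 1 / 3 < β) {S : ℝ → ℂ}
    (hS : IsSolitonHat β S) {κ : ℝ} (hκ : 0 ≤ κ) :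
    ∃ ε₂ : ℝ, 0 < ε₂ ∧ ∀ ε : ℝ, 0 < ε → ε ≤ ε₂ → ∀ r : ℝ → ℂ, MemSobAll r → EvenAE r →
      SolvesHat β ε (fun ξ => S ξ + r ξ) → (∀ x, ‖𝓕⁻ r x‖ ≤ κ * ε ^ 2) →
      (∀ x, ‖𝓕⁻ (dMul r) x‖ ≤ κ * ε ^ 2) →
      ∀ x, 1 ≤ x → 𝓕⁻ (dMul fun ξ => S ξ + r ξ) x ≠ 0 := by
  obtain ⟨A, hA, hsplit⟩ := exists_splitting hβ
  have hγ := dispCoeff_pos hβ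
  set γ := dispCoeff β with hγd
  set M := 3 / 2 * γ + κ with hM
  have hM0 : 0 < M := by positivity
  obtain ⟨ε₁, C, hε₁, hC, hsplit⟩ := hsplit M hM0.le
  set G₀ := (2 * κ + (A + 2 * M) * C) / γ with hG₀
  have hG₀' : 0 ≤ G₀ := by positivity
  set L := 32 * M / γ with hLd
  have hL0 : 0 < L := by positivity
  -- `Q` collects the smallness conditions: each term of `Q ε² ≤ 1` is used once below.
  set Q := 16 * (κ + 2 * M * C) / γ + 1376 * L * G₀ + 64 * L * C + 2 * C with hQ
  have hQ0 : 0 ≤ Q := by positivity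
  refine ⟨min ε₁ (1 / (Q + 1)), lt_min hε₁ (by positivity), fun ε hε hε' r hr er hs br br' => ?_⟩
  have h1 : ε * (Q + 1) ≤ 1 := by
    rw [← le_div_iff₀ (by positivity)]; exact hε'.trans (min_le_right _ _)
  have hε1 : ε ^ 2 ≤ 1 := by nlinarith [mul_nonneg hε.le hQ0]
  have hQε : Q * ε ^ 2 ≤ 1 := by nlinarith [mul_nonneg hε.le hQ0]
  have q1 : 0 ≤ 16 * (κ + 2 * M * C) / γ * ε ^ 2 := by positivity
  have q2 : 0 ≤ 1376 * L * G₀ * ε ^ 2 := by positivity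
  have q3 : 0 ≤ 64 * L * C * ε ^ 2 := by positivity
  have q4 : 0 ≤ 2 * C * ε ^ 2 := by positivity
  have hQe : Q * ε ^ 2 = 16 * (κ + 2 * M * C) / γ * ε ^ 2 + 1376 * L * G₀ * ε ^ 2 +
    64 * L * C * ε ^ 2 + 2 * C * ε ^ 2 := by rw [hQ]; ring
  have s1 : (κ + 2 * M * C) * ε ^ 2 ≤ γ / 16 := by
    have : 16 * (κ + 2 * M * C) / γ * ε ^ 2 ≤ 1 := by linarith
    rw [div_mul_eq_mul_div, div_le_one hγ] at this
    linarith
  set f : ℝ → ℂ := fun ξ => S ξ + r ξ with hfd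
  have hf : MemSobAll f := hS.memSobAll.add hr
  have ef : ∀ x, 𝓕⁻ f x = (soliton β x : ℂ) + 𝓕⁻ r x := fun x => by
    rw [hfd, (hS.memSobAll 1).fourierInv_add (hr 1), hS.fourierInv]
  have ev : ∀ x, 𝓕⁻ (dMul f) x = ((3 / 2 * γ * oddSol x : ℝ) : ℂ) + 𝓕⁻ (dMul r) x := fun x => by
    rw [show dMul f = fun ξ => dMul S ξ + dMul r ξ from funext fun ξ => by
      simp only [dMul, hfd]; ring,
      (memSobAll_dMul hS.memSobAll 1).fourierInv_add (memSobAll_dMul hr 1), hS.fourierInv_dMul]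
  have bf : ∀ x, ‖𝓕⁻ f x‖ ≤ M := fun x => by
    rw [ef]
    refine (norm_add_le _ _).trans (add_le_add ?_ ((br x).trans (mul_le_of_le_one_right hκ hε1)))
    rw [Complex.norm_real, soliton, Real.norm_eq_abs, abs_mul, abs_of_pos (sechSq_pos x), abs_mul,
      abs_of_pos hγ, abs_neg, abs_of_pos (by norm_num)]
    exact mul_le_of_le_one_right (by positivity) (sechSq_le_one x)
  have bv : ∀ x, ‖𝓕⁻ (dMul f) x‖ ≤ M := fun x => by
    rw [ev]
    refine (norm_add_le _ _).trans (add_le_add ?_ ((br' x).trans (mul_le_of_le_one_right hκ hε1)))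
    rw [Complex.norm_real, Real.norm_eq_abs, abs_mul, abs_of_pos (by positivity)]
    exact mul_le_of_le_one_right (by positivity) (abs_oddSol_le_one x)
  obtain ⟨U, H, hU, hv, hode, hodd, hH⟩ := hsplit ε hε (hε'.trans (min_le_left _ _)) f hf hs
    (hS.even.add er).fourierInv bf bv
  obtain ⟨M₀, b0, b0'⟩ : ∃ M₀, (∀ x, ‖𝓕⁻ U x‖ ≤ M₀) ∧ ∀ x, ‖𝓕⁻ (dMul U) x‖ ≤ M₀ :=
    ⟨_, fun x => ((hU 1).norm_fourierInv_le x).trans (le_max_left _ _),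
      fun x => ((memSobAll_dMul hU 1).norm_fourierInv_le x).trans (le_max_right _ _)⟩
  have hh : ∀ x, ‖𝓕⁻ H x‖ ≤ C * ε ^ 2 * wideSup (𝓕⁻ U) x := fun x =>
    hH x _ fun y => le_wideSup b0 x y
  have bu : ∀ x, ‖𝓕⁻ U x‖ ≤ 2 * M := norm_le_two_mul_of_splitting b0 bv hv hh (by positivity)
    (by linarith)
  have bh : ∀ x, ‖𝓕⁻ H x‖ ≤ 2 * M * C * ε ^ 2 := fun x => (hh x).trans (by
    calc C * ε ^ 2 * wideSup (𝓕⁻ U) x ≤ C * ε ^ 2 * (2 * M) := by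
          gcongr; exact wideSup_le bu x
      _ = _ := by ring)
  -- the lower bound for `u(1)`
  have u1 : γ / 16 ≤ ‖𝓕⁻ U 1‖ := by
    have e1 : ((3 / 2 * γ * oddSol 1 : ℝ) : ℂ) = 𝓕⁻ U 1 + (𝓕⁻ H 1 - 𝓕⁻ (dMul r) 1) := by
      have h2 := hv 1
      rw [ev] at h2
      linear_combination h2
    have h2 : ‖((3 / 2 * γ * oddSol 1 : ℝ) : ℂ)‖ ≤ ‖𝓕⁻ U 1‖ + (‖𝓕⁻ H 1‖ + ‖𝓕⁻ (dMul r) 1‖) := by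
      rw [e1]
      exact (norm_add_le _ _).trans (add_le_add le_rfl (norm_sub_le _ _))
    have h3 : γ / 8 ≤ ‖((3 / 2 * γ * oddSol 1 : ℝ) : ℂ)‖ := by
      rw [Complex.norm_real, Real.norm_eq_abs]
      refine le_trans ?_ (le_abs_self _)
      have := div_le_oddSol zero_le_one le_rfl
      nlinarith
    have := bh 1
    have := br' 1
    linarith
  have h01 : ∀ y, 0 ≤ y → y ≤ 1 → ‖𝓕⁻ U y‖ ≤ L * ‖𝓕⁻ U 1‖ := fun y _ _ => by
    calc ‖𝓕⁻ U y‖ ≤ 2 * M := bu y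
      _ = L * (γ / 16) := by rw [hLd]; field_simp; norm_num
      _ ≤ _ := by gcongr
  have hL : 1 ≤ L := by rw [hLd, le_div_iff₀ hγ, hM]; linarith
  set g : ℝ → ℂ := fun x => (2 * 𝓕⁻ r x * 𝓕⁻ U x - (A - 2 * 𝓕⁻ f x) * 𝓕⁻ H x) / γ with hg
  have hγC : (γ : ℂ) ≠ 0 := by exact_mod_cast hγ.ne'
  have hu'' : ∀ x, HasDerivAt (𝓕⁻ (dMul U)) ((1 - 3 * sechSq x : ℝ) * 𝓕⁻ U x + g x) x :=
    fun x => by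
      refine (memSobAll_dMul hU 2).hasDerivAt x |>.congr_deriv (mul_left_cancel₀ hγC ?_)
      have e : ∀ X : ℂ, (γ : ℂ) * (X / γ) = X := fun X => by field_simp
      rw [hode, hg, mul_add, e, ef, soliton, ← hγd]
      push_cast
      ring
  have bg : ∀ x, ‖g x‖ ≤ ε ^ 2 * G₀ * wideSup (𝓕⁻ U) x := fun x => by
    have hVx := wideSup_nonneg (𝓕⁻ U) x
    have h2 : ‖2 * 𝓕⁻ r x * 𝓕⁻ U x‖ ≤ 2 * (κ * ε ^ 2) * wideSup (𝓕⁻ U) x := by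
      rw [norm_mul, norm_mul]
      have := br x
      gcongr
      · norm_num
      · exact norm_le_wideSup b0 x
    have h3 : ‖((A : ℂ) - 2 * 𝓕⁻ f x) * 𝓕⁻ H x‖ ≤
        (A + 2 * M) * (C * ε ^ 2 * wideSup (𝓕⁻ U) x) := by
      rw [norm_mul]
      gcongr
      · refine (norm_sub_le _ _).trans ?_
        rw [norm_mul, Complex.norm_real, Real.norm_of_nonneg hA.le]
        have := bf x
        norm_num
        linarith
      · exact hh x
    rw [hg, norm_div, Complex.norm_real, Real.norm_of_nonneg hγ.le, div_le_iff₀ hγ]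
    refine (norm_sub_le _ _).trans ((add_le_add h2 h3).trans (le_of_eq ?_))
    rw [hG₀]
    field_simp
  intro x hx
  have key := wideSup_le_norm (hU 2).hasDerivAt hu'' b0 b0' (by positivity) bg hodd hL h01 hx
  set V := wideSup (𝓕⁻ U) x with hVd
  have hV0 : 0 ≤ V := wideSup_nonneg _ _
  have k1 : V ≤ 32 * L * ‖𝓕⁻ U x‖ := by
    have : 1376 * L * G₀ * ε ^ 2 * V ≤ 1 * V := by gcongr; linarith
    nlinarith
  have k2 : ‖𝓕⁻ H x‖ ≤ 1 / 2 * ‖𝓕⁻ U x‖ := by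
    calc ‖𝓕⁻ H x‖ ≤ C * ε ^ 2 * V := hh x
      _ ≤ C * ε ^ 2 * (32 * L * ‖𝓕⁻ U x‖) := by gcongr
      _ = 1 / 2 * (64 * L * C * ε ^ 2) * ‖𝓕⁻ U x‖ := by ring
      _ ≤ 1 / 2 * 1 * ‖𝓕⁻ U x‖ := by gcongr; linarith
      _ = _ := by ring
  -- The windowed supremum is positive because `u` does not vanish at `1`.
  have k3 : 0 < V := lt_of_lt_of_le
    (mul_pos (wide_pos x 1) (lt_of_lt_of_le (by positivity) u1)) (le_wideSup b0 x 1)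
  intro h0
  rw [hv] at h0
  have h4 : ‖𝓕⁻ U x‖ = ‖𝓕⁻ H x‖ := by rw [eq_neg_of_add_eq_zero_left h0, norm_neg]
  have h5 : ‖𝓕⁻ U x‖ = 0 := le_antisymm (by linarith) (norm_nonneg _)
  rw [h5] at k1
  linarith

/-- For small `ε`, an even solution close to the soliton is strictly increasing on the positive
half-line. On `(0, 1]` the derivatives of the solution and of the soliton differ by at most a small
multiple of `x`; beyond `1` the derivative keeps its sign because it does not vanish. -/
theorem exists_deriv_pos {β : ℝ} (hβ : 1 / 3 < β) {S : ℝ → ℂ} (hS : IsSolitonHat β S) {K : ℝ}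
    (hK : 0 ≤ K) :
    ∃ ε₂ : ℝ, 0 < ε₂ ∧ ∀ ε : ℝ, 0 < ε → ε ≤ ε₂ → ∀ r : ℝ → ℂ, MemSobAll r → EvenAE r →
      SolvesHat β ε (fun ξ => S ξ + r ξ) → sobNorm 3 r ≤ ENNReal.ofReal (K * ε ^ 2) →
      ∀ Z : ℝ → ℝ, (∀ x, (Z x : ℂ) = 𝓕⁻ (fun ξ => S ξ + r ξ) x) → ∀ x, 0 < x → 0 < deriv Z x := by
  have hγ := dispCoeff_pos hβ
  have hE : 0 ≤ embConst.toReal := ENNReal.toReal_nonneg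
  set κ := embConst.toReal * K with hκd
  have hκ : 0 ≤ κ := by positivity
  obtain ⟨ε₂, hε₂, hne⟩ := exists_fourierInv_dMul_ne_zero hβ hS hκ
  set Q := 16 * κ / dispCoeff β with hQ
  have hQ0 : 0 ≤ Q := by positivity
  refine ⟨min ε₂ (1 / (Q + 1)), lt_min hε₂ (by positivity),
    fun ε hε hε' r hr er hs h3 Z hZ => ?_⟩
  have h1 : ε * (Q + 1) ≤ 1 := by
    rw [← le_div_iff₀ (by positivity)]; exact hε'.trans (min_le_right _ _)
  have hQε : Q * ε ^ 2 ≤ 1 := by nlinarith [mul_nonneg hε.le hQ0]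
  have s1 : κ * ε ^ 2 ≤ dispCoeff β / 16 := by
    rw [hQ, div_mul_eq_mul_div, div_le_one hγ] at hQε
    linarith
  have hb : ∀ q : ℝ → ℂ, MemSobAll q → sobNorm 1 q ≤ sobNorm 3 r → ∀ x,
      ‖𝓕⁻ q x‖ ≤ κ * ε ^ 2 := fun q hq hle x => by
    refine ((hq 1).norm_fourierInv_le x).trans ?_
    rw [ENNReal.toReal_mul, hκd, mul_assoc]
    gcongr
    have := ENNReal.toReal_mono ENNReal.ofReal_ne_top (hle.trans h3)
    rwa [ENNReal.toReal_ofReal (by positivity)] at this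
  have dr := memSobAll_dMul hr
  have ddr := memSobAll_dMul dr
  have br := hb r hr (sobNorm_mono (by norm_num) r)
  have bdr := hb _ dr ((sobNorm_dMul_le 1 r).trans (sobNorm_mono (by norm_num) r))
  have bddr := hb _ ddr ((sobNorm_dMul_le 1 _).trans
    ((sobNorm_dMul_le _ r).trans (sobNorm_mono (by norm_num) r)))
  have hf : MemSobAll fun ξ => S ξ + r ξ := hS.memSobAll.add hr
  have ed : ∀ x, ((deriv Z x : ℝ) : ℂ) = 𝓕⁻ (dMul fun ξ => S ξ + r ξ) x := fun x => by
    have := (hf.iteratedDeriv_ofReal hZ 1 x).1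
    rwa [iteratedDeriv_one, Function.iterate_one] at this
  have hcont : Continuous (deriv Z) := by
    have := (memSobAll_dMul hf 1).continuous
    rw [← funext ed] at this
    exact Complex.continuous_re.comp this
  -- Near the origin the derivative is compared with that of the soliton.
  have hsmall : ∀ x, 0 < x → x ≤ 1 → 0 < deriv Z x := fun x hx hx1 => by
    have e0 : 𝓕⁻ (dMul r) 0 = 0 := by
      have h2 := ((hr 2).hasDerivAt (-0)).scomp 0 (hasDerivAt_neg 0)
      rw [show 𝓕⁻ r ∘ Neg.neg = 𝓕⁻ r from funext er.fourierInv] at h2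
      have h4 := h2.unique ((hr 2).hasDerivAt 0)
      simp only [neg_zero, neg_smul, one_smul] at h4
      exact self_eq_neg.1 h4.symm
    have h2 : ‖𝓕⁻ (dMul r) x - 𝓕⁻ (dMul r) 0‖ ≤ κ * ε ^ 2 * ‖x - 0‖ :=
      convex_univ.norm_image_sub_le_of_norm_hasDerivWithin_le
        (fun y _ => ((dr 2).hasDerivAt y).hasDerivWithinAt) (fun y _ => bddr y)
        (Set.mem_univ _) (Set.mem_univ _)
    rw [e0, sub_zero, sub_zero, Real.norm_of_nonneg hx.le] at h2
    have h4 : 𝓕⁻ (dMul fun ξ => S ξ + r ξ) x =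
        ((3 / 2 * dispCoeff β * oddSol x : ℝ) : ℂ) + 𝓕⁻ (dMul r) x := by
      rw [show (dMul fun ξ => S ξ + r ξ) = fun ξ => dMul S ξ + dMul r ξ from funext fun ξ => by
        simp only [dMul]; ring,
        (memSobAll_dMul hS.memSobAll 1).fourierInv_add (dr 1), hS.fourierInv_dMul]
    have h5 : deriv Z x = 3 / 2 * dispCoeff β * oddSol x + (𝓕⁻ (dMul r) x).re := by
      have := congrArg Complex.re ((ed x).trans h4)
      simpa only [Complex.ofReal_re, Complex.add_re] using this
    have h6 := (abs_le.1 ((Complex.abs_re_le_norm _).trans h2)).1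
    have h7 := div_le_oddSol hx.le hx1
    rw [h5]
    have h8 : κ * ε ^ 2 * x ≤ dispCoeff β / 16 * x := by gcongr
    have h9 : dispCoeff β * (x / 12) ≤ dispCoeff β * oddSol x := by gcongr
    have := mul_pos hγ hx
    linarith
  intro x hx
  rcases le_total x 1 with h | h
  · exact hsmall x hx h
  · by_contra hneg
    obtain ⟨y, hy, hy0⟩ := intermediate_value_Icc' h hcont.continuousOn
      ⟨not_lt.1 hneg, (hsmall 1 one_pos le_rfl).le⟩
    refine hne ε hε (hε'.trans (min_le_left _ _)) r hr er hs br bdr y hy.1 ?_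
    rw [← ed, hy0, Complex.ofReal_zero]

/-! ### Solitary waves of depression -/

theorem norm_fourierChar_mul (a ξ : ℝ) : ‖(𝐞 (-(ξ * a)) : ℂ)‖ = 1 := Circle.norm_coe _

theorem continuous_fourierChar_mul (a : ℝ) : Continuous fun ξ : ℝ => (𝐞 (-(ξ * a)) : ℂ) :=
  continuous_subtype_val.comp (Real.continuous_fourierChar.comp (by fun_prop))

/-- Fourier multipliers commute with translations. -/
theorem IsMultiplierImage.comp_sub {m u v : ℝ → ℝ} {f g : ℝ → ℂ} (hf : MemSob 1 f)
    (hg : MemSob 1 g) (hu : ∀ x, (u x : ℂ) = 𝓕⁻ f x) (hv : ∀ x, (v x : ℂ) = 𝓕⁻ g x)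
    (h : IsMultiplierImage m u v) (a : ℝ) :
    IsMultiplierImage m (fun x => u (x - a)) fun x => v (x - a) := by
  have hm : ∀ {q : ℝ → ℂ}, MemSob 1 q → MemSob 1 fun ξ : ℝ => (𝐞 (-(ξ * a)) : ℂ) * q ξ :=
    fun hq => MemSob.mul (a := 0) (c := 1) (by simpa using hq)
      (continuous_fourierChar_mul a).aestronglyMeasurable fun ξ => by
        rw [norm_fourierChar_mul]; simp
  rw [isMultiplierImage_iff hf (hg.memLp_two zero_le_one) (hg.integrable le_rfl) hu hv] at h
  refine (isMultiplierImage_iff (hm hf) ((hm hg).memLp_two zero_le_one) ((hm hg).integrable le_rfl)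
    (fun x => ?_) fun x => ?_).2 ?_
  · rw [fourierInv_comp_sub, hu]
  · rw [fourierInv_comp_sub, hv]
  · filter_upwards [h] with ξ h1
    rw [h1]; ring

/-- A differentiable solution of the profile equation travels as a classical solution. -/
theorem SolvesProfileEquation.solvesWhitham {β c : ℝ} {w : ℝ → ℝ} {W : ℝ → ℂ} (hW : MemSob 1 W)
    (hw : ∀ x, (w x : ℂ) = 𝓕⁻ W x) (hd : Differentiable ℝ w) (h : SolvesProfileEquation β c w) :
    SolvesWhitham β fun x t => w (x - c * t) := by
  obtain ⟨g, hg, hgw⟩ := h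
  have hWW := memSob_conv le_rfl hW hW
  have hgV : ∀ x, (g x : ℂ) = 𝓕⁻ (fun ξ => (c : ℂ) * W ξ + (-1) * conv W W ξ) x := fun x => by
    rw [(hW.const_mul _).fourierInv_add (hWW.const_mul (-1)), fourierInv_const_mul,
      fourierInv_const_mul, hW.fourierInv_conv hW, ← hw]
    have : g x = c * w x - w x ^ 2 := by linarith [hgw x]
    rw [this]
    push_cast; ring
  refine ⟨fun x t => g (x - c * t), fun t => IsMultiplierImage.comp_sub hW
    ((hW.const_mul _).add (hWW.const_mul (-1))) hw hgV hg (c * t), fun x t =>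
    ⟨deriv w (x - c * t) * -c, c * deriv w (x - c * t), ?_, ?_, by ring⟩⟩
  · have h1 : HasDerivAt (fun s => x - c * s) (-c) t := by
      simpa using ((hasDerivAt_id t).const_mul c).const_sub x
    exact (hd _).hasDerivAt.comp t h1
  · have e : (fun y => g (y - c * t) + w (y - c * t) ^ 2) = fun y => c * w (y - c * t) := by
      ext y; linarith [hgw (y - c * t)]
    simp only [e]
    exact ((hd _).hasDerivAt.comp_sub_const x (c * t)).const_mul c

/-- An even function that increases strictly to `0` on the positive half-line has a unique critical
point, which is a strictly negative absolute minimum. -/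
theorem exists_unique_critical_point {w : ℝ → ℝ} (hd : Differentiable ℝ w)
    (he : ∀ x, w (-x) = w x) (hpos : ∀ x, 0 < x → 0 < deriv w x)
    (h0 : Tendsto w (cocompact ℝ) (𝓝 0)) :
    ∃ x₀ : ℝ, (∀ x, deriv w x = 0 ↔ x = x₀) ∧ (∀ x, w x₀ ≤ w x) ∧ w x₀ < 0 := by
  have hodd : ∀ x, deriv w (-x) = -deriv w x := fun x => by
    have := deriv_comp_neg w x
    rw [funext he] at this
    linarith
  have hmono : StrictMonoOn w (Set.Ici 0) :=
    strictMonoOn_of_deriv_pos (convex_Ici 0) hd.continuous.continuousOn fun x hx => by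
      rw [interior_Ici] at hx
      exact hpos x hx
  have hlim : Tendsto w atTop (𝓝 0) := h0.mono_left atTop_le_cocompact
  have hle : w 1 ≤ 0 := ge_of_tendsto hlim (by
    filter_upwards [eventually_ge_atTop 1] with x hx
    exact hmono.monotoneOn (Set.mem_Ici.2 zero_le_one) (Set.mem_Ici.2 (zero_le_one.trans hx)) hx)
  have habs : ∀ x, w |x| = w x := fun x => by
    rcases abs_choice x with h | h <;> rw [h]
    exact he x
  refine ⟨0, fun x => ⟨fun h => ?_, fun h => ?_⟩, fun x => ?_, ?_⟩
  · rcases lt_trichotomy x 0 with hx | hx | hx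
    · have := hpos (-x) (by linarith)
      rw [hodd, h] at this
      linarith
    · exact hx
    · exact absurd h (hpos x hx).ne'
  · rw [h]
    have := hodd 0
    rw [neg_zero] at this
    linarith
  · rw [← habs x]
    exact hmono.monotoneOn Set.self_mem_Ici (Set.mem_Ici.2 (abs_nonneg x)) (abs_nonneg x)
  · exact (hmono Set.self_mem_Ici (Set.mem_Ici.2 zero_le_one) one_pos).trans_le hle

/-- A solution of the scaled equation whose inverse transform increases on the positive half-line
is the scaled profile of a solitary wave of depression. -/
theorem isSolitaryWaveOfDepression_of_solvesHat {β ε : ℝ} (hε : 0 < ε) {f : ℝ → ℂ}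
    (hf : MemSobAll f) (ef : EvenAE f) (hs : SolvesHat β ε f) {z w : ℝ → ℝ}
    (hz : ∀ x, (z x : ℂ) = 𝓕⁻ f x) (hw : ∀ x, w x = ε ^ 2 * z (ε * x))
    (hpos : ∀ x, 0 < x → 0 < deriv z x) :
    IsSolitaryWaveOfDepression β (speed β ε) w := by
  have hzd : Differentiable ℝ z := fun x => by
    simpa using (hf.iteratedDeriv_ofReal hz 0 x).2.differentiableAt
  have hwd : ∀ x, HasDerivAt w (ε ^ 2 * (deriv z (ε * x) * ε)) x := fun x => by
    rw [funext hw]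
    have h1 : HasDerivAt (fun x => ε * x) ε x := by simpa using (hasDerivAt_id x).const_mul ε
    exact ((hzd _).hasDerivAt.comp x h1).const_mul (ε ^ 2)
  have hd : Differentiable ℝ w := fun x => (hwd x).differentiableAt
  have mW := memSob_dilateHat hε (hf 1)
  have hwW : ∀ x, (w x : ℂ) = 𝓕⁻ (dilateHat ε f) x := fun x => by
    rw [fourierInv_dilateHat hε, ← hz, hw]; push_cast; ring
  have h0 : Tendsto w (cocompact ℝ) (𝓝 0) := by
    have := (Complex.continuous_re.tendsto 0).comp (tendsto_fourierInv_cocompact (dilateHat ε f))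
    rw [← funext hwW] at this
    simpa [Function.comp_def] using this
  refine ⟨((solvesProfileEquation_iff hε (hf 1) hz hw).2 hs).solvesWhitham mW hwW hd, hd, h0,
    exists_unique_critical_point hd (fun x => ?_) (fun x hx => ?_) h0⟩
  · have : z (ε * -x) = z (ε * x) := by
      have h1 : ((z (-(ε * x)) : ℝ) : ℂ) = z (ε * x) := by rw [hz, hz, ef.fourierInv]
      rw [mul_neg]
      exact_mod_cast h1
    rw [hw, hw, this]
  · rw [(hwd x).deriv]
    have := hpos _ (mul_pos hε hx)
    positivity

end GravityCapillaryWhitham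

open GravityCapillaryWhitham FourierTransform

theorem corollary1p1 (β : ℝ) (hβ : 1 / 3 < β) :
    ∃ ε₀ : ℝ, 0 < ε₀ ∧ ∃ C : ℕ → ℝ, (∀ r, 0 < C r) ∧ ∃ R : ℝ → ℝ → ℝ,
      (∀ ε ∈ Set.Ioc (0 : ℝ) ε₀,
        GravityCapillaryWhitham.IsCorrection β ε C (R ε) ∧
        GravityCapillaryWhitham.IsSolitaryWaveOfDepression β
          (GravityCapillaryWhitham.speed β ε)
          (GravityCapillaryWhitham.profile β ε (R ε)) ∧
        GravityCapillaryWhitham.IsSubcritical β (GravityCapillaryWhitham.speed β ε) ∧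
        ∀ S : ℝ → ℝ, GravityCapillaryWhitham.IsCorrection β ε C S → S = R ε) ∧
      (∀ C' : ℕ → ℝ, ∃ ε₁ ∈ Set.Ioc (0 : ℝ) ε₀, ∀ ε ∈ Set.Ioc (0 : ℝ) ε₁,
        ∀ S : ℝ → ℝ, GravityCapillaryWhitham.IsCorrection β ε C' S → S = R ε) := by

  obtain ⟨S, hS⟩ := exists_isSolitonHat hβ
  obtain ⟨ε₂, δ, K, hε₂, hε₂1, hδ, hK, hsol⟩ := exists_smooth_solution hβ hS
  obtain ⟨ε₃, hε₃, hpos⟩ := exists_deriv_pos hβ hS (hK 3).le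
  -- the threshold below which a correction with constants `C'` lies in the uniqueness ball
  have hthr : ∀ C' : ℕ → ℝ, ∃ η : ℝ, 0 < η ∧ ∀ ε : ℝ, 0 < ε → ε ≤ 1 → ε ≤ η →
      (|C' 0| + |C' 1|) * ε ^ 2 ≤ δ := fun C' => by
    refine ⟨δ / (|C' 0| + |C' 1| + 1), by positivity, fun ε hε h1 h => ?_⟩
    rw [le_div_iff₀ (by positivity)] at h
    have : 0 ≤ |C' 0| + |C' 1| := by positivity
    nlinarith [mul_nonneg hε.le this]
  obtain ⟨η, hη, hηK⟩ := hthr K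
  choose! r mr er hre hs hn huniq using hsol
  have hmin : ∀ {ε : ℝ}, ε ≤ min (min ε₂ ε₃) η → ε ≤ ε₂ ∧ ε ≤ ε₃ ∧ ε ≤ η := fun h =>
    ⟨h.trans ((min_le_left _ _).trans (min_le_left _ _)),
      h.trans ((min_le_left _ _).trans (min_le_right _ _)), h.trans (min_le_right _ _)⟩
  have huniq' : ∀ (C' : ℕ → ℝ) (ε : ℝ), 0 < ε → ε ≤ ε₂ → (|C' 0| + |C' 1|) * ε ^ 2 ≤ δ →
      ∀ T : ℝ → ℝ, IsCorrection β ε C' T → T = fun x => ε ^ 2 * (𝓕⁻ (r ε) x).re := by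
    intro C' ε hε hε' hC' T hT
    obtain ⟨r₂, m₂, e₂, n₂, s₂, hT₂⟩ := hT.exists_hat hε hS hC'
    ext x
    rw [hT₂, fourierInv_congr_ae (huniq ε hε hε' r₂ m₂ e₂ n₂ s₂)]
  refine ⟨min (min ε₂ ε₃) η, by positivity, K, hK, fun ε x => ε ^ 2 * (𝓕⁻ (r ε) x).re, ?_, ?_⟩
  · rintro ε ⟨hε, hε'⟩
    obtain ⟨h2, h3, h4⟩ := hmin hε'
    refine ⟨isCorrection_of_solvesHat hε hS (mr ε hε h2) (er ε hε h2) (hre ε hε h2) (hs ε hε h2)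
      (hn ε hε h2), ?_, ?_, huniq' K ε hε h2 (hηK ε hε (h2.trans hε₂1) h4)⟩
    · have hz := hS.fourierInv_add (mr ε hε h2 1) (hre ε hε h2)
      exact isSolitaryWaveOfDepression_of_solvesHat hε (hS.memSobAll.add (mr ε hε h2))
        (hS.even.add (er ε hε h2)) (hs ε hε h2) hz (profile_eq β ε fun x => rfl)
        (hpos ε hε h3 _ (mr ε hε h2) (er ε hε h2) (hs ε hε h2) (hn ε hε h2 3) _ hz)
    · rw [IsSubcritical, phaseSpeed_zero, speed]
      have : 0 < (3 * β - 1) / 6 * ε ^ 2 := by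
        have : 0 < 3 * β - 1 := by linarith
        positivity
      linarith
  · intro C'
    obtain ⟨η', hη', hηC⟩ := hthr C'
    refine ⟨min (min (min ε₂ ε₃) η) η', ⟨by positivity, min_le_left _ _⟩, ?_⟩
    rintro ε ⟨hε, hε'⟩ T hT
    have h2 := (hmin (hε'.trans (min_le_left _ _))).1
    exact huniq' C' ε hε h2 (hηC ε hε (h2.trans hε₂1) (hε'.trans (min_le_right _ _))) T hT
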